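/- Let $n>2$, and let $\mathbb{X}^n$ be the Euclidean space $\mathbb{R}^n$, the unit sphere $\mathbb{S}^n\subset\mathbb{R}^{n+1}$ or the hyperbolic space $\mathbb{H}^n$. A set $K\subset\mathbb{X}^n$ is convex if any two points of $K$ are joined by some shortest geodesic segment contained in $K$, and a convex body is a closed convex set with non-empty interior. Let $\mathcal{M}$ be a compact connected $(n-1)$-manifold without boundary and let $r:\mathcal{M}\to\mathbb{X}^n$ be continuous. Call $(\mathcal{M},r)$ locally convex at $p\in\mathcal{M}$ if there are a neighbourhood $U$ of $p$ and a convex body $K_p$ such that $r|_U$ is a homeomorphism onto its image and $r(U)\subset\partial K_p$. Call it strictly locally convex at $p$ if moreover $U$ and $K_p$ can be chosen so that $K_p\setminus\{r(p)\}$ lies in an open half-space bounded by a hyperplane through $r(p)$ (on $\mathbb{S}^n$, half-spaces are hemispheres). The $r$-metric on $\mathcal{M}$ is $d(p,q)=\inf_\gamma |r\circ\gamma|$, the infimum over the paths $\gamma$ in $\mathcal{M}$ from $p$ to $q$ of the length of $r\circ\gamma$. Suppose that $\mathcal{M}$ is complete with respect to the $r$-metric and that $(\mathcal{M},r)$ is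 locally convex at all points. Then at least one of the following holds: 1. $(\mathcal{M},r)$ is strictly locally convex at some point; 2. $\mathbb{X}^n=\mathbb{S}^n$ and $r$ is a homeomorphism of $\mathcal{M}$ onto $\mathbb{S}^n\cap\partial C$ for some closed convex cone $C\subset\mathbb{R}^{n+1}$ with apex at the origin, whose faces, in particular the one of smallest dimension, contain the origin ($C$ may be a hyperplane, in which case $\partial C=C$). In particular, for $\mathbb{X}^n=\mathbb{R}^n$ and $\mathbb{X}^n=\mathbb{H}^n$ the first alternative holds. -/

import Mathlib

open scoped ENNReal Topology RealInnerProductSpace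

noncomputable section

/-- The metric data of a model space that enter the definitions below: its distance, its shortest
geodesic segments, and its open half-spaces. It is only used for the three models
`euclideanGeometry`, `sphericalGeometry` and `hyperbolicGeometry`. -/
structure Geometry (X : Type*) where
  /-- The geodesic distance. -/
  dist : X → X → ℝ
  /-- `IsSegment p q A`: the set `A` is a shortest geodesic segment from `p` to `q`. -/
  IsSegment : X → X → Set X → Prop
  /-- `IsHalfSpaceAt p H`: the set `H` is an open half-space whose bounding hyperplane
  passes through `p`. -/
  IsHalfSpaceAt : X → Set X → Prop

/-- Euclidean space `ℝⁿ`. -/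
abbrev Euc (n : ℕ) : Type := EuclideanSpace ℝ (Fin n)

/-- The unit sphere `𝕊ⁿ` of `ℝⁿ⁺¹`. -/
abbrev Sph (n : ℕ) : Type := Metric.sphere (0 : Euc (n + 1)) 1

/-- The Lorentz form `⟨x, y⟩ - s t` of the vectors `(s, x)` and `(t, y)` of `ℝ × ℝⁿ`. -/
def lorentz {n : ℕ} (x y : ℝ × Euc n) : ℝ := ⟪x.2, y.2⟫ - x.1 * y.1

/-- Hyperbolic space `ℍⁿ`: the upper sheet of the two-sheeted hyperboloid, with the subspace
topology. -/
abbrev Hyp (n : ℕ) : Type := {x : ℝ × Euc n // lorentz x x = -1 ∧ 0 < x.1}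

/-- The geometry of `ℝⁿ`. -/
def euclideanGeometry (n : ℕ) : Geometry (Euc n) where
  dist p q := Dist.dist p q
  IsSegment p q A := A = segment ℝ p q
  IsHalfSpaceAt p H := ∃ v : Euc n, v ≠ 0 ∧ H = {x | 0 < ⟪v, x - p⟫}

/-- The geometry of `𝕊ⁿ`: the angular distance, great-circle arcs of length at most `π`, and
open hemispheres. -/
def sphericalGeometry (n : ℕ) : Geometry (Sph n) where
  dist p q := InnerProductGeometry.angle (p : Euc (n + 1)) (q : Euc (n + 1))
  IsSegment p q A :=
    ∃ v : Euc (n + 1), ‖v‖ = 1 ∧ ⟪(p : Euc (n + 1)), v⟫ = 0 ∧ ∃ l : ℝ, 0 ≤ l ∧ l ≤ Real.pi ∧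
      (q : Euc (n + 1)) = Real.cos l • (p : Euc (n + 1)) + Real.sin l • v ∧
      A = {x | ∃ t ∈ Set.Icc 0 l,
        (x : Euc (n + 1)) = Real.cos t • (p : Euc (n + 1)) + Real.sin t • v}
  IsHalfSpaceAt p H :=
    ∃ v : Euc (n + 1), v ≠ 0 ∧ ⟪v, (p : Euc (n + 1))⟫ = 0 ∧ H = {x | 0 < ⟪v, (x : Euc (n + 1))⟫}

/-- The geometry of `ℍⁿ` in the hyperboloid model. -/
def hyperbolicGeometry (n : ℕ) : Geometry (Hyp n) where
  dist p q := Real.arcosh (-lorentz p.1 q.1)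
  IsSegment p q A :=
    ∃ v : ℝ × Euc n, lorentz v v = 1 ∧ lorentz p.1 v = 0 ∧ ∃ l : ℝ, 0 ≤ l ∧
      q.1 = Real.cosh l • p.1 + Real.sinh l • v ∧
      A = {x | ∃ t ∈ Set.Icc 0 l, x.1 = Real.cosh t • p.1 + Real.sinh t • v}
  IsHalfSpaceAt p H :=
    ∃ v : ℝ × Euc n, v ≠ 0 ∧ lorentz v p.1 = 0 ∧ H = {x | 0 < lorentz v x.1}

namespace Geometry

variable {X : Type*} (G : Geometry X)

/-- A set is convex if any two of its points are joined by some shortest geodesic segment that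
lies in it. -/
def IsConvex (K : Set X) : Prop :=
  ∀ p ∈ K, ∀ q ∈ K, ∃ A, G.IsSegment p q A ∧ A ⊆ K

/-- A full-dimensional convex body: a closed convex set with non-empty interior. -/
def IsConvexBody [TopologicalSpace X] (K : Set X) : Prop :=
  IsClosed K ∧ (interior K).Nonempty ∧ G.IsConvex K

/-- The length of a curve: the supremum of the lengths of the inscribed geodesic polygons. -/
def length (c : unitInterval → X) : ℝ≥0∞ :=
  ⨆ (k : ℕ) (t : Fin (k + 1) → unitInterval) (_ : Monotone t),
    ∑ i : Fin k, ENNReal.ofReal (G.dist (c (t i.castSucc)) (c (t i.succ)))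

variable {M : Type*} [TopologicalSpace M]

/-- The `r`-metric: the infimum of the lengths of the `r`-images of the paths from `p` to `q`. -/
def inducedDist (r : M → X) (p q : M) : ℝ≥0∞ :=
  ⨅ γ : Path p q, G.length (fun t => r (γ t))

/-- `M` is complete with respect to the `r`-metric. -/
def IsCompleteRealization (r : M → X) : Prop :=
  ∀ u : ℕ → M,
    (∀ ε : ℝ≥0∞, 0 < ε → ∃ N, ∀ i ≥ N, ∀ j ≥ N, G.inducedDist r (u i) (u j) < ε) →
    ∃ x, ∀ ε : ℝ≥0∞, 0 < ε → ∃ N, ∀ i ≥ N, G.inducedDist r (u i) x < ε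

/-- `K` witnesses the local convexity of `r` at `p`: it is a convex body, and `r` maps some
neighbourhood of `p` homeomorphically onto a subset of its boundary. -/
def IsConvexWitness [TopologicalSpace X] (r : M → X) (p : M) (K : Set X) : Prop :=
  G.IsConvexBody K ∧
    ∃ U ∈ 𝓝 p, Topology.IsEmbedding (U.domRestrict r) ∧ r '' U ⊆ frontier K

/-- `(M, r)` is locally convex at `p`. -/
def LocallyConvexAt [TopologicalSpace X] (r : M → X) (p : M) : Prop :=
  ∃ K, G.IsConvexWitness r p K

/-- `(M, r)` is strictly locally convex at `p`: the convex body can be chosen so that all of it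
except `r p` lies in an open half-space whose bounding hyperplane passes through `r p`. -/
def StrictlyLocallyConvexAt [TopologicalSpace X] (r : M → X) (p : M) : Prop :=
  ∃ K, G.IsConvexWitness r p K ∧ ∃ H, G.IsHalfSpaceAt (r p) H ∧ K \ {r p} ⊆ H

end Geometry

/-- `(M, r)` is a spherical hypersurface `𝕊ⁿ ∩ ∂C`: the map `r` is a homeomorphism of `M` onto
`𝕊ⁿ ∩ ∂C`, for a closed convex cone `C` in `ℝⁿ⁺¹` with apex at the origin, all of whose faces, in
particular the one of smallest dimension, contain the origin. A hyperplane is allowed as `C`. -/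
def IsSphericalConeBoundary {n : ℕ} {M : Type*} [TopologicalSpace M] (r : M → Sph n) : Prop :=
  ∃ C : ConvexCone ℝ (Euc (n + 1)),
    IsClosed (C : Set (Euc (n + 1))) ∧ (0 : Euc (n + 1)) ∈ C ∧
    (∀ F : Set (Euc (n + 1)), IsExtreme ℝ (C : Set (Euc (n + 1))) F → F.Nonempty → 0 ∈ F) ∧
    Topology.IsEmbedding r ∧
    Set.range r = {x : Sph n | (x : Euc (n + 1)) ∈ frontier (C : Set (Euc (n + 1)))}

end

/-! In `ℝⁿ` and `ℍⁿ` the hypersurface is compact, so some point `p` maximizes the distance to a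
fixed origin. Cutting the local convex body at `p` with the ball of that radius leaves a convex body
that still contains the image of a neighbourhood of `p` and meets the hyperplane tangent to the ball
at `r p` only in `r p`.

On the sphere the second alternative is proved for every closed locally convex hypersurface. Coning
turns spherical convex bodies into solid cones of `ℝⁿ⁺¹`. By invariance of domain, deduced here from
Brouwer's theorem, `r` locally covers the boundaries of these cones; hence the span of the smallest
face and the boundary of the tangent cone at a point depend on `r` alone. There are two cases.

If all these faces have dimension at least two, take a point whose face span `V` has minimal
dimension. A great circle of `V` through this point lifts to a leaf in `M`, along which the face
span and the boundary of the tangent cone `C` are constant. A maximum principle in slices through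
half of the leaf shows that the hypersurface coincides with `∂C` near the leaf
(`eventually_mem_of_leafSet`). Quarter circles of `∂C` running from the leaf in transverse
directions are then lifted to `M`, and `C` remains a chart all along them (`isConeChart_of_wedge`,
`hasLift_sweep`). The swept region is compact, open, and mapped injectively onto the unit vectors of
`∂C`, so it is all of `M` (`injective_and_range_eq`).

If some face is a ray, an extreme point argument cuts off a cap and yields a strict local support
hyperplane `v` at some `p` (`exists_isLocalMax`). A generic pencil `e + t • v` is turned about its
axis; the component at `p` of the positive side stays on the positive side of `v` (`isSweepGood`),
so `v` supports globally (`IsStrictSupport.global`). A local support hyperplane that contains no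
piece of the hypersurface can be perturbed to a strict one and therefore supports globally too
(`nonneg_of_local_support`). Points without global support would be flat, and a countability
argument shows that flat pieces have global support as well (`mem_globalSupportSet`). So `r` runs in
the boundary of the closed convex cone that it spans, and connectedness makes it a bijection onto
the unit vectors of that boundary. -/

/-! ### No retraction of the ball onto the sphere, by a volume argument. -/

section Brouwer

open MeasureTheory Metric Polynomial

variable {E : Type*} [NormedAddCommGroup E] [InnerProductSpace ℝ E] [FiniteDimensional ℝ E]

/-- Extrapolation: `det (1 + f)` is a fixed linear combination of the values `det (1 + t f)` at
small positive nodes `t`. -/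
theorem exists_det_one_add_eq_sum (E : Type*) [NormedAddCommGroup E] [NormedSpace ℝ E]
    [FiniteDimensional ℝ E] {δ : ℝ} (hδ : 0 < δ) :
    ∃ (m : ℕ) (c t : Fin m → ℝ), (∀ i, 0 < t i ∧ t i < δ) ∧
      ∀ f : E →L[ℝ] E, (1 + f).det = ∑ i, c i * (1 + t i • f).det := by
  classical
  set d := Module.finrank ℝ E
  let b := Module.finBasis ℝ E
  -- The offset 2 keeps all nodes strictly below `δ`, even for `i = 0`. There are `d + 1` of them,
  -- enough for a polynomial of degree at most `d`.
  let t : Fin (d + 1) → ℝ := fun i => δ / (i + 2)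
  have hpos : ∀ i : Fin (d + 1), (0 : ℝ) < i + 2 := fun i => by positivity
  have ht : Set.InjOn t (Finset.univ : Finset (Fin (d + 1))) := by
    intro i _ j _ hij
    have h : (i : ℝ) + 2 = j + 2 := by
      have hi := hpos i
      have hj := hpos j
      simp only [t] at hij
      field_simp at hij
      linarith
    exact Fin.ext (by exact_mod_cast (add_right_cancel h))
  refine ⟨d + 1, fun i => (Lagrange.basis Finset.univ t i).eval 1, t, fun i => ⟨by
    have := hpos i; positivity, ?_⟩, fun f => ?_⟩
  · rw [div_lt_iff₀ (hpos i)]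
    have : (0 : ℝ) ≤ i := by positivity
    nlinarith
  let A := LinearMap.toMatrix b b (f : E →ₗ[ℝ] E)
  let P : ℝ[X] := Matrix.det ((X : ℝ[X]) • A.map C + (1 : Matrix _ _ ℝ).map C)
  have hP : ∀ s : ℝ, P.eval s = (1 + s • f).det := by
    intro s
    have h1 : (1 + s • f).det = Matrix.det (1 + s • A) := by
      rw [ContinuousLinearMap.det, ← LinearMap.det_toMatrix b]
      congr 1
      have : ((1 + s • f : E →L[ℝ] E) : E →ₗ[ℝ] E) = LinearMap.id + s • (f : E →ₗ[ℝ] E) := by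
        ext x; simp
      rw [this]
      simp [A]
    rw [h1]
    have h2 : P.eval s = (Polynomial.evalRingHom s) P := rfl
    rw [h2, RingHom.map_det]
    congr 1
    ext i j
    by_cases hij : i = j <;> simp [hij, mul_comm s, add_comm (1 : ℝ)]
  have hdeg : P.degree < (Finset.univ : Finset (Fin (d + 1))).card := by
    refine (Polynomial.degree_le_natDegree).trans_lt ?_
    have := Polynomial.natDegree_det_X_add_C_le A (1 : Matrix _ _ ℝ)
    rw [Fintype.card_fin] at this
    rw [Finset.card_univ, Fintype.card_fin]
    exact_mod_cast Nat.lt_succ_of_le this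
  have h := Lagrange.eq_interpolate ht hdeg
  have h1 := congrArg (Polynomial.eval 1) h
  rw [hP 1, one_smul] at h1
  rw [h1, Lagrange.interpolate_apply, Polynomial.eval_finsetSum]
  refine Finset.sum_congr rfl fun i _ => ?_
  rw [Polynomial.eval_mul, Polynomial.eval_C, hP, mul_comm]

/-- By the Neumann series `1 + s f` stays invertible for `s` in `[0, 1]`, so its determinant keeps
the sign that it has at `s = 0`. -/
theorem det_one_add_pos {f : E →L[ℝ] E} (hf : ‖f‖ < 1) : 0 < (1 + f).det := by
  have hne : ∀ s ∈ Set.Icc (0 : ℝ) 1, (1 + s • f).det ≠ 0 := by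
    intro s hs
    have h1 : ‖-(s • f)‖ < 1 := by
      rw [norm_neg, norm_smul, Real.norm_of_nonneg hs.1]
      nlinarith [hs.2, norm_nonneg f]
    have hu : IsUnit (1 + s • f) := by
      have := (Units.oneSub (-(s • f)) h1).isUnit
      simpa [Units.oneSub] using this
    have := hu.map (ContinuousLinearMap.toLinearMapRingHom : (E →L[ℝ] E) →+* (E →ₗ[ℝ] E))
    exact ((LinearMap.isUnit_iff_isUnit_det _).1 this).ne_zero
  have hc : ContinuousOn (fun s : ℝ => (1 + s • f).det) (Set.Icc 0 1) :=
    (ContinuousLinearMap.continuous_det.comp (by fun_prop)).continuousOn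
  by_contra! hcon
  have h0 : (1 + (0 : ℝ) • f).det = 1 := by simp [ContinuousLinearMap.det]
  obtain ⟨s, hs, hs0⟩ := intermediate_value_Icc' (zero_le_one' ℝ) hc
    ⟨(by simpa using hcon : (1 + (1 : ℝ) • f).det ≤ 0), h0.symm ▸ zero_le_one⟩
  exact hne s hs hs0

/-- There is no continuously differentiable retraction of the closed unit ball onto the sphere. -/
theorem no_contDiff_retraction {g : E → E} {W : Set E} (hW : IsOpen W)
    (hBW : closedBall (0 : E) 1 ⊆ W) (hg : ContDiffOn ℝ 1 g W)
    (hn : ∀ x ∈ closedBall (0 : E) 1, ‖g x‖ = 1) (hS : ∀ x, ‖x‖ = 1 → g x = x) : False := by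
  let _ : MeasurableSpace E := borel E
  have _ : BorelSpace E := ⟨rfl⟩
  set B := closedBall (0 : E) 1 with hB
  set U := ball (0 : E) 1 with hU
  have hUB : U ⊆ B := ball_subset_closedBall
  let h : E → E := fun x => g x - x
  have hh : ContDiffOn ℝ 1 h W := hg.sub contDiffOn_id
  have hBc : IsCompact B := isCompact_closedBall 0 1
  have hDc : ContinuousOn (fderiv ℝ h) W := hh.continuousOn_fderiv_of_isOpen hW le_rfl
  obtain ⟨L, hL⟩ := (hBc.image_of_continuousOn (hDc.mono hBW)).isBounded.exists_norm_le
  have hL' : ∀ x ∈ B, ‖fderiv ℝ h x‖ ≤ L := fun x hx => hL _ ⟨x, hx, rfl⟩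
  have h0B : (0 : E) ∈ B := by simp [hB]
  have hL0 : 0 ≤ L := (norm_nonneg _).trans (hL' 0 h0B)
  have hd : ∀ x ∈ B, HasStrictFDerivAt h (fderiv ℝ h x) x := fun x hx =>
    (hh.contDiffAt (hW.mem_nhds (hBW hx))).hasStrictFDerivAt one_ne_zero
  have hlip : ∀ x ∈ B, ∀ y ∈ B, ‖h y - h x‖ ≤ L * ‖y - x‖ := fun x hx y hy =>
    Convex.norm_image_sub_le_of_norm_hasFDerivWithin_le
      (fun z hz => (hd z hz).hasFDerivAt.hasFDerivWithinAt) hL' (convex_closedBall 0 1) hx hy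
  have hδ : 0 < 1 / (L + 1) := by positivity
  -- the volume of the image of the ball is constant for small parameters
  have key : ∀ t : ℝ, 0 < t → t < 1 / (L + 1) →
      ∫ x in U, (1 + t • fderiv ℝ h x).det = volume.real U := by
    intro t ht0 ht
    have htL : t * (L + 1) < 1 := (lt_div_iff₀ (by positivity)).1 ht
    have htL' : t * L < 1 := by nlinarith
    have ht1 : t < 1 := by nlinarith [mul_nonneg ht0.le hL0]
    -- `G = (1 - t) id + t g` joins the identity to the supposed retraction. For `t L < 1` it is
    -- injective with invertible derivative and fixes the sphere; the image of the open ball is then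
    -- open and relatively closed in the ball, hence equal to it.
    let G : E → E := fun x => x + t • h x
    have hGd : ∀ x ∈ B, HasStrictFDerivAt G (1 + t • fderiv ℝ h x) x := fun x hx =>
      (hasStrictFDerivAt_id x).add ((hd x hx).const_smul t)
    have hsmall : ∀ x ∈ B, ‖t • fderiv ℝ h x‖ < 1 := by
      intro x hx
      rw [norm_smul, Real.norm_of_nonneg ht0.le]
      exact (mul_le_mul_of_nonneg_left (hL' x hx) ht0.le).trans_lt htL'
    have hinj : Set.InjOn G B := by
      intro x hx y hy hxy
      have h1 : y - x = -(t • (h y - h x)) := by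
        simp only [G] at hxy
        rw [smul_sub, ← sub_eq_zero]
        rw [← sub_eq_zero] at hxy
        rw [← neg_eq_zero, ← hxy]
        abel
      have h2 : ‖y - x‖ ≤ t * L * ‖y - x‖ := by
        conv_lhs => rw [h1]
        rw [norm_neg, norm_smul, Real.norm_of_nonneg ht0.le, mul_assoc]
        exact mul_le_mul_of_nonneg_left (hlip x hx y hy) ht0.le
      have h3 : ‖y - x‖ = 0 := by nlinarith [norm_nonneg (y - x)]
      exact (sub_eq_zero.1 (norm_eq_zero.1 h3)).symm
    have hGeq : ∀ x, G x = (1 - t) • x + t • g x := by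
      intro x; simp only [G, h]; module
    have hGU : G '' U ⊆ U := by
      rintro _ ⟨x, hx, rfl⟩
      have hx' : ‖x‖ < 1 := by simpa [hU] using hx
      rw [hU, mem_ball_zero_iff, hGeq]
      refine (norm_add_le _ _).trans_lt ?_
      rw [norm_smul, norm_smul, Real.norm_of_nonneg ht0.le,
        Real.norm_of_nonneg (by linarith : 0 ≤ 1 - t), hn x (hUB hx)]
      nlinarith
    have hGS : ∀ x, ‖x‖ = 1 → G x = x := by
      intro x hx
      rw [hGeq, hS x hx]; module
    have hopen : IsOpen (G '' U) := by
      rw [isOpen_iff_mem_nhds]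
      rintro _ ⟨x, hx, rfl⟩
      have hx' := hUB hx
      have hdet := (det_one_add_pos (hsmall x hx')).ne'
      rw [← (hGd x hx').map_nhds_eq_of_surj]
      · exact Filter.image_mem_map (isOpen_ball.mem_nhds hx)
      · exact LinearMap.range_eq_top.2
          (LinearMap.equivOfDetNeZero _ hdet).surjective
    have hGc : ContinuousOn G B := fun x hx =>
      (hGd x hx).hasFDerivAt.continuousAt.continuousWithinAt
    have hclosed : IsClosed (G '' B) := (hBc.image_of_continuousOn hGc).isClosed
    have himg : G '' U = U := by
      refine hGU.antisymm ?_
      have hpre : IsPreconnected U := (convex_ball (0 : E) 1).isPreconnected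
      refine hpre.subset_left_of_subset_union hopen hclosed.isOpen_compl ?_ ?_ ?_
      · exact disjoint_compl_right.mono_left (Set.image_mono hUB)
      · intro y hy
        by_cases hyB : y ∈ G '' B
        · left
          obtain ⟨x, hx, rfl⟩ := hyB
          refine ⟨x, ?_, rfl⟩
          by_contra hxU
          have hx1 : ‖x‖ = 1 := by
            refine le_antisymm (by simpa [hB] using hx) ?_
            simpa [hU] using hxU
          rw [hGS x hx1] at hy
          exact hxU hy
        · right; exact hyB
      · exact ⟨G 0, hGU ⟨0, mem_ball_self one_pos, rfl⟩, ⟨0, mem_ball_self one_pos, rfl⟩⟩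
    have hcv := integral_image_eq_integral_abs_det_fderiv_smul (volume : Measure E)
      (measurableSet_ball : MeasurableSet U)
      (fun x hx => (hGd x (hUB hx)).hasFDerivAt.hasFDerivWithinAt) (hinj.mono hUB)
      (fun _ => (1 : ℝ))
    rw [himg, setIntegral_const, smul_eq_mul, mul_one] at hcv
    rw [hcv]
    refine setIntegral_congr_fun measurableSet_ball fun x hx => ?_
    simp only [smul_eq_mul, mul_one]
    exact (abs_of_pos (det_one_add_pos (hsmall x (hUB hx)))).symm
  obtain ⟨m, c, t, ht, hdet⟩ := exists_det_one_add_eq_sum E hδ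
  have hint : ∀ s : ℝ, IntegrableOn (fun x => (1 + s • fderiv ℝ h x).det) U := by
    intro s
    refine (ContinuousOn.integrableOn_compact hBc ?_).mono_set hUB
    refine ContinuousLinearMap.continuous_det.comp_continuousOn ?_
    exact continuousOn_const.add ((hDc.mono hBW).const_smul s)
  have hvol : 0 < volume.real U :=
    ENNReal.toReal_pos (isOpen_ball.measure_pos volume ⟨0, mem_ball_self one_pos⟩).ne'
      measure_ball_lt_top.ne
  -- Extrapolation at `f = 0`: the weights sum to one, so the volume formula, known for small
  -- parameters, persists at parameter 1.
  have hc1 : ∑ i, c i = 1 := by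
    have := hdet 0
    simp only [smul_zero, add_zero, ContinuousLinearMap.det] at this
    simpa using this.symm
  -- Differentiating `‖g‖² = 1` shows that the image of the derivative of `g` is orthogonal to `g
  -- x`, so the derivative is singular and the integral at parameter 1 vanishes.
  have hzero : ∀ x ∈ U, (1 + fderiv ℝ h x).det = 0 := by
    intro x hx
    have hxW := hBW (hUB hx)
    by_contra hne
    have hgd : HasFDerivAt g (1 + fderiv ℝ h x) x := by
      have := (hd x (hUB hx)).hasFDerivAt.add (hasFDerivAt_id x)
      refine (this.congr_of_eventuallyEq (Filter.Eventually.of_forall fun y => ?_)).congr_fderiv ?_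
      · simp [h]
      · ext y; simp [add_comm]
    have hsq : HasFDerivAt (fun y => ‖g y‖ ^ 2)
        (2 • (innerSL ℝ (g x)).comp (1 + fderiv ℝ h x)) x := hgd.norm_sq
    have hconst : HasFDerivAt (fun y => ‖g y‖ ^ 2) (0 : E →L[ℝ] ℝ) x := by
      refine (hasFDerivAt_const (1 : ℝ) x).congr_of_eventuallyEq ?_
      filter_upwards [isOpen_ball.mem_nhds hx] with y hy
      rw [hn y (hUB hy)]; norm_num
    obtain ⟨y, hy⟩ := (LinearMap.equivOfDetNeZero _ hne).surjective (g x)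
    have hy' : (1 + fderiv ℝ h x) y = g x := hy
    have := DFunLike.congr_fun (hsq.unique hconst) y
    have hgx := hn x (hUB hx)
    simp only [smul_apply, ContinuousLinearMap.comp_apply, hy',
      innerSL_apply_apply, real_inner_self_eq_norm_sq, hgx, zero_apply] at this
    norm_num at this
  have hsum : ∫ x in U, (1 + fderiv ℝ h x).det = volume.real U := by
    rw [show (fun x => (1 + fderiv ℝ h x).det) = fun x => ∑ i, c i * (1 + t i • fderiv ℝ h x).det from
      funext fun x => hdet _, integral_finsetSum _ fun i _ => (hint (t i)).const_mul (c i)]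
    simp_rw [integral_const_mul]
    rw [Finset.sum_congr rfl fun i _ => by rw [key (t i) (ht i).1 (ht i).2], ← Finset.sum_mul, hc1,
      one_mul]
  rw [setIntegral_congr_fun measurableSet_ball hzero] at hsum
  simp at hsum
  exact hvol.ne hsum

end Brouwer

/-! ### Brouwer's fixed point theorem and invariance of domain. -/

section InvarianceOfDomain

open MeasureTheory Metric

variable {E : Type*} [NormedAddCommGroup E] [InnerProductSpace ℝ E] [FiniteDimensional ℝ E]

/-- A smooth map without fixed points from the closed unit ball to the open unit ball gives a
retraction onto the sphere. -/
theorem exists_fixedPoint_of_contDiff {φ : E → E} (hφ : ContDiff ℝ 1 φ)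
    (hb : ∀ x, ‖φ x‖ < 1) : ∃ x ∈ closedBall (0 : E) 1, φ x = x := by
  by_contra! hne
  let u : E → E := fun x => x - φ x
  let a : E → ℝ := fun x => ⟪x, u x⟫
  let d : E → ℝ := fun x => a x ^ 2 + ‖u x‖ ^ 2 * (1 - ‖x‖ ^ 2)
  -- The larger root of `‖x + l u‖² = 1`: the retraction sends `x` to the point where the ray from
  -- `φ x` through `x` leaves the ball. The discriminant `d` is positive on the closed ball, which
  -- makes the root smooth.
  let l : E → ℝ := fun x => (-a x + √(d x)) / ‖u x‖ ^ 2
  have hu : ContDiff ℝ 1 u := contDiff_id.sub hφ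
  have ha : ContDiff ℝ 1 a := contDiff_id.inner ℝ hu
  have hun : ContDiff ℝ 1 fun x => ‖u x‖ ^ 2 := hu.norm_sq ℝ
  have hd : ContDiff ℝ 1 d := (ha.pow 2).add (hun.mul (contDiff_const.sub (contDiff_id.norm_sq ℝ)))
  have hu0 : ∀ x ∈ closedBall (0 : E) 1, u x ≠ 0 := fun x hx h =>
    hne x hx (sub_eq_zero.1 h).symm
  have hapos : ∀ x, ‖x‖ = 1 → 0 < a x := by
    intro x hx
    simp only [a, u, inner_sub_right, real_inner_self_eq_norm_sq, hx]
    have := real_inner_le_norm x (φ x)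
    rw [hx] at this
    linarith [hb x]
  have hd0 : ∀ x ∈ closedBall (0 : E) 1, 0 < d x := by
    intro x hx
    have hx1 : ‖x‖ ≤ 1 := by simpa using hx
    rcases hx1.lt_or_eq with h | h
    · have h1 : 0 < ‖u x‖ := norm_pos_iff.2 (hu0 x hx)
      have h2 : 0 < 1 - ‖x‖ ^ 2 := by nlinarith [norm_nonneg x]
      have := sq_nonneg (a x)
      positivity
    · simp only [d, h]
      have := hapos x h
      norm_num
      positivity
  refine no_contDiff_retraction (g := fun x => x + l x • u x)
    (W := {x | u x ≠ 0} ∩ {x | 0 < d x}) ?_ (fun x hx => ⟨hu0 x hx, hd0 x hx⟩) ?_ ?_ ?_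
  · exact (isOpen_ne_fun hu.continuous continuous_const).inter
      (isOpen_lt continuous_const hd.continuous)
  · refine contDiffOn_id.add (ContDiffOn.smul ?_ hu.contDiffOn)
    refine ContDiffOn.div (ha.neg.contDiffOn.add ?_) hun.contDiffOn ?_
    · exact hd.contDiffOn.sqrt fun x hx => hx.2.ne'
    · exact fun x hx => pow_ne_zero 2 (norm_ne_zero_iff.2 hx.1)
  · intro x hx
    have h1 : 0 < ‖u x‖ ^ 2 := by
      have := norm_pos_iff.2 (hu0 x hx); positivity
    have h2 : l x * ‖u x‖ ^ 2 = -a x + √(d x) := div_mul_cancel₀ _ h1.ne'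
    have h3 : (l x * ‖u x‖ ^ 2 + a x) ^ 2 = d x := by
      rw [h2]; ring_nf; exact Real.sq_sqrt (hd0 x hx).le
    have h4 : ‖x + l x • u x‖ ^ 2 = 1 := by
      rw [norm_add_sq_real, inner_smul_right, norm_smul, mul_pow, Real.norm_eq_abs, sq_abs]
      change ‖x‖ ^ 2 + 2 * (l x * a x) + l x ^ 2 * ‖u x‖ ^ 2 = 1
      simp only [d] at h3
      refine mul_left_cancel₀ h1.ne' ?_
      linear_combination h3
    exact (pow_eq_one_iff_of_nonneg (norm_nonneg _) two_ne_zero).1 h4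
  · intro x hx
    have : l x = 0 := by
      simp only [l, d, hx]
      rw [one_pow, sub_self, mul_zero, add_zero, Real.sqrt_sq (hapos x hx).le]
      simp
    simp [this]

/-- **Brouwer's fixed point theorem** for the closed unit ball. -/
theorem exists_fixedPoint_closedBall {f : E → E} (hf : ContinuousOn f (closedBall 0 1))
    (hm : Set.MapsTo f (closedBall 0 1) (closedBall 0 1)) :
    ∃ x ∈ closedBall (0 : E) 1, f x = x := by
  by_contra! hne
  let ρ : E → E := fun x => (max 1 ‖x‖)⁻¹ • x
  have hρc : Continuous ρ := by
    refine Continuous.smul (Continuous.inv₀ (by fun_prop) fun x => ?_) continuous_id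
    exact (zero_lt_one.trans_le (le_max_left _ _)).ne'
  have hρm : ∀ x, ρ x ∈ closedBall (0 : E) 1 := by
    intro x
    have h1 : 0 < max 1 ‖x‖ := zero_lt_one.trans_le (le_max_left _ _)
    rw [mem_closedBall_zero_iff, norm_smul, norm_inv, Real.norm_of_nonneg h1.le,
      inv_mul_le_iff₀ h1, mul_one]
    exact le_max_right _ _
  have hρB : ∀ x ∈ closedBall (0 : E) 1, ρ x = x := by
    intro x hx
    have : ‖x‖ ≤ 1 := by simpa using hx
    simp [ρ, max_eq_left this]
  let F : E → E := fun x => f (ρ x)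
  have hF : Continuous F := hf.comp_continuous hρc hρm
  have hF1 : ∀ x, ‖F x‖ ≤ 1 := fun x => by simpa using hm (hρm x)
  obtain ⟨x₀, hx₀, hmin⟩ := (isCompact_closedBall (0 : E) 1).exists_isMinOn ⟨0, by simp⟩
    (f := fun x => ‖F x - x‖) (by fun_prop)
  set δ := ‖F x₀ - x₀‖ with hδ
  have hδ0 : 0 < δ := by
    rw [hδ, norm_pos_iff, sub_ne_zero]
    simpa [F, hρB x₀ hx₀] using hne x₀ hx₀
  set η := min (1 / 2) (δ / 4) with hη
  have hη0 : 0 < η := by positivity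
  have hη1 : η ≤ 1 / 2 := min_le_left _ _
  have hη2 : η ≤ δ / 4 := min_le_right _ _
  -- The factor `1 - η` makes room for the approximation error, so that `φ` takes values in the open
  -- ball.
  obtain ⟨φ, hφ, hφd, -⟩ := (hF.const_smul (1 - η)).exists_contDiff_approx 1
    (ε := fun _ => η) continuous_const fun _ => hη0
  have hφd' : ∀ x, ‖φ x - (1 - η) • F x‖ < η := fun x => by
    have := hφd x
    rwa [dist_eq_norm] at this
  obtain ⟨x, hx, hfix⟩ := exists_fixedPoint_of_contDiff (φ := φ) (by exact_mod_cast hφ) (by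
    intro x
    have h1 : ‖(1 - η) • F x‖ ≤ 1 - η := by
      rw [norm_smul, Real.norm_of_nonneg (by linarith)]
      nlinarith [hF1 x]
    have h2 := norm_sub_norm_le (φ x) ((1 - η) • F x)
    linarith [hφd' x])
  have h1 : δ ≤ ‖F x - x‖ := hmin hx
  have h2 : F x - x = η • F x - (φ x - (1 - η) • F x) := by rw [hfix]; module
  have h3 : ‖F x - x‖ < η + η := by
    rw [h2]
    refine (norm_sub_le _ _).trans_lt (add_lt_add_of_le_of_lt ?_ (hφd' x))
    rw [norm_smul, Real.norm_of_nonneg hη0.le]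
    nlinarith [hF1 x]
  linarith

/-- The central point of an injectively and continuously embedded ball is an interior point of
the image. -/
theorem mem_interior_image_closedBall {f : E → E} (hf : ContinuousOn f (closedBall 0 1))
    (hinj : Set.InjOn f (closedBall 0 1)) : f 0 ∈ interior (f '' closedBall 0 1) := by
  by_contra hnot
  set B := closedBall (0 : E) 1 with hB
  have hBc : IsCompact B := isCompact_closedBall 0 1
  have h0B : (0 : E) ∈ B := by simp [hB]
  have hKc : IsCompact (f '' B) := hBc.image_of_continuousOn hf
  -- a continuous extension of the inverse map
  obtain ⟨G, hG⟩ : ∃ G : C(E, E), ∀ x ∈ B, G (f x) = x := by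
    have : CompactSpace B := isCompact_iff_compactSpace.1 hBc
    have hemb : Topology.IsClosedEmbedding (B.domRestrict f) :=
      (continuousOn_iff_continuous_domRestrict.1 hf).isClosedEmbedding
        (Set.injOn_iff_injective.1 hinj)
    obtain ⟨G, hG⟩ := ContinuousMap.exists_extension hemb
      (⟨Subtype.val, continuous_subtype_val⟩ : C(B, E))
    exact ⟨G, fun x hx => DFunLike.congr_fun hG ⟨x, hx⟩⟩
  -- Any `H` within distance 1 of the inverse `G` vanishes somewhere on the image: apply Brouwer to
  -- `x - H (f x)`. The rest of the proof builds such an `H` without zeros.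
  have zero : ∀ H : E → E, ContinuousOn H (f '' B) → (∀ y ∈ f '' B, ‖G y - H y‖ ≤ 1) →
      ∃ y ∈ f '' B, H y = 0 := by
    intro H hH hGH
    obtain ⟨x, hx, hfix⟩ := exists_fixedPoint_closedBall (f := fun x => x - H (f x))
      (continuousOn_id.sub (hH.comp hf (Set.mapsTo_image f B))) (by
        intro x hx
        have := hGH (f x) ⟨x, hx, rfl⟩
        rw [hG x hx] at this
        simpa using this)
    exact ⟨f x, ⟨x, hx, rfl⟩, by simpa using hfix⟩
  have hG0 : G (f 0) = 0 := hG 0 h0B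
  obtain ⟨ε₂, hε₂, hGε⟩ := Metric.continuousAt_iff.1 (G.continuous.continuousAt (x := f 0))
    (1 / 10) (by norm_num)
  set ε := ε₂ / 2 with hε
  have hε0 : 0 < ε := by positivity
  have hGε' : ∀ y, ‖y - f 0‖ < 2 * ε → ‖G y‖ < 1 / 10 := by
    intro y hy
    have := hGε (x := y) (by rw [dist_eq_norm]; linarith)
    rwa [hG0, dist_zero_right] at this
  obtain ⟨c, hcK, hc⟩ : ∃ c, c ∉ f '' B ∧ ‖c - f 0‖ < ε := by
    by_contra! hall
    refine hnot (mem_interior_iff_mem_nhds.2 ?_)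
    refine Filter.mem_of_superset (ball_mem_nhds (f 0) hε0) fun y hy => ?_
    by_contra hyK
    exact absurd (hall y hyK) (not_le.2 (by rwa [mem_ball, dist_eq_norm] at hy))
  -- `Φ` pushes the part of the image inside the ball around `c` radially onto its sphere; this is
  -- possible because `c` is not in the image.
  let Φ : E → E := fun y => c + max 1 (ε / ‖y - c‖) • (y - c)
  have hyc : ∀ y ∈ f '' B, 0 < ‖y - c‖ := fun y hy =>
    norm_pos_iff.2 (sub_ne_zero.2 fun h => hcK (h ▸ hy))
  have hΦ : ContinuousOn Φ (f '' B) := by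
    refine continuousOn_const.add (ContinuousOn.smul (continuousOn_const.sup ?_) (by fun_prop))
    exact ContinuousOn.div (by fun_prop) (by fun_prop) fun y hy => (hyc y hy).ne'
  have hΦ1 : ∀ y, ε ≤ ‖y - c‖ → Φ y = y := by
    intro y hy
    have : ε / ‖y - c‖ ≤ 1 := div_le_one_of_le₀ hy (norm_nonneg _)
    simp [Φ, max_eq_left this]
  have hΦ2 : ∀ y ∈ f '' B, ‖y - c‖ < ε → ‖Φ y - c‖ = ε := by
    intro y hyK hy
    have h1 := hyc y hyK
    have : 1 ≤ ε / ‖y - c‖ := (one_le_div h1).2 hy.le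
    simp only [Φ, max_eq_right this, add_sub_cancel_left, norm_smul, norm_div, norm_norm,
      Real.norm_of_nonneg hε0.le]
    field_simp
  obtain ⟨δ, hδ0, hδ1, hδ⟩ : ∃ δ : ℝ, 0 < δ ∧ δ ≤ 1 / 10 ∧
      ∀ y ∈ f '' B, ε ≤ ‖y - c‖ → δ ≤ ‖G y‖ := by
    set K₁ := f '' B ∩ {y | ε ≤ ‖y - c‖} with hK₁
    have hK₁c : IsCompact K₁ := hKc.inter_right
      (isClosed_le continuous_const (by fun_prop))
    rcases K₁.eq_empty_or_nonempty with he | hne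
    · refine ⟨1 / 10, by norm_num, le_rfl, fun y hy hyc => ?_⟩
      have : y ∈ K₁ := ⟨hy, hyc⟩
      simp [he] at this
    · obtain ⟨y₀, hy₀, hmin⟩ := hK₁c.exists_isMinOn hne (f := fun y => ‖G y‖) (by fun_prop)
      refine ⟨min (1 / 10) ‖G y₀‖, lt_min (by norm_num) (norm_pos_iff.2 fun h => ?_),
        min_le_left _ _, fun y hy hyc => (min_le_right _ _).trans (hmin ⟨hy, hyc⟩)⟩
      obtain ⟨⟨x, hx, hxy⟩, hyc⟩ := hy₀
      have hx0 : x = 0 := by rw [← hG x hx, hxy, h]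
      rw [Set.mem_ofPred_eq, ← hxy, hx0, norm_sub_rev] at hyc
      linarith
  obtain ⟨P, hP, hPd, -⟩ := G.continuous.exists_contDiff_approx 1
    (ε := fun _ => δ / 2) continuous_const fun _ => by positivity
  have hP1 : ∀ y, ‖P y - G y‖ < δ / 2 := fun y => by
    have := hPd y
    rwa [dist_eq_norm] at this
  -- The smooth image of a sphere is a null set, so a small translation `v` removes the zeros on the
  -- sphere. Off the ball, `‖G‖ ≥ δ` already excludes zeros of `P - v`.
  obtain ⟨v, hv, hvP⟩ : ∃ v, ‖v‖ < δ / 2 ∧ v ∉ P '' sphere c ε := by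
    let _ : MeasurableSpace E := borel E
    have _ : BorelSpace E := ⟨rfl⟩
    have hnull : volume (P '' sphere c ε) = 0 :=
      addHaar_image_eq_zero_of_differentiableOn_of_addHaar_eq_zero volume
        ((hP.differentiable (by norm_num)).differentiableOn)
        (Measure.addHaar_sphere_of_ne_zero volume c hε0.ne')
    by_contra! hall
    have hsub : ball (0 : E) (δ / 2) ⊆ P '' sphere c ε := fun v hv => hall v (by simpa using hv)
    exact (measure_ball_pos (volume : Measure E) 0 (by positivity)).ne'
      (measure_mono_null hsub hnull)
  obtain ⟨y, hyK, hy0⟩ := zero (fun y => P (Φ y) - v)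
    ((hP.continuous.comp_continuousOn hΦ).sub continuousOn_const) (by
      intro y hyK
      have h1 : ‖G y - G (Φ y)‖ ≤ 2 / 10 := by
        rcases le_or_gt ε ‖y - c‖ with h | h
        · rw [hΦ1 y h]; norm_num
        · have h2 : ‖y - f 0‖ < 2 * ε := by
            have := norm_add_le (y - c) (c - f 0)
            rw [sub_add_sub_cancel] at this
            linarith
          have h3 : ‖Φ y - f 0‖ < 2 * ε := by
            have := norm_add_le (Φ y - c) (c - f 0)
            rw [sub_add_sub_cancel, hΦ2 y hyK h] at this
            linarith
          linarith [norm_sub_le (G y) (G (Φ y)), hGε' y h2, hGε' _ h3]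
      have h4 : G y - (P (Φ y) - v) = (G y - G (Φ y)) - (P (Φ y) - G (Φ y)) + v := by abel
      rw [h4]
      have := norm_add_le ((G y - G (Φ y)) - (P (Φ y) - G (Φ y))) v
      have := norm_sub_le (G y - G (Φ y)) (P (Φ y) - G (Φ y))
      linarith [hP1 (Φ y)])
  have hy0' : P (Φ y) = v := sub_eq_zero.1 hy0
  rcases le_or_gt ε ‖y - c‖ with h | h
  · rw [hΦ1 y h] at hy0'
    have h1 := hδ y hyK h
    have h2 := hP1 y
    rw [hy0'] at h2
    have h3 := norm_sub_norm_le (G y) v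
    rw [norm_sub_rev] at h3
    linarith
  · exact hvP ⟨Φ y, by rw [mem_sphere, dist_eq_norm]; exact hΦ2 y hyK h, hy0'⟩

/-- **Invariance of domain.** -/
theorem isOpen_image_of_injOn {V W : Type*} [NormedAddCommGroup V] [NormedSpace ℝ V]
    [FiniteDimensional ℝ V] [NormedAddCommGroup W] [NormedSpace ℝ W] [FiniteDimensional ℝ W]
    (hVW : Module.finrank ℝ V = Module.finrank ℝ W) {f : V → W} {s : Set V} (hs : IsOpen s)
    (hf : ContinuousOn f s) (hinj : Set.InjOn f s) : IsOpen (f '' s) := by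
  let X := EuclideanSpace ℝ (Fin (Module.finrank ℝ V))
  have hX : Module.finrank ℝ X = Module.finrank ℝ V := by simp [X]
  let e : X ≃L[ℝ] V := ContinuousLinearEquiv.ofFinrankEq hX
  let e' : W ≃L[ℝ] X := ContinuousLinearEquiv.ofFinrankEq (hVW.symm.trans hX.symm)
  rw [isOpen_iff_mem_nhds]
  rintro _ ⟨x, hx, rfl⟩
  obtain ⟨ρ, hρ, hball⟩ := Metric.nhds_basis_closedBall.mem_iff.1
    ((hs.preimage e.continuous).mem_nhds (show e.symm x ∈ e ⁻¹' s by simpa using hx))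
  let g : X → X := fun y => e' (f (e (e.symm x + ρ • y)))
  have hmem : ∀ y ∈ closedBall (0 : X) 1, e (e.symm x + ρ • y) ∈ s := by
    intro y hy
    refine hball ?_
    have hy1 : ‖y‖ ≤ 1 := by simpa using hy
    rw [mem_closedBall, dist_eq_norm, add_sub_cancel_left, norm_smul, Real.norm_of_nonneg hρ.le]
    nlinarith
  have hgc : ContinuousOn g (closedBall 0 1) :=
    e'.continuous.comp_continuousOn (hf.comp (by fun_prop) hmem)
  have hgi : Set.InjOn g (closedBall 0 1) := by
    intro y hy z hz hyz
    have h1 := e.injective (hinj (hmem y hy) (hmem z hz) (e'.injective hyz))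
    exact smul_right_injective X hρ.ne' (add_left_cancel h1)
  have h := mem_interior_iff_mem_nhds.1 (mem_interior_image_closedBall hgc hgi)
  have hg0 : g 0 = e' (f x) := by simp [g]
  rw [hg0] at h
  have h2 := e'.continuous.continuousAt.preimage_mem_nhds h
  refine Filter.mem_of_superset h2 ?_
  rintro w ⟨y, hy, hyw⟩
  exact ⟨_, hmem y hy, e'.injective hyw⟩

end InvarianceOfDomain

/-! ### Solid cones: faces, tangent cones and their boundaries. -/

section SolidCone

variable {E : Type*} [NormedAddCommGroup E] [InnerProductSpace ℝ E]

/-- A segment is connected, so it is not covered by the disjoint open sets interior and exterior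
unless it stays in one of them. -/
theorem exists_mem_frontier_of_mem_of_notMem {A : Set E} {x y : E} (hx : x ∈ A) (hy : y ∉ A) :
    ∃ s ∈ Set.Icc (0 : ℝ) 1, x + s • (y - x) ∈ frontier A := by
  have hpre : IsPreconnected ((fun s : ℝ => x + s • (y - x)) '' Set.Icc 0 1) :=
    isPreconnected_Icc.image _ (by fun_prop)
  by_contra! hcon
  have hsub := hpre.subset_left_of_subset_union (u := interior A) (v := (closure A)ᶜ)
    isOpen_interior isClosed_closure.isOpen_compl
    (disjoint_compl_right.mono_left (interior_subset.trans subset_closure)) (by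
      rintro _ ⟨s, hs, rfl⟩
      by_contra hz
      rw [Set.mem_union, not_or, Set.mem_compl_iff, not_not] at hz
      exact hcon s hs ⟨hz.2, hz.1⟩) (by
      refine ⟨x, ⟨0, by simp, by simp⟩, ?_⟩
      by_contra hxi
      exact hcon 0 (by simp) (by simpa using ⟨subset_closure hx, hxi⟩))
  exact hy (interior_subset (hsub ⟨1, by simp, by simp⟩))

/-- Closed convex cones with apex at the origin and non-empty interior. -/
structure IsSolidCone (A : Set E) : Prop where
  closed : IsClosed A
  add_mem : ∀ {x y}, x ∈ A → y ∈ A → x + y ∈ A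
  smul_mem : ∀ {t : ℝ} {x}, 0 ≤ t → x ∈ A → t • x ∈ A
  nonempty_interior : (interior A).Nonempty

namespace IsSolidCone

variable {A B : Set E} (hA : IsSolidCone A) (hB : IsSolidCone B)
include hA

theorem zero_mem : (0 : E) ∈ A := by
  obtain ⟨x, hx⟩ := hA.nonempty_interior
  simpa using hA.smul_mem le_rfl (interior_subset hx)

theorem convex : Convex ℝ A := fun _ hx _ hy _ _ ha hb _ =>
  hA.add_mem (hA.smul_mem ha hx) (hA.smul_mem hb hy)

theorem add_mem_interior {x y : E} (hx : x ∈ A) (hy : y ∈ interior A) : x + y ∈ interior A := by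
  have h : (fun z => x + z) '' interior A ⊆ A := by
    rintro _ ⟨z, hz, rfl⟩
    exact hA.add_mem hx (interior_subset hz)
  exact interior_maximal h (isOpenMap_add_left x _ isOpen_interior) ⟨y, hy, rfl⟩

theorem smul_mem_interior {t : ℝ} {x : E} (ht : 0 < t) (hx : x ∈ interior A) :
    t • x ∈ interior A := by
  have h : (fun z => t • z) '' interior A ⊆ A := by
    rintro _ ⟨z, hz, rfl⟩
    exact hA.smul_mem ht.le (interior_subset hz)
  exact interior_maximal h (isOpenMap_smul₀ ht.ne' _ isOpen_interior) ⟨x, hx, rfl⟩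

theorem mem_frontier {x : E} : x ∈ frontier A ↔ x ∈ A ∧ x ∉ interior A := by
  rw [hA.closed.frontier_eq]; rfl

theorem mem_of_frontier {x : E} (hx : x ∈ frontier A) : x ∈ A := (hA.mem_frontier.1 hx).1

theorem smul_mem_frontier {t : ℝ} {x : E} (ht : 0 < t) (hx : x ∈ frontier A) :
    t • x ∈ frontier A := by
  rw [hA.mem_frontier] at hx ⊢
  refine ⟨hA.smul_mem ht.le hx.1, fun h => hx.2 ?_⟩
  have := hA.smul_mem_interior (inv_pos.2 ht) h
  rwa [smul_smul, inv_mul_cancel₀ ht.ne', one_smul] at this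

theorem smul_mem_frontier_iff {t : ℝ} {x : E} (ht : 0 < t) :
    t • x ∈ frontier A ↔ x ∈ frontier A := by
  refine ⟨fun h => ?_, hA.smul_mem_frontier ht⟩
  have := hA.smul_mem_frontier (inv_pos.2 ht) h
  rwa [smul_smul, inv_mul_cancel₀ ht.ne', one_smul] at this

theorem smul_mem_interior_iff {t : ℝ} {x : E} (ht : 0 < t) :
    t • x ∈ interior A ↔ x ∈ interior A := by
  refine ⟨fun h => ?_, hA.smul_mem_interior ht⟩
  have := hA.smul_mem_interior (inv_pos.2 ht) h
  rwa [smul_smul, inv_mul_cancel₀ ht.ne', one_smul] at this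

/-- A consequence of `A + interior A ⊆ interior A`. It says that a line in an interior direction
meets the boundary at most once, so the boundary is a graph in every such direction. -/
theorem frontier_sub_notMem {x y : E} (hx : x ∈ frontier A) (hy : y ∈ interior A) :
    x - y ∉ A := fun h =>
  (hA.mem_frontier.1 hx).2 (by simpa using hA.add_mem_interior h hy)

/-- Points between a point of the cone and an interior point are interior points. -/
theorem mem_interior_of_combo {x y : E} {s : ℝ} (hx : x ∈ A) (hy : y ∈ interior A) (hs0 : 0 < s)
    (hs1 : s ≤ 1) : (1 - s) • x + s • y ∈ interior A :=
  hA.add_mem_interior (hA.smul_mem (by linarith) hx) (hA.smul_mem_interior hs0 hy)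

theorem subset_closure_interior : A ⊆ closure (interior A) := by
  rw [hA.convex.closure_interior_eq_closure_of_nonempty_interior hA.nonempty_interior]
  exact subset_closure

/-- The linear span of the smallest face of the cone through `w`. -/
def faceSpan (w : E) : Submodule ℝ E where
  carrier := {v | ∃ s : ℝ, 0 ≤ s ∧ s • w + v ∈ A ∧ s • w - v ∈ A}
  zero_mem' := ⟨0, le_rfl, by simpa using hA.zero_mem, by simpa using hA.zero_mem⟩
  add_mem' := by
    rintro u v ⟨s, hs, h1, h2⟩ ⟨t, ht, h3, h4⟩
    refine ⟨s + t, add_nonneg hs ht, ?_, ?_⟩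
    · convert hA.add_mem h1 h3 using 1; module
    · convert hA.add_mem h2 h4 using 1; module
  smul_mem' := by
    rintro c v ⟨s, hs, h1, h2⟩
    refine ⟨|c| * s, by positivity, ?_⟩
    rcases le_total 0 c with hc | hc
    · rw [abs_of_nonneg hc]
      constructor
      · convert hA.smul_mem hc h1 using 1; module
      · convert hA.smul_mem hc h2 using 1; module
    · rw [abs_of_nonpos hc]
      constructor
      · convert hA.smul_mem (neg_nonneg.2 hc) h2 using 1; module
      · convert hA.smul_mem (neg_nonneg.2 hc) h1 using 1; module

theorem self_mem_faceSpan {w : E} (hw : w ∈ A) : w ∈ hA.faceSpan w :=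
  ⟨1, zero_le_one, by simpa using hA.add_mem hw hw, by simpa using hA.zero_mem⟩

theorem faceSpan_mono {w w' : E} (h : w' ∈ hA.faceSpan w) :
    hA.faceSpan w' ≤ hA.faceSpan w := by
  rintro v ⟨s, hs, h1, h2⟩
  obtain ⟨t, ht, -, h4⟩ := h
  have h5 := hA.smul_mem hs h4
  refine ⟨s * t, mul_nonneg hs ht, ?_, ?_⟩
  · convert hA.add_mem h5 h1 using 1; module
  · convert hA.add_mem h5 h2 using 1; module

/-- Small perturbations in the direction of the smallest face stay in the cone. -/
theorem exists_add_smul_mem {w v : E} (hw : w ∈ A) (hv : v ∈ hA.faceSpan w) :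
    ∃ ε : ℝ, 0 < ε ∧ ∀ t : ℝ, |t| ≤ ε → w + t • v ∈ A := by
  obtain ⟨s, hs, h1, h2⟩ := hv
  -- This bound gives `|t| s ≤ 1`, and `w + t v = (1 - |t| s) w + |t| (s w ± v)` is a sum of
  -- elements of `A`.
  refine ⟨1 / (s + 1), by positivity, fun t ht => ?_⟩
  have h3 : |t| * s ≤ 1 := by
    have := (le_div_iff₀ (by positivity)).1 ht
    nlinarith [abs_nonneg t]
  have h4 : (1 - |t| * s) • w ∈ A := hA.smul_mem (by linarith) hw
  rcases le_total 0 t with h | h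
  · rw [abs_of_nonneg h] at h4
    convert hA.add_mem h4 (hA.smul_mem h h1) using 1; module
  · rw [abs_of_nonpos h] at h4
    convert hA.add_mem h4 (hA.smul_mem (neg_nonneg.2 h) h2) using 1; module

omit hA in
/-- The tangent cone at the point `w`. -/
def _root_.tangentSolidCone (A : Set E) (w : E) : Set E := closure {v | ∃ s : ℝ, 0 ≤ s ∧ v + s • w ∈ A}

omit hA in
theorem _root_.subset_tangentSolidCone (A : Set E) (w : E) : A ⊆ tangentSolidCone A w := fun v hv =>
  subset_closure ⟨0, le_rfl, by simpa using hv⟩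

theorem convex_preTangent (w : E) : Convex ℝ {v | ∃ s : ℝ, 0 ≤ s ∧ v + s • w ∈ A} := by
  rintro x ⟨s, hs, h1⟩ y ⟨t, ht, h2⟩ a b ha hb -
  refine ⟨a * s + b * t, by positivity, ?_⟩
  convert hA.add_mem (hA.smul_mem ha h1) (hA.smul_mem hb h2) using 1
  module

theorem tangentSolidCone_isSolidCone (w : E) : IsSolidCone (tangentSolidCone A w) where
  closed := isClosed_closure
  add_mem := by
    intro x y hx hy
    refine map_mem_closure₂ continuous_add hx hy ?_
    rintro x ⟨s, hs, h1⟩ y ⟨t, ht, h2⟩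
    refine ⟨s + t, by positivity, ?_⟩
    convert hA.add_mem h1 h2 using 1
    module
  smul_mem := by
    intro c x hc hx
    refine map_mem_closure (continuous_const_smul c) hx ?_
    rintro x ⟨s, hs, h1⟩
    refine ⟨c * s, by positivity, ?_⟩
    convert hA.smul_mem hc h1 using 1
    module
  nonempty_interior := hA.nonempty_interior.mono (interior_mono (subset_tangentSolidCone A w))

/-- A convex set with interior points has the same interior as its closure, so `z - ε a`, with `a`
interior to `A`, lies in the tangent set before closing; adding `ε a` back lands in the interior. -/
theorem exists_add_smul_mem_interior {w z : E} (hz : z ∈ interior (tangentSolidCone A w)) :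
    ∃ s : ℝ, 0 ≤ s ∧ z + s • w ∈ interior A := by
  set S := {v | ∃ s : ℝ, 0 ≤ s ∧ v + s • w ∈ A} with hS
  have hAS : A ⊆ S := fun v hv => ⟨0, le_rfl, by simpa using hv⟩
  have hzS : z ∈ interior S := by
    rwa [tangentSolidCone,
      (hA.convex_preTangent w).interior_closure_eq_interior_of_nonempty_interior
      (hA.nonempty_interior.mono (interior_mono hAS))] at hz
  obtain ⟨a, ha⟩ := hA.nonempty_interior
  have hcont : Filter.Tendsto (fun ε : ℝ => z - ε • a) (𝓝[>] 0) (𝓝 z) := by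
    refine (Continuous.tendsto' (by fun_prop) _ _ (by simp)).mono_left nhdsWithin_le_nhds
  obtain ⟨ε, hε, hε0⟩ := ((hcont.eventually (mem_interior_iff_mem_nhds.1 hzS)).and
    self_mem_nhdsWithin).exists
  obtain ⟨s, hs, h1⟩ := hε
  refine ⟨s, hs, ?_⟩
  convert hA.add_mem_interior h1 (hA.smul_mem_interior hε0 ha) using 1
  module

theorem add_smul_mem_interior_of_le {w z : E} (hw : w ∈ A) {s t : ℝ}
    (h : z + s • w ∈ interior A) (hst : s ≤ t) : z + t • w ∈ interior A := by
  convert hA.add_mem_interior (hA.smul_mem (sub_nonneg.2 hst) hw) h using 1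
  module

theorem tangentSolidCone_mono {w w' : E} (h : w ∈ hA.faceSpan w') :
    tangentSolidCone A w ⊆ tangentSolidCone A w' := by
  refine closure_mono ?_
  rintro v ⟨s, hs, h1⟩
  obtain ⟨t, ht, -, h4⟩ := h
  refine ⟨s * t, by positivity, ?_⟩
  convert hA.add_mem h1 (hA.smul_mem hs h4) using 1
  module

theorem faceSpan_subset_tangentSolidCone (w : E) :
    (hA.faceSpan w : Set E) ⊆ tangentSolidCone A w := by
  rintro v ⟨s, hs, h1, -⟩
  exact subset_closure ⟨s, hs, by rwa [add_comm]⟩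

/-- The criterion mentions only boundary points near `w`, so the tangent boundary is determined by
the germ of the boundary. The tangent cone itself is not: the germ does not tell on which side the
cone lies, as opposite half-spaces show. -/
theorem mem_frontier_tangentSolidCone_iff {w z : E} (hw : w ∈ A) :
    z ∈ frontier (tangentSolidCone A w) ↔
      ∀ κ : ℝ, 0 < κ → ∃ s₀ : ℝ, 0 < s₀ ∧ ∀ s : ℝ, 0 < s → s < s₀ →
        ∃ b ∈ frontier A, ‖b - (w + s • z)‖ < s * κ := by
  have hT := hA.tangentSolidCone_isSolidCone w
  constructor
  · intro hz κ hκ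
    -- For small `s`, `w + s (z + ζ)` belongs to `A` and `w + s (z - ζ)` does not, so the boundary
    -- is crossed within `s ‖ζ‖` of `w + s z`.
    obtain ⟨ζ, hζ, hζκ⟩ : ∃ ζ ∈ interior A, ‖ζ‖ < κ := by
      obtain ⟨a, ha⟩ := hA.nonempty_interior
      refine ⟨(κ / (2 * (‖a‖ + 1))) • a, hA.smul_mem_interior (by positivity) ha, ?_⟩
      rw [norm_smul, Real.norm_of_nonneg (by positivity), div_mul_eq_mul_div,
        div_lt_iff₀ (by positivity)]
      nlinarith [norm_nonneg a]
    have hζT := interior_mono (subset_tangentSolidCone A w) hζ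
    obtain ⟨s₁, hs₁, h1⟩ := hA.exists_add_smul_mem_interior
      (hT.add_mem_interior (hT.mem_of_frontier hz) hζT)
    have h2 : z - ζ ∉ tangentSolidCone A w := hT.frontier_sub_notMem hz hζT
    refine ⟨1 / (s₁ + 1), by positivity, fun s hs hss => ?_⟩
    have h3 : s * (s₁ + 1) < 1 := (lt_div_iff₀ (by positivity)).1 hss
    have h4 : w + s • (z + ζ) ∈ A := by
      have h5 : s₁ ≤ s⁻¹ := by
        rw [← one_div, le_div_iff₀ hs]; nlinarith
      have := hA.smul_mem hs.le (interior_subset (hA.add_smul_mem_interior_of_le hw h1 h5))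
      convert this using 1
      rw [smul_add s (z + ζ), smul_smul, mul_inv_cancel₀ hs.ne', one_smul, add_comm]
    have h5 : w + s • (z - ζ) ∉ A := by
      intro h
      refine h2 (subset_closure ⟨s⁻¹, by positivity, ?_⟩)
      convert hA.smul_mem (inv_nonneg.2 hs.le) h using 1
      rw [smul_add, smul_smul, inv_mul_cancel₀ hs.ne', one_smul, add_comm]
    obtain ⟨τ, hτ, hb⟩ := exists_mem_frontier_of_mem_of_notMem h4 h5
    refine ⟨_, hb, ?_⟩
    have h6 : w + s • (z + ζ) + τ • (w + s • (z - ζ) - (w + s • (z + ζ))) - (w + s • z) =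
        (s * (1 - 2 * τ)) • ζ := by module
    rw [h6, norm_smul, norm_mul, Real.norm_of_nonneg hs.le, mul_assoc]
    refine mul_lt_mul_of_pos_left ?_ hs
    have h7 : ‖1 - 2 * τ‖ ≤ 1 := by
      rw [Real.norm_eq_abs, abs_le]; constructor <;> linarith [hτ.1, hτ.2]
    nlinarith [norm_nonneg ζ]
  · intro h
    by_contra hz
    rw [hT.mem_frontier, not_and_not_right] at hz
    by_cases hzT : z ∈ tangentSolidCone A w
    · obtain ⟨s₁, hs₁, h1⟩ := hA.exists_add_smul_mem_interior (hz hzT)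
      obtain ⟨κ, hκ, hball⟩ := Metric.isOpen_iff.1 isOpen_interior _ h1
      obtain ⟨s₀, hs₀, hs⟩ := h κ hκ
      obtain ⟨s, hs1, hs2⟩ : ∃ s : ℝ, 0 < s ∧ s < min s₀ (1 / (s₁ + 1)) :=
        exists_between (by positivity)
      obtain ⟨b, hb, hbd⟩ := hs s hs1 (hs2.trans_le (min_le_left _ _))
      have h3 : s * (s₁ + 1) < 1 :=
        (lt_div_iff₀ (by positivity)).1 (hs2.trans_le (min_le_right _ _))
      have h5 : s₁ ≤ s⁻¹ := by
        rw [← one_div, le_div_iff₀ hs1]; nlinarith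
      have h6 : s⁻¹ • (b - w) + s₁ • w ∈ interior A := by
        refine hball ?_
        rw [Metric.mem_ball, dist_eq_norm]
        have : s⁻¹ • (b - w) + s₁ • w - (z + s₁ • w) = s⁻¹ • (b - (w + s • z)) := by
          rw [← sub_sub b, smul_sub s⁻¹ (b - w), smul_smul, inv_mul_cancel₀ hs1.ne', one_smul]
          abel
        rw [this, norm_smul, norm_inv, Real.norm_of_nonneg hs1.le, inv_mul_lt_iff₀ hs1]
        exact hbd
      have h7 := hA.smul_mem_interior hs1 (hA.add_smul_mem_interior_of_le hw h6 h5)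
      refine (hA.mem_frontier.1 hb).2 ?_
      convert h7 using 1
      rw [smul_add, smul_smul, smul_smul, mul_inv_cancel₀ hs1.ne', one_smul, one_smul]
      abel
    · obtain ⟨κ, hκ, hball⟩ := Metric.isOpen_iff.1 hT.closed.isOpen_compl _ hzT
      obtain ⟨s₀, hs₀, hs⟩ := h κ hκ
      obtain ⟨s, hs1, hs2⟩ := exists_between hs₀
      obtain ⟨b, hb, hbd⟩ := hs s hs1 hs2
      have h6 : s⁻¹ • (b - w) ∈ Metric.ball z κ := by
        rw [Metric.mem_ball, dist_eq_norm]
        have : s⁻¹ • (b - w) - z = s⁻¹ • (b - (w + s • z)) := by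
          rw [← sub_sub b, smul_sub s⁻¹ (b - w), smul_smul, inv_mul_cancel₀ hs1.ne', one_smul]
        rw [this, norm_smul, norm_inv, Real.norm_of_nonneg hs1.le, inv_mul_lt_iff₀ hs1]
        exact hbd
      refine hball h6 (subset_closure ⟨s⁻¹, by positivity, ?_⟩)
      convert hA.smul_mem (inv_nonneg.2 hs1.le) (hA.mem_of_frontier hb) using 1
      module

/-- The tangent boundary only depends on the germ of the boundary. -/
theorem frontier_tangentSolidCone_congr (hB : IsSolidCone B) {w : E} (hwA : w ∈ A) (hwB : w ∈ B) {δ : ℝ}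
    (hδ : 0 < δ) (h : ∀ b, ‖b - w‖ < δ → b ∈ frontier A → b ∈ frontier B) :
    frontier (tangentSolidCone A w) ⊆ frontier (tangentSolidCone B w) := by
  intro z hz
  rw [hB.mem_frontier_tangentSolidCone_iff hwB]
  rw [hA.mem_frontier_tangentSolidCone_iff hwA] at hz
  intro κ hκ
  obtain ⟨s₀, hs₀, hs⟩ := hz κ hκ
  refine ⟨min s₀ (δ / (κ + ‖z‖)), by positivity, fun s hs1 hs2 => ?_⟩
  obtain ⟨b, hb, hbd⟩ := hs s hs1 (hs2.trans_le (min_le_left _ _))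
  refine ⟨b, h b ?_ hb, hbd⟩
  have h1 : s * (κ + ‖z‖) < δ :=
    (lt_div_iff₀ (by positivity)).1 (hs2.trans_le (min_le_right _ _))
  have h2 : b - w = b - (w + s • z) + s • z := by abel
  rw [h2]
  refine (norm_add_le _ _).trans_lt ?_
  rw [norm_smul, Real.norm_of_nonneg hs1.le]
  linarith

/-- If `y` were interior, then `s w = (s w - y) + y` would be interior, and with it `w`. -/
theorem mem_frontier_of_mem_faceSpan {w y : E} (hw : w ∈ frontier A) (hy : y ∈ A)
    (hwy : y ∈ hA.faceSpan w) : y ∈ frontier A := by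
  rw [hA.mem_frontier] at hw ⊢
  refine ⟨hy, fun hyi => hw.2 ?_⟩
  obtain ⟨s, hs, -, h2⟩ := hwy
  have h3 := hA.add_mem_interior h2 hyi
  rw [sub_add_cancel] at h3
  rcases hs.eq_or_lt with rfl | hs
  · rw [zero_smul] at h3
    simpa using hA.add_mem_interior hw.1 h3
  · exact (hA.smul_mem_interior_iff hs).1 h3

/-- The face span only depends on the germ of the boundary. -/
theorem faceSpan_le_of_frontier (hB : IsSolidCone B) {w : E} (hwA : w ∈ frontier A) {δ : ℝ}
    (hδ : 0 < δ) (h : ∀ b, ‖b - w‖ < δ → b ∈ frontier A → b ∈ frontier B) :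
    hA.faceSpan w ≤ hB.faceSpan w := by
  intro v hv
  have hwA' := hA.mem_of_frontier hwA
  obtain ⟨ε, hε, h1⟩ := hA.exists_add_smul_mem hwA' hv
  obtain ⟨t, ht, ht2⟩ : ∃ t : ℝ, 0 < t ∧ t < min ε (δ / (‖v‖ + 1)) :=
    exists_between (by positivity)
  have ht3 : t * (‖v‖ + 1) < δ :=
    (lt_div_iff₀ (by positivity)).1 (ht2.trans_le (min_le_right _ _))
  have key : ∀ c : ℝ, |c| = t → w + c • v ∈ B := by
    intro c hc
    refine hB.mem_of_frontier (h _ ?_ (hA.mem_frontier_of_mem_faceSpan hwA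
      (h1 c (hc ▸ ht2.le.trans (min_le_left _ _))) ?_))
    · rw [add_sub_cancel_left, norm_smul, Real.norm_eq_abs, hc]
      nlinarith
    · exact (hA.faceSpan w).add_mem (hA.self_mem_faceSpan hwA') (Submodule.smul_mem _ _ hv)
  have h2 := hB.smul_mem (inv_nonneg.2 ht.le) (key t (abs_of_pos ht))
  have h3 := hB.smul_mem (inv_nonneg.2 ht.le) (key (-t) (by rw [abs_neg, abs_of_pos ht]))
  refine ⟨t⁻¹, by positivity, ?_, ?_⟩
  · convert h2 using 1
    rw [smul_add, smul_smul, inv_mul_cancel₀ ht.ne', one_smul]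
  · convert h3 using 1
    rw [smul_add, smul_smul, mul_neg, inv_mul_cancel₀ ht.ne', neg_one_smul, sub_eq_add_neg]

/-- Two solid cones with the same boundary whose interiors meet are equal. -/
theorem eq_of_frontier_eq (hB : IsSolidCone B) (h : frontier A = frontier B) {z : E}
    (hz : z ∈ interior A) (hzB : z ∈ B) : A = B := by
  have hzBi : z ∈ interior B := by
    by_contra hc
    have : z ∈ frontier A := h ▸ hB.mem_frontier.2 ⟨hzB, hc⟩
    exact (hA.mem_frontier.1 this).2 hz
  -- Segments between interior points of `A` avoid the common boundary, hence cannot leave `B`.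
  have aux : ∀ {A B : Set E} (_ : IsSolidCone A) (_ : IsSolidCone B), frontier A = frontier B →
      z ∈ interior A → z ∈ interior B → A ⊆ B := by
    intro A B hA hB h hzA hzB
    have h1 : interior A ⊆ B := by
      intro y hy
      by_contra hyB
      obtain ⟨s, hs, hf⟩ := exists_mem_frontier_of_mem_of_notMem (interior_subset hzB) hyB
      rw [← h, hA.mem_frontier] at hf
      refine hf.2 ?_
      have := hA.convex.interior hzA hy (sub_nonneg.2 hs.2) hs.1 (by ring)
      convert this using 1
      module
    exact hA.subset_closure_interior.trans (hB.closed.closure_subset_iff.2 h1)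
  exact (aux hA hB h hz hzBi).antisymm (aux hB hA h.symm hzBi hz)

end IsSolidCone

end SolidCone

/-! ### Lifting curves through a locally injective map on a compact space. -/

section Lifting

variable {E : Type*} [NormedAddCommGroup E]
variable {M : Type*} [TopologicalSpace M] [T2Space M] [CompactSpace M] {r : M → E}

/-- A connected family of points whose images stay close to `r q₀` cannot leave a small
neighbourhood of `q₀`. -/
theorem exists_nhds_of_locallyInjective (hr : Continuous r) (hli : IsLocallyInjective r) {q₀ : M}
    {W : Set M} (hW : W ∈ 𝓝 q₀) :
    ∃ U ∈ 𝓝 q₀, U ⊆ W ∧ IsCompact U ∧ Set.InjOn r U ∧ ∃ η : ℝ, 0 < η ∧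
      ∀ {Z : Type} [TopologicalSpace Z] {S : Set Z} {h : Z → M}, IsPreconnected S →
        ContinuousOn h S → (∀ z ∈ S, ‖r (h z) - r q₀‖ < η) → ∀ z₀ ∈ S, h z₀ ∈ U →
        ∀ z ∈ S, h z ∈ U := by
  obtain ⟨U₁, hU₁o, hqU₁, hinj₁⟩ := hli q₀
  obtain ⟨U, hU, hUW, hUc⟩ := local_compact_nhds (Filter.inter_mem hW (hU₁o.mem_nhds hqU₁))
  have hinj : Set.InjOn r U := hinj₁.mono fun q hq => (hUW hq).2
  refine ⟨U, hU, fun q hq => (hUW hq).1, hUc, hinj, ?_⟩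
  have hfc : IsClosed (r '' frontier U) := ((hUc.of_isClosed_subset isClosed_frontier
    hUc.isClosed.frontier_subset).image hr).isClosed
  have hnot : r q₀ ∉ r '' frontier U := by
    rintro ⟨q, hq, hqr⟩
    have : q = q₀ := hinj (hUc.isClosed.frontier_subset hq) (mem_of_mem_nhds hU) hqr
    rw [this] at hq
    exact hq.2 (mem_interior_iff_mem_nhds.2 hU)
  -- `η` separates `r q₀` from the image of the boundary of `U`; a connected family whose image
  -- stays within `η` never meets that boundary.
  obtain ⟨η, hη, hball⟩ := Metric.isOpen_iff.1 hfc.isOpen_compl _ hnot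
  refine ⟨η, hη, fun {Z _ S h} hS hh hclose z₀ hz₀ hz₀U => ?_⟩
  have hnf : ∀ z ∈ S, h z ∉ frontier U := fun z hz hf =>
    hball (by rw [Metric.mem_ball, dist_eq_norm]; exact hclose z hz) ⟨h z, hf, rfl⟩
  have hsub := (hS.image h hh).subset_left_of_subset_union (u := interior U) (v := Uᶜ)
    isOpen_interior hUc.isClosed.isOpen_compl
    (disjoint_compl_right.mono_left interior_subset) (by
      rintro _ ⟨z, hz, rfl⟩
      by_contra hcon
      rw [Set.mem_union, not_or, Set.mem_compl_iff, not_not] at hcon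
      exact hnf z hz ⟨subset_closure hcon.2, hcon.1⟩) (by
      refine ⟨h z₀, ⟨z₀, hz₀, rfl⟩, ?_⟩
      by_contra hcon
      exact hnf z₀ hz₀ ⟨subset_closure hz₀U, hcon⟩)
  exact fun z hz => interior_subset (hsub ⟨z, hz, rfl⟩)

/-- Compactness gives a cluster point `q₀`. Near time `T` the image stays near `r q₀`, so a curve
that has entered a small neighbourhood of `q₀` is trapped there: the cluster point is a limit. -/
theorem exists_tendsto_of_lift (hr : Continuous r) (hli : IsLocallyInjective r) {g : ℝ → M}
    {a T : ℝ} (haT : a < T) (hg : ContinuousOn g (Set.Ico a T)) {w : E}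
    (hw : Filter.Tendsto (fun s => r (g s)) (𝓝[<] T) (𝓝 w)) :
    ∃ q₀, r q₀ = w ∧ Filter.Tendsto g (𝓝[<] T) (𝓝 q₀) := by
  obtain ⟨q₀, hq₀⟩ := exists_clusterPt_of_compactSpace (Filter.map g (𝓝[<] T))
  have hcl : MapClusterPt q₀ (𝓝[<] T) g := hq₀
  have hrq : r q₀ = w := by
    have h1 : MapClusterPt (r q₀) (𝓝[<] T) (fun s => r (g s)) :=
      hcl.tendsto_comp hr.continuousAt
    by_contra hne
    have h2 : ClusterPt (r q₀) (𝓝 w) := ClusterPt.mono h1 hw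
    exact hne (eq_of_nhds_neBot h2)
  refine ⟨q₀, hrq, fun W hW => Filter.mem_map.2 ?_⟩
  obtain ⟨U, hU, hUW, -, -, η, hη, hstay⟩ := exists_nhds_of_locallyInjective hr hli hW
  have h1 : ∀ᶠ s in 𝓝[<] T, ‖r (g s) - r q₀‖ < η := by
    rw [hrq]
    filter_upwards [hw (Metric.ball_mem_nhds w hη)] with s hs
    rwa [Set.mem_preimage, Metric.mem_ball, dist_eq_norm] at hs
  obtain ⟨b, hbT, hb⟩ := (mem_nhdsLT_iff_exists_Ioo_subset' haT).1
    (Filter.inter_mem h1 (Ioo_mem_nhdsLT haT))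
  obtain ⟨s₀, hs₀U, hs₀⟩ := ((mapClusterPt_iff_frequently.1 hcl U hU).and_eventually
    (Ioo_mem_nhdsLT hbT)).exists
  have h2 := hstay (S := Set.Ioo b T) isPreconnected_Ioo
    (hg.mono fun s hs => ⟨(hb hs).2.1.le, hs.2⟩) (fun s hs => (hb hs).1) s₀ hs₀ hs₀U
  refine Filter.mem_of_superset (Ioo_mem_nhdsLT hbT) fun s hs => hUW (h2 s hs)

-- On the compact set `U` the injective map `r` is a closed embedding, so continuity can be tested
-- after composing with `r`. This lets lifts be chosen pointwise.
omit [T2Space M] [CompactSpace M] in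
theorem continuousOn_of_comp {U : Set M} (hUc : IsCompact U) (hr : Continuous r)
    (hinj : Set.InjOn r U) {Z : Type*} [TopologicalSpace Z] {S : Set Z} {h : Z → M}
    (hU : ∀ z ∈ S, h z ∈ U) (hc : ContinuousOn (fun z => r (h z)) S) : ContinuousOn h S := by
  have : CompactSpace U := isCompact_iff_compactSpace.1 hUc
  have hemb : Topology.IsClosedEmbedding (U.domRestrict r) :=
    (hr.continuousOn.domRestrict).isClosedEmbedding (Set.injOn_iff_injective.1 hinj)
  rw [continuousOn_iff_continuous_domRestrict] at hc ⊢
  have h1 : Continuous fun z : S => (⟨h z, hU z z.2⟩ : U) := hemb.continuous_iff.2 hc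
  exact continuous_subtype_val.comp h1

/-- Points of `G` over `c t` can be found near `p`, for all `t` near `t₀`. -/
def LiftsNear (r : M → E) (G : Set M) (c : ℝ → E) (p : M) (t₀ : ℝ) : Prop :=
  ∀ W ∈ 𝓝 p, ∃ δ : ℝ, 0 < δ ∧ ∀ t, |t - t₀| < δ → ∃ q ∈ W, q ∈ G ∧ r q = c t

/-- A partial lift over `[0, T]` of the curve `c` to `G`, starting at `p`. -/
def HasLift (r : M → E) (G : Set M) (c : ℝ → E) (p : M) (T : ℝ) : Prop :=
  ∃ g : ℝ → M, ContinuousOn g (Set.Icc 0 T) ∧ g 0 = p ∧ ∀ s ∈ Set.Icc 0 T, g s ∈ G ∧ r (g s) = c s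

omit [NormedAddCommGroup E] [T2Space M] [CompactSpace M] in
theorem HasLift.mono {G : Set M} {c : ℝ → E} {p : M} {T T' : ℝ} (h : HasLift r G c p T)
    (hT : T' ≤ T) : HasLift r G c p T' := by
  obtain ⟨g, hg, hg0, hgc⟩ := h
  have hsub : Set.Icc 0 T' ⊆ Set.Icc 0 T := Set.Icc_subset_Icc_right hT
  exact ⟨g, hg.mono hsub, hg0, fun s hs => hgc s (hsub hs)⟩

theorem exists_local_lift (hr : Continuous r) (hli : IsLocallyInjective r) {G : Set M} {c : ℝ → E}
    (hc : Continuous c) {p : M} {t₀ : ℝ} (hpc : r p = c t₀)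
    (h : LiftsNear r G c p t₀) :
    ∃ δ : ℝ, 0 < δ ∧ ∃ g : ℝ → M, ContinuousOn g (Set.Ioo (t₀ - δ) (t₀ + δ)) ∧ g t₀ = p ∧
      ∀ t ∈ Set.Ioo (t₀ - δ) (t₀ + δ), g t ∈ G ∧ r (g t) = c t := by
  obtain ⟨U, hU, -, hUc, hinj, -⟩ := exists_nhds_of_locallyInjective hr hli
    (Filter.univ_mem : Set.univ ∈ 𝓝 p)
  obtain ⟨δ, hδ, hq⟩ := h U hU
  have : Nonempty M := ⟨p⟩
  choose! g hgU hgG hgc using hq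
  have hmem : ∀ t ∈ Set.Ioo (t₀ - δ) (t₀ + δ), |t - t₀| < δ := fun t ht => by
    rw [abs_lt]; constructor <;> linarith [ht.1, ht.2]
  have ht₀ : |t₀ - t₀| < δ := by simpa using hδ
  refine ⟨δ, hδ, g, ?_, ?_, fun t ht => ⟨hgG t (hmem t ht), hgc t (hmem t ht)⟩⟩
  · refine continuousOn_of_comp hUc hr hinj (fun t ht => hgU t (hmem t ht)) ?_
    exact hc.continuousOn.congr fun t ht => hgc t (hmem t ht)
  · exact hinj (hgU t₀ ht₀) (mem_of_mem_nhds hU) ((hgc t₀ ht₀).trans hpc.symm)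

theorem HasLift.extend (hr : Continuous r) (hli : IsLocallyInjective r) {G : Set M} {c : ℝ → E}
    (hc : Continuous c) {p : M} {T : ℝ} (hT : 0 ≤ T) (h : HasLift r G c p T)
    (hloc : ∀ q ∈ G, r q = c T → LiftsNear r G c q T) : ∃ T' > T, HasLift r G c p T' := by
  obtain ⟨g, hg, hg0, hgc⟩ := h
  have hTT : T ∈ Set.Icc 0 T := ⟨hT, le_rfl⟩
  obtain ⟨δ, hδ, g', hg', hg'T, hg'c⟩ := exists_local_lift hr hli hc (hgc T hTT).2
    (hloc _ (hgc T hTT).1 (hgc T hTT).2)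
  refine ⟨T + δ / 2, by linarith, fun s => if s ≤ T then g s else g' s, ?_, by simp [hT, hg0],
    fun s hs => ?_⟩
  · refine ContinuousOn.if ?_ (hg.mono ?_) (hg'.mono ?_)
    · rintro s ⟨-, hs⟩
      have : s = T := by
        have := frontier_Iic_subset T hs
        simpa using this
      rw [this, hg'T]
    · rintro s ⟨hs, hs'⟩
      have h1 : closure {a | a ≤ T} ⊆ Set.Iic T := closure_minimal (fun a ha => ha) isClosed_Iic
      exact ⟨hs.1, h1 hs'⟩
    · rintro s ⟨hs, hs'⟩
      have h1 : T ≤ s := by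
        have h2 : closure {a | ¬a ≤ T} ⊆ Set.Ici T :=
          closure_minimal (fun a ha => (not_le.1 ha).le) isClosed_Ici
        exact h2 hs'
      constructor <;> linarith [hs.2]
  · by_cases h : s ≤ T
    · simp only [h, if_true]; exact hgc s ⟨hs.1, h⟩
    · simp only [h, if_false]
      exact hg'c s ⟨by linarith, by linarith [hs.2]⟩

/-- If partial lifts exist over all `[0, s]` with `s < T`, then they converge as `s → T`. -/
theorem exists_lift_Ico (hr : Continuous r) (hli : IsLocallyInjective r) {G : Set M} {c : ℝ → E}
    (hc : Continuous c) {p : M} {T : ℝ} (hT : 0 < T) (h : ∀ s < T, HasLift r G c p s) :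
    ∃ g : ℝ → M, ∃ q₀, ContinuousOn g (Set.Icc 0 T) ∧ g 0 = p ∧ g T = q₀ ∧ r q₀ = c T ∧
      ∀ s ∈ Set.Ico 0 T, g s ∈ G ∧ r (g s) = c s := by
  have : Nonempty M := ⟨p⟩
  choose! g hg hg0 hgc using h
  -- Lifts with the same starting point agree where both are defined, so the diagonal `g t t` glues
  -- them to one continuous lift on `[0, T)`.
  have huniq : ∀ s < T, ∀ t, 0 ≤ t → t ≤ s → g s t = g t t := by
    intro s hs t ht0 hts
    have := (T2Space.isSeparatedMap r).eqOn_of_comp_eqOn hli (s := Set.Icc 0 t) isPreconnected_Icc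
      ((hg s hs).mono (Set.Icc_subset_Icc_right hts)) (hg t (hts.trans_lt hs)) (fun u hu => by
        simp only [Function.comp]
        rw [(hgc s hs u ⟨hu.1, hu.2.trans hts⟩).2, (hgc t (hts.trans_lt hs) u hu).2])
      (a := 0) ⟨le_rfl, ht0⟩ (by rw [hg0 s hs, hg0 t (hts.trans_lt hs)])
    exact this ⟨ht0, le_rfl⟩
  let G₁ : ℝ → M := fun t => g t t
  have hG₁c : ∀ s ∈ Set.Ico 0 T, G₁ s ∈ G ∧ r (G₁ s) = c s := fun s hs =>
    hgc s hs.2 s ⟨hs.1, le_rfl⟩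
  have hG₁ : ContinuousOn G₁ (Set.Ico 0 T) := by
    intro t ht
    obtain ⟨s, hts, hsT⟩ := exists_between ht.2
    have h1 : ContinuousWithinAt (g s) (Set.Icc 0 s) t := hg s hsT t ⟨ht.1, hts.le⟩
    have h2 : ContinuousWithinAt (g s) (Set.Ico 0 T) t := by
      refine h1.mono_of_mem_nhdsWithin ?_
      refine mem_nhdsWithin.2 ⟨Set.Iio s, isOpen_Iio, hts, fun u hu => ⟨hu.2.1, hu.1.le⟩⟩
    refine h2.congr_of_eventuallyEq ?_ (huniq s hsT t ht.1 hts.le).symm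
    refine mem_nhdsWithin.2 ⟨Set.Iio s, isOpen_Iio, hts, fun u hu => ?_⟩
    exact (huniq s hsT u hu.2.1 (le_of_lt hu.1)).symm
  have hlim : Filter.Tendsto (fun s => r (G₁ s)) (𝓝[<] T) (𝓝 (c T)) := by
    refine ((hc.tendsto T).mono_left nhdsWithin_le_nhds).congr' ?_
    filter_upwards [Ico_mem_nhdsLT hT] with s hs
    exact (hG₁c s hs).2.symm
  obtain ⟨q₀, hq₀, htend⟩ := exists_tendsto_of_lift hr hli hT hG₁ hlim
  classical
  refine ⟨Function.update G₁ T q₀, q₀, ?_, ?_, by simp, hq₀, fun s hs => ?_⟩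
  · rw [continuousOn_update_iff]
    refine ⟨hG₁.mono ?_, fun _ => htend.mono_left (nhdsWithin_mono _ ?_)⟩
    · rintro s ⟨hs, hsT⟩
      exact ⟨hs.1, lt_of_le_of_ne hs.2 hsT⟩
    · rintro s ⟨hs, hsT⟩
      exact lt_of_le_of_ne hs.2 hsT
  · rw [Function.update_of_ne hT.ne]
    exact hg0 0 hT
  · rw [Function.update_of_ne hs.2.ne]
    exact hG₁c s hs

/-- Continuity method: the set of times up to which a lift exists is closed, because lifts converge
and `G` is closed, and can be extended to the right by local lifts. -/
theorem HasLift.of_isClosed (hr : Continuous r) (hli : IsLocallyInjective r) {G : Set M}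
    (hG : IsClosed G) {c : ℝ → E} (hc : Continuous c) {p : M} (hp : p ∈ G) (hpc : r p = c 0)
    (hloc : ∀ q ∈ G, ∀ t, r q = c t → LiftsNear r G c q t) (T : ℝ) : HasLift r G c p T := by
  rcases lt_or_ge T 0 with hT | hT
  · exact ⟨fun _ => p, continuousOn_const, rfl, fun s hs => absurd (hs.1.trans hs.2) (not_le.2 hT)⟩
  have h0 : HasLift r G c p 0 := ⟨fun _ => p, continuousOn_const, rfl, fun s hs => by
    rw [le_antisymm hs.2 hs.1]; exact ⟨hp, hpc⟩⟩
  have hmain : Set.Icc 0 T ⊆ {t | HasLift r G c p t} := by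
    refine IsClosed.Icc_subset_of_forall_exists_gt ?_ h0 ?_
    · refine isClosed_of_closure_subset fun t ht => ?_
      have htI : t ∈ Set.Icc 0 T :=
        (isClosed_Icc.closure_subset_iff.2 Set.inter_subset_right) ht
      refine ⟨?_, htI⟩
      rcases htI.1.eq_or_lt with h | h
      · rw [← h]; exact h0
      by_cases hlt : ∃ s ∈ {t | HasLift r G c p t}, t ≤ s
      · obtain ⟨s, hs, hts⟩ := hlt
        exact HasLift.mono hs hts
      push Not at hlt
      have hall : ∀ s < t, HasLift r G c p s := by
        intro s hs
        obtain ⟨u, hu, hu2⟩ := mem_closure_iff.1 ht (Set.Ioi s) isOpen_Ioi hs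
        exact HasLift.mono hu2.1 (le_of_lt hu)
      obtain ⟨g, q₀, hg, hg0, hgT, hq₀, hgc⟩ := exists_lift_Ico hr hli hc h hall
      refine ⟨g, hg, hg0, fun s hs => ?_⟩
      rcases hs.2.lt_or_eq with hst | rfl
      · exact hgc s ⟨hs.1, hst⟩
      · refine ⟨?_, by rw [hgT, hq₀]⟩
        have hcw : Filter.Tendsto g (𝓝[<] s) (𝓝 (g s)) := by
          refine (hg s ⟨h.le, le_rfl⟩).mono_left (nhdsWithin_le_iff.2 ?_)
          filter_upwards [Ico_mem_nhdsLT h] with u hu using ⟨hu.1, hu.2.le⟩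
        refine hG.mem_of_tendsto hcw ?_
        filter_upwards [Ico_mem_nhdsLT h] with u hu using (hgc u hu).1
    · rintro t ⟨ht, ht0, htT⟩ y hy
      obtain ⟨T', hT', hl⟩ := HasLift.extend hr hli hc ht0 ht fun q hq hqc => hloc q hq t hqc
      exact ⟨min T' y, hl.mono (min_le_left _ _), lt_min hT' hy, min_le_right _ _⟩
  exact hmain ⟨hT, le_rfl⟩

/-- Curves lift to a closed set `G` along which local lifts exist. -/
theorem exists_lift_of_isClosed (hr : Continuous r) (hli : IsLocallyInjective r) {G : Set M}
    (hG : IsClosed G) {c : ℝ → E} (hc : Continuous c) {p : M} (hp : p ∈ G) (hpc : r p = c 0)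
    (hloc : ∀ q ∈ G, ∀ t, r q = c t → LiftsNear r G c q t) :
    ∃ γ : ℝ → M, Continuous γ ∧ γ 0 = p ∧ ∀ t, γ t ∈ G ∧ r (γ t) = c t := by
  have half : ∀ c : ℝ → E, Continuous c → r p = c 0 →
      (∀ q ∈ G, ∀ t, r q = c t → LiftsNear r G c q t) →
      ∃ γ : ℝ → M, ContinuousOn γ (Set.Ici 0) ∧ γ 0 = p ∧ ∀ t, 0 ≤ t → γ t ∈ G ∧ r (γ t) = c t := by
    intro c hc hpc hloc
    choose g hg hg0 hgc using fun T => HasLift.of_isClosed hr hli hG hc hp hpc hloc T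
    have huniq : ∀ s t, 0 ≤ t → t ≤ s → g s t = g t t := by
      intro s t ht0 hts
      have := (T2Space.isSeparatedMap r).eqOn_of_comp_eqOn hli (s := Set.Icc 0 t)
        isPreconnected_Icc ((hg s).mono (Set.Icc_subset_Icc_right hts)) (hg t) (fun u hu => by
          simp only [Function.comp]
          rw [(hgc s u ⟨hu.1, hu.2.trans hts⟩).2, (hgc t u hu).2])
        (a := 0) ⟨le_rfl, ht0⟩ (by rw [hg0 s, hg0 t])
      exact this ⟨ht0, le_rfl⟩
    refine ⟨fun t => g t t, fun t ht => ?_, hg0 0, fun t ht => hgc t t ⟨ht, le_rfl⟩⟩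
    have hlt : t < t + 1 := by linarith
    have h2 : ContinuousWithinAt (g (t + 1)) (Set.Ici 0) t := by
      refine (hg (t + 1) t ⟨ht, hlt.le⟩).mono_of_mem_nhdsWithin ?_
      exact mem_nhdsWithin.2 ⟨Set.Iio (t + 1), isOpen_Iio, hlt, fun u hu => ⟨hu.2, hu.1.le⟩⟩
    refine h2.congr_of_eventuallyEq ?_ (huniq (t + 1) t ht hlt.le).symm
    refine mem_nhdsWithin.2 ⟨Set.Iio (t + 1), isOpen_Iio, hlt, fun u hu => ?_⟩
    exact (huniq (t + 1) u hu.2 (le_of_lt hu.1)).symm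
  obtain ⟨γ₁, h1, h10, h1c⟩ := half c hc hpc hloc
  obtain ⟨γ₂, h2, h20, h2c⟩ := half (fun t => c (-t)) (by fun_prop) (by simpa using hpc)
    (fun q hq t hqt W hW => by
      obtain ⟨δ, hδ, h⟩ := hloc q hq (-t) hqt W hW
      refine ⟨δ, hδ, fun u hu => h (-u) ?_⟩
      rwa [← neg_sub', abs_neg])
  refine ⟨fun t => if 0 ≤ t then γ₁ t else γ₂ (-t), ?_, by simp [h10], fun t => ?_⟩
  · refine continuous_if_le continuous_const continuous_id ?_ ?_ ?_
    · exact h1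
    · exact h2.comp (by fun_prop) fun t ht => by simpa using ht
    · rintro t rfl
      simp [h10, h20]
  · by_cases h : 0 ≤ t
    · simp only [h, if_true]; exact h1c t h
    · simp only [h, if_false]
      have := h2c (-t) (by linarith)
      rwa [neg_neg] at this

end Lifting

/-! ### Cone charts, and leaves over great circles. -/

section ConeChart

variable {E : Type*} [NormedAddCommGroup E] [InnerProductSpace ℝ E]
variable {M : Type*} [TopologicalSpace M] {r : M → E} {A B : Set E} {p : M}

/-- Near `p`, the map `r` is an injection into the boundary of the solid cone `A`. -/
structure IsConeChart (r : M → E) (A : Set E) (p : M) : Prop where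
  cone : IsSolidCone A
  exists_nhds : ∃ U ∈ 𝓝 p, Set.InjOn r U ∧ Set.MapsTo r U (frontier A)

theorem IsConeChart.mem_frontier (h : IsConeChart r A p) : r p ∈ frontier A := by
  obtain ⟨U, hU, -, hm⟩ := h.exists_nhds
  exact hm (mem_of_mem_nhds hU)

theorem IsConeChart.mem (h : IsConeChart r A p) : r p ∈ A := h.cone.mem_of_frontier h.mem_frontier

theorem IsConeChart.eventually (h : IsConeChart r A p) : ∀ᶠ q in 𝓝 p, IsConeChart r A q := by
  obtain ⟨U, hU, hi, hm⟩ := h.exists_nhds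
  filter_upwards [eventually_mem_nhds_iff.2 hU] with q hq using ⟨h.cone, U, hq, hi, hm⟩

/-- A map into the unit sphere which locally is a homeomorphism onto an open part of the boundary
of a solid cone. -/
structure IsLocallyConeBoundary (r : M → E) : Prop where
  continuous : Continuous r
  norm_eq : ∀ p, ‖r p‖ = 1
  exists_chart : ∀ p, ∃ A, IsConeChart r A p
  exists_mem : ∀ {A p}, IsConeChart r A p → ∀ W ∈ 𝓝 p, ∃ δ : ℝ, 0 < δ ∧
    ∀ w ∈ frontier A, ‖w‖ = 1 → ‖w - r p‖ < δ → ∃ q ∈ W, r q = w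

/-- Extend `r` homogeneously by a factor `t > 0` and project along an interior direction `ζ` of the
cone. This is a continuous injection between spaces of equal dimension, hence open, and the
projection loses nothing on the boundary of `A`. -/
theorem IsConeChart.exists_mem_of_manifold {H : Type*} [NormedAddCommGroup H] [NormedSpace ℝ H]
    [FiniteDimensional ℝ H] [FiniteDimensional ℝ E] [ChartedSpace H M]
    (hdim : Module.finrank ℝ E = Module.finrank ℝ H + 2) (hr : Continuous r)
    (hn : ∀ p, ‖r p‖ = 1) (h : IsConeChart r A p) {W : Set M} (hW : W ∈ 𝓝 p) :
    ∃ δ : ℝ, 0 < δ ∧ ∀ w ∈ frontier A, ‖w‖ = 1 → ‖w - r p‖ < δ → ∃ q ∈ W, r q = w := by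
  have hA := h.cone
  obtain ⟨ζ, hζ⟩ := hA.nonempty_interior
  have hζ0 : ζ ≠ 0 := by
    rintro rfl
    exact hA.frontier_sub_notMem h.mem_frontier hζ (by simpa using h.mem)
  obtain ⟨U, hU, hinj, hmaps⟩ := h.exists_nhds
  set O := interior (U ∩ W) with hO
  have hpO : p ∈ O := mem_interior_iff_mem_nhds.2 (Filter.inter_mem hU hW)
  have hOU : O ⊆ U := interior_subset.trans Set.inter_subset_left
  have hOW : O ⊆ W := interior_subset.trans Set.inter_subset_right
  let φ := chartAt H p
  let π : E →L[ℝ] (ℝ ∙ ζ)ᗮ := (ℝ ∙ ζ)ᗮ.orthogonalProjectionOnto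
  have hπ : ∀ u v : E, π u = π v → ∃ c : ℝ, u = v + c • ζ := by
    intro u v huv
    have h1 : π (u - v) = 0 := by rw [map_sub, huv, sub_self]
    have h2 : u - v ∈ (ℝ ∙ ζ)ᗮᗮ := Submodule.orthogonalProjectionOnto_eq_zero_iff.1 h1
    rw [Submodule.orthogonal_orthogonal, Submodule.mem_span_singleton] at h2
    obtain ⟨c, hc⟩ := h2
    exact ⟨c, by rw [hc]; abel⟩
  have hπinj : ∀ u ∈ frontier A, ∀ v ∈ frontier A, π u = π v → u = v := by
    intro u hu v hv huv
    obtain ⟨c, hc⟩ := hπ u v huv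
    rcases lt_trichotomy c 0 with hc0 | hc0 | hc0
    · refine absurd (hA.mem_of_frontier hu)
        (hc ▸ ?_)
      have := hA.frontier_sub_notMem hv (hA.smul_mem_interior (neg_pos.2 hc0) hζ)
      rwa [neg_smul, sub_neg_eq_add] at this
    · rw [hc, hc0, zero_smul, add_zero]
    · refine absurd (hA.mem_of_frontier hv) ?_
      have := hA.frontier_sub_notMem hu (hA.smul_mem_interior hc0 hζ)
      rwa [hc, add_sub_cancel_right] at this
  let s : Set (H × ℝ) := (φ.target ∩ φ.symm ⁻¹' O) ×ˢ Set.Ioi 0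
  have hs : IsOpen s := (φ.isOpen_inter_preimage_symm isOpen_interior).prod isOpen_Ioi
  let g : H × ℝ → (ℝ ∙ ζ)ᗮ := fun y => π (y.2 • r (φ.symm y.1))
  have hgc : ContinuousOn g s := by
    refine π.continuous.comp_continuousOn (continuous_snd.continuousOn.smul ?_)
    refine hr.comp_continuousOn (φ.continuousOn_symm.comp continuous_fst.continuousOn ?_)
    exact fun y hy => hy.1.1
  have hgi : Set.InjOn g s := by
    rintro ⟨y, t⟩ ⟨⟨hy, hyO⟩, ht⟩ ⟨y', t'⟩ ⟨⟨hy', hyO'⟩, ht'⟩ heq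
    have h1 : t • r (φ.symm y) = t' • r (φ.symm y') :=
      hπinj _ (hA.smul_mem_frontier ht (hmaps (hOU hyO))) _
        (hA.smul_mem_frontier ht' (hmaps (hOU hyO'))) heq
    have h2 : t = t' := by
      have := congrArg norm h1
      rwa [norm_smul, norm_smul, hn, hn, mul_one, mul_one,
        Real.norm_of_nonneg (le_of_lt ht), Real.norm_of_nonneg (le_of_lt ht')] at this
    subst h2
    have h3 := hinj (hOU hyO) (hOU hyO') (smul_right_injective E (ne_of_gt ht) h1)
    have h4 : y = y' := φ.symm.injOn hy hy' h3
    rw [h4]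
  have hfin : Module.finrank ℝ (H × ℝ) = Module.finrank ℝ (ℝ ∙ ζ)ᗮ := by
    have : Fact (Module.finrank ℝ E = (Module.finrank ℝ H + 1) + 1) := ⟨hdim⟩
    rw [Submodule.finrank_orthogonal_span_singleton (n := Module.finrank ℝ H + 1) hζ0]
    simp
  have hopen : IsOpen (g '' s) := isOpen_image_of_injOn hfin hs hgc hgi
  have hmem : π (r p) ∈ g '' s := by
    refine ⟨(φ p, 1), ⟨⟨φ.map_source (mem_chart_source H p), ?_⟩, zero_lt_one' ℝ⟩, ?_⟩
    · rw [Set.mem_preimage, φ.left_inv (mem_chart_source H p)]; exact hpO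
    · simp only [g]
      rw [φ.left_inv (mem_chart_source H p), one_smul]
  obtain ⟨δ, hδ, hball⟩ := Metric.isOpen_iff.1 (hopen.preimage π.continuous) (r p) hmem
  refine ⟨δ, hδ, fun w hw hw1 hwd => ?_⟩
  obtain ⟨⟨y, t⟩, ⟨⟨hy, hyO⟩, ht⟩, hg⟩ := hball
    (show w ∈ Metric.ball (r p) δ by rwa [Metric.mem_ball, dist_eq_norm])
  have h1 : t • r (φ.symm y) = w :=
    hπinj _ (hA.smul_mem_frontier ht (hmaps (hOU hyO))) _ hw hg
  have h2 : t = 1 := by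
    have := congrArg norm h1
    rwa [norm_smul, hn, mul_one, Real.norm_of_nonneg (le_of_lt ht), hw1] at this
  exact ⟨φ.symm y, hOW hyO, by rw [← h1, h2, one_smul]⟩

namespace IsLocallyConeBoundary

variable (hr : IsLocallyConeBoundary r)
include hr

theorem isLocallyInjective : IsLocallyInjective r := by
  rw [isLocallyInjective_iff_nhds]
  intro p
  obtain ⟨A, hA⟩ := hr.exists_chart p
  obtain ⟨U, hU, hi, -⟩ := hA.exists_nhds
  exact ⟨U, hU, hi⟩

/-- Boundary points near `r p` are positive multiples of images of points near `p`. -/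
theorem exists_smul_mem (hA : IsConeChart r A p) {W : Set M} (hW : W ∈ 𝓝 p) :
    ∃ δ : ℝ, 0 < δ ∧ ∀ b ∈ frontier A, ‖b - r p‖ < δ → ∃ q ∈ W, 0 < ‖b‖ ∧ b = ‖b‖ • r q := by
  obtain ⟨δ, hδ, h⟩ := hr.exists_mem hA W hW
  have hcont : ContinuousAt (fun b : E => ‖b‖⁻¹ • b) (r p) := by
    refine ContinuousAt.smul (ContinuousAt.inv₀ continuous_norm.continuousAt ?_) continuousAt_id
    rw [hr.norm_eq]; exact one_ne_zero
  have h1 : (fun b : E => ‖b‖⁻¹ • b) ⁻¹' Metric.ball (r p) δ ∈ 𝓝 (r p) := by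
    refine hcont.preimage_mem_nhds ?_
    simp only [hr.norm_eq, inv_one, one_smul]
    exact Metric.ball_mem_nhds _ hδ
  have h2 : {b : E | 0 < ‖b‖} ∈ 𝓝 (r p) :=
    (isOpen_lt continuous_const continuous_norm).mem_nhds (by
      rw [Set.mem_ofPred_eq, hr.norm_eq]; exact one_pos)
  obtain ⟨ε, hε, hball⟩ := Metric.mem_nhds_iff.1 (Filter.inter_mem h1 h2)
  refine ⟨ε, hε, fun b hb hbd => ?_⟩
  obtain ⟨h3, h4⟩ := hball (show b ∈ Metric.ball (r p) ε by rwa [Metric.mem_ball, dist_eq_norm])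
  rw [Set.mem_preimage, Metric.mem_ball, dist_eq_norm] at h3
  obtain ⟨q, hq, hqr⟩ := h _ (hA.cone.smul_mem_frontier (inv_pos.2 h4) hb)
    (by rw [norm_smul, norm_inv, norm_norm, inv_mul_cancel₀ (ne_of_gt h4)]) h3
  exact ⟨q, hq, h4, by rw [hqr, smul_smul, mul_inv_cancel₀ (ne_of_gt h4), one_smul]⟩

/-- All boundary points of `A` near `r p` are multiples of images of points near `p`, and these lie
in the boundary of `B`. Thus everything determined by the germ of the boundary is independent of the
chart. -/
theorem frontier_subset_near (hA : IsConeChart r A p) (hB : IsConeChart r B p) :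
    ∃ δ : ℝ, 0 < δ ∧ ∀ b, ‖b - r p‖ < δ → b ∈ frontier A → b ∈ frontier B := by
  obtain ⟨U, hU, -, hm⟩ := hB.exists_nhds
  obtain ⟨δ, hδ, h⟩ := hr.exists_smul_mem hA hU
  refine ⟨δ, hδ, fun b hbd hb => ?_⟩
  obtain ⟨q, hq, hb0, hbq⟩ := h b hb hbd
  rw [hbq]
  exact hB.cone.smul_mem_frontier hb0 (hm hq)

theorem faceSpan_eq (hA : IsConeChart r A p) (hB : IsConeChart r B p) :
    hA.cone.faceSpan (r p) = hB.cone.faceSpan (r p) := by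
  obtain ⟨δ, hδ, h⟩ := hr.frontier_subset_near hA hB
  obtain ⟨δ', hδ', h'⟩ := hr.frontier_subset_near hB hA
  exact le_antisymm (hA.cone.faceSpan_le_of_frontier hB.cone hA.mem_frontier hδ h)
    (hB.cone.faceSpan_le_of_frontier hA.cone hB.mem_frontier hδ' h')

theorem frontier_tangentSolidCone_eq (hA : IsConeChart r A p) (hB : IsConeChart r B p) :
    frontier (tangentSolidCone A (r p)) = frontier (tangentSolidCone B (r p)) := by
  obtain ⟨δ, hδ, h⟩ := hr.frontier_subset_near hA hB
  obtain ⟨δ', hδ', h'⟩ := hr.frontier_subset_near hB hA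
  exact (hA.cone.frontier_tangentSolidCone_congr hB.cone hA.mem hB.mem hδ h).antisymm
    (hB.cone.frontier_tangentSolidCone_congr hA.cone hB.mem hA.mem hδ' h')

end IsLocallyConeBoundary

/-- The unit speed great circle through `x` in the direction `v`. -/
noncomputable def circlePt (x v : E) (θ : ℝ) : E := Real.cos θ • x + Real.sin θ • v

theorem continuous_circlePt (x v : E) : Continuous (circlePt x v) := by
  unfold circlePt; fun_prop

theorem norm_circlePt {x v : E} (hx : ‖x‖ = 1) (hv : ‖v‖ = 1) (hxv : ⟪x, v⟫ = 0) (θ : ℝ) :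
    ‖circlePt x v θ‖ = 1 := by
  have h : ‖circlePt x v θ‖ ^ 2 = 1 := by
    rw [circlePt, norm_add_sq_real, norm_smul, norm_smul, hx, hv, inner_smul_left,
      inner_smul_right, hxv, Real.norm_eq_abs, Real.norm_eq_abs, mul_one, mul_one, sq_abs, sq_abs]
    simp
  exact (pow_eq_one_iff_of_nonneg (norm_nonneg _) two_ne_zero).1 h

theorem circlePt_add (x v : E) (α β : ℝ) :
    circlePt x v (α + β) =
      Real.cos β • circlePt x v α + Real.sin β • circlePt x v (α + Real.pi / 2) := by
  simp only [circlePt, Real.cos_add, Real.sin_add, Real.cos_pi_div_two, Real.sin_pi_div_two]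
  module

theorem circlePt_mem {V : Submodule ℝ E} {x v : E} (hx : x ∈ V) (hv : v ∈ V) (θ : ℝ) :
    circlePt x v θ ∈ V := V.add_mem (V.smul_mem _ hx) (V.smul_mem _ hv)

/-- The points of `M` over the great circle through `x` and `v` at which the smallest face spans
`V`, and the tangent cone has the boundary `D`. -/
def leafSet (r : M → E) (x v : E) (V : Submodule ℝ E) (D : Set E) : Set M :=
  {p | (∃ θ, r p = circlePt x v θ) ∧ ∀ A, ∀ h : IsConeChart r A p,
    h.cone.faceSpan (r p) = V ∧ frontier (tangentSolidCone A (r p)) = D}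

theorem isClosed_range_circlePt (x v : E) : IsClosed (Set.range (circlePt x v)) := by
  have : Set.range (circlePt x v) = circlePt x v '' Set.Icc 0 (2 * Real.pi) := by
    refine Set.Subset.antisymm ?_ (Set.image_subset_range _ _)
    rintro _ ⟨θ, rfl⟩
    refine ⟨toIcoMod Real.two_pi_pos 0 θ, ?_, ?_⟩
    · have := toIcoMod_mem_Ico Real.two_pi_pos 0 θ
      rw [zero_add] at this
      exact ⟨this.1, this.2.le⟩
    · have h := toIcoMod_add_toIcoDiv_zsmul Real.two_pi_pos 0 θ
      rw [zsmul_eq_mul] at h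
      conv_rhs => rw [← h]
      simp only [circlePt, Real.cos_add_int_mul_two_pi, Real.sin_add_int_mul_two_pi]
  rw [this]
  exact (isCompact_Icc.image (continuous_circlePt x v)).isClosed

theorem IsSolidCone.tangentSolidCone_eq (hA : IsSolidCone A) {w w' : E}
    (h : w ∈ hA.faceSpan w') (h' : w' ∈ hA.faceSpan w) :
    tangentSolidCone A w = tangentSolidCone A w' :=
  (hA.tangentSolidCone_mono h).antisymm (hA.tangentSolidCone_mono h')

variable [FiniteDimensional ℝ E] {x v : E} {V : Submodule ℝ E} {D : Set E}

namespace IsLocallyConeBoundary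

variable (hr : IsLocallyConeBoundary r)
include hr

/-- The conditions defining the leaf set pass to a nearby point whose image lies in the face of a
leaf point. -/
theorem mem_leafSet_of_chart
    (hmin : ∀ q A, ∀ h : IsConeChart r A q,
      Module.finrank ℝ V ≤ Module.finrank ℝ (h.cone.faceSpan (r q)))
    {q q' : M} (hA : IsConeChart r A q) (hA' : IsConeChart r A q')
    (hV : hA.cone.faceSpan (r q) = V) (hD : frontier (tangentSolidCone A (r q)) = D)
    (hq'V : r q' ∈ V) (hq'c : ∃ θ, r q' = circlePt x v θ) : q' ∈ leafSet r x v V D := by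
  have h1 : hA'.cone.faceSpan (r q') ≤ V := by
    rw [← hV]
    exact hA.cone.faceSpan_mono (hV ▸ hq'V)
  -- Minimality of the dimension of `V` turns the inclusion of face spans into an equality.
  have h2 : hA'.cone.faceSpan (r q') = V := Submodule.eq_of_le_of_finrank_le h1 (hmin _ _ hA')
  have hqV : r q ∈ hA'.cone.faceSpan (r q') := by
    rw [h2, ← hV]; exact hA.cone.self_mem_faceSpan hA.mem
  have h3 : tangentSolidCone A (r q') = tangentSolidCone A (r q) :=
    hA.cone.tangentSolidCone_eq (hV ▸ hq'V) hqV
  refine ⟨hq'c, fun B hB => ⟨?_, ?_⟩⟩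
  · rw [hr.faceSpan_eq hB hA', h2]
  · rw [hr.frontier_tangentSolidCone_eq hB hA', h3, hD]

/-- A chart at the limit point is also a chart at nearby leaf points, and the limit has its image on
the circle, hence in `V`; `mem_leafSet_of_chart` then transfers the leaf conditions. -/
theorem isClosed_leafSet (hx : x ∈ V) (hv : v ∈ V)
    (hmin : ∀ q A, ∀ h : IsConeChart r A q,
      Module.finrank ℝ V ≤ Module.finrank ℝ (h.cone.faceSpan (r q))) :
    IsClosed (leafSet r x v V D) := by
  refine isClosed_of_closure_subset fun q₀ hq₀ => ?_
  have hc : r q₀ ∈ Set.range (circlePt x v) := by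
    refine (isClosed_range_circlePt x v).closure_subset_iff.2 ?_
      (map_mem_closure hr.continuous hq₀ (t := Set.range (circlePt x v)) ?_)
    · exact subset_rfl
    · rintro q ⟨⟨θ, hθ⟩, -⟩
      exact ⟨θ, hθ.symm⟩
  obtain ⟨θ, hθ⟩ := hc
  obtain ⟨A, hA⟩ := hr.exists_chart q₀
  obtain ⟨q, hqA, hq⟩ := mem_closure_iff_nhds.1 hq₀ _ hA.eventually
  obtain ⟨h1, h2⟩ := hq.2 A hqA
  refine hr.mem_leafSet_of_chart hmin hqA hA h1 h2 ?_ ⟨θ, hθ.symm⟩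
  rw [← hθ]
  exact circlePt_mem hx hv θ

/-- Up to the positive factor `cos (θ - t)`, a small move along the circle is a small move inside
the face of `r q`. It stays in the cone, and in its boundary, which `r` covers locally. -/
theorem liftsNear_leafSet (hx : x ∈ V) (hv : v ∈ V) (hx1 : ‖x‖ = 1) (hv1 : ‖v‖ = 1)
    (hxv : ⟪x, v⟫ = 0)
    (hmin : ∀ q A, ∀ h : IsConeChart r A q,
      Module.finrank ℝ V ≤ Module.finrank ℝ (h.cone.faceSpan (r q)))
    {q : M} (hq : q ∈ leafSet r x v V D) {t : ℝ} (hqt : r q = circlePt x v t) :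
    LiftsNear r (leafSet r x v V D) (circlePt x v) q t := by
  intro W hW
  obtain ⟨A, hA⟩ := hr.exists_chart q
  obtain ⟨hV, hD⟩ := hq.2 A hA
  obtain ⟨δ, hδ, hsurj⟩ := hr.exists_mem hA _ (Filter.inter_mem hW hA.eventually)
  obtain ⟨ε, hε, hmem⟩ := hA.cone.exists_add_smul_mem hA.mem
    (v := circlePt x v (t + Real.pi / 2)) (by rw [hV]; exact circlePt_mem hx hv _)
  have h1 : ∀ᶠ θ in 𝓝 t, ‖circlePt x v θ - r q‖ < δ := by
    have := (continuous_circlePt x v).continuousAt (x := t) |>.eventually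
      (Metric.ball_mem_nhds _ hδ)
    filter_upwards [this] with θ hθ
    rw [hqt]
    rwa [dist_eq_norm] at hθ
  have h2 : ∀ᶠ θ in 𝓝 t, 0 < Real.cos (θ - t) :=
    (Continuous.continuousAt (by fun_prop)).eventually (lt_mem_nhds (by simp))
  have h3 : ∀ᶠ θ in 𝓝 t, |Real.sin (θ - t)| < ε * Real.cos (θ - t) := by
    refine ContinuousAt.eventually_lt (Continuous.continuousAt (by fun_prop))
      (Continuous.continuousAt (by fun_prop)) (by simpa using hε)
  obtain ⟨κ, hκ, hball⟩ := Metric.eventually_nhds_iff.1 (h1.and (h2.and h3))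
  refine ⟨κ, hκ, fun θ hθ => ?_⟩
  obtain ⟨h1, h2, h3⟩ := hball (y := θ) (by rwa [Real.dist_eq])
  have h4 : circlePt x v θ = Real.cos (θ - t) •
      (r q + (Real.sin (θ - t) / Real.cos (θ - t)) • circlePt x v (t + Real.pi / 2)) := by
    have := circlePt_add x v t (θ - t)
    rw [add_sub_cancel] at this
    rw [this, hqt, smul_add, smul_smul, mul_div_cancel₀ _ h2.ne']
  have h5 : circlePt x v θ ∈ A := by
    rw [h4]
    refine hA.cone.smul_mem h2.le (hmem _ ?_)
    rw [abs_div, abs_of_pos h2, div_le_iff₀ h2]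
    exact h3.le
  have hVθ : circlePt x v θ ∈ V := circlePt_mem hx hv θ
  have h6 : circlePt x v θ ∈ frontier A :=
    hA.cone.mem_frontier_of_mem_faceSpan hA.mem_frontier h5 (by rw [hV]; exact hVθ)
  obtain ⟨q', ⟨hq'W, hq'A⟩, hq'⟩ := hsurj _ h6 (norm_circlePt hx1 hv1 hxv θ) h1
  exact ⟨q', hq'W, hr.mem_leafSet_of_chart hmin hA hq'A hV hD (by rw [hq']; exact hVθ) ⟨θ, hq'⟩,
    hq'⟩

/-- Great circles lift to the leaf set. -/
theorem exists_leaf [T2Space M] [CompactSpace M] (hx : x ∈ V) (hv : v ∈ V) (hx1 : ‖x‖ = 1)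
    (hv1 : ‖v‖ = 1) (hxv : ⟪x, v⟫ = 0)
    (hmin : ∀ q A, ∀ h : IsConeChart r A q,
      Module.finrank ℝ V ≤ Module.finrank ℝ (h.cone.faceSpan (r q)))
    {p : M} (hp : p ∈ leafSet r x v V D) {t : ℝ} (hpt : r p = circlePt x v t) :
    ∃ γ : ℝ → M, Continuous γ ∧ γ 0 = p ∧
      ∀ θ, γ θ ∈ leafSet r x v V D ∧ r (γ θ) = circlePt x v (t + θ) := by
  refine exists_lift_of_isClosed hr.continuous hr.isLocallyInjective
    (hr.isClosed_leafSet hx hv hmin) (c := fun θ => circlePt x v (t + θ))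
    ((continuous_circlePt x v).comp (by fun_prop)) hp (by simpa using hpt) ?_
  intro q hq θ hqθ W hW
  obtain ⟨δ, hδ, h⟩ := hr.liftsNear_leafSet hx hv hx1 hv1 hxv hmin hq hqθ W hW
  refine ⟨δ, hδ, fun θ' hθ' => h _ ?_⟩
  rwa [add_sub_add_left_eq_sub]

end IsLocallyConeBoundary

end ConeChart

/-! ### Transversality and first order heights near a leaf. -/

section NearLeaf

variable {E : Type*} [NormedAddCommGroup E] [InnerProductSpace ℝ E]

namespace IsSolidCone

variable {A C T : Set E} {w ζ : E}

theorem interior_notMem_zero (hC : IsSolidCone C) (h : (frontier C).Nonempty) :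
    (0 : E) ∉ interior C := by
  intro h0
  obtain ⟨y, hy⟩ := h
  exact hC.frontier_sub_notMem hy h0 (by simpa using hC.mem_of_frontier hy)

theorem zero_mem_frontier_tangentSolidCone (hA : IsSolidCone A) (hw : w ∈ frontier A) :
    (0 : E) ∈ frontier (tangentSolidCone A w) := by
  have hT := hA.tangentSolidCone_isSolidCone w
  refine hT.mem_frontier.2 ⟨hT.zero_mem, fun h => ?_⟩
  obtain ⟨s, hs, h1⟩ := hA.exists_add_smul_mem_interior h
  rw [zero_add] at h1
  rcases hs.eq_or_lt with rfl | hs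
  · rw [zero_smul] at h1
    exact hA.interior_notMem_zero ⟨w, hw⟩ h1
  · exact (hA.mem_frontier.1 hw).2 ((hA.smul_mem_interior_iff hs).1 h1)

/-- Two solid cones with the same boundary which do not overlap are opposite to each other. -/
theorem neg_mem_interior_of_disjoint (hC : IsSolidCone C) (hT : IsSolidCone T)
    (h : frontier T = frontier C) (hd : Disjoint (interior C) T) (hζ : ζ ∈ interior C) :
    -ζ ∈ interior T := by
  obtain ⟨f, u, hfu, huf⟩ :=
    geometric_hahn_banach_open hC.convex.interior isOpen_interior hT.convex hd
  have hu : u ≤ 0 := by simpa using huf 0 hT.zero_mem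
  have hfC : ∀ c ∈ C, f c ≤ u := by
    have : C ⊆ {c | f c ≤ u} := hC.subset_closure_interior.trans
      (closure_minimal (fun a ha => (hfu a ha).le) (isClosed_le f.continuous continuous_const))
    exact this
  have hu0 : u = 0 := le_antisymm hu (by simpa using hfC 0 hC.zero_mem)
  -- The separating functional vanishes on the common boundary. It is positive both at `-ζ` and at
  -- an interior point of `T`, so the segment between them cannot leave `T`.
  have hD : ∀ y ∈ frontier T, f y = 0 := by
    intro y hy
    have h1 := huf y (hT.mem_of_frontier hy)
    have h2 := hfC y (hC.mem_of_frontier (h ▸ hy))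
    linarith
  have hfζ : f ζ < 0 := hu0 ▸ hfu ζ hζ
  by_contra hneg
  have hnT : -ζ ∉ T := by
    intro hmem
    have := hD _ (hT.mem_frontier.2 ⟨hmem, hneg⟩)
    rw [map_neg] at this
    linarith
  obtain ⟨c, hc⟩ := hT.nonempty_interior
  have hfc : 0 < f c := by
    have hcont : Filter.Tendsto (fun s : ℝ => c + s • ζ) (𝓝[>] 0) (𝓝 c) :=
      (Continuous.tendsto' (by fun_prop) _ _ (by simp)).mono_left nhdsWithin_le_nhds
    obtain ⟨s, hs, hs0⟩ := ((hcont.eventually (mem_interior_iff_mem_nhds.1 hc)).and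
      self_mem_nhdsWithin).exists
    have h1 := huf _ hs
    rw [map_add, map_smul, smul_eq_mul, hu0] at h1
    have : s * f ζ < 0 := mul_neg_of_pos_of_neg hs0 hfζ
    linarith
  obtain ⟨s, hs, hy⟩ := exists_mem_frontier_of_mem_of_notMem (interior_subset hc) hnT
  have h1 := hD _ hy
  rw [map_add, map_smul, map_sub, map_neg, smul_eq_mul] at h1
  rcases hs.1.eq_or_lt with h0 | h0
  · rw [← h0] at h1; linarith
  · nlinarith [hs.2, mul_pos h0 (neg_pos.2 hfζ)]

/-- An interior direction of the tangent cone points into the cone. -/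
theorem exists_add_smul_mem_interior_of_tangent (hA : IsSolidCone A) (hw : w ∈ A)
    (hζ : ζ ∈ interior (tangentSolidCone A w)) : ∃ t : ℝ, 0 < t ∧ w + t • ζ ∈ interior A := by
  obtain ⟨s, hs, h1⟩ := hA.exists_add_smul_mem_interior hζ
  refine ⟨1 / (s + 1), by positivity, ?_⟩
  have h2 := hA.smul_mem_interior (t := 1 / (s + 1)) (by positivity)
    (hA.add_smul_mem_interior_of_le hw h1 (t := s + 1) (by linarith))
  convert h2 using 1
  rw [smul_add, smul_smul, one_div_mul_cancel (by positivity), one_smul, add_comm]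

theorem add_smul_mem_interior_of_le' (hA : IsSolidCone A) (hw : w ∈ A) {s t : ℝ}
    (h : w + t • ζ ∈ interior A) (hs : 0 < s) (hst : s ≤ t) : w + s • ζ ∈ interior A := by
  have ht : 0 < t := hs.trans_le hst
  have := hA.mem_interior_of_combo hw h (div_pos hs ht) ((div_le_one ht).2 hst)
  convert this using 1
  rw [smul_add, smul_smul, div_mul_cancel₀ _ ht.ne']
  module

end IsSolidCone

variable {M : Type*} [TopologicalSpace M] {r : M → E} {x v ζ : E} {V : Submodule ℝ E}
  {C D : Set E} {p : M}

namespace IsLocallyConeBoundary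

variable (hr : IsLocallyConeBoundary r)
include hr

/-- Near a leaf point, the boundary is transversal to every interior direction of `C`. -/
theorem exists_transversal (hp : p ∈ leafSet r x v V D) (hC : IsSolidCone C)
    (hCD : frontier C = D) (hζ : ζ ∈ interior C) :
    ∃ (A : Set E) (σ t₀ : ℝ), IsConeChart r A p ∧ 0 < t₀ ∧
      (∀ᶠ q in 𝓝 p, ∀ t, 0 < t → t ≤ t₀ → r q + t • σ • ζ ∈ interior A) ∧
      ((σ = 1 ∧ tangentSolidCone A (r p) = C) ∨
        (σ = -1 ∧ ∀ᶠ q in 𝓝 p, r q ∉ interior C)) := by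
  obtain ⟨A, hA⟩ := hr.exists_chart p
  obtain ⟨-, hD⟩ := hp.2 A hA
  set T := tangentSolidCone A (r p) with hT
  have hTs : IsSolidCone T := hA.cone.tangentSolidCone_isSolidCone _
  have hmem : ∀ᶠ q in 𝓝 p, r q ∈ A := hA.eventually.mono fun q hq => hq.mem
  have key : ∀ σ : ℝ, σ • ζ ∈ interior T → ∃ t₀ : ℝ, 0 < t₀ ∧
      ∀ᶠ q in 𝓝 p, ∀ t, 0 < t → t ≤ t₀ → r q + t • σ • ζ ∈ interior A := by
    intro σ hσ
    obtain ⟨t₀, ht₀, h⟩ := hA.cone.exists_add_smul_mem_interior_of_tangent hA.mem hσ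
    have hc : Continuous fun q => r q + t₀ • σ • ζ := hr.continuous.add continuous_const
    refine ⟨t₀, ht₀, ?_⟩
    filter_upwards [hmem, hc.continuousAt.eventually (isOpen_interior.mem_nhds h)]
      with q hq hq' t ht htt
    exact hA.cone.add_smul_mem_interior_of_le' hq hq' ht htt
  -- `T` and `C` share their boundary: either they overlap and coincide (`σ = 1`), or they are
  -- opposite (`σ = -1`), and then `A ⊆ T` keeps the hypersurface out of the interior of `C`.
  by_cases hd : Disjoint (interior C) T
  · obtain ⟨t₀, ht₀, h⟩ := key (-1) (by
      rw [neg_one_smul]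
      exact hC.neg_mem_interior_of_disjoint hTs (hD.trans hCD.symm) hd hζ)
    refine ⟨A, -1, t₀, hA, ht₀, h, Or.inr ⟨rfl, ?_⟩⟩
    filter_upwards [hmem] with q hq hqC
    exact Set.disjoint_left.1 hd hqC (subset_tangentSolidCone _ _ hq)
  · obtain ⟨y, hyC, hyT⟩ := Set.not_disjoint_iff.1 hd
    have hTC : T = C := (hC.eq_of_frontier_eq hTs (hCD.trans hD.symm) hyC hyT).symm
    obtain ⟨t₀, ht₀, h⟩ := key 1 (by rw [one_smul, hTC]; exact hζ)
    exact ⟨A, 1, t₀, hA, ht₀, h, Or.inl ⟨rfl, hTC⟩⟩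

/-- The height over the tangent cone is of lower order near a leaf point. -/
theorem eventually_height_le (hp : p ∈ leafSet r x v V D) (hC : IsSolidCone C)
    (hCD : frontier C = D) (hζ : ζ ∈ interior C) {n e : E} (hn : ⟪n, r p⟫ = 0) {κ : ℝ}
    (he : e + κ • ζ ∈ interior C) :
    ∀ᶠ q in 𝓝 p, r q ∈ interior C → 0 < ⟪n, r q⟫ → ∀ τ : ℝ,
      r q = ⟪r p, r q⟫ • r p + ⟪n, r q⟫ • e + τ • ζ → τ ≤ κ * ⟪n, r q⟫ := by
  obtain ⟨A, σ, t₀, hA, ht₀, htr, h⟩ := hr.exists_transversal hp hC hCD hζ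
  rcases h with ⟨rfl, hTC⟩ | ⟨-, h⟩
  swap
  · filter_upwards [h] with q hq hqC
    exact absurd hqC hq
  rw [← hTC] at he
  obtain ⟨s, hs, h1⟩ := hA.cone.exists_add_smul_mem_interior he
  have h2 : ∀ᶠ q in 𝓝 p, s * ⟪n, r q⟫ < ⟪r p, r q⟫ := by
    refine ContinuousAt.eventually_lt ?_ ?_ ?_
    · exact (continuous_const.mul (continuous_const.inner hr.continuous)).continuousAt
    · exact (continuous_const.inner hr.continuous).continuousAt
    · rw [hn, real_inner_self_eq_norm_sq, hr.norm_eq]; simp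
  filter_upwards [h2, htr, hA.eventually] with q hq htr hAq _ hb τ hτ
  by_contra! hcon
  set b := ⟪n, r q⟫
  set a := ⟪r p, r q⟫
  -- The point with the same `r p` and `e` components as `r q` but height `κ b` is interior to `A`.
  -- If `r q` were higher, it would lie between that point and `r q + t₀ ζ`, both interior.
  have h3 := hA.cone.add_smul_mem_interior_of_le hA.mem h1
    (t := a / b) ((le_div_iff₀ hb).2 hq.le)
  have h4 := hA.cone.smul_mem_interior hb h3
  have h5 : b • (e + κ • ζ + (a / b) • r p) = r q - (τ - κ * b) • ζ := by
    rw [smul_add, smul_smul, mul_div_cancel₀ _ hb.ne']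
    conv_rhs => rw [hτ]
    module
  rw [h5] at h4
  have h6 := htr t₀ ht₀ le_rfl
  rw [one_smul] at h6
  set c := τ - κ * b
  have hc : 0 < c := by simp only [c]; linarith
  have h7 := hA.cone.convex.interior h4 h6 (a := t₀ / (c + t₀)) (b := c / (c + t₀))
    (by positivity) (by positivity) (by field_simp; ring)
  refine (hAq.cone.mem_frontier.1 hAq.mem_frontier).2 ?_
  convert h7 using 1
  have h8 : t₀ / (c + t₀) + c / (c + t₀) = 1 := by field_simp; ring
  have h9 : t₀ / (c + t₀) * c = c / (c + t₀) * t₀ := by ring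
  rw [smul_sub, smul_add, smul_smul, smul_smul, h9]
  rw [show (t₀ / (c + t₀)) • r q - (c / (c + t₀) * t₀) • ζ +
    ((c / (c + t₀)) • r q + (c / (c + t₀) * t₀) • ζ) =
    (t₀ / (c + t₀) + c / (c + t₀)) • r q by module, h8, one_smul]

end IsLocallyConeBoundary

/-- The component of `w` orthogonal to the orthonormal vectors `x`, `v`, `ζ`. -/
noncomputable def orthRest (x v ζ w : E) : E := w - ⟪x, w⟫ • x - ⟪v, w⟫ • v - ⟪ζ, w⟫ • ζ

theorem continuous_orthRest (x v ζ : E) : Continuous (orthRest x v ζ) := by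
  unfold orthRest; fun_prop

theorem orthRest_smul (x v ζ w : E) (c : ℝ) : orthRest x v ζ (c • w) = c • orthRest x v ζ w := by
  simp only [orthRest, inner_smul_right]; module

theorem eq_add_orthRest (x v ζ w : E) :
    w = ⟪x, w⟫ • x + ⟪v, w⟫ • v + ⟪ζ, w⟫ • ζ + orthRest x v ζ w := by
  simp only [orthRest]; abel

end NearLeaf

/-! ### The hypersurface coincides with the tangent boundary near a leaf. -/

section HalfLeaf

variable {E : Type*} [NormedAddCommGroup E] [InnerProductSpace ℝ E]

/-- Three pairwise orthogonal unit vectors. -/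
structure IsOrthoTriple (x v ζ : E) : Prop where
  norm_x : ‖x‖ = 1
  norm_v : ‖v‖ = 1
  norm_ζ : ‖ζ‖ = 1
  inner_xv : ⟪x, v⟫ = 0
  inner_xζ : ⟪x, ζ⟫ = 0
  inner_vζ : ⟪v, ζ⟫ = 0

namespace IsOrthoTriple

variable {x v ζ : E} (h : IsOrthoTriple x v ζ)
include h

theorem inner_x (a b c : ℝ) : ⟪x, a • x + b • v + c • ζ⟫ = a := by
  simp [inner_add_right, inner_smul_right, h.inner_xv, h.inner_xζ, h.norm_x]

theorem inner_v (a b c : ℝ) : ⟪v, a • x + b • v + c • ζ⟫ = b := by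
  simp [inner_add_right, inner_smul_right, real_inner_comm x v, h.inner_xv, h.inner_vζ, h.norm_v]

theorem inner_ζ (a b c : ℝ) : ⟪ζ, a • x + b • v + c • ζ⟫ = c := by
  simp [inner_add_right, inner_smul_right, real_inner_comm x ζ, real_inner_comm v ζ, h.inner_xζ,
    h.inner_vζ, h.norm_ζ]

theorem orthRest_add (a b c : ℝ) (w : E) :
    orthRest x v ζ (w + (a • x + b • v + c • ζ)) = orthRest x v ζ w := by
  simp only [orthRest, inner_add_right _ w, h.inner_x, h.inner_v, h.inner_ζ]
  module

theorem orthRest_combo (a b c : ℝ) : orthRest x v ζ (a • x + b • v + c • ζ) = 0 := by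
  have := h.orthRest_add a b c 0
  rw [zero_add] at this
  rw [this]; simp [orthRest]

omit h in
theorem circlePt_eq (θ : ℝ) :
    circlePt x v θ = Real.cos θ • x + Real.sin θ • v + (0 : ℝ) • ζ := by
  simp [circlePt]

end IsOrthoTriple

variable {M : Type*} [TopologicalSpace M] {r : M → E} {x v ζ : E} {V : Submodule ℝ E}
  {C D : Set E}

namespace IsLocallyConeBoundary

variable (hr : IsLocallyConeBoundary r)
include hr

/-- Near a half leaf, the only points over the half plane of the leaf and its normal direction are
those of the half leaf. -/
theorem eventually_mem_image_Icc (h3 : IsOrthoTriple x v ζ) (hC : IsSolidCone C)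
    (hCD : frontier C = D) (hζ : ζ ∈ interior C) {γ : ℝ → M} (hγ : Continuous γ)
    (hleaf : ∀ θ, γ θ ∈ leafSet r x v V D ∧ r (γ θ) = circlePt x v θ) {θ₀ : ℝ}
    (hθ₀ : θ₀ ∈ Set.Icc 0 Real.pi) :
    ∀ᶠ q in 𝓝 (γ θ₀), 0 ≤ ⟪v, r q⟫ → orthRest x v ζ (r q) = 0 → q ∈ γ '' Set.Icc 0 Real.pi := by
  obtain ⟨A, σ, t₀, hA, ht₀, htr, hσ⟩ := hr.exists_transversal (hleaf θ₀).1 hC hCD hζ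
  have hσ2 : σ * σ = 1 := by rcases hσ with ⟨rfl, -⟩ | ⟨rfl, -⟩ <;> norm_num
  obtain ⟨U, hU, hinj, hmaps⟩ := hA.exists_nhds
  have hrc := hr.continuous
  let a : M → ℝ := fun q => ⟪x, r q⟫
  let b : M → ℝ := fun q => ⟪v, r q⟫
  let c : M → ℝ := fun q => ⟪ζ, r q⟫
  -- Polar coordinates in the plane of `x` and `v`: a point `q` over the half plane is compared with
  -- the leaf point of the same angle `arccos (a q / m q)`.
  let m : M → ℝ := fun q => Real.sqrt (a q ^ 2 + b q ^ 2)
  have hac : Continuous a := continuous_const.inner hrc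
  have hbc : Continuous b := continuous_const.inner hrc
  have hcc : Continuous c := continuous_const.inner hrc
  have hmc : Continuous m := by fun_prop
  have ha0 : a (γ θ₀) = Real.cos θ₀ := by
    simp only [a]; rw [(hleaf θ₀).2, IsOrthoTriple.circlePt_eq, h3.inner_x]
  have hb0 : b (γ θ₀) = Real.sin θ₀ := by
    simp only [b]; rw [(hleaf θ₀).2, IsOrthoTriple.circlePt_eq, h3.inner_v]
  have hc0 : c (γ θ₀) = 0 := by
    simp only [c]; rw [(hleaf θ₀).2, IsOrthoTriple.circlePt_eq, h3.inner_ζ]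
  have hm0 : m (γ θ₀) = 1 := by simp [m, ha0, hb0]
  have hθc : ContinuousAt (fun q => Real.arccos (a q / m q)) (γ θ₀) :=
    Real.continuous_arccos.continuousAt.comp
      (hac.continuousAt.div hmc.continuousAt (by rw [hm0]; exact one_ne_zero))
  have hθ0 : Real.arccos (a (γ θ₀) / m (γ θ₀)) = θ₀ := by
    rw [hm0, ha0, div_one, Real.arccos_cos hθ₀.1 hθ₀.2]
  have hγc : ContinuousAt (fun q => γ (Real.arccos (a q / m q))) (γ θ₀) :=
    hγ.continuousAt.comp hθc
  have e1 : ∀ᶠ q in 𝓝 (γ θ₀), γ (Real.arccos (a q / m q)) ∈ U := by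
    refine hγc.eventually (p := fun y => y ∈ U) ?_
    simp only [hθ0]; exact hU
  have e1' : ∀ᶠ q in 𝓝 (γ θ₀), ∀ t, 0 < t → t ≤ t₀ →
      r (γ (Real.arccos (a q / m q))) + t • σ • ζ ∈ interior A := by
    refine hγc.eventually (p := fun y => ∀ t, 0 < t → t ≤ t₀ → r y + t • σ • ζ ∈ interior A) ?_
    simp only [hθ0]; exact htr
  have e2 : ∀ᶠ q in 𝓝 (γ θ₀), 1 / 2 < m q :=
    hmc.continuousAt.eventually (lt_mem_nhds (by rw [hm0]; norm_num))
  have e3 : ∀ᶠ q in 𝓝 (γ θ₀), |c q| < t₀ / 2 :=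
    hcc.abs.continuousAt.eventually (gt_mem_nhds (by simpa [hc0] using ht₀))
  filter_upwards [hU, htr, e1, e1', e2, e3] with q hqU htq hθU hθt hm hc hb hρ
  have hmpos : 0 < m q := by linarith
  set θ := Real.arccos (a q / m q) with hθ
  have hmsq : m q ^ 2 = a q ^ 2 + b q ^ 2 := Real.sq_sqrt (by positivity)
  have ham : |a q / m q| ≤ 1 := by
    rw [abs_div, abs_of_pos hmpos, div_le_one hmpos]
    exact Real.abs_le_sqrt (by nlinarith [sq_nonneg (b q)])
  have hcos : Real.cos θ = a q / m q := Real.cos_arccos (abs_le.1 ham).1 (abs_le.1 ham).2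
  have hsin : Real.sin θ = b q / m q := by
    have h1 : 1 - (a q / m q) ^ 2 = (b q / m q) ^ 2 := by
      rw [div_pow, div_pow, hmsq]
      have : a q ^ 2 + b q ^ 2 ≠ 0 := by rw [← hmsq]; positivity
      field_simp
      ring
    rw [hθ, Real.sin_arccos, h1, Real.sqrt_sq (div_nonneg hb hmpos.le)]
  have hrq : r q = m q • r (γ θ) + c q • ζ := by
    rw [(hleaf θ).2, circlePt, hcos, hsin, smul_add, smul_smul, smul_smul,
      mul_div_cancel₀ _ hmpos.ne', mul_div_cancel₀ _ hmpos.ne']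
    have := eq_add_orthRest x v ζ (r q)
    rw [hρ, add_zero] at this
    exact this
  have hfq : r q ∉ interior A := (hA.cone.mem_frontier.1 (hmaps hqU)).2
  have hfθ : m q • r (γ θ) ∉ interior A :=
    (hA.cone.mem_frontier.1 (hA.cone.smul_mem_frontier hmpos (hmaps hθU))).2
  -- A nonzero height is impossible: `r q` and `m • r (γ θ)` differ by a multiple of the transversal
  -- direction `ζ`, so one of these two boundary points would be interior.
  have hc0 : c q = 0 := by
    rcases lt_trichotomy (σ * c q) 0 with hlt | heq | hgt
    · refine absurd ?_ hfθ
      have h1 : -(σ * c q) ≤ t₀ := by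
        have := neg_abs_le (σ * c q)
        rw [abs_mul, show |σ| = 1 by rcases hσ with ⟨rfl, -⟩ | ⟨rfl, -⟩ <;> simp, one_mul] at this
        linarith
      have h2 := htq (-(σ * c q)) (by linarith) h1
      rw [hrq, smul_smul, show -(σ * c q) * σ = -c q by linear_combination -(c q) * hσ2,
        add_assoc, ← add_smul, add_neg_cancel, zero_smul, add_zero] at h2
      exact h2
    · rcases mul_eq_zero.1 heq with h0 | h0
      · rw [h0] at hσ2; norm_num at hσ2
      · exact h0
    · refine absurd ?_ hfq
      have h1 : σ * c q ≤ t₀ / 2 := by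
        have := le_abs_self (σ * c q)
        rw [abs_mul, show |σ| = 1 by rcases hσ with ⟨rfl, -⟩ | ⟨rfl, -⟩ <;> simp, one_mul] at this
        linarith
      have h2 := hA.cone.smul_mem_interior hmpos (hθt (σ * c q / m q) (by positivity) (by
        rw [div_le_iff₀ hmpos]; nlinarith))
      rw [smul_add, smul_smul, smul_smul, mul_div_cancel₀ _ hmpos.ne',
        show σ * c q * σ = c q by linear_combination (c q) * hσ2, ← hrq] at h2
      exact h2
  rw [hc0, zero_smul, add_zero] at hrq
  have hm1 : m q = 1 := by
    have := congrArg norm hrq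
    rw [norm_smul, hr.norm_eq, hr.norm_eq, mul_one, Real.norm_of_nonneg hmpos.le] at this
    exact this.symm
  rw [hm1, one_smul] at hrq
  exact ⟨θ, ⟨Real.arccos_nonneg _, Real.arccos_le_pi _⟩, (hinj hqU hθU hrq).symm⟩

/-- A point in the interior of `C` excludes the opposite alternative of `exists_transversal`, so `ζ`
points into the chart itself. -/
theorem eventually_exists_chart (hC : IsSolidCone C) (hCD : frontier C = D) (hζ : ζ ∈ interior C)
    {p : M} (hp : p ∈ leafSet r x v V D) :
    ∀ᶠ q in 𝓝 p, r q ∈ interior C → ∃ A, IsConeChart r A q ∧ ∃ t₀ : ℝ, 0 < t₀ ∧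
      ∀ t, 0 < t → t ≤ t₀ → r q + t • ζ ∈ interior A := by
  obtain ⟨A, σ, t₀, hA, ht₀, htr, ⟨rfl, -⟩ | ⟨-, hσ⟩⟩ := hr.exists_transversal hp hC hCD hζ
  · filter_upwards [hA.eventually, htr] with q hq htq _
    exact ⟨A, hq, t₀, ht₀, by simpa using htq⟩
  · filter_upwards [hσ] with q hq hq' using absurd hq' hq

/-- Along a half leaf whose end points are opposite points of the lineality space of `C`, the slices
of the hypersurface over the half planes close to the leaf do not enter the interior of `C`. -/
theorem notMem_interior_of_slice [T2Space M] (h3 : IsOrthoTriple x v ζ) (hC : IsSolidCone C)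
    (hCD : frontier C = D) (hζ : ζ ∈ interior C) (hxC : x ∈ C) (hxC' : -x ∈ C)
    {γ : ℝ → M} (hleaf : ∀ θ, γ θ ∈ leafSet r x v V D ∧ r (γ θ) = circlePt x v θ)
    {N : Set M} (hN : IsCompact N)
    (harc : ∀ q ∈ N, 0 ≤ ⟪v, r q⟫ → orthRest x v ζ (r q) = 0 → q ∈ γ '' Set.Icc 0 Real.pi)
    (hchart : ∀ q ∈ N, r q ∈ interior C → ∃ A, IsConeChart r A q ∧ ∃ t₀ : ℝ, 0 < t₀ ∧
      ∀ t, 0 < t → t ≤ t₀ → r q + t • ζ ∈ interior A) {z : E}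
    (hz : ∀ q ∈ N, 0 ≤ ⟪v, r q⟫ → orthRest x v ζ (r q) = ⟪v, r q⟫ • z → q ∈ interior N)
    {q₁ : M} (hq₁ : q₁ ∈ N) (hb₁ : 0 < ⟪v, r q₁⟫)
    (hz₁ : orthRest x v ζ (r q₁) = ⟪v, r q₁⟫ • z) : r q₁ ∉ interior C := by
  intro hint
  have hrc := hr.continuous
  let a : M → ℝ := fun q => ⟪x, r q⟫
  let b : M → ℝ := fun q => ⟪v, r q⟫
  let c : M → ℝ := fun q => ⟪ζ, r q⟫
  have hac : Continuous a := continuous_const.inner hrc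
  have hbc : Continuous b := continuous_const.inner hrc
  have hcc : Continuous c := continuous_const.inner hrc
  -- `X` is the slice over the half space spanned by `x`, the ray of `v + z`, and `ζ`. Where `b >
  -- 0`, the quotients `a / b` and `c / b` serve as affine coordinates on it, with `c / b` as
  -- height.
  let X : Set M := {q | q ∈ N ∧ 0 ≤ b q ∧ orthRest x v ζ (r q) = b q • z}
  have hXc : IsCompact X := by
    refine hN.inter_right ((isClosed_le continuous_const hbc).inter ?_)
    exact isClosed_eq ((continuous_orthRest x v ζ).comp hrc) (hbc.smul continuous_const)
  have hX : ∀ q ∈ X, r q = a q • x + b q • (v + z) + c q • ζ := by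
    intro q hq
    have := eq_add_orthRest x v ζ (r q)
    rw [hq.2.2] at this
    refine this.trans ?_
    simp only [a, b, c]; module
  have hxs : ∀ s : ℝ, s • x ∈ C := by
    intro s
    rcases le_total 0 s with hs | hs
    · exact hC.smul_mem hs hxC
    · have := hC.smul_mem (neg_nonneg.2 hs) hxC'
      rwa [smul_neg, neg_smul, neg_neg] at this
  have h0D : (0 : E) ∈ frontier C := by
    obtain ⟨A, hA⟩ := hr.exists_chart (γ 0)
    rw [hCD, ← ((hleaf 0).1.2 A hA).2]
    exact hA.cone.zero_mem_frontier_tangentSolidCone hA.mem_frontier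
  have hq₁X : q₁ ∈ X := ⟨hq₁, hb₁.le, hz₁⟩
  -- membership in the interior of `C` is a condition on the height
  have hshift : ∀ q ∈ X, 0 < b q → (r q ∈ interior C ↔ v + z + (c q / b q) • ζ ∈ interior C) := by
    intro q hq hb
    have hb' : b q ≠ 0 := hb.ne'
    constructor
    · intro h
      have h1 := hC.smul_mem_interior (inv_pos.2 hb) (hC.add_mem_interior (hxs (-a q)) h)
      convert h1 using 1
      rw [hX q hq, smul_add, smul_add, smul_add, smul_smul, smul_smul, smul_smul, smul_smul,
        inv_mul_cancel₀ hb', one_smul, ← div_eq_inv_mul]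
      module
    · intro h
      have h1 := hC.add_mem_interior (hxs (a q)) (hC.smul_mem_interior hb h)
      convert h1 using 1
      rw [hX q hq, smul_add (b q) (v + z), smul_smul, mul_div_cancel₀ _ hb']
      module
  -- Since `C` contains the line of `x`, its boundary has the constant height `f` over the slice.
  obtain ⟨f, hf⟩ : ∃ f : ℝ, v + z + f • ζ ∈ frontier C := by
    obtain ⟨S, hS⟩ : ∃ S : ℝ, v + z + S • ζ ∉ C := by
      by_contra! hall
      have hneg : -ζ ∈ C := by
        refine hC.closed.mem_of_tendsto (f := fun s : ℝ => s • (v + z) - ζ) (b := 𝓝[>] 0) ?_ ?_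
        · exact (Continuous.tendsto' (by fun_prop) _ _ (by simp)).mono_left nhdsWithin_le_nhds
        · filter_upwards [self_mem_nhdsWithin] with s hs
          have := hC.smul_mem (le_of_lt hs) (hall (-s⁻¹))
          rw [smul_add, smul_smul, mul_neg, mul_inv_cancel₀ (ne_of_gt hs), neg_one_smul,
            ← sub_eq_add_neg] at this
          exact this
      have := hC.add_mem_interior hneg hζ
      rw [neg_add_cancel] at this
      exact hC.interior_notMem_zero ⟨0, h0D⟩ this
    obtain ⟨s, -, hs⟩ := exists_mem_frontier_of_mem_of_notMem
      (interior_subset ((hshift q₁ hq₁X hb₁).1 hint)) hS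
    refine ⟨c q₁ / b q₁ + s * (S - c q₁ / b q₁), ?_⟩
    convert hs using 1
    module
  have hfi : ∀ t : ℝ, v + z + t • ζ ∈ interior C ↔ f < t := by
    intro t
    constructor
    · intro h
      by_contra! hle
      refine (hC.mem_frontier.1 hf).2 ?_
      have h1 := hC.add_mem_interior (hC.smul_mem (sub_nonneg.2 hle) (interior_subset hζ)) h
      convert h1 using 1
      module
    · intro h
      have h1 := hC.add_mem_interior (hC.mem_of_frontier hf)
        (hC.smul_mem_interior (sub_pos.2 h) hζ)
      convert h1 using 1
      module
  have hheight : ∀ q ∈ X, 0 < b q → (r q ∈ interior C ↔ f < c q / b q) := fun q hq hb =>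
    (hshift q hq hb).trans (hfi _)
  set κ := (c q₁ / b q₁ - f) / 2 with hκ
  have hκ0 : 0 < κ := by have := (hheight q₁ hq₁X hb₁).1 hint; linarith
  have heκ : v + z + f • ζ + κ • ζ ∈ interior C := by
    rw [add_assoc, ← add_smul, hfi]; linarith
  -- the ends of the half leaf
  have hend : ∀ p : M, p ∈ leafSet r x v V D → (r p = x ∨ r p = -x) →
      ∃ W, IsOpen W ∧ p ∈ W ∧ ∀ q ∈ W, q ∈ X → 0 < b q → c q / b q ≤ f + κ := by
    intro p hp hpx
    have hn : ⟪v, r p⟫ = 0 := by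
      rcases hpx with h | h <;> rw [h] <;> simp [real_inner_comm x v, h3.inner_xv]
    have h := hr.eventually_height_le hp hC hCD hζ hn heκ
    obtain ⟨W, hW, hWo, hpW⟩ := eventually_nhds_iff.1 h
    refine ⟨W, hWo, hpW, fun q hq hqX hb => ?_⟩
    by_contra! hlt
    have h1 := hW q hq ((hheight q hqX hb).2 (by linarith)) hb (c q - f * b q) (by
      have : ⟪r p, r q⟫ • r p = a q • x := by
        rcases hpx with h | h
        · rw [h]
        · rw [h]; simp [a, inner_neg_left]
      rw [this]
      refine (hX q hqX).trans ?_
      simp only [b]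
      module)
    rw [lt_div_iff₀ hb] at hlt
    change c q - f * b q ≤ κ * b q at h1
    nlinarith
  obtain ⟨W₀, hW₀, hp₀, hW₀h⟩ := hend (γ 0) (hleaf 0).1 (Or.inl (by
    rw [(hleaf 0).2]; simp [circlePt]))
  obtain ⟨W₁, hW₁, hp₁, hW₁h⟩ := hend (γ Real.pi) (hleaf Real.pi).1 (Or.inr (by
    rw [(hleaf Real.pi).2]; simp [circlePt]))
  -- Near both ends of the half leaf the height is at most `f + κ`, below that of `q₁`. Removing the
  -- ends leaves a compact set on which `b > 0`, and it still contains all points of greater height.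
  let X' : Set M := X \ (W₀ ∪ W₁)
  have hX'c : IsCompact X' := hXc.diff (hW₀.union hW₁)
  have hX'b : ∀ q ∈ X', 0 < b q := by
    intro q hq
    refine lt_of_le_of_ne hq.1.2.1 fun h0 => ?_
    obtain ⟨θ, hθ, rfl⟩ := harc q hq.1.1 hq.1.2.1 (by rw [hq.1.2.2, ← h0, zero_smul])
    have h1 : Real.sin θ = 0 := by
      rw [h0]; simp only [b]
      rw [(hleaf θ).2, IsOrthoTriple.circlePt_eq (ζ := ζ), h3.inner_v]
    have h2 : θ = 0 ∨ θ = Real.pi := by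
      by_contra! hcon
      exact (Real.sin_pos_of_pos_of_lt_pi (lt_of_le_of_ne hθ.1 hcon.1.symm)
        (lt_of_le_of_ne hθ.2 hcon.2)).ne' h1
    rcases h2 with rfl | rfl
    · exact hq.2 (Or.inl hp₀)
    · exact hq.2 (Or.inr hp₁)
  have hmemX' : ∀ q ∈ X, 0 < b q → f + κ < c q / b q → q ∈ X' := by
    intro q hq hb hlt
    refine ⟨hq, ?_⟩
    rintro (h | h)
    · exact absurd (hW₀h q h hq hb) (not_le.2 hlt)
    · exact absurd (hW₁h q h hq hb) (not_le.2 hlt)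
  have hhc : ContinuousOn (fun q => c q / b q) X' :=
    hcc.continuousOn.div hbc.continuousOn fun q hq => (hX'b q hq).ne'
  have hgc : ContinuousOn (fun q => a q / b q) X' :=
    hac.continuousOn.div hbc.continuousOn fun q hq => (hX'b q hq).ne'
  have hq₁X' : q₁ ∈ X' := hmemX' q₁ hq₁X hb₁ (by linarith)
  -- Among the points of maximal height, one with the least `a / b` is taken. Convexity of the chart
  -- will show that maximal height persists in the direction `-x`, a contradiction.
  obtain ⟨qm, hqm, hqmax⟩ := hX'c.exists_isMaxOn ⟨q₁, hq₁X'⟩ hhc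
  have hYc : IsCompact (X' ∩ (fun q => c q / b q) ⁻¹' {c qm / b qm}) := by
    obtain ⟨F, hF, hFe⟩ := continuousOn_iff_isClosed.1 hhc _ (isClosed_singleton (x := c qm / b qm))
    rw [Set.inter_comm, hFe, Set.inter_comm]
    exact hX'c.inter_right hF
  obtain ⟨q, ⟨hqX', hqh⟩, hqmin⟩ := hYc.exists_isMinOn ⟨qm, hqm, rfl⟩
    (hgc.mono Set.inter_subset_left)
  replace hqh : c q / b q = c qm / b qm := hqh
  have hbig : f + κ < c q / b q := by
    have : c q₁ / b q₁ ≤ c qm / b qm := hqmax hq₁X'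
    rw [hqh]; linarith
  have hbq : 0 < b q := hX'b q hqX'
  have hmax : ∀ q' ∈ X, 0 < b q' → c q' / b q' ≤ c q / b q := by
    intro q' hq' hb'
    by_contra! hlt
    have : c q' / b q' ≤ c qm / b qm := hqmax (hmemX' q' hq' hb' (hbig.trans hlt))
    linarith
  have hqint : r q ∈ interior C := (hheight q hqX'.1 hbq).2 (by linarith)
  obtain ⟨A, hA, t₀, ht₀, htr⟩ := hchart q hqX'.1.1 hqint
  have hNq : N ∈ 𝓝 q := mem_interior_iff_mem_nhds.1 (hz q hqX'.1.1 hbq.le hqX'.1.2.2)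
  obtain ⟨δ, hδ, hsurj⟩ := hr.exists_smul_mem hA hNq
  set ε := min t₀ (δ / 2) with hε
  have hε0 : 0 < ε := by positivity
  have hup : r q + ε • ζ ∈ interior A := htr ε hε0 (min_le_left _ _)
  have hdown : ∀ t : ℝ, 0 < t → r q - t • ζ ∉ A := by
    intro t ht hmem
    refine (hA.cone.mem_frontier.1 hA.mem_frontier).2 ?_
    have := hA.cone.mem_interior_of_combo hmem hup (s := t / (t + ε)) (by positivity)
      (by rw [div_le_one (by positivity)]; linarith)
    convert this using 1
    have : t + ε ≠ 0 := by positivity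
    match_scalars <;> field_simp <;> ring
  have hupc : ∀ᶠ s : ℝ in 𝓝 0, r q + s • x + ε • ζ ∈ interior A := by
    have : Continuous fun s : ℝ => r q + s • x + ε • ζ := by fun_prop
    exact this.continuousAt.eventually (isOpen_interior.mem_nhds (by simpa using hup))
  have hdownc : ∀ᶠ s : ℝ in 𝓝 0, r q + s • x - ε • ζ ∉ A := by
    have : Continuous fun s : ℝ => r q + s • x - ε • ζ := by fun_prop
    exact this.continuousAt.eventually
      (hA.cone.closed.isOpen_compl.mem_nhds (by simpa using hdown ε hε0))
  obtain ⟨η, hη, hball⟩ := Metric.eventually_nhds_iff.1 (hupc.and hdownc)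
  set s₀ := min (η / 2) (δ / 4) with hs₀
  have hs₀0 : 0 < s₀ := by positivity
  -- Shifting by `s • x` and correcting by `τ • ζ` gives another boundary point. It comes from the
  -- slice, so maximality forces `τ ≤ 0`.
  have cross : ∀ s : ℝ, |s| = s₀ → ∃ τ : ℝ, τ ≤ 0 ∧ r q + s • x + τ • ζ ∈ A ∧
      (τ = 0 → ∃ q' ∈ X', c q' / b q' = c q / b q ∧ a q' / b q' = a q / b q + s / b q) := by
    intro s hs
    obtain ⟨hup', hdown'⟩ := hball (y := s) (by
      rw [Real.dist_eq, sub_zero, hs]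
      exact (min_le_left _ _).trans_lt (by linarith))
    obtain ⟨l, hl, hlf⟩ := exists_mem_frontier_of_mem_of_notMem (interior_subset hup') hdown'
    set τ := ε - l * (2 * ε) with hτ
    have heq : r q + s • x + ε • ζ + l • (r q + s • x - ε • ζ - (r q + s • x + ε • ζ)) =
        r q + s • x + τ • ζ := by rw [hτ]; module
    rw [heq] at hlf
    have hτε : |τ| ≤ ε := by
      rw [abs_le, hτ]; constructor <;> nlinarith [hl.1, hl.2]
    obtain ⟨q', hq'N, hpos, hq'⟩ := hsurj _ hlf (by
      rw [add_assoc, add_sub_cancel_left]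
      refine (norm_add_le _ _).trans_lt ?_
      rw [norm_smul, norm_smul, h3.norm_x, h3.norm_ζ, mul_one, mul_one, Real.norm_eq_abs,
        Real.norm_eq_abs, hs]
      have h1 := min_le_right t₀ (δ / 2)
      have h2 := min_le_right (η / 2) (δ / 4)
      linarith)
    set k := ‖r q + s • x + τ • ζ‖ with hk
    have hk0 : k ≠ 0 := hpos.ne'
    have hrq' : r q' = k⁻¹ • (r q + (s • x + (0 : ℝ) • v + τ • ζ)) := by
      rw [zero_smul, add_zero, ← add_assoc, hq', smul_smul, inv_mul_cancel₀ hk0, one_smul]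
    have ha' : a q' = k⁻¹ * (a q + s) := by
      simp only [a]; rw [hrq', inner_smul_right, inner_add_right, h3.inner_x]
    have hb' : b q' = k⁻¹ * b q := by
      simp only [b]; rw [hrq', inner_smul_right, inner_add_right, h3.inner_v, add_zero]
    have hc' : c q' = k⁻¹ * (c q + τ) := by
      simp only [c]; rw [hrq', inner_smul_right, inner_add_right, h3.inner_ζ]
    have hb'0 : 0 < b q' := by rw [hb']; positivity
    have hq'X : q' ∈ X := by
      refine ⟨hq'N, hb'0.le, ?_⟩
      rw [hb', hrq', orthRest_smul, h3.orthRest_add, hqX'.1.2.2, smul_smul]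
    have hh' : c q' / b q' = c q / b q + τ / b q := by
      rw [hc', hb']; field_simp
    have hτ0 : τ ≤ 0 := by
      have h1 := hmax q' hq'X hb'0
      rw [hh'] at h1
      have h2 : τ / b q ≤ 0 := by linarith
      by_contra! h
      exact absurd (div_pos h hbq) (not_lt.2 h2)
    refine ⟨τ, hτ0, hA.cone.mem_of_frontier hlf, fun h0 => ⟨q', ?_, ?_, ?_⟩⟩
    · refine hmemX' q' hq'X hb'0 ?_
      rw [hh', h0, zero_div, add_zero]; exact hbig
    · rw [hh', h0, zero_div, add_zero]
    · rw [ha', hb']; field_simp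
  obtain ⟨τ, hτ, hτA, -⟩ := cross s₀ (abs_of_pos hs₀0)
  obtain ⟨τ', hτ', hτA', hτ0⟩ := cross (-s₀) (by rw [abs_neg, abs_of_pos hs₀0])
  -- The midpoint of the two shifted points lies in the convex cone `A`, at relative height `(τ +
  -- τ') / 2`, and `A` contains nothing below `r q`.
  have hsum : τ' = 0 := by
    by_contra hne
    have hlt : τ' < 0 := lt_of_le_of_ne hτ' hne
    refine hdown (-((τ + τ') / 2)) (by linarith) ?_
    have := hA.cone.smul_mem (t := 1 / 2) (by norm_num) (hA.cone.add_mem hτA hτA')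
    convert this using 1
    module
  obtain ⟨q', hq', h1, h2⟩ := hτ0 hsum
  have h4 : a q / b q ≤ a q' / b q' := hqmin (show q' ∈ X' ∩ _ from ⟨hq', h1.trans hqh⟩)
  rw [h2] at h4
  have : 0 < s₀ / b q := by positivity
  rw [neg_div] at h4
  linarith

/-- The hypersurface does not enter the interior of `C` near the midpoint of a half leaf. -/
theorem eventually_notMem_interior [T2Space M] [CompactSpace M] (h3 : IsOrthoTriple x v ζ)
    (hC : IsSolidCone C) (hCD : frontier C = D) (hζ : ζ ∈ interior C) (hxC : x ∈ C) (hxC' : -x ∈ C)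
    {γ : ℝ → M} (hγ : Continuous γ)
    (hleaf : ∀ θ, γ θ ∈ leafSet r x v V D ∧ r (γ θ) = circlePt x v θ) :
    ∀ᶠ q in 𝓝 (γ (Real.pi / 2)), r q ∉ interior C := by
  have hrc := hr.continuous
  have hbc : Continuous fun q => ⟪v, r q⟫ := continuous_const.inner hrc
  have hρc : Continuous fun q => orthRest x v ζ (r q) := (continuous_orthRest x v ζ).comp hrc
  let P : Set M := {q | (0 ≤ ⟪v, r q⟫ → orthRest x v ζ (r q) = 0 → q ∈ γ '' Set.Icc 0 Real.pi) ∧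
    (r q ∈ interior C → ∃ A, IsConeChart r A q ∧ ∃ t₀ : ℝ, 0 < t₀ ∧
      ∀ t, 0 < t → t ≤ t₀ → r q + t • ζ ∈ interior A)}
  have hΓ : IsCompact (γ '' Set.Icc 0 Real.pi) := isCompact_Icc.image hγ
  have hΓP : γ '' Set.Icc 0 Real.pi ⊆ interior P := by
    rintro _ ⟨θ, hθ, rfl⟩
    exact mem_interior_iff_mem_nhds.2
      ((hr.eventually_mem_image_Icc h3 hC hCD hζ hγ hleaf hθ).and
        (hr.eventually_exists_chart hC hCD hζ (hleaf θ).1))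
  obtain ⟨N, hN, hΓN, hNP⟩ := exists_compact_between hΓ isOpen_interior hΓP
  -- `m` bounds from below the component off the half plane on the rim of `N`. As `⟪v, r q⟫ ≤ 1`, a
  -- slice with `‖z‖ < m` does not meet the rim.
  obtain ⟨m, hm, hmN⟩ : ∃ m : ℝ, 0 < m ∧
      ∀ q ∈ (N \ interior N) ∩ {q | 0 ≤ ⟪v, r q⟫}, m ≤ ‖orthRest x v ζ (r q)‖ := by
    refine ((hN.diff isOpen_interior).inter_right
      (isClosed_le continuous_const hbc)).exists_forall_le' hρc.norm.continuousOn ?_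
    rintro q ⟨⟨hqN, hqi⟩, hqb⟩
    refine norm_pos_iff.2 fun h0 => hqi ?_
    exact hΓN ((interior_subset (hNP hqN)).1 hqb h0)
  have hπ : Real.pi / 2 ∈ Set.Icc 0 Real.pi := ⟨by positivity, by linarith [Real.pi_pos]⟩
  have h1 : ⟪v, r (γ (Real.pi / 2))⟫ = 1 := by
    rw [(hleaf _).2, IsOrthoTriple.circlePt_eq (ζ := ζ), h3.inner_v, Real.sin_pi_div_two]
  have h2 : orthRest x v ζ (r (γ (Real.pi / 2))) = 0 := by
    rw [(hleaf _).2, IsOrthoTriple.circlePt_eq (ζ := ζ), h3.orthRest_combo]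
  have e1 : ∀ᶠ q in 𝓝 (γ (Real.pi / 2)), 0 < ⟪v, r q⟫ :=
    hbc.continuousAt.eventually (lt_mem_nhds (by simp [h1]))
  have e2 : ∀ᶠ q in 𝓝 (γ (Real.pi / 2)), ‖orthRest x v ζ (r q)‖ < m * ⟪v, r q⟫ := by
    refine ContinuousAt.eventually_lt hρc.norm.continuousAt
      (continuous_const.mul hbc).continuousAt ?_
    rw [h1, h2, norm_zero, mul_one]; exact hm
  filter_upwards [mem_interior_iff_mem_nhds.1 (hΓN ⟨_, hπ, rfl⟩), e1, e2] with q hqN hb hρ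
  refine hr.notMem_interior_of_slice h3 hC hCD hζ hxC hxC' hleaf hN
    (fun q' hq' => (interior_subset (hNP hq')).1) (fun q' hq' => (interior_subset (hNP hq')).2)
    (z := ⟪v, r q⟫⁻¹ • orthRest x v ζ (r q)) ?_ hqN hb ?_
  · intro q' hq'N hb' hρ'
    by_contra hcon
    have h4 := hmN q' ⟨⟨hq'N, hcon⟩, hb'⟩
    rw [hρ', norm_smul, norm_smul, norm_inv, Real.norm_of_nonneg hb', Real.norm_of_nonneg hb.le]
      at h4
    have h5 : ⟪v, r q'⟫ ≤ 1 := by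
      have := real_inner_le_norm v (r q')
      rwa [h3.norm_v, hr.norm_eq, mul_one] at this
    have h6 : ⟪v, r q⟫⁻¹ * ‖orthRest x v ζ (r q)‖ < m := by
      rw [inv_mul_lt_iff₀ hb, mul_comm]; exact hρ
    have h7 : 0 ≤ ⟪v, r q⟫⁻¹ * ‖orthRest x v ζ (r q)‖ := by positivity
    nlinarith
  · rw [smul_smul, mul_inv_cancel₀ hb.ne', one_smul]

end IsLocallyConeBoundary

theorem inner_circlePt_add_pi_div_two {x v : E} (hx : ‖x‖ = 1) (hv : ‖v‖ = 1) (hxv : ⟪x, v⟫ = 0)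
    (θ : ℝ) : ⟪circlePt x v θ, circlePt x v (θ + Real.pi / 2)⟫ = 0 := by
  simp [circlePt, Real.cos_add_pi_div_two, Real.sin_add_pi_div_two, inner_add_left,
    inner_add_right, inner_smul_left, inner_smul_right, hxv, real_inner_comm x v, hx, hv]
  ring

/-- Since `V` is a linear subspace of `C`, subtracting components along `x` and `v` does not leave
the interior of `C`. -/
theorem IsSolidCone.exists_orthoTriple (hC : IsSolidCone C) (h0 : (0 : E) ∉ interior C)
    (hx : ‖x‖ = 1) (hv : ‖v‖ = 1) (hxv : ⟪x, v⟫ = 0) (hxV : x ∈ V) (hvV : v ∈ V)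
    (hVC : (V : Set E) ⊆ C) : ∃ ζ ∈ interior C, IsOrthoTriple x v ζ := by
  obtain ⟨a, ha⟩ := hC.nonempty_interior
  set b := a - ⟪x, a⟫ • x - ⟪v, a⟫ • v with hb
  have hvx : ⟪v, x⟫ = 0 := by rw [real_inner_comm, hxv]
  have hbC : b ∈ interior C := by
    have h1 : -(⟪x, a⟫ • x + ⟪v, a⟫ • v) ∈ C :=
      hVC (V.neg_mem (V.add_mem (V.smul_mem _ hxV) (V.smul_mem _ hvV)))
    have h2 := hC.add_mem_interior h1 ha
    convert h2 using 1
    rw [hb]; abel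
  have hb0 : b ≠ 0 := fun h => h0 (h ▸ hbC)
  have hxb : ⟪x, b⟫ = 0 := by
    simp [hb, inner_sub_right, inner_smul_right, hxv, hx]
  have hvb : ⟪v, b⟫ = 0 := by
    simp [hb, inner_sub_right, inner_smul_right, hvx, hv]
  refine ⟨‖b‖⁻¹ • b, hC.smul_mem_interior (inv_pos.2 (norm_pos_iff.2 hb0)) hbC,
    hx, hv, ?_, hxv, ?_, ?_⟩
  · rw [norm_smul, norm_inv, norm_norm, inv_mul_cancel₀ (norm_ne_zero_iff.2 hb0)]
  · rw [inner_smul_right, hxb, mul_zero]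
  · rw [inner_smul_right, hvb, mul_zero]

namespace IsLocallyConeBoundary

variable (hr : IsLocallyConeBoundary r)
include hr

/-- Near the leaf set, the hypersurface coincides with the boundary of the tangent cone. -/
theorem eventually_mem_of_leafSet [FiniteDimensional ℝ E] [T2Space M] [CompactSpace M]
    (hxV : x ∈ V) (hvV : v ∈ V) (hx : ‖x‖ = 1) (hv : ‖v‖ = 1) (hxv : ⟪x, v⟫ = 0)
    (hmin : ∀ q A, ∀ h : IsConeChart r A q,
      Module.finrank ℝ V ≤ Module.finrank ℝ (h.cone.faceSpan (r q)))
    {p : M} (hp : p ∈ leafSet r x v V D) : ∀ᶠ q in 𝓝 p, r q ∈ D := by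
  obtain ⟨t, ht⟩ := hp.1
  obtain ⟨γ, hγ, hγ0, hγl⟩ := hr.exists_leaf hxV hvV hx hv hxv hmin hp ht
  -- The circle is reparametrized so that `p` becomes the midpoint of the half leaf, at angle `π /
  -- 2`.
  set x' := circlePt x v (t - Real.pi / 2) with hx'
  set v' := circlePt x v t with hv'
  have hrot : ∀ θ, circlePt x' v' θ = circlePt x v (t - Real.pi / 2 + θ) := by
    intro θ
    rw [circlePt_add x v (t - Real.pi / 2) θ, sub_add_cancel]
    rfl
  obtain ⟨A, hA⟩ := hr.exists_chart p
  obtain ⟨hAV, hAD⟩ := hp.2 A hA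
  have hT := hA.cone.tangentSolidCone_isSolidCone (r p)
  have hVT : (V : Set E) ⊆ tangentSolidCone A (r p) := by
    rw [← hAV]; exact hA.cone.faceSpan_subset_tangentSolidCone _
  have hx'V : x' ∈ V := circlePt_mem hxV hvV _
  have hv'V : v' ∈ V := circlePt_mem hxV hvV _
  obtain ⟨ζ, hζ, h3⟩ := hT.exists_orthoTriple (x := x') (v := v')
    (hT.interior_notMem_zero ⟨0, hA.cone.zero_mem_frontier_tangentSolidCone hA.mem_frontier⟩)
    (norm_circlePt hx hv hxv _) (norm_circlePt hx hv hxv _) (by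
      have := inner_circlePt_add_pi_div_two hx hv hxv (t - Real.pi / 2)
      rwa [sub_add_cancel] at this) hx'V hv'V hVT
  have hleaf : ∀ θ, γ (θ - Real.pi / 2) ∈ leafSet r x' v' V D ∧
      r (γ (θ - Real.pi / 2)) = circlePt x' v' θ := by
    intro θ
    have h1 : r (γ (θ - Real.pi / 2)) = circlePt x' v' θ := by
      rw [(hγl _).2, hrot]; congr 1; ring
    exact ⟨⟨⟨θ, h1⟩, (hγl _).1.2⟩, h1⟩
  have h := hr.eventually_notMem_interior h3 hT hAD hζ (hVT hx'V) (hVT (V.neg_mem hx'V))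
    (γ := fun θ => γ (θ - Real.pi / 2)) (hγ.comp (continuous_id.sub continuous_const)) hleaf
  simp only [sub_self, hγ0] at h
  filter_upwards [h, hA.eventually] with q hq hqA
  rw [← hAD, hT.mem_frontier]
  exact ⟨subset_tangentSolidCone _ _ hqA.mem, hq⟩

end IsLocallyConeBoundary

end HalfLeaf

/-! ### Continuous families of lifts. -/

section LiftFamily

variable {E M : Type*} [NormedAddCommGroup E] [TopologicalSpace M] [T2Space M] [CompactSpace M]
  {r : M → E}

/-- Lifts of a continuous family of curves depend continuously on the parameter. -/
theorem continuousOn_lift_family (hr : Continuous r) (hli : IsLocallyInjective r) {A : Type*}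
    [TopologicalSpace A] {c : A × ℝ → E} (hc : Continuous c) {Ψ : A → ℝ → M} {T : ℝ}
    (hΨ : ∀ a, ContinuousOn (Ψ a) (Set.Icc 0 T)) (h0 : Continuous fun a => Ψ a 0)
    (hΨc : ∀ a, ∀ s ∈ Set.Icc 0 T, r (Ψ a s) = c (a, s)) :
    ContinuousOn (fun z : A × ℝ => Ψ z.1 z.2) (Set.univ ×ˢ Set.Icc 0 T) := by
  -- Near `(a₁, s₀)` the lifts are trapped in a compact set on which `r` is injective, so continuity
  -- in the parameter at one time spreads to all nearby times.
  have key : ∀ a₁, ∀ s₀ ∈ Set.Icc 0 T, ∃ ε : ℝ, 0 < ε ∧ ∀ s₁ ∈ Set.Icc 0 T, |s₁ - s₀| < ε →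
      ContinuousAt (fun a => Ψ a s₁) a₁ → ∀ s ∈ Set.Icc 0 T, |s - s₀| < ε →
        ContinuousWithinAt (fun z : A × ℝ => Ψ z.1 z.2) (Set.univ ×ˢ Set.Icc 0 T) (a₁, s) := by
    intro a₁ s₀ hs₀
    obtain ⟨U, hU, -, hUc, hinj, η, hη, hstay⟩ := exists_nhds_of_locallyInjective hr hli
      (Filter.univ_mem : Set.univ ∈ 𝓝 (Ψ a₁ s₀))
    have h1 : ∀ᶠ z in 𝓝 (a₁, s₀), ‖c z - r (Ψ a₁ s₀)‖ < η := by
      rw [hΨc a₁ s₀ hs₀]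
      have := hc.continuousAt (x := (a₁, s₀)) |>.eventually (Metric.ball_mem_nhds _ hη)
      filter_upwards [this] with z hz
      rwa [dist_eq_norm] at hz
    obtain ⟨N, hN, S₁, hS₁, hNS⟩ := mem_nhds_prod_iff.1 h1
    have h2 : ∀ᶠ s in 𝓝[Set.Icc 0 T] s₀, Ψ a₁ s ∈ interior U :=
      hΨ a₁ s₀ hs₀ (isOpen_interior.mem_nhds (mem_interior_iff_mem_nhds.2 hU))
    rw [eventually_nhdsWithin_iff] at h2
    obtain ⟨ε, hε, hball⟩ := Metric.eventually_nhds_iff.1 (h2.and hS₁)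
    refine ⟨ε, hε, fun s₁ hs₁ hs₁ε hcont s hs hsε => ?_⟩
    have h3 : ∀ᶠ a in 𝓝 a₁, a ∈ N ∧ Ψ a s₁ ∈ U :=
      Filter.Eventually.and hN ((hcont.eventually (isOpen_interior.mem_nhds
        ((hball (y := s₁) hs₁ε).1 hs₁))).mono fun a ha => interior_subset ha)
    obtain ⟨N', hN', hN'o, ha₁⟩ := eventually_nhds_iff.1 h3
    have hmem : ∀ {s : ℝ}, s ∈ Set.Ioo (s₀ - ε) (s₀ + ε) ↔ |s - s₀| < ε := by
      intro s
      rw [abs_lt, Set.mem_Ioo]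
      constructor <;> rintro ⟨h, h'⟩ <;> constructor <;> linarith
    have hin : ∀ z ∈ N' ×ˢ (Set.Icc 0 T ∩ Set.Ioo (s₀ - ε) (s₀ + ε)), Ψ z.1 z.2 ∈ U := by
      rintro ⟨a, s⟩ ⟨ha, hs⟩
      refine hstay (Z := ℝ) (S := Set.Icc 0 T ∩ Set.Ioo (s₀ - ε) (s₀ + ε)) (h := Ψ a)
        (Set.OrdConnected.isPreconnected inferInstance)
        ((hΨ a).mono Set.inter_subset_left) ?_ s₁ ⟨hs₁, hmem.2 hs₁ε⟩ (hN' a ha).2 s hs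
      intro s' hs'
      rw [hΨc a s' hs'.1]
      exact hNS ⟨(hN' a ha).1, (hball (y := s') (hmem.1 hs'.2)).2⟩
    have hcon : ContinuousOn (fun z : A × ℝ => Ψ z.1 z.2)
        (N' ×ˢ (Set.Icc 0 T ∩ Set.Ioo (s₀ - ε) (s₀ + ε))) := by
      refine continuousOn_of_comp hUc hr hinj hin (hc.continuousOn.congr ?_)
      rintro ⟨a, s⟩ ⟨-, hs⟩
      exact hΨc a s hs.1
    refine (hcon (a₁, s) ⟨ha₁, hs, hmem.2 hsε⟩).mono_of_mem_nhdsWithin ?_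
    rw [nhdsWithin_prod_eq, nhdsWithin_univ]
    refine Filter.prod_mem_prod (hN'o.mem_nhds ha₁) ?_
    exact Filter.inter_mem self_mem_nhdsWithin
      (mem_nhdsWithin_of_mem_nhds (isOpen_Ioo.mem_nhds (hmem.2 hsε)))
  rintro ⟨a₁, s⟩ ⟨-, hs⟩
  have hslice : ∀ s ∈ Set.Icc 0 T, ContinuousWithinAt (fun z : A × ℝ => Ψ z.1 z.2)
      (Set.univ ×ˢ Set.Icc 0 T) (a₁, s) → ContinuousAt (fun a => Ψ a s) a₁ := by
    intro s hs h
    rw [← continuousWithinAt_univ]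
    exact h.comp (f := fun a => (a, s)) (Continuous.continuousWithinAt (by fun_prop))
      fun a _ => ⟨trivial, hs⟩
  have hcont : ContinuousAt (fun a => Ψ a s) a₁ := by
    have h00 : (0 : ℝ) ∈ Set.Icc 0 T := ⟨le_rfl, hs.1.trans hs.2⟩
    -- Continuity in the parameter is a locally constant property of the time, and it holds at time
    -- 0.
    refine (isPreconnected_Icc (a := (0 : ℝ)) (b := T)).induction₂
      (fun s s' => ContinuousAt (fun a => Ψ a s) a₁ ↔ ContinuousAt (fun a => Ψ a s') a₁)
      ?_ (fun _ _ _ _ _ _ h h' => h.trans h') (fun _ _ _ _ h => h.symm) h00 hs |>.1 h0.continuousAt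
    intro s₀ hs₀
    obtain ⟨ε, hε, h⟩ := key a₁ s₀ hs₀
    have : ∀ᶠ s in 𝓝 s₀, |s - s₀| < ε := Metric.ball_mem_nhds s₀ hε
    filter_upwards [mem_nhdsWithin_of_mem_nhds this, self_mem_nhdsWithin] with s' hs' hs'I
    exact ⟨fun hh => hslice s' hs'I (h s₀ hs₀ (by simpa using hε) hh s' hs'I hs'),
      fun hh => hslice s₀ hs₀ (h s' hs'I hs' hh s₀ hs₀ (by simpa using hε))⟩
  obtain ⟨ε, hε, h⟩ := key a₁ s hs
  exact h s hs (by simpa using hε) hcont s hs (by simpa using hε)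

omit [T2Space M] [CompactSpace M] in
/-- A lift extends as long as the curve can be lifted to a set on which `r` is injective. -/
theorem exists_lift_extend (hr : Continuous r) {U G : Set M} (hUc : IsCompact U)
    (hinj : Set.InjOn r U) {c : ℝ → E} (hc : Continuous c) {g : ℝ → M} {T T' : ℝ} (hT : 0 ≤ T)
    (hg : ContinuousOn g (Set.Icc 0 T)) (hgc : ∀ s ∈ Set.Icc 0 T, g s ∈ G ∧ r (g s) = c s)
    (hgT : g T ∈ U) (h : ∀ s ∈ Set.Icc T T', ∃ q ∈ U, q ∈ G ∧ r q = c s) :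
    HasLift r G c (g 0) T' := by
  have : Nonempty M := ⟨g 0⟩
  rcases lt_or_ge T' T with hTT | hTT
  · have hsub : Set.Icc 0 T' ⊆ Set.Icc 0 T := Set.Icc_subset_Icc_right hTT.le
    exact ⟨g, hg.mono hsub, rfl, fun s hs => hgc s (hsub hs)⟩
  choose! g' hg'U hg'G hg'c using h
  have hg'T : g' T = g T := hinj (hg'U T ⟨le_rfl, hTT⟩) hgT (by
    rw [hg'c T ⟨le_rfl, hTT⟩, (hgc T ⟨hT, le_rfl⟩).2])
  have hg' : ContinuousOn g' (Set.Icc T T') :=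
    continuousOn_of_comp hUc hr hinj hg'U (hc.continuousOn.congr hg'c)
  refine ⟨fun s => if s ≤ T then g s else g' s, ?_, by simp [hT], fun s hs => ?_⟩
  · refine ContinuousOn.if ?_ (hg.mono ?_) (hg'.mono ?_)
    · rintro s ⟨-, hs⟩
      have : s = T := by
        have := frontier_Iic_subset T hs
        simpa using this
      rw [this, hg'T]
    · rintro s ⟨hs, hs'⟩
      have : s ≤ T := by
        have h := closure_mono (le_refl _) hs'
        simpa using (isClosed_Iic (a := T)).closure_subset_iff.2 (fun _ h => h) h
      exact ⟨hs.1, this⟩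
    · rintro s ⟨hs, hs'⟩
      have h1 : {a : ℝ | ¬a ≤ T} ⊆ Set.Ici T := fun a ha => (not_le.1 ha).le
      have : s ∈ Set.Ici T := (isClosed_Ici (a := T)).closure_subset_iff.2 h1 hs'
      exact ⟨this, hs.2⟩
  · by_cases hsT : s ≤ T
    · simp only [if_pos hsT]; exact hgc s ⟨hs.1, hsT⟩
    · simp only [if_neg hsT]
      exact ⟨hg'G s ⟨(not_le.1 hsT).le, hs.2⟩, hg'c s ⟨(not_le.1 hsT).le, hs.2⟩⟩

end LiftFamily

/-! ### Germs of cone boundaries: inclusion implies equality. -/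

section FrontierComparison

variable {E : Type*} [NormedAddCommGroup E] [InnerProductSpace ℝ E] {A C : Set E} {w : E}

theorem Convex.exists_mem_frontier {S : Set E} (hS : Convex ℝ S) {x y : E} (hx : x ∈ S)
    (hxA : x ∈ A) (hy : y ∈ S) (hyA : y ∉ A) : ∃ b ∈ S, b ∈ frontier A := by
  obtain ⟨s, hs, h⟩ := exists_mem_frontier_of_mem_of_notMem hxA hyA
  exact ⟨_, hS.add_smul_sub_mem hx hy hs, h⟩

/-- If near `w` the boundary of `C` is contained in the boundary of `A`, then it coincides
with it. -/
theorem IsSolidCone.frontier_subset_of_frontier_subset (hA : IsSolidCone A) (hC : IsSolidCone C)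
    (hwC : w ∈ frontier C) {δ : ℝ} (hδ : 0 < δ)
    (h : ∀ b, ‖b - w‖ < δ → b ∈ frontier C → b ∈ frontier A) :
    ∃ δ' : ℝ, 0 < δ' ∧ ∀ b, ‖b - w‖ < δ' → b ∈ frontier A → b ∈ frontier C := by
  have hwA : w ∈ frontier A := h w (by simpa using hδ) hwC
  have hsmall : ∀ {B : Set E}, IsSolidCone B → ∃ ζ ∈ interior B, ‖ζ‖ < δ / 2 := by
    intro B hB
    obtain ⟨ζ, hζ⟩ := hB.nonempty_interior
    refine ⟨(δ / 2 / (‖ζ‖ + 1)) • ζ, hB.smul_mem_interior (by positivity) hζ, ?_⟩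
    rw [norm_smul, Real.norm_of_nonneg (by positivity), div_mul_eq_mul_div,
      div_lt_iff₀ (by positivity)]
    nlinarith [norm_nonneg ζ]
  obtain ⟨ζ, hζ, hζδ⟩ := hsmall hA
  -- the line in the direction `ζ` crosses the boundary of `C`
  have hcross : ∃ σ : ℝ, |σ| = 1 ∧ w + σ • ζ ∈ interior C ∧ w - σ • ζ ∉ C := by
    have hSo : IsOpen (interior A ∩ Metric.ball w δ) := isOpen_interior.inter Metric.isOpen_ball
    have hSc : Convex ℝ (interior A ∩ Metric.ball w δ) :=
      hA.convex.interior.inter (convex_ball w δ)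
    have hwζ : w + ζ ∈ interior A ∩ Metric.ball w δ := by
      refine ⟨hA.add_mem_interior (hA.mem_of_frontier hwA) hζ, ?_⟩
      rw [mem_ball_iff_norm, add_sub_cancel_left]; linarith
    have hSd : ¬ ((interior A ∩ Metric.ball w δ) ∩ frontier C).Nonempty := by
      rintro ⟨b, ⟨hb, hbδ⟩, hbC⟩
      exact (hA.mem_frontier.1 (h b (mem_ball_iff_norm.1 hbδ) hbC)).2 hb
    -- The convex set `interior A ∩ ball` misses the boundary of `C`, so it lies in the interior of
    -- `C` or outside `C`. In the latter case a separating hyperplane puts `A` on its negative side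
    -- near `w`; the positive side then contains no boundary of `C`, and so consists of interior
    -- points of `C` near `w`.
    by_cases hd : Disjoint (interior A ∩ Metric.ball w δ) C
    · obtain ⟨f, u, hfu, huf⟩ := geometric_hahn_banach_open hSc hSo hC.convex hd
      have hlim : ∀ b ∈ A, ‖b - w‖ < δ → f b ≤ u := by
        intro b hb hbδ
        have hc : Filter.Tendsto (fun s : ℝ => b + s • ζ) (𝓝[>] 0) (𝓝 b) :=
          (Continuous.tendsto' (by fun_prop) _ _ (by simp)).mono_left nhdsWithin_le_nhds
        refine le_of_tendsto ((f.continuous.tendsto b).comp hc) ?_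
        filter_upwards [hc.eventually (Metric.isOpen_ball.mem_nhds
          (mem_ball_iff_norm.2 hbδ)), self_mem_nhdsWithin] with s hs hs0
        exact (hfu _ ⟨hA.add_mem_interior hb (hA.smul_mem_interior hs0 hζ), hs⟩).le
      have hwCm := hC.mem_of_frontier hwC
      have h1 : f w ≤ u := hlim w (hA.mem_of_frontier hwA) (by simpa using hδ)
      have h2 := huf w hwCm
      have h3 := huf _ (hC.smul_mem (t := 2) (by norm_num) hwCm)
      have h4 := huf _ hC.zero_mem
      rw [map_smul, smul_eq_mul] at h3
      rw [map_zero] at h4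
      have hu : u = 0 := by linarith
      subst hu
      have hfw : f w = 0 := le_antisymm h1 h2
      have hfζ : f ζ < 0 := by
        have := hfu _ hwζ
        rwa [map_add, hfw, zero_add] at this
      obtain ⟨c, hc, hcδ⟩ := hsmall hC
      have hfc : 0 < f c := by
        have hcont : Filter.Tendsto (fun s : ℝ => c + s • ζ) (𝓝[>] 0) (𝓝 c) :=
          (Continuous.tendsto' (by fun_prop) _ _ (by simp)).mono_left nhdsWithin_le_nhds
        obtain ⟨s, hs, hs0⟩ := ((hcont.eventually (mem_interior_iff_mem_nhds.1 hc)).and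
          self_mem_nhdsWithin).exists
        have h1 := huf _ hs
        rw [map_add, map_smul, smul_eq_mul] at h1
        have : s * f ζ < 0 := mul_neg_of_pos_of_neg hs0 hfζ
        linarith
      have hHc : Convex ℝ ({b | 0 < f b} ∩ Metric.ball w δ) :=
        (convex_halfSpace_gt f.isLinear 0).inter (convex_ball w δ)
      refine ⟨-1, by simp, ?_, ?_⟩
      · by_contra hcon
        have hwc : w + c ∈ {b | 0 < f b} ∩ Metric.ball w δ := by
          refine ⟨?_, ?_⟩
          · rw [Set.mem_ofPred_eq, map_add, hfw, zero_add]; exact hfc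
          · rw [mem_ball_iff_norm, add_sub_cancel_left]; linarith
        have hwm : w + (-1 : ℝ) • ζ ∈ {b | 0 < f b} ∩ Metric.ball w δ := by
          refine ⟨?_, ?_⟩
          · rw [Set.mem_ofPred_eq, map_add, hfw, zero_add, map_smul, smul_eq_mul]; linarith
          · rw [mem_ball_iff_norm, add_sub_cancel_left, neg_one_smul, norm_neg]; linarith
        have hnot : ∀ b ∈ {b | 0 < f b} ∩ Metric.ball w δ, b ∉ frontier C := by
          rintro b ⟨hb, hbδ⟩ hbC
          have hbA := h b (mem_ball_iff_norm.1 hbδ) hbC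
          exact absurd (hlim b (hA.mem_of_frontier hbA) (mem_ball_iff_norm.1 hbδ)) (not_le.2 hb)
        by_cases hmC : w + (-1 : ℝ) • ζ ∈ C
        · exact hnot _ hwm (hC.mem_frontier.2 ⟨hmC, hcon⟩)
        · obtain ⟨b, hb, hbC⟩ := hHc.exists_mem_frontier hwc
            (interior_subset (hC.add_mem_interior hwCm hc)) hwm hmC
          exact hnot b hb hbC
      · rw [neg_one_smul, sub_neg_eq_add]
        exact fun hm => Set.disjoint_left.1 hd hwζ hm
    · obtain ⟨b, hb, hbC⟩ := Set.not_disjoint_iff.1 hd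
      have hwζC : w + ζ ∈ C := by
        by_contra hcon
        exact hSd (hSc.exists_mem_frontier hb hbC hwζ hcon)
      have hwζi : w + ζ ∈ interior C := by
        by_contra hcon
        exact hSd ⟨_, hwζ, hC.mem_frontier.2 ⟨hwζC, hcon⟩⟩
      refine ⟨1, by simp, by simpa using hwζi, fun hm => (hC.mem_frontier.1 hwC).2 ?_⟩
      have := hC.mem_interior_of_combo hm (y := w + ζ) (s := 1 / 2) hwζi (by norm_num)
        (by norm_num)
      convert this using 1
      module
  obtain ⟨σ, hσ, hin, hout⟩ := hcross
  have h1 : ∀ᶠ a in 𝓝 w, a + σ • ζ ∈ interior C :=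
    (Continuous.continuousAt (by fun_prop) : ContinuousAt (fun a => a + σ • ζ) w).eventually
      (isOpen_interior.mem_nhds hin)
  have h2 : ∀ᶠ a in 𝓝 w, a - σ • ζ ∉ C :=
    (Continuous.continuousAt (by fun_prop) : ContinuousAt (fun a => a - σ • ζ) w).eventually
      (hC.closed.isOpen_compl.mem_nhds hout)
  obtain ⟨ε, hε, hball⟩ := Metric.eventually_nhds_iff.1 (h1.and h2)
  refine ⟨min ε (δ / 2), by positivity, fun a ha haA => ?_⟩
  obtain ⟨ha1, ha2⟩ := hball (y := a) (by rw [dist_eq_norm]; exact ha.trans_le (min_le_left _ _))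
  obtain ⟨l, hl, hlC⟩ := exists_mem_frontier_of_mem_of_notMem (interior_subset ha1) ha2
  set τ := σ - l * (2 * σ) with hτ
  have heq : a + σ • ζ + l • (a - σ • ζ - (a + σ • ζ)) = a + τ • ζ := by rw [hτ]; module
  rw [heq] at hlC
  have hτ1 : |τ| ≤ 1 := by
    rw [hτ, show σ - l * (2 * σ) = (1 - 2 * l) * σ by ring, abs_mul, hσ, mul_one, abs_le]
    constructor <;> linarith [hl.1, hl.2]
  have hlA : a + τ • ζ ∈ frontier A := by
    refine h _ ?_ hlC
    rw [add_sub_right_comm]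
    refine (norm_add_le _ _).trans_lt ?_
    rw [norm_smul, Real.norm_eq_abs]
    have h3 := ha.trans_le (min_le_right _ _)
    have h4 : |τ| * ‖ζ‖ ≤ 1 * ‖ζ‖ := by gcongr
    linarith
  -- Both `a` and `a + τ • ζ` are boundary points of `A`, and a line in the interior direction `ζ`
  -- contains only one.
  have hτ0 : τ = 0 := by
    rcases lt_trichotomy τ 0 with h0 | h0 | h0
    · refine absurd (hA.mem_of_frontier hlA) ?_
      have := hA.frontier_sub_notMem haA (hA.smul_mem_interior (neg_pos.2 h0) hζ)
      rwa [neg_smul, sub_neg_eq_add] at this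
    · exact h0
    · refine absurd (hA.mem_of_frontier haA) ?_
      have := hA.frontier_sub_notMem hlA (hA.smul_mem_interior h0 hζ)
      rwa [add_sub_cancel_right] at this
  rwa [hτ0, zero_smul, add_zero] at hlC

end FrontierComparison

/-! ### Uniform extension of compact families of lifts. -/

section LiftFamily

variable {E M : Type*} [NormedAddCommGroup E] [TopologicalSpace M] [T2Space M] [CompactSpace M]
  {r : M → E}

/-- The lifts of a compact family of curves extend for a uniform time. -/
theorem exists_hasLift_gt_of_compactSpace (hr : Continuous r) (hli : IsLocallyInjective r)
    {B : Type*} [TopologicalSpace B] [CompactSpace B] {f : B → M} (hf : Continuous f)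
    {c : B × ℝ → E} (hc : Continuous c) {G : Set M} {T T₁ : ℝ} (hT0 : 0 ≤ T) (hT : T < T₁)
    (hlift : ∀ a, HasLift r G (fun s => c (a, s)) (f a) T)
    (hloc : ∀ q ∈ G, ∀ W ∈ 𝓝 q, ∃ U ∈ 𝓝 q, U ⊆ W ∧ ∃ δ : ℝ, 0 < δ ∧ ∀ a s, T ≤ s → s ≤ T₁ →
      ‖c (a, s) - r q‖ < δ → ∃ q' ∈ U, q' ∈ G ∧ r q' = c (a, s)) :
    ∃ T' > T, ∀ a, HasLift r G (fun s => c (a, s)) (f a) T' := by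
  choose Ψ hΨ hΨ0 hΨc using hlift
  have hcont := continuousOn_lift_family hr hli hc hΨ (by simpa only [hΨ0] using hf)
    (fun a s hs => (hΨc a s hs).2)
  have hTI : T ∈ Set.Icc 0 T := ⟨hT0, le_rfl⟩
  have hcT : Continuous fun a : B => Ψ a T := by
    rw [← continuousOn_univ]
    exact hcont.comp (f := fun a : B => (a, T)) (by fun_prop) fun a _ => ⟨trivial, hTI⟩
  have key : ∀ a₁ : B, ∃ ε : ℝ, 0 < ε ∧ ∀ᶠ a in 𝓝 a₁,
      HasLift r G (fun s => c (a, s)) (f a) (T + ε) := by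
    intro a₁
    obtain ⟨U₁, hU₁, -, hUc, hinj, -⟩ := exists_nhds_of_locallyInjective hr hli
      (Filter.univ_mem : Set.univ ∈ 𝓝 (Ψ a₁ T))
    obtain ⟨U, hU, hUU, δ, hδ, hsurj⟩ := hloc _ (hΨc a₁ T hTI).1 U₁ hU₁
    have h1 : ∀ᶠ z in 𝓝 (a₁, T), ‖c z - r (Ψ a₁ T)‖ < δ := by
      rw [(hΨc a₁ T hTI).2]
      have := hc.continuousAt (x := (a₁, T)) |>.eventually (Metric.ball_mem_nhds _ hδ)
      filter_upwards [this] with z hz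
      rwa [dist_eq_norm] at hz
    obtain ⟨N, hN, S, hS, hNS⟩ := mem_nhds_prod_iff.1 h1
    obtain ⟨ε, hε, hball⟩ := Metric.mem_nhds_iff.1 hS
    have hε' : 0 < min (ε / 2) (T₁ - T) := lt_min (by linarith) (by linarith)
    refine ⟨min (ε / 2) (T₁ - T), hε', ?_⟩
    filter_upwards [hN, hcT.continuousAt.eventually hU] with a haN haU
    rw [← hΨ0 a]
    refine exists_lift_extend hr hUc hinj (hc.comp (by fun_prop)) hT0 (hΨ a) (hΨc a) (hUU haU) ?_
    intro s hs
    have hs1 := hs.2.trans (add_le_add le_rfl (min_le_left _ _))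
    have hs2 := hs.2.trans (add_le_add le_rfl (min_le_right _ _))
    have hsS : s ∈ S := hball (by
      rw [Metric.mem_ball, Real.dist_eq, abs_lt]; constructor <;> linarith [hs.1])
    obtain ⟨q, hq, hqG, hqr⟩ := hsurj a s hs.1 (by linarith) (hNS (Set.mk_mem_prod haN hsS))
    exact ⟨q, hUU hq, hqG, hqr⟩
  choose ε hε hεl using key
  obtain ⟨F, hF⟩ := CompactSpace.elim_nhds_subcover
    (fun a₁ : B => {a | HasLift r G (fun s => c (a, s)) (f a) (T + ε a₁)}) hεl
  obtain ⟨ε₀, hε₀, hle⟩ : ∃ ε₀ : ℝ, 0 < ε₀ ∧ ∀ a ∈ F, ε₀ ≤ ε a := by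
    rcases F.eq_empty_or_nonempty with rfl | hne
    · exact ⟨1, one_pos, by simp⟩
    · obtain ⟨a₀, -, ha₀⟩ := F.exists_min_image ε hne
      exact ⟨ε a₀, hε a₀, ha₀⟩
  refine ⟨T + ε₀, by linarith, fun a' => ?_⟩
  have hmem : a' ∈ ⋃ a ∈ F, {a' : B | HasLift r G (fun s => c (a', s)) (f a') (T + ε a)} := by
    rw [hF]; trivial
  simp only [Set.mem_iUnion] at hmem
  obtain ⟨a, ha, hl⟩ := hmem
  exact HasLift.mono hl (by linarith [hle a ha])

end LiftFamily

/-! ### The sweep of the tangent boundary from a leaf. -/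

section Sweep

variable {E : Type*} [NormedAddCommGroup E] [InnerProductSpace ℝ E]
variable {M : Type*} [TopologicalSpace M] {r : M → E} {A C : Set E} {p : M}

theorem IsConeChart.of_eventually (hA : IsConeChart r A p) (hC : IsSolidCone C)
    (h : ∀ᶠ q in 𝓝 p, r q ∈ frontier C) : IsConeChart r C p := by
  obtain ⟨U, hU, hi, -⟩ := hA.exists_nhds
  exact ⟨hC, _, Filter.inter_mem hU h, hi.mono Set.inter_subset_left, fun q hq => hq.2⟩

namespace IsSolidCone

theorem add_mem_frontier (hC : IsSolidCone C) {y u : E} (hy : y ∈ frontier C) (hu : u ∈ C)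
    (hu' : -u ∈ C) : y + u ∈ frontier C := by
  rw [hC.mem_frontier] at hy ⊢
  refine ⟨hC.add_mem hy.1 hu, fun h => hy.2 ?_⟩
  have := hC.add_mem_interior hu' h
  rwa [neg_add_cancel_comm_assoc] at this

theorem zero_mem_frontier (hC : IsSolidCone C) (h : (frontier C).Nonempty) :
    (0 : E) ∈ frontier C :=
  hC.mem_frontier.2 ⟨hC.zero_mem, hC.interior_notMem_zero h⟩

/-- `z` is in `A` as the midpoint of `z ± u`. If it were interior, then `z + u`, which lies strictly
between `z` and `z + 2 u`, would be interior too. -/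
theorem mem_frontier_of_chord (hA : IsSolidCone A) {z u : E} (h1 : z - u ∈ frontier A)
    (h2 : z + u ∈ frontier A) (h3 : z + (2 : ℝ) • u ∈ frontier A) : z ∈ frontier A := by
  rw [hA.mem_frontier]
  constructor
  · have := hA.smul_mem (t := 1 / 2) (by norm_num)
      (hA.add_mem (hA.mem_of_frontier h1) (hA.mem_of_frontier h2))
    convert this using 1
    module
  · intro hz
    refine (hA.mem_frontier.1 h2).2 ?_
    have := hA.mem_interior_of_combo (hA.mem_of_frontier h3) hz (s := 1 / 2) (by norm_num)
      (by norm_num)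
    convert this using 1
    module

end IsSolidCone

/-- The unit vectors of the boundary of `C` which are orthogonal to `x` and `v`. -/
def transverseSet (C : Set E) (x v : E) : Set E :=
  {e | e ∈ frontier C ∧ ‖e‖ = 1 ∧ ∀ θ, ⟪circlePt x v θ, e⟫ = 0}

theorem isCompact_transverseSet [FiniteDimensional ℝ E] (C : Set E) (x v : E) :
    IsCompact (transverseSet C x v) := by
  refine Metric.isCompact_of_isClosed_isBounded ?_ ?_
  · have : transverseSet C x v = frontier C ∩ ({e | ‖e‖ = 1} ∩ ⋂ θ, {e | ⟪circlePt x v θ, e⟫ = 0}) := by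
      ext e
      simp only [transverseSet, Set.mem_ofPred_eq, Set.mem_inter_iff, Set.mem_iInter]
    rw [this]
    refine isClosed_frontier.inter ((isClosed_eq continuous_norm continuous_const).inter
      (isClosed_iInter fun θ => isClosed_eq (by fun_prop) continuous_const))
  · refine (Metric.isBounded_closedBall (x := (0 : E)) (r := 1)).subset fun e he => ?_
    rw [mem_closedBall_zero_iff, he.2.1]

/-- A solid cone `C` whose lineality space contains `V`, together with a great circle of `V`; the
dimension of `V` is minimal among the spans of the smallest faces. -/
structure IsLeafCone (r : M → E) (x v : E) (V : Submodule ℝ E) (C : Set E) : Prop where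
  base : IsLocallyConeBoundary r
  cone : IsSolidCone C
  norm_x : ‖x‖ = 1
  norm_v : ‖v‖ = 1
  inner_xv : ⟪x, v⟫ = 0
  mem_x : x ∈ V
  mem_v : v ∈ V
  subset : (V : Set E) ⊆ C
  finrank_le : ∀ q A, ∀ h : IsConeChart r A q,
    Module.finrank ℝ V ≤ Module.finrank ℝ (h.cone.faceSpan (r q))

namespace IsLeafCone

variable {x v : E} {V : Submodule ℝ E} (h : IsLeafCone r x v V C)
include h

theorem circlePt_mem (θ : ℝ) : circlePt x v θ ∈ V := _root_.circlePt_mem h.mem_x h.mem_v θ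

theorem add_mem_frontier {y u : E} (hy : y ∈ frontier C) (hu : u ∈ V) : y + u ∈ frontier C :=
  h.cone.add_mem_frontier hy (h.subset hu) (h.subset (V.neg_mem hu))

theorem norm_circlePt (θ : ℝ) : ‖circlePt x v θ‖ = 1 :=
  _root_.norm_circlePt h.norm_x h.norm_v h.inner_xv θ

/-- This starts the sweep: along the leaf the tangent cone itself can be used as a chart. -/
theorem isConeChart_of_leafSet [FiniteDimensional ℝ E] [T2Space M] [CompactSpace M]
    (hp : p ∈ leafSet r x v V (frontier C)) : IsConeChart r C p := by
  obtain ⟨A, hA⟩ := h.base.exists_chart p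
  exact hA.of_eventually h.cone (h.base.eventually_mem_of_leafSet h.mem_x h.mem_v h.norm_x h.norm_v
    h.inner_xv h.finrank_le hp)

theorem exists_leaf [FiniteDimensional ℝ E] [T2Space M] [CompactSpace M]
    (hp : p ∈ leafSet r x v V (frontier C)) {t : ℝ} (ht : r p = circlePt x v t) :
    ∃ γ : ℝ → M, Continuous γ ∧ γ 0 = p ∧
      ∀ θ, γ θ ∈ leafSet r x v V (frontier C) ∧ r (γ θ) = circlePt x v (t + θ) :=
  h.base.exists_leaf h.mem_x h.mem_v h.norm_x h.norm_v h.inner_xv h.finrank_le hp ht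

/-- The boundary of `C` is invariant under translation by `V`, and the circle point is a nonnegative
multiple of `e` plus an element of `V`. -/
theorem sweep_mem {e : E} (he : e ∈ transverseSet C x v) (θ : ℝ) {s : ℝ} (hs : s ∈ Set.Icc 0 Real.pi) :
    circlePt (circlePt x v θ) e s ∈ frontier C := by
  rw [circlePt, add_comm]
  refine h.add_mem_frontier ?_ (V.smul_mem _ (h.circlePt_mem θ))
  rcases (Real.sin_nonneg_of_mem_Icc hs).eq_or_lt with h0 | h0
  · rw [← h0, zero_smul]; exact h.cone.zero_mem_frontier ⟨e, he.1⟩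
  · exact h.cone.smul_mem_frontier h0 he.1

theorem norm_sweep {e : E} (he : e ∈ transverseSet C x v) (θ s : ℝ) :
    ‖circlePt (circlePt x v θ) e s‖ = 1 :=
  _root_.norm_circlePt (h.norm_circlePt θ) he.2.1 (he.2.2 θ) s

variable [FiniteDimensional ℝ E] [T2Space M] [CompactSpace M]

omit [T2Space M] in
theorem isCompact_leafSet : IsCompact (leafSet r x v V (frontier C)) :=
  (h.base.isClosed_leafSet h.mem_x h.mem_v h.finrank_le).isCompact

omit [FiniteDimensional ℝ E] [T2Space M] [CompactSpace M] h in
theorem continuous_sweep (hr : Continuous r) {B : Type*} [TopologicalSpace B] {f : B → M}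
    {g : B → E} (hf : Continuous f) (hg : Continuous g) :
    Continuous fun z : B × ℝ => circlePt (r (f z.1)) (g z.1) z.2 := by
  unfold circlePt; fun_prop

omit h [FiniteDimensional ℝ E] [T2Space M] [CompactSpace M] in
/-- The parameter space of the sweep: its curves run from the leaf set in transverse directions. -/
abbrev _root_.SweepBase (r : M → E) (x v : E) (V : Submodule ℝ E) (C : Set E) : Type _ :=
  leafSet r x v V (frontier C) × transverseSet C x v

/-- The common time up to which the curves of the sweep lift can be extended. -/
theorem exists_hasLift_gt {T : ℝ} (hT0 : 0 ≤ T) (hT : T < Real.pi / 2)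
    (hlift : ∀ a : SweepBase r x v V C,
      HasLift r {q | IsConeChart r C q} (circlePt (r a.1) a.2) a.1 T) :
    ∃ T' > T, ∀ a : SweepBase r x v V C,
      HasLift r {q | IsConeChart r C q} (circlePt (r a.1) a.2) a.1 T' := by
  have hrc := h.base.continuous
  have : CompactSpace (leafSet r x v V (frontier C)) := isCompact_iff_compactSpace.1 h.isCompact_leafSet
  have : CompactSpace (transverseSet C x v) :=
    isCompact_iff_compactSpace.1 (isCompact_transverseSet C x v)
  refine exists_hasLift_gt_of_compactSpace hrc h.base.isLocallyInjective
    (f := fun a : SweepBase r x v V C => (a.1 : M)) (by fun_prop)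
    (c := fun z => circlePt (r z.1.1) z.1.2 z.2)
    (continuous_sweep hrc (f := fun a : SweepBase r x v V C => (a.1 : M))
      (g := fun a => (a.2 : E)) (by fun_prop) (by fun_prop)) hT0 hT hlift ?_
  intro q hq W hW
  have hU := Filter.inter_mem hW (IsConeChart.eventually hq)
  obtain ⟨δ, hδ, hsurj⟩ := h.base.exists_mem hq _ hU
  refine ⟨_, hU, Set.inter_subset_left, δ, hδ, fun a s hs hs' hd => ?_⟩
  obtain ⟨θ, hθ⟩ := a.1.2.1
  obtain ⟨q', hq', hqr⟩ := hsurj (circlePt (r a.1) a.2 s)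
    (by rw [hθ]; exact h.sweep_mem a.2.2 θ ⟨hT0.trans hs, by linarith [Real.pi_pos]⟩)
    (by rw [hθ]; exact h.norm_sweep a.2.2 θ s) hd
  exact ⟨q', hq', hq'.2, hqr⟩

end IsLeafCone

end Sweep

/-! ### Propagation of the chart along the sweep. -/

section Barrier

variable {E : Type*} [NormedAddCommGroup E] [InnerProductSpace ℝ E]

theorem exists_eq_smul_circlePt (x v : E) {a b : ℝ} (h : 0 < a ^ 2 + b ^ 2) :
    ∃ θ : ℝ, |θ| = Real.arccos (a / Real.sqrt (a ^ 2 + b ^ 2)) ∧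
      a • x + b • v = Real.sqrt (a ^ 2 + b ^ 2) • circlePt x v θ := by
  set k := Real.sqrt (a ^ 2 + b ^ 2) with hk
  have hk0 : 0 < k := Real.sqrt_pos.2 h
  have hk2 : k ^ 2 = a ^ 2 + b ^ 2 := Real.sq_sqrt h.le
  have hak : |a / k| ≤ 1 := by
    rw [abs_div, abs_of_pos hk0, div_le_one hk0]
    exact Real.abs_le_sqrt (by nlinarith [sq_nonneg b])
  have hcos : Real.cos (Real.arccos (a / k)) = a / k :=
    Real.cos_arccos (abs_le.1 hak).1 (abs_le.1 hak).2
  have hsin : Real.sin (Real.arccos (a / k)) = |b| / k := by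
    have h1 : 1 - (a / k) ^ 2 = (|b| / k) ^ 2 := by
      rw [div_pow, div_pow, sq_abs, hk2]
      field_simp
      ring
    rw [Real.sin_arccos, h1, Real.sqrt_sq (by positivity)]
  rcases le_total 0 b with hb | hb
  · refine ⟨Real.arccos (a / k), abs_of_nonneg (Real.arccos_nonneg _), ?_⟩
    rw [circlePt, hcos, hsin, abs_of_nonneg hb, smul_add, smul_smul, smul_smul,
      mul_div_cancel₀ _ hk0.ne', mul_div_cancel₀ _ hk0.ne']
  · refine ⟨-Real.arccos (a / k), by rw [abs_neg, abs_of_nonneg (Real.arccos_nonneg _)], ?_⟩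
    rw [circlePt, Real.cos_neg, Real.sin_neg, hcos, hsin, abs_of_nonpos hb, smul_add, smul_smul,
      smul_smul, mul_div_cancel₀ _ hk0.ne', mul_neg, mul_div_cancel₀ _ hk0.ne', neg_neg]

theorem circlePt_eq_rotate (x v : E) (t θ : ℝ) :
    circlePt x v θ = Real.cos (θ - t) • circlePt x v t +
      Real.sin (θ - t) • circlePt x v (t + Real.pi / 2) := by
  rw [← circlePt_add, add_sub_cancel]

variable {M : Type*} [TopologicalSpace M] {r : M → E} {A C : Set E} {x v : E} {V : Submodule ℝ E}

namespace IsLeafCone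

variable (h : IsLeafCone r x v V C)
include h

/-- If the boundary of `A` contains the part of the boundary of `C` near `r q₀` which lies beyond
`r q₀`, as seen from the directions transverse to the leaf, then `C` is a chart at `q₀`. -/
theorem isConeChart_of_wedge {q₀ : M} (hA : IsConeChart r A q₀) {t₁ T : ℝ}
    (hT : T ∈ Set.Ioc 0 (Real.pi / 2)) {e₁ : E} (he₁ : e₁ ∈ transverseSet C x v)
    (hq₀ : r q₀ = circlePt (circlePt x v t₁) e₁ T) {ε : ℝ} (hε : 0 < ε)
    (H : ∀ e ∈ transverseSet C x v, ‖e - e₁‖ < ε → ∀ a b : ℝ,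
      |a - Real.tan (Real.pi / 2 - T)| < ε → |b| < ε →
      Real.tan (Real.pi / 2 - T) ^ 2 < a ^ 2 + b ^ 2 →
      e + (a • circlePt x v t₁ + b • circlePt x v (t₁ + Real.pi / 2)) ∈ frontier A) :
    IsConeChart r C q₀ := by
  -- `m = cot T`. In coordinates `e + (a x' + b v')`, the curves of the sweep pass through a point
  -- at the time whose cotangent is `√(a² + b²)`, so the points reached before `T` are those outside
  -- the disc of radius `m`.
  set m := Real.tan (Real.pi / 2 - T) with hm
  set x' := circlePt x v t₁ with hx'
  set v' := circlePt x v (t₁ + Real.pi / 2) with hv'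
  have hx'1 : ‖x'‖ = 1 := h.norm_circlePt _
  have hv'1 : ‖v'‖ = 1 := h.norm_circlePt _
  have hxv' : ⟪x', v'⟫ = 0 := inner_circlePt_add_pi_div_two h.norm_x h.norm_v h.inner_xv t₁
  have hvx' : ⟪v', x'⟫ = 0 := by rw [real_inner_comm, hxv']
  have hsT : 0 < Real.sin T := Real.sin_pos_of_pos_of_lt_pi hT.1 (by linarith [hT.2, Real.pi_pos])
  have hmT : m = Real.cos T / Real.sin T := by
    rw [hm, Real.tan_eq_sin_div_cos, Real.sin_pi_div_two_sub, Real.cos_pi_div_two_sub]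
  have hw₀C : r q₀ ∈ frontier C := by
    rw [hq₀]; exact h.sweep_mem he₁ t₁ ⟨hT.1.le, by linarith [hT.2, Real.pi_pos]⟩
  -- chords
  have hchord : ∀ᶠ z : ℝ × ℝ in 𝓝 (m, 0), ∀ e ∈ transverseSet C x v, ‖e - e₁‖ < ε →
      e + (z.1 • x' + z.2 • v') ∈ frontier A := by
    have hj : ∀ j : ℝ, |j| ≤ 2 → j ≠ 0 → ∀ᶠ z : ℝ × ℝ in 𝓝 (m, 0),
        ∀ e ∈ transverseSet C x v, ‖e - e₁‖ < ε →
          e + (z.1 • x' + (z.2 + j * (ε / 4)) • v') ∈ frontier A := by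
      intro j hj hj0
      have e1 : ∀ᶠ z : ℝ × ℝ in 𝓝 (m, 0), |z.1 - m| < ε :=
        (Continuous.continuousAt (by fun_prop) :
          ContinuousAt (fun z : ℝ × ℝ => |z.1 - m|) (m, 0)).eventually (gt_mem_nhds (by simpa))
      have e2 : ∀ᶠ z : ℝ × ℝ in 𝓝 (m, 0), |z.2 + j * (ε / 4)| < ε :=
        (Continuous.continuousAt (by fun_prop) :
          ContinuousAt (fun z : ℝ × ℝ => |z.2 + j * (ε / 4)|) (m, 0)).eventually
          (gt_mem_nhds (by
            simp only [zero_add, abs_mul, abs_of_pos (show 0 < ε / 4 by positivity)]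
            nlinarith))
      have e3 : ∀ᶠ z : ℝ × ℝ in 𝓝 (m, 0), m ^ 2 < z.1 ^ 2 + (z.2 + j * (ε / 4)) ^ 2 :=
        (Continuous.continuousAt (by fun_prop) :
          ContinuousAt (fun z : ℝ × ℝ => z.1 ^ 2 + (z.2 + j * (ε / 4)) ^ 2) (m, 0)).eventually
          (lt_mem_nhds (by
            have : 0 < (j * (ε / 4)) ^ 2 := by positivity
            simp only [zero_add]; linarith))
      filter_upwards [e1, e2, e3] with z h1 h2 h3 e he hee
      exact H e he hee _ _ h1 h2 h3
    -- The chord in the direction `v'` through a point near `(m, 0)` is tangent to the disc up to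
    -- small errors; its points at offsets `-1`, `1` and `2` times `ε / 4` lie outside the disc, as
    -- `mem_frontier_of_chord` requires.
    filter_upwards [hj (-1) (by norm_num) (by norm_num), hj 1 (by norm_num) (by norm_num),
      hj 2 (by norm_num) (by norm_num)] with z h1 h2 h3 e he hee
    refine hA.cone.mem_frontier_of_chord (u := (ε / 4) • v') ?_ ?_ ?_
    · convert h1 e he hee using 1; module
    · convert h2 e he hee using 1; module
    · convert h3 e he hee using 1; module
  -- `N b` is the component of `b` orthogonal to the circle; normalized, it is the transverse
  -- direction `e` of `b`.
  let N : E → E := fun b => b - ⟪x', b⟫ • x' - ⟪v', b⟫ • v'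
  have hNc : Continuous N := by simp only [N]; fun_prop
  have hxe : ⟪x', e₁⟫ = 0 := he₁.2.2 _
  have hve : ⟪v', e₁⟫ = 0 := he₁.2.2 _
  have hxw : ⟪x', r q₀⟫ = Real.cos T := by
    rw [hq₀]; simp [circlePt, inner_add_right, inner_smul_right, hxe, hx'1]
  have hvw : ⟪v', r q₀⟫ = 0 := by
    rw [hq₀, circlePt, inner_add_right, inner_smul_right, inner_smul_right, hve, hvx']; simp
  have hNw : N (r q₀) = Real.sin T • e₁ := by
    simp only [N, hxw, hvw]
    rw [hq₀, circlePt]; module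
  have hNn : ‖N (r q₀)‖ = Real.sin T := by
    rw [hNw, norm_smul, he₁.2.1, mul_one, Real.norm_of_nonneg hsT.le]
  have e1 : ∀ᶠ b in 𝓝 (r q₀), 0 < ‖N b‖ :=
    hNc.norm.continuousAt.eventually (lt_mem_nhds (by simpa [hNn] using hsT))
  have e2 : ∀ᶠ b in 𝓝 (r q₀), ‖‖N b‖⁻¹ • N b - e₁‖ < ε := by
    have hc : ContinuousAt (fun b => ‖‖N b‖⁻¹ • N b - e₁‖) (r q₀) := by
      refine (((hNc.norm.continuousAt.inv₀ ?_).smul hNc.continuousAt).sub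
        continuousAt_const).norm
      rw [hNn]; exact hsT.ne'
    refine hc.eventually (gt_mem_nhds ?_)
    change ‖‖N (r q₀)‖⁻¹ • N (r q₀) - e₁‖ < ε
    rw [hNn, hNw, smul_smul, inv_mul_cancel₀ hsT.ne', one_smul, sub_self, norm_zero]
    exact hε
  have e3 : ∀ᶠ b in 𝓝 (r q₀), ∀ e ∈ transverseSet C x v, ‖e - e₁‖ < ε →
      e + ((⟪x', b⟫ / ‖N b‖) • x' + (⟪v', b⟫ / ‖N b‖) • v') ∈ frontier A := by
    have hc : ContinuousAt (fun b => (⟪x', b⟫ / ‖N b‖, ⟪v', b⟫ / ‖N b‖)) (r q₀) := by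
      refine ContinuousAt.prodMk
        (ContinuousAt.div (by fun_prop) hNc.norm.continuousAt (by rw [hNn]; exact hsT.ne'))
        (ContinuousAt.div (by fun_prop) hNc.norm.continuousAt (by rw [hNn]; exact hsT.ne'))
    have hval : (⟪x', r q₀⟫ / ‖N (r q₀)‖, ⟪v', r q₀⟫ / ‖N (r q₀)‖) = (m, (0 : ℝ)) := by
      rw [hxw, hvw, hNn, hmT, zero_div]
    have := hc.tendsto
    simp only [hval] at this
    exact this.eventually hchord
  obtain ⟨δ, hδ, hball⟩ := Metric.eventually_nhds_iff.1 (e1.and (e2.and e3))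
  obtain ⟨δ', hδ', hsub⟩ := hA.cone.frontier_subset_of_frontier_subset h.cone hw₀C hδ (by
    intro b hb hbC
    obtain ⟨h1, h2, h3⟩ := hball (y := b) (by rwa [dist_eq_norm])
    have hx'V : x' ∈ V := h.circlePt_mem _
    have hv'V : v' ∈ V := h.circlePt_mem _
    have hNb : N b ∈ frontier C := by
      have := h.add_mem_frontier hbC
        (V.neg_mem (V.add_mem (V.smul_mem ⟪x', b⟫ hx'V) (V.smul_mem ⟪v', b⟫ hv'V)))
      convert this using 1
      simp only [N]; abel
    have he : ‖N b‖⁻¹ • N b ∈ transverseSet C x v := by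
      refine ⟨h.cone.smul_mem_frontier (inv_pos.2 h1) hNb, ?_, fun θ => ?_⟩
      · rw [norm_smul, norm_inv, norm_norm, inv_mul_cancel₀ h1.ne']
      · have h4 : ⟪x', N b⟫ = 0 := by
          simp [N, inner_sub_right, inner_smul_right, hxv', hx'1]
        have h5 : ⟪v', N b⟫ = 0 := by
          simp [N, inner_sub_right, inner_smul_right, hvx', hv'1]
        rw [circlePt_eq_rotate x v t₁ θ, inner_smul_right, inner_add_left, inner_smul_left,
          inner_smul_left, h4, h5]
        simp
    have h6 := hA.cone.smul_mem_frontier h1 (h3 _ he h2)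
    convert h6 using 1
    rw [smul_add, smul_add, smul_smul, smul_smul, smul_smul, mul_inv_cancel₀ h1.ne',
      mul_div_cancel₀ _ h1.ne', mul_div_cancel₀ _ h1.ne']
    simp only [N]; module)
  refine hA.of_eventually h.cone ?_
  have h1 : ∀ᶠ q in 𝓝 q₀, ‖r q - r q₀‖ < δ' := by
    have := h.base.continuous.continuousAt (x := q₀) |>.eventually (Metric.ball_mem_nhds _ hδ')
    filter_upwards [this] with q hq
    rwa [dist_eq_norm] at hq
  filter_upwards [h1, hA.eventually] with q hq hqA
  exact hsub _ hq hqA.mem_frontier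

variable [FiniteDimensional ℝ E] [T2Space M] [CompactSpace M]

/-- The curves of the sweep lift up to a given time if they lift up to all earlier times. -/
theorem hasLift_of_lt {T : ℝ} (hT : T ∈ Set.Ioc 0 (Real.pi / 2))
    (hlift : ∀ s < T, ∀ a : SweepBase r x v V C,
      HasLift r {q | IsConeChart r C q} (circlePt (r a.1) a.2) a.1 s) (a₁ : SweepBase r x v V C) :
    HasLift r {q | IsConeChart r C q} (circlePt (r a₁.1) a₁.2) a₁.1 T := by
  have hrc := h.base.continuous
  have hli := h.base.isLocallyInjective
  choose Ψ Q hΨ hΨ0 hΨT hQ hΨc using fun a : SweepBase r x v V C =>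
    exists_lift_Ico hrc hli (continuous_circlePt (r a.1) (a.2 : E)) hT.1 fun s hs => hlift s hs a
  have hΨr : ∀ a : SweepBase r x v V C, ∀ s ∈ Set.Icc 0 T, r (Ψ a s) = circlePt (r a.1) a.2 s := by
    intro a s hs
    rcases hs.2.eq_or_lt with rfl | hlt
    · rw [hΨT, hQ]
    · exact (hΨc a s ⟨hs.1, hlt⟩).2
  have hTI : T ∈ Set.Icc 0 T := ⟨hT.1.le, le_rfl⟩
  refine ⟨Ψ a₁, hΨ a₁, hΨ0 a₁, fun s hs => ⟨?_, hΨr a₁ s hs⟩⟩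
  rcases hs.2.lt_or_eq with hlt | rfl
  · exact (hΨc a₁ s ⟨hs.1, hlt⟩).1
  obtain ⟨t₁, ht₁⟩ := a₁.1.2.1
  obtain ⟨γ, hγ, hγ0, hγl⟩ := h.exists_leaf a₁.1.2 ht₁
  obtain ⟨A, hA⟩ := h.base.exists_chart (Ψ a₁ s)
  let f : ℝ × transverseSet C x v → SweepBase r x v V C := fun z => (⟨γ z.1, (hγl z.1).1⟩, z.2)
  have hf : Continuous f := by
    refine Continuous.prodMk (Continuous.subtype_mk (by fun_prop) _) continuous_snd
  have hf0 : f (0, a₁.2) = a₁ := by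
    simp only [f]
    exact Prod.ext (Subtype.ext hγ0) rfl
  have hcont := continuousOn_lift_family hrc hli (A := ℝ × transverseSet C x v)
    (c := fun z => circlePt (r (γ z.1.1)) z.1.2 z.2)
    (continuous_sweep hrc (f := fun z : ℝ × transverseSet C x v => γ z.1)
      (g := fun z => (z.2 : E)) (by fun_prop) (by fun_prop)) (Ψ := fun z => Ψ (f z)) (T := s)
    (fun z => hΨ _) (by simp only [hΨ0]; exact hγ.comp continuous_fst)
    (fun z s' hs' => hΨr _ s' hs')
  -- the chart at the limit point is a chart along an arc of limit points
  have harc : ∃ α : ℝ, (∀ θ ∈ Set.Icc (-α) α, IsConeChart r A (Ψ (f (θ, a₁.2)) s)) ∧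
      ∀ᶠ z : ℝ × ℝ in 𝓝 (Real.tan (Real.pi / 2 - s), 0),
        Real.tan (Real.pi / 2 - s) ^ 2 < z.1 ^ 2 + z.2 ^ 2 →
          Real.arccos (z.1 / Real.sqrt (z.1 ^ 2 + z.2 ^ 2)) ≤ α := by
    have hθc : Continuous fun θ => Ψ (f (θ, a₁.2)) s := by
      rw [← continuousOn_univ]
      exact hcont.comp (f := fun θ : ℝ => ((θ, a₁.2), s)) (by fun_prop) fun θ _ => ⟨trivial, hTI⟩
    -- Before `π / 2`, `m > 0` and only leaf angles near 0 are needed, so an open condition at `θ =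
    -- 0` suffices. At `π / 2` all angles are needed, but then all curves with the same `e` end in
    -- one point.
    rcases hT.2.lt_or_eq with hlt | heq
    · have h1 : ∀ᶠ θ in 𝓝 (0 : ℝ), IsConeChart r A (Ψ (f (θ, a₁.2)) s) := by
        refine hθc.continuousAt.eventually (p := fun q => IsConeChart r A q) ?_
        simp only [hf0]
        exact hA.eventually
      obtain ⟨ε, hε, hball⟩ := Metric.eventually_nhds_iff.1 h1
      refine ⟨ε / 2, fun θ hθ => hball (by
        rw [Real.dist_eq, sub_zero, abs_lt]; constructor <;> linarith [hθ.1, hθ.2]), ?_⟩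
      have hm : 0 < Real.tan (Real.pi / 2 - s) :=
        Real.tan_pos_of_pos_of_lt_pi_div_two (by linarith) (by linarith [hT.1])
      have hk : Real.sqrt (Real.tan (Real.pi / 2 - s) ^ 2 + 0 ^ 2) = Real.tan (Real.pi / 2 - s) := by
        rw [zero_pow two_ne_zero, add_zero, Real.sqrt_sq hm.le]
      have hc : ContinuousAt (fun z : ℝ × ℝ => Real.arccos (z.1 / Real.sqrt (z.1 ^ 2 + z.2 ^ 2)))
          (Real.tan (Real.pi / 2 - s), 0) := by
        refine Real.continuous_arccos.continuousAt.comp (ContinuousAt.div (by fun_prop)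
          (by fun_prop) ?_)
        change Real.sqrt (Real.tan (Real.pi / 2 - s) ^ 2 + 0 ^ 2) ≠ 0
        rw [hk]; exact hm.ne'
      have := hc.eventually (gt_mem_nhds (show Real.arccos (Real.tan (Real.pi / 2 - s) /
          Real.sqrt (Real.tan (Real.pi / 2 - s) ^ 2 + 0 ^ 2)) < ε / 2 by
        rw [hk, div_self hm.ne', Real.arccos_one]; positivity))
      filter_upwards [this] with z hz _ using hz.le
    · refine ⟨Real.pi, fun θ _ => ?_, Filter.Eventually.of_forall fun z _ => Real.arccos_le_pi _⟩
      have hconst : Ψ (f (θ, a₁.2)) s = Ψ (f (0, a₁.2)) s := by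
        refine (T2Space.isSeparatedMap r).const_of_comp hli hθc (fun θ θ' => ?_) θ 0
        rw [hΨr _ s hTI, hΨr _ s hTI, heq]
        simp [circlePt, f]
      rw [hconst, hf0]
      exact hA
  obtain ⟨α, hα, hαz⟩ := harc
  have hs0 : Real.pi / 2 - Real.arctan (Real.tan (Real.pi / 2 - s)) = s := by
    rw [Real.arctan_tan (by linarith [hT.2, Real.pi_pos]) (by linarith [hT.1])]; ring
  have htube : ∀ᶠ z : transverseSet C x v × Set.Icc 0 s in 𝓝 (a₁.2, ⟨s, hTI⟩),
      ∀ θ ∈ Set.Icc (-α) α, IsConeChart r A (Ψ (f (θ, z.1)) z.2) := by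
    refine isCompact_Icc.eventually_forall_of_forall_eventually
      (P := fun (z : transverseSet C x v × Set.Icc 0 s) (θ : ℝ) =>
        IsConeChart r A (Ψ (f (θ, z.1)) z.2)) fun θ hθ => ?_
    have hc : Continuous fun w : (transverseSet C x v × Set.Icc 0 s) × ℝ =>
        Ψ (f (w.2, w.1.1)) w.1.2 := by
      rw [← continuousOn_univ]
      exact hcont.comp
        (f := fun w : (transverseSet C x v × Set.Icc 0 s) × ℝ => ((w.2, w.1.1), (w.1.2 : ℝ)))
        (by fun_prop) fun w _ => ⟨trivial, w.1.2.2⟩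
    exact hc.continuousAt.eventually (p := fun q => IsConeChart r A q) (hα θ hθ).eventually
  obtain ⟨S₁, hS₁, S₂, hS₂, hSS⟩ := mem_nhds_prod_iff.1 htube
  obtain ⟨ε₁, hε₁, hb₁⟩ := Metric.mem_nhds_iff.1 hS₁
  obtain ⟨ε₂, hε₂, hb₂⟩ := Metric.mem_nhds_iff.1 hS₂
  have hs2 : ∀ᶠ z : ℝ × ℝ in 𝓝 (Real.tan (Real.pi / 2 - s), 0),
      |Real.pi / 2 - Real.arctan (Real.sqrt (z.1 ^ 2 + z.2 ^ 2)) - s| < ε₂ := by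
    have hc : Continuous fun z : ℝ × ℝ =>
        |Real.pi / 2 - Real.arctan (Real.sqrt (z.1 ^ 2 + z.2 ^ 2)) - s| := by
      have := Real.continuous_arctan
      fun_prop
    refine hc.continuousAt.eventually (gt_mem_nhds ?_)
    have hm : 0 ≤ Real.tan (Real.pi / 2 - s) :=
      Real.tan_nonneg_of_nonneg_of_le_pi_div_two (by linarith [hT.2]) (by linarith [hT.1])
    simp only [zero_pow two_ne_zero, add_zero, Real.sqrt_sq hm, hs0, sub_self, abs_zero]
    exact hε₂
  obtain ⟨ε₃, hε₃, hb₃⟩ := Metric.eventually_nhds_iff.1 (hαz.and hs2)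
  refine h.isConeChart_of_wedge hA hT a₁.2.2 (t₁ := t₁) ?_ (ε := min ε₁ ε₃) (by positivity) ?_
  · rw [hΨr _ s hTI, ht₁]
  intro e he hee a b ha hb hab
  obtain ⟨h1, h2⟩ := hb₃ (y := (a, b)) (by
    rw [Prod.dist_eq, max_lt_iff, Real.dist_eq, Real.dist_eq, sub_zero]
    exact ⟨ha.trans_le (min_le_right _ _), hb.trans_le (min_le_right _ _)⟩)
  have hpos : 0 < a ^ 2 + b ^ 2 := (sq_nonneg _).trans_lt hab
  obtain ⟨θ, hθ, hθe⟩ := exists_eq_smul_circlePt (circlePt x v t₁)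
    (circlePt x v (t₁ + Real.pi / 2)) hpos
  have hrot : circlePt (circlePt x v t₁) (circlePt x v (t₁ + Real.pi / 2)) θ =
      circlePt x v (t₁ + θ) := by
    rw [circlePt_add x v t₁ θ]; rfl
  rw [hrot] at hθe
  rw [hθe]
  set k := Real.sqrt (a ^ 2 + b ^ 2) with hk
  have hk0 : 0 < k := Real.sqrt_pos.2 hpos
  have hmk : Real.tan (Real.pi / 2 - s) < k := Real.lt_sqrt_of_sq_lt hab
  -- The time at which the curve with angle `θ` and direction `e` passes through the prescribed ray;
  -- it is earlier than `s`, so the lift is already known there.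
  set s' := Real.pi / 2 - Real.arctan k with hs'
  have hs's : s' < s := by
    rw [← hs0]
    have := Real.arctan_strictMono hmk
    linarith
  have hs'0 : 0 < s' := by linarith [Real.arctan_lt_pi_div_two k]
  have hs'I : s' ∈ Set.Icc 0 s := ⟨hs'0.le, hs's.le⟩
  have hsin : 0 < Real.sin s' := Real.sin_pos_of_pos_of_lt_pi hs'0 (by
    linarith [hT.2, Real.pi_pos])
  have hcos : Real.cos s' = Real.sin s' * k := by
    rw [hs', Real.cos_pi_div_two_sub, Real.sin_pi_div_two_sub, mul_comm,
      ← Real.tan_mul_cos (Real.cos_arctan_pos k).ne', Real.tan_arctan]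
  have hchart : IsConeChart r A (Ψ (f (θ, ⟨e, he⟩)) s') := by
    have hmem : ((⟨e, he⟩, ⟨s', hs'I⟩) : transverseSet C x v × Set.Icc 0 s) ∈ S₁ ×ˢ S₂ := by
      refine ⟨hb₁ ?_, hb₂ ?_⟩
      · rw [Metric.mem_ball, Subtype.dist_eq, dist_eq_norm]
        exact hee.trans_le (min_le_left _ _)
      · rw [Metric.mem_ball, Subtype.dist_eq, Real.dist_eq]
        exact h2
    exact hSS hmem θ (by rw [Set.mem_Icc, ← abs_le, hθ]; exact h1 hab)
  have h3 := hchart.mem_frontier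
  rw [hΨr _ s' hs'I] at h3
  rw [← hA.cone.smul_mem_frontier_iff hsin]
  convert h3 using 1
  simp only [f]
  rw [(hγl θ).2, circlePt.eq_def (circlePt x v (t₁ + θ)) e, hcos]
  module

/-- All curves of the sweep lift to the part of the hypersurface on which `C` is a chart. -/
theorem hasLift_sweep (a : SweepBase r x v V C) :
    HasLift r {q | IsConeChart r C q} (circlePt (r a.1) a.2) a.1 (Real.pi / 2) := by
  have hpi : (0 : ℝ) ≤ Real.pi / 2 := by positivity
  have h0 : ∀ a : SweepBase r x v V C,
      HasLift r {q | IsConeChart r C q} (circlePt (r a.1) a.2) a.1 0 := by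
    intro a
    refine ⟨fun _ => a.1, continuousOn_const, rfl, fun s hs => ?_⟩
    rw [le_antisymm hs.2 hs.1]
    exact ⟨h.isConeChart_of_leafSet a.1.2, by simp [circlePt]⟩
  have hmain : Set.Icc 0 (Real.pi / 2) ⊆ {t | ∀ a : SweepBase r x v V C,
      HasLift r {q | IsConeChart r C q} (circlePt (r a.1) a.2) a.1 t} := by
    refine IsClosed.Icc_subset_of_forall_exists_gt ?_ h0 ?_
    · refine isClosed_of_closure_subset fun t ht => ?_
      have htI : t ∈ Set.Icc 0 (Real.pi / 2) :=
        (isClosed_Icc.closure_subset_iff.2 Set.inter_subset_right) ht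
      refine ⟨?_, htI⟩
      rcases htI.1.eq_or_lt with h' | h'
      · rw [← h']; exact h0
      refine fun a => h.hasLift_of_lt ⟨h', htI.2⟩ (fun s hs a => ?_) a
      obtain ⟨u, hu, hu2⟩ := mem_closure_iff.1 ht (Set.Ioi s) isOpen_Ioi hs
      exact HasLift.mono (hu2.1 a) (le_of_lt hu)
    · rintro t ⟨ht, ht0, htT⟩ y hy
      obtain ⟨T', hT', hl⟩ := h.exists_hasLift_gt ht0 htT ht
      exact ⟨min T' y, fun a => (hl a).mono (min_le_left _ _), lt_min hT' hy, min_le_right _ _⟩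
  exact hmain ⟨hpi, le_rfl⟩ a

end IsLeafCone

end Barrier

/-! ### Conclusion when no face is one-dimensional. -/

section ConeBoundary

variable {E : Type*} [NormedAddCommGroup E] [InnerProductSpace ℝ E] [FiniteDimensional ℝ E]
variable {M : Type*} [TopologicalSpace M] {r : M → E} {C : Set E} {x v : E} {V : Submodule ℝ E}

/-- In dimension at least four there is a unit vector `g` orthogonal to `x`, `v` and `ζ`. The circle
of `ζ` and `g` contains `ζ` in the interior and `-ζ` outside `C`, so it crosses the boundary. -/
theorem IsSolidCone.transverseSet_nonempty (hC : IsSolidCone C) (h0 : (0 : E) ∉ interior C)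
    (hx : ‖x‖ = 1) (hv : ‖v‖ = 1) (hxv : ⟪x, v⟫ = 0) (hxV : x ∈ V) (hvV : v ∈ V)
    (hVC : (V : Set E) ⊆ C) (hdim : 4 ≤ Module.finrank ℝ E) : (transverseSet C x v).Nonempty := by
  obtain ⟨ζ, hζ, h3⟩ := hC.exists_orthoTriple h0 hx hv hxv hxV hvV hVC
  obtain ⟨g, hg1, hg⟩ : ∃ g : E, ‖g‖ = 1 ∧ g ∈ (Submodule.span ℝ {x, v, ζ})ᗮ := by
    have hfr : Module.finrank ℝ (Submodule.span ℝ {x, v, ζ}) ≤ 3 := by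
      classical
      have h1 := finrank_span_finset_le_card (R := ℝ) ({x, v, ζ} : Finset E)
      simp only [Finset.coe_insert, Finset.coe_singleton] at h1
      exact h1.trans Finset.card_le_three
    have hne : (Submodule.span ℝ {x, v, ζ})ᗮ ≠ ⊥ := by
      intro hbot
      have := Submodule.finrank_add_finrank_orthogonal (Submodule.span ℝ {x, v, ζ})
      rw [hbot, finrank_bot] at this
      omega
    obtain ⟨g, hg, hg0⟩ := Submodule.exists_mem_ne_zero_of_ne_bot hne
    refine ⟨‖g‖⁻¹ • g, ?_, Submodule.smul_mem _ _ hg⟩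
    rw [norm_smul, norm_inv, norm_norm, inv_mul_cancel₀ (norm_ne_zero_iff.2 hg0)]
  rw [Submodule.mem_orthogonal] at hg
  have hxg : ⟪x, g⟫ = 0 := hg _ (Submodule.subset_span (by simp))
  have hvg : ⟪v, g⟫ = 0 := hg _ (Submodule.subset_span (by simp))
  have hζg : ⟪ζ, g⟫ = 0 := hg _ (Submodule.subset_span (by simp))
  have hneg : -ζ ∉ C := fun hm => h0 (by simpa using hC.add_mem_interior hm hζ)
  by_contra hcon
  have hsub : Set.range (circlePt ζ g) ∩ frontier C = ∅ := by
    rw [Set.eq_empty_iff_forall_notMem]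
    rintro _ ⟨⟨φ, rfl⟩, hφ⟩
    refine hcon ⟨_, hφ, norm_circlePt h3.norm_ζ hg1 hζg φ, fun θ => ?_⟩
    simp [circlePt, inner_add_left, inner_add_right, inner_smul_left, inner_smul_right, hxg, hvg,
      h3.inner_xζ, h3.inner_vζ]
  have hpre : IsPreconnected (Set.range (circlePt ζ g)) :=
    isPreconnected_range (continuous_circlePt ζ g)
  have hleft := hpre.subset_left_of_subset_union (u := interior C) (v := Cᶜ) isOpen_interior
    hC.closed.isOpen_compl
    (disjoint_compl_right.mono_left interior_subset) (fun y hy => by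
      by_contra hn
      rw [Set.mem_union, not_or, Set.mem_compl_iff, not_not] at hn
      exact Set.eq_empty_iff_forall_notMem.1 hsub y ⟨hy, hC.mem_frontier.2 ⟨hn.2, hn.1⟩⟩)
    ⟨ζ, Set.mem_inter (Set.mem_range.2 ⟨0, by simp [circlePt]⟩) hζ⟩
  exact hneg (interior_subset (hleft (Set.mem_range.2 ⟨Real.pi, by simp [circlePt]⟩)))

omit [FiniteDimensional ℝ E] in
theorem exists_norm_smul_circlePt (x v : E) (a b : ℝ) : ∃ θ ∈ Set.Icc (-Real.pi) Real.pi,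
    a • x + b • v = Real.sqrt (a ^ 2 + b ^ 2) • circlePt x v θ := by
  rcases (show 0 ≤ a ^ 2 + b ^ 2 by positivity).eq_or_lt with h | h
  · have ha : a = 0 := by nlinarith [sq_nonneg a, sq_nonneg b]
    have hb : b = 0 := by nlinarith [sq_nonneg a, sq_nonneg b]
    refine ⟨0, ⟨by linarith [Real.pi_pos], Real.pi_pos.le⟩, ?_⟩
    rw [← h, ha, hb]; simp
  · obtain ⟨θ, hθ, he⟩ := exists_eq_smul_circlePt x v h
    refine ⟨θ, ?_, he⟩
    rw [Set.mem_Icc, ← abs_le, hθ]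
    exact Real.arccos_le_pi _

namespace IsLeafCone

variable (h : IsLeafCone r x v V C)
include h

omit [FiniteDimensional ℝ E] in
/-- Every unit vector of the boundary of `C` lies on a curve of the sweep. -/
theorem exists_sweep_eq (hne : (transverseSet C x v).Nonempty) {w : E} (hw : w ∈ frontier C)
    (hw1 : ‖w‖ = 1) : ∃ θ ∈ Set.Icc (-Real.pi) Real.pi, ∃ e ∈ transverseSet C x v,
      ∃ s ∈ Set.Icc 0 (Real.pi / 2), circlePt (circlePt x v θ) e s = w := by
  have hvx : ⟪v, x⟫ = 0 := by rw [real_inner_comm, h.inner_xv]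
  set a := ⟪x, w⟫ with ha
  set b := ⟪v, w⟫ with hb
  set w' := w - a • x - b • v with hw'
  have hxw' : ⟪x, w'⟫ = 0 := by
    simp [hw', inner_sub_right, inner_smul_right, h.inner_xv, h.norm_x, ha]
  have hvw' : ⟪v, w'⟫ = 0 := by
    simp [hw', inner_sub_right, inner_smul_right, hvx, h.norm_v, hb]
  obtain ⟨θ, hθ, he⟩ := exists_norm_smul_circlePt x v a b
  set k := Real.sqrt (a ^ 2 + b ^ 2) with hk
  have hw'C : w' ∈ frontier C := by
    have := h.add_mem_frontier hw (V.neg_mem (V.add_mem (V.smul_mem a h.mem_x) (V.smul_mem b h.mem_v)))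
    convert this using 1
    rw [hw']; abel
  have hdec : w = k • circlePt x v θ + w' := by rw [← he, hw']; abel
  have horth : ⟪circlePt x v θ, w'⟫ = 0 := by
    rw [circlePt, inner_add_left, inner_smul_left, inner_smul_left, hxw', hvw']; simp
  have hnorm : k ^ 2 + ‖w'‖ ^ 2 = 1 := by
    have h1 : ‖w‖ ^ 2 = ‖k • circlePt x v θ + w'‖ ^ 2 := by rw [← hdec]
    rw [norm_add_sq_real, inner_smul_left, horth, norm_smul, h.norm_circlePt, hw1, mul_one,
      Real.norm_eq_abs, sq_abs] at h1
    simp only [mul_zero, add_zero] at h1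
    linarith
  have hk0 : 0 ≤ k := Real.sqrt_nonneg _
  have hk1 : k ≤ 1 := by nlinarith [sq_nonneg ‖w'‖]
  obtain ⟨e, heT, hew⟩ : ∃ e ∈ transverseSet C x v, w' = ‖w'‖ • e := by
    by_cases h0 : w' = 0
    · obtain ⟨e, he⟩ := hne
      exact ⟨e, he, by rw [h0]; simp⟩
    · have hpos : 0 < ‖w'‖ := norm_pos_iff.2 h0
      refine ⟨‖w'‖⁻¹ • w', ⟨h.cone.smul_mem_frontier (inv_pos.2 hpos) hw'C, ?_, fun φ => ?_⟩, ?_⟩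
      · rw [norm_smul, norm_inv, norm_norm, inv_mul_cancel₀ hpos.ne']
      · rw [inner_smul_right, circlePt, inner_add_left, inner_smul_left, inner_smul_left, hxw', hvw']
        simp
      · rw [smul_smul, mul_inv_cancel₀ hpos.ne', one_smul]
  refine ⟨θ, hθ, e, heT, Real.arccos k, ⟨Real.arccos_nonneg _, Real.arccos_le_pi_div_two.2 hk0⟩, ?_⟩
  have hsin : Real.sin (Real.arccos k) = ‖w'‖ := by
    rw [Real.sin_arccos, show 1 - k ^ 2 = ‖w'‖ ^ 2 by linarith, Real.sqrt_sq (norm_nonneg _)]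
  rw [circlePt, hsin, Real.cos_arccos (by linarith) hk1, ← hew, ← hdec]

variable [T2Space M] [CompactSpace M]

/-- A connected hypersurface with a leaf is the boundary of its tangent cone along the leaf. -/
theorem injective_and_range_eq [ConnectedSpace M] (hleaf : (leafSet r x v V (frontier C)).Nonempty)
    (hne : (transverseSet C x v).Nonempty) :
    Function.Injective r ∧ Set.range r = {w | w ∈ frontier C ∧ ‖w‖ = 1} := by
  have hrc := h.base.continuous
  have hli := h.base.isLocallyInjective
  obtain ⟨p₀, hp₀⟩ := hleaf
  obtain ⟨t₀, ht₀⟩ := hp₀.1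
  obtain ⟨γ', hγ', -, hγl'⟩ := h.exists_leaf hp₀ ht₀
  obtain ⟨γ, hγ, hγl⟩ : ∃ γ : ℝ → M, Continuous γ ∧
      ∀ θ, γ θ ∈ leafSet r x v V (frontier C) ∧ r (γ θ) = circlePt x v θ := by
    refine ⟨fun θ => γ' (θ - t₀), hγ'.comp (continuous_id.sub continuous_const), fun θ => ?_⟩
    have := hγl' (θ - t₀)
    rwa [add_sub_cancel] at this
  choose Ψ hΨ hΨ0 hΨc using h.hasLift_sweep
  let Φ : ℝ × transverseSet C x v → ℝ → M := fun z => Ψ (⟨γ z.1, (hγl z.1).1⟩, z.2)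
  have hΦ : ∀ z, ContinuousOn (Φ z) (Set.Icc 0 (Real.pi / 2)) := fun z => hΨ _
  have hΦ0 : ∀ z, Φ z 0 = γ z.1 := fun z => hΨ0 _
  have hΦO : ∀ z, ∀ s ∈ Set.Icc 0 (Real.pi / 2), IsConeChart r C (Φ z s) :=
    fun z s hs => (hΨc _ s hs).1
  have hΦr : ∀ z, ∀ s ∈ Set.Icc 0 (Real.pi / 2),
      r (Φ z s) = circlePt (circlePt x v z.1) z.2 s := by
    intro z s hs
    refine (hΨc _ s hs).2.trans ?_
    simp only [(hγl z.1).2]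
  have hcont : ContinuousOn (fun z : (ℝ × transverseSet C x v) × ℝ => Φ z.1 z.2)
      (Set.univ ×ˢ Set.Icc 0 (Real.pi / 2)) :=
    continuousOn_lift_family hrc hli
      (c := fun z : (ℝ × transverseSet C x v) × ℝ => circlePt (circlePt x v z.1.1) z.1.2 z.2)
      (((Real.continuous_cos.comp continuous_snd).smul ((continuous_circlePt x v).comp (by fun_prop))).add
        ((Real.continuous_sin.comp continuous_snd).smul (by fun_prop))) hΦ (by simp only [hΦ0]; fun_prop) hΦr
  have hpi : Real.pi / 2 ∈ Set.Icc 0 (Real.pi / 2) := ⟨by positivity, le_rfl⟩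
  have h00 : (0 : ℝ) ∈ Set.Icc 0 (Real.pi / 2) := ⟨le_rfl, by positivity⟩
  -- The image of the end point is `e` for all `θ`; a continuous family in a fibre of a locally
  -- injective map is constant.
  have hend : ∀ θ θ' e, Φ (θ, e) (Real.pi / 2) = Φ (θ', e) (Real.pi / 2) := by
    intro θ θ' e
    have hc : Continuous fun θ => Φ (θ, e) (Real.pi / 2) := by
      rw [← continuousOn_univ]
      exact hcont.comp (f := fun θ : ℝ => ((θ, e), Real.pi / 2)) (by fun_prop)
        fun θ _ => ⟨trivial, hpi⟩
    refine (T2Space.isSeparatedMap r).const_of_comp hli hc (fun θ θ' => ?_) θ θ'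
    rw [hΦr _ _ hpi, hΦr _ _ hpi]
    simp [circlePt]
  -- A priori the leaf could wind around the circle without closing up. Since all curves in the
  -- direction `e` end in the same point, uniqueness of lifts, run backwards from there, excludes
  -- this.
  have hcirc : ∀ θ θ' e, circlePt x v θ = circlePt x v θ' → ∀ s ∈ Set.Icc 0 (Real.pi / 2),
      Φ (θ, e) s = Φ (θ', e) s := by
    intro θ θ' e hθ
    refine (T2Space.isSeparatedMap r).eqOn_of_comp_eqOn hli isPreconnected_Icc (hΦ _) (hΦ _)
      (fun s hs => ?_) hpi (hend θ θ' e)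
    simp only [Function.comp]
    rw [hΦr _ s hs, hΦr _ s hs, hθ]
  have hinj : ∀ θ e θ' e', ∀ s ∈ Set.Icc 0 (Real.pi / 2), ∀ s' ∈ Set.Icc 0 (Real.pi / 2),
      r (Φ (θ, e) s) = r (Φ (θ', e') s') → Φ (θ, e) s = Φ (θ', e') s' := by
    intro θ e θ' e' s hs s' hs' heq
    rw [hΦr _ s hs, hΦr _ s' hs'] at heq
    dsimp only at heq
    set y := circlePt x v θ with hy
    set y' := circlePt x v θ' with hy'
    have hy1 : ‖y‖ = 1 := h.norm_circlePt θ
    have hy'1 : ‖y'‖ = 1 := h.norm_circlePt θ'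
    have hpiI : ∀ {s : ℝ}, s ∈ Set.Icc 0 (Real.pi / 2) → s ∈ Set.Icc 0 Real.pi :=
      fun hs => ⟨hs.1, hs.2.trans (by linarith [Real.pi_pos])⟩
    have hcs : ∀ {s : ℝ}, s ∈ Set.Icc 0 (Real.pi / 2) → 0 ≤ Real.cos s := fun hs =>
      Real.cos_nonneg_of_mem_Icc ⟨by linarith [hs.1, Real.pi_pos], hs.2⟩
    have h1 : Real.cos s = Real.cos s' * ⟪y, y'⟫ := by
      have := congrArg (fun w => ⟪y, w⟫) heq
      simpa [circlePt.eq_def y, circlePt.eq_def y', inner_add_right, inner_smul_right, hy1,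
        show ⟪y, (e : E)⟫ = 0 from e.2.2.2 θ, show ⟪y, (e' : E)⟫ = 0 from e'.2.2.2 θ] using this
    have h2 : Real.cos s * ⟪y', y⟫ = Real.cos s' := by
      have := congrArg (fun w => ⟪y', w⟫) heq
      simpa [circlePt.eq_def y, circlePt.eq_def y', inner_add_right, inner_smul_right, hy'1,
        show ⟪y', (e : E)⟫ = 0 from e.2.2.2 θ', show ⟪y', (e' : E)⟫ = 0 from e'.2.2.2 θ'] using this
    have h3 : ⟪y, y'⟫ ≤ 1 := by
      have := real_inner_le_norm y y'
      rwa [hy1, hy'1, mul_one] at this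
    have h4 : ⟪y', y⟫ = ⟪y, y'⟫ := real_inner_comm _ _
    rw [h4] at h2
    have h5 : Real.cos s = Real.cos s' := by
      nlinarith [hcs hs, hcs hs', mul_le_mul_of_nonneg_left h3 (hcs hs),
        mul_le_mul_of_nonneg_left h3 (hcs hs')]
    have hss : s = s' := Real.injOn_cos (hpiI hs) (hpiI hs') h5
    subst hss
    rcases hs.2.lt_or_eq with hlt | rfl
    · have hcos : 0 < Real.cos s := Real.cos_pos_of_mem_Ioo ⟨by linarith [hs.1, Real.pi_pos], hlt⟩
      have h6 : ⟪y, y'⟫ = 1 := by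
        have : Real.cos s * ⟪y, y'⟫ = Real.cos s * 1 := by rw [← h1, mul_one]
        exact mul_left_cancel₀ hcos.ne' this
      have h7 : y = y' := (inner_eq_one_iff_of_norm_eq_one hy1 hy'1).1 h6
      rcases hs.1.eq_or_lt with h0 | h0
      · rw [← h0, hΦ0, hΦ0]
        have := hcirc θ θ' e h7 0 h00
        rwa [hΦ0, hΦ0] at this
      · have hsin : 0 < Real.sin s :=
          Real.sin_pos_of_pos_of_lt_pi h0 (by linarith [Real.pi_pos])
        rw [h7] at heq
        have h8 : (e : E) = e' := by
          have : Real.sin s • (e : E) = Real.sin s • (e' : E) := by simpa [circlePt] using heq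
          exact smul_right_injective E hsin.ne' this
        rw [← Subtype.ext h8]
        exact hcirc θ θ' e h7 s hs
    · have h8 : (e : E) = e' := by simpa [circlePt] using heq
      rw [← Subtype.ext h8]
      exact hend θ θ' e
  have : CompactSpace (transverseSet C x v) :=
    isCompact_iff_compactSpace.1 (isCompact_transverseSet C x v)
  -- The swept region `R` is compact, and `r` maps it bijectively onto the unit vectors of the
  -- boundary of `C`. This also makes it open, hence all of `M`.
  set R : Set M := (fun z : (ℝ × transverseSet C x v) × ℝ => Φ z.1 z.2) ''
    ((Set.Icc (-Real.pi) Real.pi ×ˢ Set.univ) ×ˢ Set.Icc 0 (Real.pi / 2)) with hR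
  have hRc : IsCompact R := ((isCompact_Icc.prod isCompact_univ).prod isCompact_Icc).image_of_continuousOn
    (hcont.mono (Set.prod_mono (Set.subset_univ _) subset_rfl))
  have hRO : ∀ q ∈ R, IsConeChart r C q := by
    rintro _ ⟨⟨z, s⟩, ⟨-, hs⟩, rfl⟩
    exact hΦO z s hs
  have hRi : Set.InjOn r R := by
    rintro _ ⟨⟨⟨θ, e⟩, s⟩, ⟨-, hs⟩, rfl⟩ _ ⟨⟨⟨θ', e'⟩, s'⟩, ⟨-, hs'⟩, rfl⟩ heq
    exact hinj θ e θ' e' s hs s' hs' heq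
  have hRs : ∀ w ∈ frontier C, ‖w‖ = 1 → ∃ q ∈ R, r q = w := by
    intro w hw hw1
    obtain ⟨θ, hθ, e, he, s, hs, hws⟩ := h.exists_sweep_eq hne hw hw1
    exact ⟨Φ (θ, ⟨e, he⟩) s, ⟨((θ, ⟨e, he⟩), s), ⟨⟨hθ, trivial⟩, hs⟩, rfl⟩, by rw [hΦr _ s hs, hws]⟩
  have hRo : IsOpen R := by
    rw [isOpen_iff_mem_nhds]
    intro q hq
    obtain ⟨U, hU, hUi, hUm⟩ := (hRO q hq).exists_nhds
    -- By injectivity on `R`, points of `R` whose image is close to `r q` lie in `U`. A point near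
    -- `q` has the same image as some point of `R`; both are in `U`, so they agree.
    obtain ⟨δ, hδ, hδR⟩ := (hRc.diff (isOpen_interior (s := U))).exists_forall_le'
      (f := fun q' => ‖r q' - r q‖) (a := 0) (by fun_prop) (by
        rintro q' ⟨hq', hq'U⟩
        refine norm_pos_iff.2 (sub_ne_zero.2 fun heq => hq'U ?_)
        rw [hRi hq' hq heq]
        exact mem_interior_iff_mem_nhds.2 hU)
    have h1 : ∀ᶠ q' in 𝓝 q, ‖r q' - r q‖ < δ := by
      have := hrc.continuousAt (x := q) |>.eventually (Metric.ball_mem_nhds _ hδ)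
      filter_upwards [this] with q' hq'
      rwa [dist_eq_norm] at hq'
    filter_upwards [hU, h1] with q' hq'U hq'δ
    obtain ⟨q'', hq'', hqq⟩ := hRs (r q') (hUm hq'U) (h.base.norm_eq q')
    have hq''U : q'' ∈ U := by
      by_contra hcon
      have := hδR q'' ⟨hq'', fun hm => hcon (interior_subset hm)⟩
      rw [hqq] at this
      linarith
    rwa [← hUi hq''U hq'U hqq]
  have hRne : R.Nonempty := by
    obtain ⟨e, he⟩ := hne
    exact ⟨_, ((0, ⟨e, he⟩), 0), ⟨⟨⟨by linarith [Real.pi_pos], Real.pi_pos.le⟩, trivial⟩, h00⟩, rfl⟩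
  have hRuniv : R = Set.univ := IsClopen.eq_univ ⟨hRc.isClosed, hRo⟩ hRne
  constructor
  · rw [← Set.injOn_univ, ← hRuniv]; exact hRi
  · ext w
    constructor
    · rintro ⟨q, rfl⟩
      exact ⟨(hRO q (hRuniv ▸ trivial)).mem_frontier, h.base.norm_eq q⟩
    · rintro ⟨hw, hw1⟩
      obtain ⟨q, -, hq⟩ := hRs w hw hw1
      exact ⟨q, hq⟩

end IsLeafCone

/-- A closed connected hypersurface of the sphere which is locally the boundary of a cone, and none
of whose points is a one-dimensional face, is the boundary of a solid cone. -/
theorem IsLocallyConeBoundary.exists_solidCone [T2Space M] [CompactSpace M] [ConnectedSpace M]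
    (hr : IsLocallyConeBoundary r) (hdim : 4 ≤ Module.finrank ℝ E)
    (htwo : ∀ q A, ∀ h : IsConeChart r A q, 2 ≤ Module.finrank ℝ (h.cone.faceSpan (r q))) :
    ∃ C, IsSolidCone C ∧ Function.Injective r ∧ Set.range r = {w | w ∈ frontier C ∧ ‖w‖ = 1} := by
  classical
  -- The leaf is started at a point whose face span has the least possible dimension.
  have hex : ∃ k, ∃ q A, ∃ h : IsConeChart r A q, Module.finrank ℝ (h.cone.faceSpan (r q)) = k := by
    obtain ⟨q⟩ := (inferInstance : Nonempty M)
    obtain ⟨A, hA⟩ := hr.exists_chart q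
    exact ⟨_, q, A, hA, rfl⟩
  obtain ⟨p, A, hA, hk⟩ := Nat.find_spec hex
  set V := hA.cone.faceSpan (r p) with hV
  have hmin : ∀ q A, ∀ h : IsConeChart r A q,
      Module.finrank ℝ V ≤ Module.finrank ℝ (h.cone.faceSpan (r q)) := fun q B hB => by
    rw [hk]; exact Nat.find_min' hex ⟨q, B, hB, rfl⟩
  have hx1 := hr.norm_eq p
  have hxV : r p ∈ V := hA.cone.self_mem_faceSpan hA.mem
  obtain ⟨v, hvV, hv1, hxv⟩ : ∃ v ∈ V, ‖v‖ = 1 ∧ ⟪r p, v⟫ = 0 := by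
    have hnle : ¬ V ≤ ℝ ∙ r p := by
      intro hle
      have h1 := Submodule.finrank_mono hle
      have h2 := finrank_span_singleton (K := ℝ) (v := r p) (by
        intro h0; rw [h0, norm_zero] at hx1; exact zero_ne_one hx1)
      have h3 := htwo p A hA
      rw [h2] at h1
      exact absurd (h3.trans h1) (by norm_num)
    obtain ⟨u, huV, hu⟩ := SetLike.not_le_iff_exists.1 hnle
    set w := u - ⟪r p, u⟫ • r p with hw
    have hw0 : w ≠ 0 := by
      intro h0
      refine hu (Submodule.mem_span_singleton.2 ⟨⟪r p, u⟫, ?_⟩)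
      rw [hw, sub_eq_zero] at h0
      exact h0.symm
    refine ⟨‖w‖⁻¹ • w, V.smul_mem _ (V.sub_mem huV (V.smul_mem _ hxV)), ?_, ?_⟩
    · rw [norm_smul, norm_inv, norm_norm, inv_mul_cancel₀ (norm_ne_zero_iff.2 hw0)]
    · rw [inner_smul_right, hw, inner_sub_right, inner_smul_right, real_inner_self_eq_norm_sq, hx1]
      ring
  set C := tangentSolidCone A (r p) with hC
  have hCs : IsSolidCone C := hA.cone.tangentSolidCone_isSolidCone (r p)
  have hVC : (V : Set E) ⊆ C := hA.cone.faceSpan_subset_tangentSolidCone (r p)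
  have h : IsLeafCone r (r p) v V C :=
    ⟨hr, hCs, hx1, hv1, hxv, hxV, hvV, hVC, hmin⟩
  have h0 : (0 : E) ∉ interior C :=
    hCs.interior_notMem_zero ⟨0, hA.cone.zero_mem_frontier_tangentSolidCone hA.mem_frontier⟩
  refine ⟨C, hCs, h.injective_and_range_eq ⟨p, ⟨0, by simp [circlePt]⟩, fun B hB => ⟨?_, ?_⟩⟩
    (hCs.transverseSet_nonempty h0 hx1 hv1 hxv hxV hvV hVC hdim)⟩
  · exact hr.faceSpan_eq hB hA
  · exact hr.frontier_tangentSolidCone_eq hB hA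

end ConeBoundary

/-! ### Separating an extreme point from a compact set. -/

section ExtremePoint

variable {E : Type*} [NormedAddCommGroup E] [NormedSpace ℝ E] {Q S : Set E} {x : E}

theorem IsCompact.convexJoin {P₁ P₂ : Set E} (h₁ : IsCompact P₁) (h₂ : IsCompact P₂) :
    IsCompact (convexJoin ℝ P₁ P₂) := by
  have : _root_.convexJoin ℝ P₁ P₂ = (fun z : ℝ × E × E => z.2.1 + z.1 • (z.2.2 - z.2.1)) ''
      (Set.Icc 0 1 ×ˢ P₁ ×ˢ P₂) := by
    ext y
    rw [mem_convexJoin]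
    constructor
    · rintro ⟨a, ha, b, hb, hy⟩
      rw [segment_eq_image'] at hy
      obtain ⟨t, ht, rfl⟩ := hy
      exact ⟨(t, a, b), ⟨ht, ha, hb⟩, rfl⟩
    · rintro ⟨⟨t, a, b⟩, ⟨ht, ha, hb⟩, rfl⟩
      refine ⟨a, ha, b, hb, ?_⟩
      rw [segment_eq_image']
      exact ⟨t, ht, rfl⟩
  rw [this]
  exact (isCompact_Icc.prod (h₁.prod h₂)).image (by fun_prop)

/-- An extreme point of `Q` is separated from a compact part of `Q` by a compact convex set. -/
theorem exists_isCompact_convex_of_mem_extremePoints [FiniteDimensional ℝ E] (hQ : Convex ℝ Q)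
    (hQc : IsClosed Q) (hx : x ∈ Q.extremePoints ℝ) (hS : IsCompact S) (hSQ : S ⊆ Q) (hxS : x ∉ S) :
    ∃ P : Set E, IsCompact P ∧ Convex ℝ P ∧ x ∉ P ∧ S ⊆ P := by
  suffices ∃ P : Set E, IsCompact P ∧ Convex ℝ P ∧ P ⊆ Q ∧ x ∉ P ∧ S ⊆ P by
    obtain ⟨P, h1, h2, -, h3, h4⟩ := this
    exact ⟨P, h1, h2, h3, h4⟩
  refine hS.induction_on (p := fun S => ∃ P : Set E, IsCompact P ∧ Convex ℝ P ∧ P ⊆ Q ∧ x ∉ P ∧ S ⊆ P)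
    ⟨∅, isCompact_empty, convex_empty, Set.empty_subset _, Set.notMem_empty _, subset_rfl⟩ ?_ ?_ ?_
  · rintro S₁ S₂ h ⟨P, h1, h2, h3, h4, h5⟩
    exact ⟨P, h1, h2, h3, h4, h.trans h5⟩
  · rintro S₁ S₂ ⟨P₁, h1, h2, h3, h4, h5⟩ ⟨P₂, g1, g2, g3, g4, g5⟩
    rcases P₁.eq_empty_or_nonempty with rfl | hne₁
    · exact ⟨P₂, g1, g2, g3, g4, Set.union_subset (h5.trans (Set.empty_subset _)) g5⟩
    rcases P₂.eq_empty_or_nonempty with rfl | hne₂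
    · exact ⟨P₁, h1, h2, h3, h4, Set.union_subset h5 (g5.trans (Set.empty_subset _))⟩
    -- The join of two convex subsets of `Q` avoiding the extreme point `x` still avoids it: `x` is
    -- not inside a segment of `Q`.
    refine ⟨_root_.convexJoin ℝ P₁ P₂, h1.convexJoin g1, h2.convexJoin g2, convexJoin_subset h3 g3 hQ,
      fun hmem => ?_, Set.union_subset (h5.trans (subset_convexJoin_left hne₂))
        (g5.trans (subset_convexJoin_right hne₁))⟩
    obtain ⟨a, ha, b, hb, hxab⟩ := mem_convexJoin.1 hmem
    have hxa : x ≠ a := fun h => h4 (h ▸ ha)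
    have hxb : x ≠ b := fun h => g4 (h ▸ hb)
    have := (mem_extremePoints.1 hx).2 a (h3 ha) b (g3 hb)
      (mem_openSegment_of_ne_left_right hxa.symm hxb.symm hxab)
    exact hxa this.1.symm
  · intro s hs
    have hd : 0 < dist x s := dist_pos.2 fun h => hxS (h ▸ hs)
    refine ⟨S ∩ Metric.closedBall s (dist x s / 2), Filter.inter_mem self_mem_nhdsWithin
      (mem_nhdsWithin_of_mem_nhds (Metric.closedBall_mem_nhds _ (by positivity))),
      Q ∩ Metric.closedBall s (dist x s / 2), (isCompact_closedBall _ _).inter_left hQc,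
      hQ.inter (convex_closedBall _ _), Set.inter_subset_left, ?_,
      Set.inter_subset_inter_left _ hSQ⟩
    rintro ⟨-, h⟩
    rw [Metric.mem_closedBall] at h
    linarith

end ExtremePoint

/-! ### Cutting off a cap at a one-dimensional face. -/

section StrictPoint

variable {E : Type*} [NormedAddCommGroup E] [InnerProductSpace ℝ E] [FiniteDimensional ℝ E]
variable {M : Type*} [TopologicalSpace M] [T2Space M] [CompactSpace M] {r : M → E} {A : Set E}
  {q₀ : M}

/-- Near a point that spans a one-dimensional face of its cone, some linear function has a negative
local maximum along `r`. -/
theorem IsConeChart.exists_isLocalMax (hA : IsConeChart r A q₀) (hr : Continuous r)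
    (hn : ∀ p, ‖r p‖ = 1) (hface : hA.cone.faceSpan (r q₀) ≤ ℝ ∙ r q₀) :
    ∃ z : E, ∃ p : M, ⟪z, r p⟫ < 0 ∧ ∀ᶠ q in 𝓝 p, ⟪z, r q⟫ ≤ ⟪z, r p⟫ := by
  set x := r q₀ with hx
  have hx1 : ‖x‖ = 1 := hn q₀
  have hxx : ⟪x, x⟫ = 1 := by rw [real_inner_self_eq_norm_sq, hx1, one_pow]
  have hxc : Continuous fun q => ⟪x, r q⟫ := continuous_const.inner hr
  obtain ⟨U₀, hU₀, hinj₀, hmaps₀⟩ := hA.exists_nhds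
  have hpos₀ : ∀ᶠ q in 𝓝 q₀, 0 < ⟪x, r q⟫ :=
    hxc.continuousAt.eventually (lt_mem_nhds (by simp [← hx, hx1]))
  obtain ⟨U, hU, hUU, hUc⟩ := local_compact_nhds (Filter.inter_mem hU₀ hpos₀)
  have hpos : ∀ q ∈ U, 0 < ⟪x, r q⟫ := fun q hq => (hUU hq).2
  -- The central projection of the hypersurface to the affine hyperplane `⟪x, ·⟫ = 1`.
  let w : M → E := fun q => (⟪x, r q⟫)⁻¹ • r q
  have hwc : ContinuousOn w U := ContinuousOn.smul
    (hxc.continuousOn.inv₀ fun q hq => (hpos q hq).ne') hr.continuousOn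
  have hw1 : ∀ q ∈ U, ⟪x, w q⟫ = 1 := fun q hq => by
    simp only [w]; rw [inner_smul_right, inv_mul_cancel₀ (hpos q hq).ne']
  have hrw : ∀ q ∈ U, r q = ⟪x, r q⟫ • w q := fun q hq => by
    simp only [w]; rw [smul_smul, mul_inv_cancel₀ (hpos q hq).ne', one_smul]
  have hw₀ : w q₀ = x := by simp only [w]; rw [← hx, hxx, inv_one, one_smul]
  have hwA : ∀ q ∈ U, w q ∈ A := fun q hq =>
    hA.cone.smul_mem (inv_nonneg.2 (hpos q hq).le) (hA.cone.mem_of_frontier (hmaps₀ (hUU hq).1))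
  have hwinj : ∀ q ∈ U, w q = x → q = q₀ := by
    intro q hq hqx
    have h1 := hrw q hq
    have h2 := congrArg norm h1
    rw [hqx, norm_smul, hn, hx1, mul_one, Real.norm_of_nonneg (hpos q hq).le] at h2
    rw [hqx, ← h2, one_smul] at h1
    exact hinj₀ (hUU hq).1 (mem_of_mem_nhds hU₀) h1
  -- the size of the cap
  obtain ⟨ε, hε0, hε1, hεU⟩ : ∃ ε : ℝ, 0 < ε ∧ ε ≤ 1 ∧ ∀ q ∈ U, ‖w q - x‖ ≤ ε → q ∈ interior U := by
    obtain ⟨ε, hε, h⟩ := (hUc.diff (isOpen_interior (s := U))).exists_forall_le'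
      (f := fun q => ‖w q - x‖) (a := 0)
      ((hwc.mono Set.sdiff_subset).sub continuousOn_const).norm (by
        rintro q ⟨hq, hqi⟩
        refine norm_pos_iff.2 (sub_ne_zero.2 fun heq => hqi ?_)
        rw [hwinj q hq heq]
        exact mem_interior_iff_mem_nhds.2 hU)
    refine ⟨min (ε / 2) 1, by positivity, min_le_right _ _, fun q hq hqε => ?_⟩
    by_contra hcon
    have h1 := h q ⟨hq, hcon⟩
    have h2 := hqε.trans (min_le_left _ _)
    linarith
  -- the slice of the cone
  set Q : Set E := A ∩ {y | ⟪x, y⟫ = 1} with hQ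
  have hQc : IsClosed Q := hA.cone.closed.inter (isClosed_eq (by fun_prop) continuous_const)
  have hQconv : Convex ℝ Q := hA.cone.convex.inter (convex_hyperplane
    (innerₗ E x).isLinear 1)
  -- A segment of the slice through `x` has its direction in the face span, hence in the line of
  -- `x`; but it is also orthogonal to `x`.
  have hxQ : x ∈ Q.extremePoints ℝ := by
    refine mem_extremePoints.2 ⟨⟨hA.mem, hxx⟩, ?_⟩
    rintro a ⟨ha, ha1⟩ b ⟨hb, hb1⟩ ⟨s, t, hs, ht, hst, hx'⟩
    have ha1' : ⟪x, a⟫ = 1 := ha1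
    have hmem : s • (a - x) ∈ hA.cone.faceSpan x := by
      refine ⟨1, zero_le_one, ?_, ?_⟩
      · have h1 := hA.cone.add_mem (hA.cone.smul_mem hs.le ha) (hA.cone.smul_mem ht.le hA.mem)
        convert h1 using 1
        rw [← hx, show t = 1 - s by linarith]; module
      · have h1 := hA.cone.add_mem (hA.cone.smul_mem hs.le hA.mem) (hA.cone.smul_mem ht.le hb)
        convert h1 using 1
        rw [one_smul, ← hx]
        have : t • b = x - s • a := by rw [← hx']; abel
        rw [this]; module
    obtain ⟨c, hc⟩ := Submodule.mem_span_singleton.1 (hface hmem)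
    have hc0 : c = 0 := by
      have := congrArg (fun y => ⟪x, y⟫) hc
      simpa [inner_smul_right, inner_sub_right, hx1, ha1'] using this
    have hax : a = x := by
      rw [hc0, zero_smul] at hc
      exact sub_eq_zero.1 ((smul_eq_zero.1 hc.symm).resolve_left hs.ne')
    refine ⟨hax, ?_⟩
    rw [hax] at hx'
    have h1 : t • (b - x) = 0 := by
      rw [smul_sub, sub_eq_zero]
      have : t • b = x - s • x := by rw [eq_sub_iff_add_eq, add_comm]; exact hx'
      rw [this, show t = 1 - s by linarith]; module
    exact sub_eq_zero.1 ((smul_eq_zero.1 h1).resolve_left ht.ne')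
  obtain ⟨P, hPc, hPconv, hxP, hSP⟩ := exists_isCompact_convex_of_mem_extremePoints hQconv hQc hxQ
    (S := Q ∩ Metric.sphere x ε) ((isCompact_sphere x ε).inter_left hQc) Set.inter_subset_left
    (fun h => by have := h.2; rw [mem_sphere_iff_norm, sub_self, norm_zero] at this; linarith)
  -- `f` separates `x` from the whole rim of the cap, the part of the slice at distance `ε` from
  -- `x`, by the margin `m`.
  obtain ⟨f, u, hfx, hfP⟩ := geometric_hahn_banach_point_closed hPconv hPc.isClosed hxP
  set m := u - f x with hm
  have hm0 : 0 < m := by linarith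
  -- the cap of the hypersurface
  set W : Set M := {q | q ∈ U ∧ ‖w q - x‖ ≤ ε} with hW
  have hWc : IsCompact W := by
    have h1 : ContinuousOn (fun q => ‖w q - x‖) U := (hwc.sub continuousOn_const).norm
    exact (h1.preimage_isClosed_of_isClosed hUc.isClosed isClosed_Iic).isCompact
  have hq₀W : q₀ ∈ W := ⟨mem_of_mem_nhds hU, by rw [hw₀, sub_self, norm_zero]; exact hε0.le⟩
  let a : M → ℝ := fun q => f (w q) - f x
  have hac : ContinuousOn a W :=
    (f.continuous.comp_continuousOn (hwc.mono fun q hq => hq.1)).sub continuousOn_const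
  obtain ⟨q₁, hq₁W, hq₁min⟩ := hWc.exists_isMinOn ⟨q₀, hq₀W⟩ hac
  set μ := a q₁ with hμ
  have hμ0 : μ ≤ 0 := by
    have : μ ≤ a q₀ := hq₁min hq₀W
    simpa [a, hw₀] using this
  let y : E := (InnerProductSpace.toDual ℝ E).symm f
  have hy : ∀ e, ⟪y, e⟫ = f e := fun e => InnerProductSpace.toDual_symm_apply
  set z : E := -(y - (f x) • x) - (m / 2 - μ) • x with hz
  have hzr : ∀ q ∈ U, ⟪z, r q⟫ = -(⟪x, r q⟫ * (a q + (m / 2 - μ))) := by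
    intro q hq
    have h1 : f (r q) = ⟪x, r q⟫ * f (w q) := by
      conv_lhs => rw [hrw q hq]
      rw [map_smul, smul_eq_mul]
    rw [hz, inner_sub_left, inner_neg_left, inner_sub_left, inner_smul_left, inner_smul_left, hy, h1]
    simp only [a, conj_trivial]
    ring
  have hx1r : ∀ q ∈ U, ⟪x, r q⟫ ≤ 1 := fun q _ => by
    have := real_inner_le_norm x (r q)
    rwa [hx1, hn, mul_one] at this
  have hmin : ∀ q ∈ W, 0 ≤ a q - μ := fun q hq => sub_nonneg.2 (hq₁min hq)
  obtain ⟨p, hpW, hpmax⟩ := hWc.exists_isMaxOn (f := fun q => ⟪z, r q⟫) ⟨q₀, hq₀W⟩ (by fun_prop)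
  have hpU := hpW.1
  have hpx := hpos p hpU
  refine ⟨z, p, ?_, ?_⟩
  · rw [hzr p hpU]
    have := hmin p hpW
    have : 0 < a p + (m / 2 - μ) := by linarith
    have := mul_pos hpx this
    linarith
  have hlt : ‖w p - x‖ < ε := by
    refine lt_of_le_of_ne hpW.2 fun heq => ?_
    have h1 : m ≤ a p := by
      have := hfP (w p) (hSP ⟨⟨hwA p hpU, hw1 p hpU⟩, mem_sphere_iff_norm.2 heq⟩)
      simp only [a, hm]; linarith
    have h2 : ⟪z, r q₁⟫ ≤ ⟪z, r p⟫ := hpmax hq₁W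
    rw [hzr p hpU, hzr q₁ hq₁W.1, ← hμ] at h2
    have h3 := hx1r q₁ hq₁W.1
    have h4 : 1 / 2 < ⟪x, r p⟫ := by
      have h5 : ‖w p‖ * ⟪x, r p⟫ = 1 := by
        have := congrArg norm (hrw p hpU)
        rw [hn, norm_smul, Real.norm_of_nonneg hpx.le] at this
        linarith
      have h6 : ‖w p‖ ^ 2 = 1 + ε ^ 2 := by
        have : ‖x + (w p - x)‖ ^ 2 = 1 + ε ^ 2 := by
          rw [norm_add_sq_real, inner_sub_right, hw1 p hpU, hxx, hx1, heq]; ring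
        rwa [add_sub_cancel] at this
      have h7 : ‖w p‖ < 2 := by
        by_contra! hge
        nlinarith
      nlinarith
    have h8 : 0 < m / 2 := by positivity
    have h9 : ⟪x, r q₁⟫ * (μ + (m / 2 - μ)) ≤ m / 2 := by nlinarith
    have h10 : m / 2 * 1 < ⟪x, r p⟫ * (a p + (m / 2 - μ)) := by
      have h11 : m ≤ a p + (m / 2 - μ) := by linarith
      nlinarith
    linarith
  have hpint : p ∈ interior U := hεU p hpU hlt.le
  have hwp : ContinuousAt w p := hwc.continuousAt (mem_interior_iff_mem_nhds.1 hpint)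
  have h1 : ∀ᶠ q in 𝓝 p, ‖w q - x‖ < ε :=
    (hwp.sub continuousAt_const).norm.eventually (gt_mem_nhds hlt)
  filter_upwards [h1, mem_interior_iff_mem_nhds.1 hpint] with q hq hqU
  exact hpmax (show q ∈ W from ⟨hqU, hq.le⟩)

end StrictPoint

/-! ### Shrinking local convex bodies. -/

section Witness

theorem exists_mem_ne_of_chartedSpace (H : Type*) [NormedAddCommGroup H] [NormedSpace ℝ H]
    [Nontrivial H] {M : Type*} [TopologicalSpace M] [ChartedSpace H M] (p : M) {W : Set M}
    (hW : W ∈ 𝓝 p) : ∃ q ∈ W, q ≠ p := by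
  let φ := chartAt H p
  have hp : p ∈ φ.source := mem_chart_source H p
  have hne : (𝓝[≠] (φ p)).NeBot := Module.punctured_nhds_neBot ℝ H (φ p)
  have h1 : ∀ᶠ y in 𝓝 (φ p), φ.symm y ∈ W := by
    have := φ.continuousAt_symm (φ.map_source hp)
    exact this.eventually (p := fun q => q ∈ W) (by rw [φ.left_inv hp]; exact hW)
  have h2 : ∀ᶠ y in 𝓝 (φ p), y ∈ φ.target := φ.open_target.mem_nhds (φ.map_source hp)
  obtain ⟨y, ⟨hy1, hy2⟩, hy3⟩ :=
    (((h1.and h2).filter_mono nhdsWithin_le_nhds).and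
      (self_mem_nhdsWithin : {y | y ≠ φ p} ∈ 𝓝[≠] (φ p))).exists
  refine ⟨φ.symm y, hy1, fun h => hy3 ?_⟩
  have := φ.right_inv hy2
  rw [h] at this
  exact this.symm

variable {X : Type*} [TopologicalSpace X] {M : Type*} [TopologicalSpace M] {G : Geometry X}
  {r : M → X} {p : M} {K K' : Set X}

/-- A smaller convex body which contains the image of a neighbourhood of `p` is again a witness. -/
theorem Geometry.IsConvexWitness.of_subset (h : G.IsConvexWitness r p K) (hK' : G.IsConvexBody K')
    (hsub : K' ⊆ K) (hmem : ∀ᶠ q in 𝓝 p, r q ∈ K') : G.IsConvexWitness r p K' := by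
  obtain ⟨hK, U, hU, hemb, hfr⟩ := h
  refine ⟨hK', U ∩ {q | r q ∈ K'}, Filter.inter_mem hU hmem, ?_, ?_⟩
  · exact hemb.comp (Topology.IsEmbedding.inclusion Set.inter_subset_left)
  · rintro _ ⟨q, ⟨hqU, hqK⟩, rfl⟩
    refine ⟨subset_closure hqK, fun hi => ?_⟩
    exact (hfr ⟨q, hqU, rfl⟩).2 (interior_mono hsub hi)

/-- Besides `p`, a witness neighbourhood contains further points. -/
theorem Geometry.IsConvexWitness.exists_ne (H : Type*) [NormedAddCommGroup H] [NormedSpace ℝ H]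
    [Nontrivial H] [ChartedSpace H M] (h : G.IsConvexWitness r p K) {W : Set M} (hW : W ∈ 𝓝 p) :
    ∃ q ∈ W, r q ∈ K ∧ r q ≠ r p := by
  obtain ⟨hK, U, hU, hemb, hfr⟩ := h
  obtain ⟨q, ⟨hqU, hqW⟩, hqp⟩ := exists_mem_ne_of_chartedSpace H p (Filter.inter_mem hU hW)
  refine ⟨q, hqW, hK.1.frontier_subset (hfr ⟨q, hqU, rfl⟩), fun heq => hqp ?_⟩
  exact Set.injOn_iff_injective.2 hemb.injective hqU (mem_of_mem_nhds hU) heq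

theorem Geometry.IsConvexWitness.mem (h : G.IsConvexWitness r p K) : r p ∈ K := by
  obtain ⟨hK, U, hU, -, hfr⟩ := h
  exact hK.1.frontier_subset (hfr ⟨p, mem_of_mem_nhds hU, rfl⟩)

end Witness

/-! ### From spherical convex bodies to solid cones. -/

section Spherical

variable {n : ℕ} {K : Set (Sph n)}

theorem Sph.norm_eq (k : Sph n) : ‖(k : Euc (n + 1))‖ = 1 := mem_sphere_zero_iff_norm.1 k.2

/-- The cone over a subset of the unit sphere. -/
def sphCone (K : Set (Sph n)) : Set (Euc (n + 1)) := {w | ∃ t : ℝ, 0 ≤ t ∧ ∃ k ∈ K, w = t • (k : Euc (n + 1))}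

theorem smul_mem_sphCone {k : Sph n} (hk : k ∈ K) {t : ℝ} (ht : 0 ≤ t) :
    t • (k : Euc (n + 1)) ∈ sphCone K := ⟨t, ht, k, hk, rfl⟩

theorem coe_mem_sphCone {k : Sph n} : (k : Euc (n + 1)) ∈ sphCone K ↔ k ∈ K := by
  constructor
  · rintro ⟨t, ht, k', hk', h⟩
    have h1 := congrArg norm h
    rw [norm_smul, Sph.norm_eq, Sph.norm_eq, mul_one, Real.norm_of_nonneg ht] at h1
    rw [← h1, one_smul] at h
    rwa [Subtype.ext h]
  · intro hk
    have := smul_mem_sphCone hk zero_le_one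
    rwa [one_smul] at this

theorem mem_sphCone_iff {w : Euc (n + 1)} (hw : w ≠ 0) :
    w ∈ sphCone K ↔ ‖w‖⁻¹ • w ∈ (fun k : Sph n => (k : Euc (n + 1))) '' K := by
  have hw0 : 0 < ‖w‖ := norm_pos_iff.2 hw
  constructor
  · rintro ⟨t, ht, k, hk, rfl⟩
    rw [norm_smul, Sph.norm_eq, mul_one, Real.norm_of_nonneg ht] at hw0 ⊢
    exact ⟨k, hk, by rw [smul_smul, inv_mul_cancel₀ hw0.ne', one_smul]⟩
  · rintro ⟨k, hk, h⟩
    refine ⟨‖w‖, hw0.le, k, hk, ?_⟩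
    dsimp only at h
    rw [h, smul_smul, mul_inv_cancel₀ hw0.ne', one_smul]

theorem isClosed_sphCone (hK : IsClosed K) (hne : K.Nonempty) : IsClosed (sphCone K) := by
  have hKc : IsClosed ((fun k : Sph n => (k : Euc (n + 1))) '' K) :=
    (hK.isCompact.image continuous_subtype_val).isClosed
  refine isClosed_of_closure_subset fun w hw => ?_
  by_cases hw0 : w = 0
  · obtain ⟨k, hk⟩ := hne
    exact ⟨0, le_rfl, k, hk, by rw [hw0, zero_smul]⟩
  by_contra hcon
  rw [mem_sphCone_iff hw0] at hcon
  have hc : ContinuousAt (fun y : Euc (n + 1) => ‖y‖⁻¹ • y) w :=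
    (continuousAt_id.norm.inv₀ (norm_ne_zero_iff.2 hw0)).smul continuousAt_id
  have h1 := (hc.eventually (hKc.isOpen_compl.mem_nhds hcon)).and (isOpen_ne.mem_nhds hw0)
  obtain ⟨y, ⟨hy1, hy2⟩, hy3⟩ := mem_closure_iff_nhds.1 hw _ h1
  exact hy1 ((mem_sphCone_iff hy2).1 hy3)

/-- The sum lies in the plane sector over the shortest arc from `k` to `k'`, so its direction is a
point of this arc. Working with the given arc also covers antipodal points, where arcs are not
unique. -/
theorem add_mem_sphCone (hK : (sphericalGeometry n).IsConvex K) {w w' : Euc (n + 1)}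
    (hw : w ∈ sphCone K) (hw' : w' ∈ sphCone K) : w + w' ∈ sphCone K := by
  obtain ⟨s, hs, k, hk, rfl⟩ := hw
  obtain ⟨t, ht, k', hk', rfl⟩ := hw'
  obtain ⟨A, ⟨v, hv, hkv, l, hl0, hlpi, hk'e, hA⟩, hAK⟩ := hK k hk k' hk'
  have hsinl := Real.sin_nonneg_of_nonneg_of_le_pi hl0 hlpi
  set a := s + t * Real.cos l with ha
  set b := t * Real.sin l with hb
  have hsum : s • (k : Euc (n + 1)) + t • (k' : Euc (n + 1)) = a • (k : Euc (n + 1)) + b • v := by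
    rw [hk'e]; module
  have hb0 : 0 ≤ b := mul_nonneg ht hsinl
  rw [hsum]
  rcases (show 0 ≤ a ^ 2 + b ^ 2 by positivity).eq_or_lt with h0 | hpos
  · have ha0 : a = 0 := by nlinarith [sq_nonneg a, sq_nonneg b]
    have hb0 : b = 0 := by nlinarith [sq_nonneg a, sq_nonneg b]
    exact ⟨0, le_rfl, k, hk, by rw [ha0, hb0]; simp⟩
  obtain ⟨θ, hθ, he⟩ := exists_eq_smul_circlePt (k : Euc (n + 1)) v hpos
  set m := Real.sqrt (a ^ 2 + b ^ 2) with hm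
  have hm0 : 0 < m := Real.sqrt_pos.2 hpos
  have hc1 : m * Real.cos θ = a := by
    have := congrArg (fun y => ⟪(k : Euc (n + 1)), y⟫) he
    simpa [circlePt, inner_add_right, inner_smul_right, hkv, Sph.norm_eq] using this.symm
  have hs1 : m * Real.sin θ = b := by
    have := congrArg (fun y => ⟪v, y⟫) he
    simpa [circlePt, inner_add_right, inner_smul_right, real_inner_comm (k : Euc (n + 1)) v, hkv, hv]
      using this.symm
  have hθpi : |θ| ≤ Real.pi := hθ ▸ Real.arccos_le_pi _
  -- replace the angle by a nonnegative one
  obtain ⟨φ, hφ0, hφpi, hcφ, hsφ⟩ : ∃ φ : ℝ, 0 ≤ φ ∧ φ ≤ Real.pi ∧ m * Real.cos φ = a ∧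
      m * Real.sin φ = b := by
    rcases le_total 0 θ with h | h
    · exact ⟨θ, h, (abs_le.1 hθpi).2, hc1, hs1⟩
    · refine ⟨-θ, by linarith, by linarith [(abs_le.1 hθpi).1], by rw [Real.cos_neg, hc1], ?_⟩
      have hsin : Real.sin θ ≤ 0 := Real.sin_nonpos_of_nonpos_of_neg_pi_le h (abs_le.1 hθpi).1
      have h0 : b = 0 := le_antisymm (by rw [← hs1]; exact mul_nonpos_of_nonneg_of_nonpos hm0.le hsin) hb0
      rw [h0] at hs1
      rw [Real.sin_neg, mul_neg, hs1, h0, neg_zero]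
  -- For `φ > l > 0` the sine of `φ - l` would be positive, whereas `m sin (φ - l) = -s sin l`.
  have hφl : φ ≤ l := by
    by_contra! hlt
    rcases hl0.eq_or_lt with h0 | hl0
    · have hb0' : b = 0 := by rw [hb, ← h0, Real.sin_zero, mul_zero]
      have ha0' : 0 ≤ a := by rw [ha, ← h0, Real.cos_zero, mul_one]; positivity
      rw [hb0'] at hsφ
      have hsin : Real.sin φ = 0 := (mul_eq_zero.1 hsφ).resolve_left hm0.ne'
      have hφ : φ = Real.pi := by
        by_contra hne
        exact (Real.sin_pos_of_pos_of_lt_pi (by linarith) (lt_of_le_of_ne hφpi hne)).ne' hsin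
      rw [hφ, Real.cos_pi] at hcφ
      linarith
    · have h1 : 0 < Real.sin (φ - l) := Real.sin_pos_of_pos_of_lt_pi (by linarith) (by linarith)
      have h2 : m * Real.sin (φ - l) = -(s * Real.sin l) := by
        rw [Real.sin_sub, mul_sub, ← mul_assoc, ← mul_assoc, hsφ, hcφ, ha, hb]; ring
      have h3 := mul_pos hm0 h1
      have h4 := mul_nonneg hs hsinl
      linarith
  obtain ⟨y, hyA, hy⟩ : Real.cos φ • (k : Euc (n + 1)) + Real.sin φ • v ∈ Subtype.val '' A := by
    rw [hA]; exact ⟨φ, ⟨hφ0, hφl⟩, rfl⟩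
  refine ⟨m, hm0.le, y, hAK hyA, ?_⟩
  rw [hy, smul_add, smul_smul, smul_smul, hcφ, hsφ]

theorem coe_mem_interior_sphCone {k : Sph n} (hk : k ∈ interior K) :
    (k : Euc (n + 1)) ∈ interior (sphCone K) := by
  obtain ⟨O, hO, hOK⟩ := isOpen_induced_iff.1 (isOpen_interior (s := K))
  have hk0 : (k : Euc (n + 1)) ≠ 0 := by
    intro h; have := Sph.norm_eq k; rw [h, norm_zero] at this; exact zero_ne_one this
  have hc : ContinuousAt (fun y : Euc (n + 1) => ‖y‖⁻¹ • y) k :=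
    (continuousAt_id.norm.inv₀ (norm_ne_zero_iff.2 hk0)).smul continuousAt_id
  rw [mem_interior_iff_mem_nhds]
  have hkO : ‖(k : Euc (n + 1))‖⁻¹ • (k : Euc (n + 1)) ∈ O := by
    rw [Sph.norm_eq, inv_one, one_smul]
    rw [← hOK] at hk
    exact hk
  filter_upwards [hc.eventually (hO.mem_nhds hkO), isOpen_ne.mem_nhds hk0] with y hy hy0
  have hy1 : ‖‖y‖⁻¹ • y‖ = 1 := by
    rw [norm_smul, norm_inv, norm_norm, inv_mul_cancel₀ (norm_ne_zero_iff.2 hy0)]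
  refine (mem_sphCone_iff hy0).2 ⟨⟨_, mem_sphere_zero_iff_norm.2 hy1⟩, interior_subset ?_, rfl⟩
  rw [← hOK]
  exact hy

theorem mem_interior_of_coe {k : Sph n} (hk : (k : Euc (n + 1)) ∈ interior (sphCone K)) :
    k ∈ interior K := by
  have h : (fun k : Sph n => (k : Euc (n + 1))) ⁻¹' interior (sphCone K) ⊆ K := fun k hk =>
    coe_mem_sphCone.1 (interior_subset hk)
  exact interior_maximal h (isOpen_interior.preimage continuous_subtype_val) hk

theorem isSolidCone_sphCone (hK : (sphericalGeometry n).IsConvexBody K) : IsSolidCone (sphCone K) where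
  closed := isClosed_sphCone hK.1 (hK.2.1.mono interior_subset)
  add_mem := add_mem_sphCone hK.2.2
  smul_mem := by
    rintro t _ ht ⟨s, hs, k, hk, rfl⟩
    rw [smul_smul]
    exact smul_mem_sphCone hk (mul_nonneg ht hs)
  nonempty_interior := by
    obtain ⟨k, hk⟩ := hK.2.1
    exact ⟨_, coe_mem_interior_sphCone hk⟩

variable {M : Type*} [TopologicalSpace M] {r : M → Sph n} {p : M}

theorem isConeChart_of_witness (h : (sphericalGeometry n).IsConvexWitness r p K) :
    IsConeChart (fun q => (r q : Euc (n + 1))) (sphCone K) p := by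
  obtain ⟨hK, U, hU, hemb, hfr⟩ := h
  have hC := isSolidCone_sphCone hK
  refine ⟨hC, U, hU, fun q hq q' hq' heq => ?_, fun q hq => ?_⟩
  · exact Set.injOn_iff_injective.2 hemb.injective hq hq' (Subtype.ext heq)
  · have hq := hfr ⟨q, hq, rfl⟩
    exact hC.mem_frontier.2 ⟨coe_mem_sphCone.2 (hK.1.frontier_subset hq),
      fun hi => hq.2 (mem_interior_of_coe hi)⟩

end Spherical

/-! ### The Euclidean case: a farthest point. -/

section Euclidean

variable {n : ℕ}

theorem euclideanGeometry_isConvex_iff {K : Set (Euc n)} :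
    (euclideanGeometry n).IsConvex K ↔ Convex ℝ K := by
  rw [convex_iff_segment_subset]
  constructor
  · intro h a ha b hb
    obtain ⟨A, rfl, hAK⟩ := h a ha b hb
    exact hAK
  · exact fun h a ha b hb => ⟨_, rfl, h ha hb⟩

/-- A compact locally convex hypersurface of `ℝⁿ` is strictly locally convex at a point farthest
from the origin. -/
theorem exists_strictlyLocallyConvexAt_euclidean (hn : 2 < n) {M : Type*} [TopologicalSpace M]
    [CompactSpace M] [Nonempty M] [ChartedSpace (EuclideanSpace ℝ (Fin (n - 1))) M] {r : M → Euc n}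
    (hr : Continuous r) (hloc : ∀ p, (euclideanGeometry n).LocallyConvexAt r p) :
    ∃ p, (euclideanGeometry n).StrictlyLocallyConvexAt r p := by
  have : Nonempty (Fin (n - 1)) := ⟨⟨0, by omega⟩⟩
  obtain ⟨p, -, hp⟩ := isCompact_univ.exists_isMaxOn Set.univ_nonempty hr.norm.continuousOn
  replace hp : ∀ q, ‖r q‖ ≤ ‖r p‖ := fun q => hp (Set.mem_univ q)
  obtain ⟨K, hK⟩ := hloc p
  have hKc : Convex ℝ K := euclideanGeometry_isConvex_iff.1 hK.1.2.2
  obtain ⟨q, -, hqK, hqp⟩ := hK.exists_ne (EuclideanSpace ℝ (Fin (n - 1))) Filter.univ_mem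
  set K' : Set (Euc n) := K ∩ Metric.closedBall 0 ‖r p‖ with hK'
  -- The ball is strictly convex, so the midpoint of `r p` and a second point of `K` is in the open
  -- ball; it is also a limit of interior points of `K`.
  have hint : (interior K').Nonempty := by
    have hm : (1 / 2 : ℝ) • r p + (1 / 2 : ℝ) • r q ∈ K :=
      hKc hK.mem hqK (by norm_num) (by norm_num) (by norm_num)
    have hmb : (1 / 2 : ℝ) • r p + (1 / 2 : ℝ) • r q ∈ Metric.ball (0 : Euc n) ‖r p‖ := by
      rw [mem_ball_zero_iff]
      exact norm_combo_lt_of_ne le_rfl (hp q) (Ne.symm hqp) (by norm_num) (by norm_num)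
        (by norm_num)
    have hcl : K ⊆ closure (interior K) := by
      rw [hKc.closure_interior_eq_closure_of_nonempty_interior hK.1.2.1]
      exact subset_closure
    obtain ⟨w, hw, hwi⟩ := mem_closure_iff.1 (hcl hm) _ Metric.isOpen_ball hmb
    rw [hK', interior_inter]
    exact ⟨w, hwi, interior_maximal Metric.ball_subset_closedBall Metric.isOpen_ball hw⟩
  have hbody : (euclideanGeometry n).IsConvexBody K' :=
    ⟨hK.1.1.inter Metric.isClosed_closedBall, hint,
      euclideanGeometry_isConvex_iff.2 (hKc.inter (convex_closedBall _ _))⟩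
  have hmem : ∀ᶠ q in 𝓝 p, r q ∈ K' := by
    obtain ⟨hKK, U, hU, -, hfr⟩ := hK
    filter_upwards [hU] with q hq
    exact ⟨hKK.1.frontier_subset (hfr ⟨q, hq, rfl⟩), mem_closedBall_zero_iff.2 (hp q)⟩
  refine ⟨p, K', hK.of_subset hbody Set.inter_subset_left hmem, _, ⟨-r p, fun h0 => hqp ?_, rfl⟩, ?_⟩
  · have h := hp q
    rw [neg_eq_zero.1 h0, norm_zero, norm_le_zero_iff] at h
    rw [h, neg_eq_zero.1 h0]
  · rintro x ⟨⟨-, hx⟩, hxp⟩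
    rw [mem_closedBall_zero_iff] at hx
    have h1 : 0 < ‖x - r p‖ := norm_pos_iff.2 (sub_ne_zero.2 hxp)
    have h2 := norm_sub_sq_real x (r p)
    change 0 < ⟪-r p, x - r p⟫
    rw [inner_neg_left, inner_sub_right, real_inner_self_eq_norm_sq, real_inner_comm]
    nlinarith [norm_nonneg x]

end Euclidean

/-! ### The hyperbolic case: a highest point of the hyperboloid. -/

section Hyperbolic

variable {n : ℕ}

theorem lorentz_add_left (x y z : ℝ × Euc n) : lorentz (x + y) z = lorentz x z + lorentz y z := by
  simp only [lorentz, Prod.fst_add, Prod.snd_add, inner_add_left]; ring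

theorem lorentz_smul_left (c : ℝ) (x z : ℝ × Euc n) : lorentz (c • x) z = c * lorentz x z := by
  simp only [lorentz, Prod.smul_fst, Prod.smul_snd, real_inner_smul_left, smul_eq_mul]; ring

theorem lorentz_comm (x y : ℝ × Euc n) : lorentz x y = lorentz y x := by
  simp only [lorentz, real_inner_comm, mul_comm]

theorem lorentz_add_right (x y z : ℝ × Euc n) : lorentz z (x + y) = lorentz z x + lorentz z y := by
  rw [lorentz_comm, lorentz_add_left, lorentz_comm x, lorentz_comm y]

theorem lorentz_smul_right (c : ℝ) (x z : ℝ × Euc n) : lorentz z (c • x) = c * lorentz z x := by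
  rw [lorentz_comm, lorentz_smul_left, lorentz_comm]

theorem continuous_lorentz_self : Continuous fun x : ℝ × Euc n => lorentz x x := by
  unfold lorentz; fun_prop

variable {K : Set (Hyp n)}

/-- Distinct points of a segment of `ℍⁿ` satisfy the strict reversed Cauchy–Schwarz inequality. -/
theorem lorentz_lt_of_isConvex (hK : (hyperbolicGeometry n).IsConvex K) {a b : Hyp n} (ha : a ∈ K)
    (hb : b ∈ K) (hab : a ≠ b) : 1 < -lorentz a.1 b.1 := by
  obtain ⟨A, ⟨v, hv, hav, l, hl0, hbe, -⟩, -⟩ := hK a ha b hb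
  have hl : l ≠ 0 := by
    rintro rfl
    rw [Real.cosh_zero, Real.sinh_zero, one_smul, zero_smul, add_zero] at hbe
    exact hab (Subtype.ext hbe.symm)
  rw [hbe, lorentz_add_right, lorentz_smul_right, lorentz_smul_right, hav, a.2.1]
  have := Real.one_lt_cosh.2 hl
  linarith

/-- The open cone over a subset of hyperbolic space. -/
def hypCone (K : Set (Hyp n)) : Set (ℝ × Euc n) := {w | ∃ t : ℝ, 0 < t ∧ ∃ k ∈ K, w = t • k.1}

theorem coe_mem_hypCone {k : Hyp n} : k.1 ∈ hypCone K ↔ k ∈ K := by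
  constructor
  · rintro ⟨t, ht, k', hk', h⟩
    have h1 := k.2.1
    rw [h, lorentz_smul_left, lorentz_smul_right, k'.2.1] at h1
    have h2 : t = 1 := by nlinarith
    rw [h2, one_smul] at h
    rwa [Subtype.ext h]
  · exact fun hk => ⟨1, one_pos, k, hk, (one_smul _ _).symm⟩

/-- Positive combinations of `a` and `b` point into the sector over the geodesic segment. The cone
reduces questions about interiors in `ℍⁿ` to linear convexity. -/
theorem convex_hypCone (hK : (hyperbolicGeometry n).IsConvex K) : Convex ℝ (hypCone K) := by
  have key : ∀ a ∈ K, ∀ b ∈ K, ∀ s t : ℝ, 0 < s → 0 < t → s • a.1 + t • b.1 ∈ hypCone K := by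
    intro a ha b hb s t hs ht
    obtain ⟨S, ⟨v, hv, hav, l, hl0, hbe, rfl⟩, hSK⟩ := hK a ha b hb
    have hsl : 0 ≤ Real.sinh l := Real.sinh_nonneg_iff.2 hl0
    have hcl := Real.one_le_cosh l
    have hcs := Real.cosh_sq l
    set A := s + t * Real.cosh l with hA
    set B := t * Real.sinh l with hB
    have hB0 : 0 ≤ B := mul_nonneg ht.le hsl
    have hA0 : 0 < A := by positivity
    have hpos : 0 < A ^ 2 - B ^ 2 := by
      have : A ^ 2 - B ^ 2 = s ^ 2 + 2 * s * t * Real.cosh l + t ^ 2 := by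
        rw [hA, hB]; linear_combination t ^ 2 * hcs
      rw [this]; positivity
    set m := Real.sqrt (A ^ 2 - B ^ 2) with hm
    have hm0 : 0 < m := Real.sqrt_pos.2 hpos
    have hm2 : m ^ 2 = A ^ 2 - B ^ 2 := Real.sq_sqrt hpos.le
    set φ := Real.arsinh (B / m) with hφ
    have hsφ : m * Real.sinh φ = B := by rw [hφ, Real.sinh_arsinh]; field_simp
    have hcφ : m * Real.cosh φ = A := by
      have h1 : (m * Real.cosh φ) ^ 2 = A ^ 2 := by
        rw [mul_pow, Real.cosh_sq, mul_add, ← mul_pow, hsφ, hm2]; ring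
      exact (pow_left_inj₀ (mul_pos hm0 (Real.cosh_pos φ)).le hA0.le two_ne_zero).1 h1
    have hφ0 : 0 ≤ φ := Real.arsinh_nonneg_iff.2 (div_nonneg hB0 hm0.le)
    have hφl : φ ≤ l := by
      have h1 : m * Real.sinh (l - φ) = s * Real.sinh l := by
        rw [Real.sinh_sub]
        linear_combination Real.sinh l * hcφ - Real.cosh l * hsφ + Real.sinh l * hA -
          Real.cosh l * hB
      have h2 : 0 ≤ Real.sinh (l - φ) := by
        by_contra! h
        nlinarith [mul_nonneg hs.le hsl, mul_pos_of_neg_of_neg (neg_neg_of_pos hm0) h]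
      have := Real.sinh_nonneg_iff.1 h2
      linarith
    set y : ℝ × Euc n := Real.cosh φ • a.1 + Real.sinh φ • v with hy
    have hmy : m • y = s • a.1 + t • b.1 := by
      rw [hy, smul_add, smul_smul, smul_smul, hcφ, hsφ, hbe, hA, hB]; module
    have hyy : lorentz y y = -1 := by
      have hva : lorentz v a.1 = 0 := by rw [lorentz_comm]; exact hav
      simp only [hy, lorentz_add_left, lorentz_add_right, lorentz_smul_left, lorentz_smul_right,
        hav, hva, hv, a.2.1]
      linear_combination -Real.cosh_sq φ
    have hy0 : 0 < y.1 := by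
      have h1 : m * y.1 = s * a.1.1 + t * b.1.1 := congrArg Prod.fst hmy
      have h2 : 0 < s * a.1.1 + t * b.1.1 := add_pos (mul_pos hs a.2.2) (mul_pos ht b.2.2)
      rw [← h1] at h2
      exact (pos_iff_pos_of_mul_pos h2).1 hm0
    exact ⟨m, hm0, ⟨y, hyy, hy0⟩, hSK ⟨φ, ⟨hφ0, hφl⟩, rfl⟩, hmy.symm⟩
  rw [convex_iff_forall_pos]
  rintro _ ⟨s, hs, a, ha, rfl⟩ _ ⟨t, ht, b, hb, rfl⟩ c d hc hd -
  rw [smul_smul, smul_smul]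
  exact key a ha b hb _ _ (mul_pos hc hs) (mul_pos hd ht)

theorem normalize_mem_hyp {w : ℝ × Euc n} (hw : lorentz w w < 0) (hw0 : 0 < w.1) :
    lorentz ((Real.sqrt (-lorentz w w))⁻¹ • w) ((Real.sqrt (-lorentz w w))⁻¹ • w) = -1 ∧
      0 < ((Real.sqrt (-lorentz w w))⁻¹ • w).1 := by
  have h1 : 0 < Real.sqrt (-lorentz w w) := Real.sqrt_pos.2 (neg_pos.2 hw)
  have h2 := Real.sq_sqrt (neg_pos.2 hw).le
  constructor
  · rw [lorentz_smul_left, lorentz_smul_right]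
    field_simp
    linarith
  · exact mul_pos (inv_pos.2 h1) hw0

theorem coe_mem_interior_hypCone {k : Hyp n} (hk : k ∈ interior K) :
    k.1 ∈ interior (hypCone K) := by
  obtain ⟨O, hO, hOK⟩ := isOpen_induced_iff.1 (isOpen_interior (s := K))
  have hL : Real.sqrt (-lorentz k.1 k.1) = 1 := by rw [k.2.1, neg_neg, Real.sqrt_one]
  have hc : ContinuousAt (fun y : ℝ × Euc n => (Real.sqrt (-lorentz y y))⁻¹ • y) k.1 :=
    ((continuous_lorentz_self.neg.sqrt.continuousAt).inv₀ (hL.trans_ne one_ne_zero)).smul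
      continuousAt_id
  have hkO : (Real.sqrt (-lorentz k.1 k.1))⁻¹ • k.1 ∈ O := by
    rw [hL, inv_one, one_smul]
    rw [← hOK] at hk
    exact hk
  have h1 : ∀ᶠ y in 𝓝 k.1, lorentz y y < 0 :=
    (isOpen_lt continuous_lorentz_self continuous_const).mem_nhds
      (by rw [Set.mem_ofPred_eq, k.2.1]; norm_num)
  have h2 : ∀ᶠ y in 𝓝 k.1, 0 < y.1 :=
    (isOpen_lt continuous_const continuous_fst).mem_nhds k.2.2
  rw [mem_interior_iff_mem_nhds]
  filter_upwards [hc.eventually (hO.mem_nhds hkO), h1, h2] with y hy hy1 hy2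
  have hs : 0 < Real.sqrt (-lorentz y y) := Real.sqrt_pos.2 (neg_pos.2 hy1)
  refine ⟨_, hs, ⟨_, normalize_mem_hyp hy1 hy2⟩, interior_subset ?_, ?_⟩
  · rw [← hOK]
    exact hy
  · rw [smul_smul, mul_inv_cancel₀ hs.ne', one_smul]

theorem mem_interior_of_coe_hyp {k : Hyp n} (hk : k.1 ∈ interior (hypCone K)) : k ∈ interior K := by
  have h : (fun k : Hyp n => k.1) ⁻¹' interior (hypCone K) ⊆ K := fun k hk =>
    coe_mem_hypCone.1 (interior_subset hk)
  exact interior_maximal h (isOpen_interior.preimage continuous_subtype_val) hk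

open scoped Pointwise in
theorem smul_mem_interior_hypCone {w : ℝ × Euc n} (hw : w ∈ interior (hypCone K)) {t : ℝ}
    (ht : 0 < t) : t • w ∈ interior (hypCone K) := by
  have h : t • interior (hypCone K) ⊆ hypCone K := by
    rintro _ ⟨y, hy, rfl⟩
    obtain ⟨s, hs, k, hk, rfl⟩ := interior_subset hy
    exact ⟨t * s, mul_pos ht hs, k, hk, smul_smul _ _ _⟩
  exact interior_maximal h (isOpen_interior.smul₀ ht.ne') (Set.smul_mem_smul_set hw)

/-- A compact locally convex hypersurface of `ℍⁿ` is strictly locally convex at a point of maximal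
height. -/
theorem exists_strictlyLocallyConvexAt_hyperbolic (hn : 2 < n) {M : Type*} [TopologicalSpace M]
    [CompactSpace M] [Nonempty M] [ChartedSpace (EuclideanSpace ℝ (Fin (n - 1))) M] {r : M → Hyp n}
    (hr : Continuous r) (hloc : ∀ p, (hyperbolicGeometry n).LocallyConvexAt r p) :
    ∃ p, (hyperbolicGeometry n).StrictlyLocallyConvexAt r p := by
  have : Nonempty (Fin (n - 1)) := ⟨⟨0, by omega⟩⟩
  have hht : Continuous fun x : Hyp n => x.1.1 := continuous_fst.comp continuous_subtype_val
  obtain ⟨p, -, hp⟩ := isCompact_univ.exists_isMaxOn Set.univ_nonempty (hht.comp hr).continuousOn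
  replace hp : ∀ q, (r q).1.1 ≤ (r p).1.1 := fun q => hp (Set.mem_univ q)
  obtain ⟨K, hK⟩ := hloc p
  obtain ⟨q, -, hqK, hqp⟩ := hK.exists_ne (EuclideanSpace ℝ (Fin (n - 1))) Filter.univ_mem
  set c := (r p).1.1 with hc
  have hc0 : 0 < c := (r p).2.2
  set K' : Set (Hyp n) := K ∩ {x | x.1.1 ≤ c} with hK'
  -- The height is convex enough along geodesics: `sinh l • y = sinh (l - t) • a + sinh t • b`, and
  -- these two coefficients sum to at most `sinh l`.
  have hconv : (hyperbolicGeometry n).IsConvex K' := by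
    rintro a ⟨ha, hac⟩ b ⟨hb, hbc⟩
    obtain ⟨A, ⟨v, hv, hav, l, hl0, hbe, rfl⟩, hAK⟩ := hK.1.2.2 a ha b hb
    refine ⟨_, ⟨v, hv, hav, l, hl0, hbe, rfl⟩, fun y hy => ⟨hAK hy, ?_⟩⟩
    obtain ⟨t, ht, hyt⟩ := hy
    rw [Set.mem_ofPred_eq] at hac hbc ⊢
    rcases hl0.eq_or_lt with h0 | hl0
    · have ht0 : t = 0 := le_antisymm (h0 ▸ ht.2) ht.1
      rw [hyt, ht0, Real.cosh_zero, Real.sinh_zero, one_smul, zero_smul, add_zero]; exact hac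
    have hsl : 0 < Real.sinh l := Real.sinh_pos_iff.2 hl0
    have hst : 0 ≤ Real.sinh t := Real.sinh_nonneg_iff.2 ht.1
    have hslt : 0 ≤ Real.sinh (l - t) := Real.sinh_nonneg_iff.2 (sub_nonneg.2 ht.2)
    have hcomb : Real.sinh l • y.1 = Real.sinh (l - t) • a.1 + Real.sinh t • b.1 := by
      rw [hyt, hbe, Real.sinh_sub]; module
    have hge : Real.sinh (l - t) + Real.sinh t ≤ Real.sinh l := by
      have h1 : Real.sinh l =
          Real.sinh (l - t) * Real.cosh t + Real.cosh (l - t) * Real.sinh t := by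
        rw [← Real.sinh_add, sub_add_cancel]
      nlinarith [Real.one_le_cosh t, Real.one_le_cosh (l - t)]
    have h2 : Real.sinh l * y.1.1 = Real.sinh (l - t) * a.1.1 + Real.sinh t * b.1.1 :=
      congrArg Prod.fst hcomb
    have h3 : Real.sinh l * y.1.1 ≤ Real.sinh l * c := by
      rw [h2]
      nlinarith [mul_le_mul_of_nonneg_left hac hslt, mul_le_mul_of_nonneg_left hbc hst]
    exact le_of_mul_le_mul_left h3 hsl
  have hint : (interior K').Nonempty := by
    have hpq := lorentz_lt_of_isConvex hK.1.2.2 hK.mem hqK (Ne.symm hqp)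
    have hC := convex_hypCone hK.1.2.2
    set m : ℝ × Euc n := (r p).1 + (r q).1 with hm
    have hmC : m ∈ hypCone K := by
      have h1 := hC (coe_mem_hypCone.2 hK.mem) (coe_mem_hypCone.2 hqK) (a := 1 / 2) (b := 1 / 2)
        (by norm_num) (by norm_num) (by norm_num)
      obtain ⟨t, ht, k, hk, h⟩ := h1
      refine ⟨2 * t, by positivity, k, hk, ?_⟩
      rw [mul_smul, ← h, hm]; module
    have hmm : 4 < -lorentz m m := by
      simp only [hm, lorentz_add_left, lorentz_add_right, (r p).2.1, (r q).2.1,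
        lorentz_comm (r q).1 (r p).1]
      linarith
    -- The normalized midpoint is strictly lower than `c`: `m.1 ≤ 2 c`, while the reversed
    -- Cauchy–Schwarz inequality makes the normalizing factor exceed 2.
    have hlt : m.1 < c * Real.sqrt (-lorentz m m) := by
      have h1 : 2 < Real.sqrt (-lorentz m m) := Real.lt_sqrt_of_sq_lt (by linarith)
      have h2 : m.1 = c + (r q).1.1 := rfl
      nlinarith [hp q]
    have ho : IsOpen {w : ℝ × Euc n | lorentz w w < 0 ∧ 0 < w.1 ∧
        w.1 < c * Real.sqrt (-lorentz w w)} :=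
      (isOpen_lt continuous_lorentz_self continuous_const).inter
        ((isOpen_lt continuous_const continuous_fst).inter
          (isOpen_lt continuous_fst (continuous_const.mul continuous_lorentz_self.neg.sqrt)))
    have hcl : hypCone K ⊆ closure (interior (hypCone K)) := by
      obtain ⟨k, hk⟩ := hK.1.2.1
      rw [hC.closure_interior_eq_closure_of_nonempty_interior ⟨_, coe_mem_interior_hypCone hk⟩]
      exact subset_closure
    obtain ⟨w, ⟨hw1, hw2, hw3⟩, hw⟩ := mem_closure_iff.1 (hcl hmC) _ ho
      ⟨by linarith, add_pos (r p).2.2 (r q).2.2, hlt⟩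
    have hs : 0 < Real.sqrt (-lorentz w w) := Real.sqrt_pos.2 (neg_pos.2 hw1)
    set k : Hyp n := ⟨_, normalize_mem_hyp hw1 hw2⟩ with hk
    have h1 : k ∈ interior K :=
      mem_interior_of_coe_hyp (smul_mem_interior_hypCone hw (inv_pos.2 hs))
    have h2 : k.1.1 < c := by
      change (Real.sqrt (-lorentz w w))⁻¹ * w.1 < c
      rwa [inv_mul_lt_iff₀ hs, mul_comm]
    refine ⟨k, interior_maximal (t := interior K ∩ {x : Hyp n | x.1.1 < c}) ?_
      (isOpen_interior.inter (isOpen_lt hht continuous_const)) ⟨h1, h2⟩⟩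
    exact fun y hy => ⟨interior_subset hy.1, (le_of_lt hy.2 : y.1.1 ≤ c)⟩
  have hcl : IsClosed K' := hK.1.1.inter (isClosed_le hht continuous_const)
  have hmem : ∀ᶠ q in 𝓝 p, r q ∈ K' := by
    obtain ⟨hKK, U, hU, -, hfr⟩ := hK
    filter_upwards [hU] with q hq
    exact ⟨hKK.1.frontier_subset (hfr ⟨q, hq, rfl⟩), hp q⟩
  -- `v` is normal to the hyperplane through `r p` tangent to the ball around `(1, 0)`. Its form on
  -- `k` is `-k.1 - c * lorentz (r p) k`, positive because `k.1 ≤ c` and `-lorentz (r p) k > 1`.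
  set v : ℝ × Euc n := (1, 0) + (-c) • (r p).1 with hv
  have hvk : ∀ k : Hyp n, lorentz v k.1 = -k.1.1 - c * lorentz (r p).1 k.1 := by
    intro k
    rw [hv, lorentz_add_left, lorentz_smul_left]
    simp only [lorentz, inner_zero_left]; ring
  have hpos : ∀ k ∈ K', k ≠ r p → 0 < lorentz v k.1 := by
    rintro k ⟨hkK, hkc⟩ hkp
    have h1 := lorentz_lt_of_isConvex hK.1.2.2 hK.mem hkK (Ne.symm hkp)
    rw [hvk]
    rw [Set.mem_ofPred_eq] at hkc
    nlinarith
  refine ⟨p, K', hK.of_subset ⟨hcl, hint, hconv⟩ Set.inter_subset_left hmem, _,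
    ⟨v, fun h0 => ?_, ?_, rfl⟩, fun k hk => hpos k hk.1 hk.2⟩
  · have := hpos (r q) ⟨hqK, hp q⟩ hqp
    rw [h0] at this
    simp [lorentz] at this
  · rw [hvk, (r p).2.1]; ring

end Hyperbolic

/-! ### The boundary of a cone as a continuous graph. -/

section Height

variable {E : Type*} [NormedAddCommGroup E] [InnerProductSpace ℝ E] {A : Set E} {ζ w x : E}

namespace IsSolidCone

/-- Supporting functionals are positive on the interior. -/
theorem inner_pos_of_mem_interior {n : E} (hn : n ≠ 0)
    (h : ∀ y ∈ A, 0 ≤ ⟪n, y⟫) (hx : x ∈ interior A) : 0 < ⟪n, x⟫ := by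
  obtain ⟨ε, hε, hb⟩ := Metric.isOpen_iff.1 isOpen_interior x hx
  have hn0 : 0 < ‖n‖ := norm_pos_iff.2 hn
  have h1 : x - (ε / 2 / ‖n‖) • n ∈ A := by
    refine interior_subset (hb ?_)
    rw [mem_ball_iff_norm, sub_sub_cancel_left, norm_neg, norm_smul, Real.norm_of_nonneg (by positivity),
      div_mul_cancel₀ _ hn0.ne']
    linarith
  have h2 := h _ h1
  rw [inner_sub_right, inner_smul_right, real_inner_self_eq_norm_sq] at h2
  have : 0 < ε / 2 / ‖n‖ * ‖n‖ ^ 2 := by positivity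
  linarith

/-- The height of the boundary of a cone over the point `y` in the direction `ζ`. -/
noncomputable def _root_.coneHeight (A : Set E) (ζ y : E) : ℝ := sInf {t : ℝ | y + t • ζ ∈ A}

variable (hA : IsSolidCone A) (hζ : ζ ∈ interior A) (hw : w ∈ frontier A)

include hA hζ

theorem exists_add_smul_mem_of_interior (y : E) : ∃ t : ℝ, y + t • ζ ∈ A := by
  have hc : ContinuousAt (fun s : ℝ => ζ + s • y) 0 := by fun_prop
  have h1 : ∀ᶠ s : ℝ in 𝓝[>] 0, ζ + s • y ∈ A :=
    (hc.eventually (p := fun x => x ∈ A) (by simpa using mem_interior_iff_mem_nhds.1 hζ)).filter_mono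
      nhdsWithin_le_nhds
  obtain ⟨s, hs, hs0⟩ := (h1.and self_mem_nhdsWithin).exists
  have hs0 : 0 < s := hs0
  refine ⟨s⁻¹, ?_⟩
  have := hA.smul_mem (inv_pos.2 hs0).le hs
  rwa [smul_add, smul_smul, inv_mul_cancel₀ hs0.ne', one_smul, add_comm] at this

include hw

theorem neg_notMem_of_interior : -ζ ∉ A := fun h => by
  have h0 := hA.interior_notMem_zero ⟨w, hw⟩
  have := hA.add_mem_interior h hζ
  rw [neg_add_cancel] at this
  exact h0 this

theorem bddBelow_height (y : E) : BddBelow {t : ℝ | y + t • ζ ∈ A} := by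
  have hne := hA.neg_notMem_of_interior hζ hw
  have hc : ContinuousAt (fun s : ℝ => -ζ + s • y) 0 := by fun_prop
  have h1 : ∀ᶠ s : ℝ in 𝓝[>] 0, -ζ + s • y ∉ A :=
    (hc.eventually (p := fun x => x ∉ A)
      (by simpa using hA.closed.isOpen_compl.eventually_mem hne)).filter_mono nhdsWithin_le_nhds
  obtain ⟨s, hs, hs0⟩ := (h1.and self_mem_nhdsWithin).exists
  have hs0 : 0 < s := hs0
  refine ⟨-s⁻¹, fun t ht => ?_⟩
  by_contra! hlt
  apply hs
  have h2 : y + t • ζ + (-s⁻¹ - t) • ζ ∈ A :=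
    hA.add_mem ht (hA.smul_mem (by linarith) (interior_subset hζ))
  have h3 := hA.smul_mem hs0.le h2
  have : s • (y + t • ζ + (-s⁻¹ - t) • ζ) = -ζ + s • y := by
    rw [add_assoc, ← add_smul, smul_add, smul_smul]
    have : s * (t + (-s⁻¹ - t)) = -1 := by field_simp; ring
    rw [this]; module
  rwa [this] at h3

/-- The admissible heights form a nonempty closed upper ray bounded below, so the infimum is
attained and is not the default value of `sInf`. -/
theorem height_le_iff {y : E} {t : ℝ} : coneHeight A ζ y ≤ t ↔ y + t • ζ ∈ A := by
  have hb := hA.bddBelow_height hζ hw y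
  have hcl : IsClosed {t : ℝ | y + t • ζ ∈ A} := hA.closed.preimage (by fun_prop)
  have hne : {t : ℝ | y + t • ζ ∈ A}.Nonempty := hA.exists_add_smul_mem_of_interior hζ y
  constructor
  · intro h
    have hmem := hcl.csInf_mem hne hb
    have := hA.add_mem hmem (hA.smul_mem (sub_nonneg.2 h) (interior_subset hζ))
    rwa [add_assoc, ← add_smul, coneHeight, add_sub_cancel] at this
  · exact fun h => csInf_le hb h

theorem height_lt_iff {y : E} {t : ℝ} : coneHeight A ζ y < t ↔ y + t • ζ ∈ interior A := by
  constructor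
  · intro h
    have := hA.add_mem_interior ((hA.height_le_iff hζ hw (y := y)).1 le_rfl)
      (hA.smul_mem_interior (sub_pos.2 h) hζ)
    rwa [add_assoc, ← add_smul, add_sub_cancel] at this
  · intro h
    have hc : ContinuousAt (fun s : ℝ => y + s • ζ) t := by fun_prop
    have h1 : ∀ᶠ s : ℝ in 𝓝[<] t, y + s • ζ ∈ A :=
      (hc.eventually (p := fun x => x ∈ A) (mem_interior_iff_mem_nhds.1 h)).filter_mono
        nhdsWithin_le_nhds
    obtain ⟨s, hs, hst⟩ := (h1.and self_mem_nhdsWithin).exists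
    exact ((hA.height_le_iff hζ hw).2 hs).trans_lt hst

theorem add_height_mem_frontier (y : E) : y + coneHeight A ζ y • ζ ∈ frontier A :=
  hA.mem_frontier.2 ⟨(hA.height_le_iff hζ hw).1 le_rfl,
    fun h => lt_irrefl _ ((hA.height_lt_iff hζ hw).2 h)⟩

theorem height_eq {y : E} {t : ℝ} (h : y + t • ζ ∈ frontier A) : coneHeight A ζ y = t := by
  rw [hA.mem_frontier] at h
  exact le_antisymm ((hA.height_le_iff hζ hw).2 h.1)
    (not_lt.1 fun hlt => h.2 ((hA.height_lt_iff hζ hw).1 hlt))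

theorem height_eq_zero {y : E} (h : y ∈ frontier A) : coneHeight A ζ y = 0 :=
  hA.height_eq hζ hw (by simpa using h)

/-- Sublevel sets are preimages of `A` and strict sublevel sets preimages of its interior, under
translations. -/
theorem continuous_height : Continuous (coneHeight A ζ) := by
  refine continuous_iff_lower_upperSemicontinuous.2 ⟨?_, ?_⟩
  · refine lowerSemicontinuous_iff_isClosed_preimage.2 fun t => ?_
    have : coneHeight A ζ ⁻¹' Set.Iic t = (fun y => y + t • ζ) ⁻¹' A := by
      ext y; exact hA.height_le_iff hζ hw
    rw [this]
    exact hA.closed.preimage (by fun_prop)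
  · refine upperSemicontinuous_iff_isOpen_preimage.2 fun t => ?_
    have : coneHeight A ζ ⁻¹' Set.Iio t = (fun y => y + t • ζ) ⁻¹' interior A := by
      ext y; exact hA.height_lt_iff hζ hw
    rw [this]
    exact isOpen_interior.preimage (by fun_prop)

end IsSolidCone

end Height

/-! ### Local sections and regular hyperplanes. -/

section LocalSection

variable {E : Type*} [NormedAddCommGroup E] [InnerProductSpace ℝ E]
variable {M : Type*} [TopologicalSpace M] {r : M → E} {A : Set E} {p q : M} {ζ n a : E}

/-- Points near `r p` project along a direction close to `ζ` to the image of a neighbourhood. -/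
theorem IsLocallyConeBoundary.exists_local_section [T2Space M] [CompactSpace M]
    (hr : IsLocallyConeBoundary r) (hA : IsConeChart r A p) (hζ : ζ ∈ interior A) {W : Set M}
    (hW : W ∈ 𝓝 p) : ∃ Z ∈ 𝓝 ζ, Z ⊆ interior A ∧ ∃ ε : ℝ, 0 < ε ∧ ∃ W' ∈ 𝓝 p, ∀ ζ' ∈ Z, ∃ h : E → M,
      ContinuousOn h (Metric.ball (r p) ε) ∧
      (∀ y ∈ Metric.ball (r p) ε, h y ∈ W ∧ ∃ t s : ℝ, 0 < t ∧ y + s • ζ' = t • r (h y)) ∧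
      ∀ q ∈ W', r q ∈ Metric.ball (r p) ε ∧ h (r q) = q := by
  obtain ⟨U, hU, hinj, hmaps⟩ := hA.exists_nhds
  obtain ⟨V, hV, hVU, hVc⟩ := local_compact_nhds (Filter.inter_mem hU hW)
  have hVinj : Set.InjOn r V := hinj.mono fun q hq => (hVU hq).1
  obtain ⟨δ, hδ, hsurj⟩ := hr.exists_smul_mem hA hV
  set η : ℝ := δ / (2 * (‖ζ‖ + 1)) with hη
  have hζn : 0 < ‖ζ‖ + 1 := by positivity
  have hη0 : 0 < η := by positivity
  have hηζ : η * (‖ζ‖ + 1) = δ / 2 := by rw [hη]; field_simp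
  have hup : r p + η • ζ ∈ interior A :=
    hA.cone.add_mem_interior hA.mem (hA.cone.smul_mem_interior hη0 hζ)
  have hdown : r p + (-η) • ζ ∉ A := fun h => by
    have := (hA.cone.height_le_iff hζ hA.mem_frontier).2 h
    rw [hA.cone.height_eq_zero hζ hA.mem_frontier hA.mem_frontier] at this
    linarith
  have hc : ∀ s : ℝ, Continuous fun z : E × E => z.2 + s • z.1 := fun s => by fun_prop
  have h1 : ∀ᶠ z : E × E in 𝓝 ζ ×ˢ 𝓝 (r p), z.2 + η • z.1 ∈ interior A ∧ z.2 + (-η) • z.1 ∉ A := by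
    rw [← nhds_prod_eq]
    exact ((hc η).continuousAt.eventually (isOpen_interior.mem_nhds hup)).and
      ((hc (-η)).continuousAt.preimage_mem_nhds (x := (ζ, r p))
        (show Aᶜ ∈ 𝓝 (r p + (-η) • ζ) from hA.cone.closed.isOpen_compl.mem_nhds hdown))
  obtain ⟨P, hP, Q, hQ, hPQ⟩ := Filter.eventually_prod_iff.1 h1
  obtain ⟨ε, hε, hb⟩ := Metric.eventually_nhds_iff_ball.1 (hQ.and (Metric.ball_mem_nhds (r p) (half_pos hδ)))
  -- `ε` and the neighbourhood of `p` are fixed before the direction `ζ'`: hyperplanes that vary in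
  -- a pencil need sections along varying directions on one common ball.
  refine ⟨{ζ' | P ζ' ∧ ‖ζ'‖ < ‖ζ‖ + 1} ∩ interior A, Filter.inter_mem (hP.and
    (continuous_norm.continuousAt.eventually (gt_mem_nhds (lt_add_one _)))) (isOpen_interior.mem_nhds hζ),
    Set.inter_subset_right, ε, hε,
    V ∩ {q | r q ∈ Metric.ball (r p) ε}, Filter.inter_mem hV
    (hr.continuous.continuousAt.eventually (Metric.ball_mem_nhds _ hε)), ?_⟩
  rintro ζ' ⟨⟨hPζ, hζ'n⟩, hζ'⟩
  have hbound : ∀ y ∈ Metric.ball (r p) ε, |coneHeight A ζ' y| ≤ η := fun y hy => by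
    obtain ⟨h1, h2⟩ := hPQ hPζ (hb y hy).1
    rw [abs_le]
    refine ⟨?_, ((hA.cone.height_lt_iff hζ' hA.mem_frontier).2 h1).le⟩
    by_contra! hlt
    exact h2 ((hA.cone.height_le_iff hζ' hA.mem_frontier).1 hlt.le)
  have hb' : ∀ y ∈ Metric.ball (r p) ε, ∃ q ∈ V, ∃ t : ℝ, 0 < t ∧
      y + coneHeight A ζ' y • ζ' = t • r q := fun y hy => by
    obtain ⟨q, hq, hpos, he⟩ := hsurj _ (hA.cone.add_height_mem_frontier hζ' hA.mem_frontier y) (by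
      have h1 : ‖y - r p‖ < δ / 2 := by rw [← mem_ball_iff_norm]; exact (hb y hy).2
      have h2 : ‖coneHeight A ζ' y • ζ'‖ ≤ δ / 2 := by
        rw [norm_smul, Real.norm_eq_abs, ← hηζ]
        exact mul_le_mul (hbound y hy) hζ'n.le (norm_nonneg _) hη0.le
      calc ‖y + coneHeight A ζ' y • ζ' - r p‖ = ‖(y - r p) + coneHeight A ζ' y • ζ'‖ := by
            congr 1; abel
        _ ≤ _ := norm_add_le _ _
        _ < δ := by linarith)
    exact ⟨q, hq, _, hpos, he⟩
  have : Nonempty M := ⟨p⟩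
  choose! h hhV t ht0 hh using hb'
  have hκ : Continuous fun y => y + coneHeight A ζ' y • ζ' :=
    continuous_id.add ((hA.cone.continuous_height hζ' hA.mem_frontier).smul continuous_const)
  have hnorm : ∀ y ∈ Metric.ball (r p) ε, t y = ‖y + coneHeight A ζ' y • ζ'‖ := fun y hy => by
    rw [hh y hy, norm_smul, hr.norm_eq, mul_one, Real.norm_of_nonneg (ht0 y hy).le]
  have hrh : ∀ y ∈ Metric.ball (r p) ε, r (h y) =
      ‖y + coneHeight A ζ' y • ζ'‖⁻¹ • (y + coneHeight A ζ' y • ζ') := fun y hy => by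
    rw [← hnorm y hy, hh y hy, smul_smul, inv_mul_cancel₀ (ht0 y hy).ne', one_smul]
  refine ⟨h, ?_, fun y hy => ⟨(hVU (hhV y hy)).2, t y, _, ht0 y hy, hh y hy⟩, ?_⟩
  · refine continuousOn_of_comp hVc hr.continuous hVinj hhV ?_
    refine ContinuousOn.congr (f := fun y => ‖y + coneHeight A ζ' y • ζ'‖⁻¹ •
      (y + coneHeight A ζ' y • ζ')) ?_ fun y hy => hrh y hy
    refine (hκ.norm.continuousOn.inv₀ fun y hy => ?_).smul hκ.continuousOn
    rw [← hnorm y hy]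
    exact (ht0 y hy).ne'
  · rintro q ⟨hqV, hq⟩
    have hq : r q ∈ Metric.ball (r p) ε := hq
    refine ⟨hq, hVinj (hhV _ hq) hqV ?_⟩
    rw [hrh _ hq, hA.cone.height_eq_zero hζ' hA.mem_frontier (hmaps (hVU hqV).1), zero_smul, add_zero,
      hr.norm_eq, inv_one, one_smul]

/-- The hyperplane orthogonal to `a` meets the interior of a chart at `p`. -/
def IsRegularAt (r : M → E) (a : E) (p : M) : Prop :=
  ∃ A, IsConeChart r A p ∧ ∃ ζ ∈ interior A, ⟪a, ζ⟫ = 0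

/-- The positive side of a hyperplane is locally connected at a regular point, and accumulates
there. -/
theorem IsLocallyConeBoundary.eventually_exists_isPreconnected [T2Space M] [CompactSpace M]
    (hr : IsLocallyConeBoundary r) (h : IsRegularAt r a p) (ha : a ≠ 0) {W : Set M} (hW : W ∈ 𝓝 p) :
    ∃ W' ∈ 𝓝 p, ∀ᶠ b in 𝓝 a, ∃ D, IsPreconnected D ∧ W' ∩ {q | 0 < ⟪b, r q⟫} ⊆ D ∧
      D ⊆ W ∩ {q | 0 < ⟪b, r q⟫} ∧ W' ∩ {q | 0 ≤ ⟪b, r q⟫} ⊆ closure D := by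
  obtain ⟨A, hA, ζ, hζ, haζ⟩ := h
  obtain ⟨Z, hZ, -, ε, hε, W', hW', hsec⟩ := hr.exists_local_section hA hζ hW
  refine ⟨W', hW', ?_⟩
  have haa : ⟪a, a⟫ ≠ 0 := inner_self_ne_zero.2 ha
  have h1 : Filter.Tendsto (fun b : E => ζ - (⟪b, ζ⟫ / ⟪b, a⟫) • a) (𝓝 a) (𝓝 ζ) := by
    have : ContinuousAt (fun b : E => ζ - (⟪b, ζ⟫ / ⟪b, a⟫) • a) a := by
      refine continuousAt_const.sub (ContinuousAt.smul (ContinuousAt.div ?_ ?_ haa) continuousAt_const)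
      · fun_prop
      · fun_prop
    have h2 := this.tendsto
    simp only [haζ, zero_div, zero_smul, sub_zero] at h2
    exact h2
  have h2 : ∀ᶠ b : E in 𝓝 a, ⟪b, a⟫ ≠ 0 := by
    have : ContinuousAt (fun b : E => ⟪b, a⟫) a := by fun_prop
    exact this.eventually_ne haa
  filter_upwards [h1.eventually hZ, h2] with b hbZ hba
  -- `ζ` is corrected to be orthogonal to `b`, so the section along `ζ'` preserves the sign of `⟪b,
  -- ·⟫` and maps the convex half ball `S` to the positive side.
  set ζ' := ζ - (⟪b, ζ⟫ / ⟪b, a⟫) • a with hζ'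
  have hbζ : ⟪b, ζ'⟫ = 0 := by
    rw [hζ', inner_sub_right, inner_smul_right, div_mul_cancel₀ _ hba, sub_self]
  obtain ⟨h, hc, hhs, hhq⟩ := hsec ζ' hbZ
  set S : Set E := Metric.ball (r p) ε ∩ {y | 0 < ⟪b, y⟫} with hS
  have hSc : Convex ℝ S := (convex_ball _ _).inter fun y hy z hz s t hs ht hst => by
    simp only [Set.mem_ofPred_eq, inner_add_right, inner_smul_right] at hy hz ⊢
    rcases hs.eq_or_lt with rfl | hs
    · rw [zero_add] at hst; subst hst; simpa using hz
    · exact add_pos_of_pos_of_nonneg (mul_pos hs hy) (mul_nonneg ht hz.le)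
  refine ⟨h '' S, hSc.isPreconnected.image h (hc.mono Set.inter_subset_left), ?_, ?_, ?_⟩
  · rintro q ⟨hqW, hqa⟩
    exact ⟨r q, ⟨(hhq q hqW).1, hqa⟩, (hhq q hqW).2⟩
  · rintro _ ⟨y, ⟨hy, hya⟩, rfl⟩
    obtain ⟨hyW, t, s, ht, he⟩ := hhs y hy
    refine ⟨hyW, ?_⟩
    have h3 := congrArg (fun x => ⟪b, x⟫) he
    simp only [inner_add_right, inner_smul_right, hbζ, mul_zero, add_zero] at h3
    rw [Set.mem_ofPred_eq] at hya ⊢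
    exact pos_of_mul_pos_right (h3 ▸ hya) ht.le
  · rintro q ⟨hqW, hqa⟩
    obtain ⟨hqb, hqh⟩ := hhq q hqW
    rw [← hqh]
    have hcl : r q ∈ closure S := by
      have hcv : ContinuousAt (fun s : ℝ => r q + s • b) 0 := by fun_prop
      have hb0 : b ≠ 0 := fun h0 => hba (by rw [h0, inner_zero_left])
      have hbb : 0 < ⟪b, b⟫ := real_inner_self_pos.2 hb0
      have hev : ∀ᶠ s : ℝ in 𝓝[>] 0, r q + s • b ∈ S := by
        have h5 : ∀ᶠ s : ℝ in 𝓝 0, r q + s • b ∈ Metric.ball (r p) ε :=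
          hcv.preimage_mem_nhds (by
            simp only [zero_smul, add_zero]; exact Metric.isOpen_ball.mem_nhds hqb)
        filter_upwards [h5.filter_mono nhdsWithin_le_nhds, self_mem_nhdsWithin] with s hs hs0
        refine ⟨hs, ?_⟩
        rw [Set.mem_ofPred_eq, inner_add_right, inner_smul_right]
        exact add_pos_of_nonneg_of_pos hqa (mul_pos hs0 hbb)
      refine mem_closure_of_tendsto (b := 𝓝[>] (0 : ℝ)) (f := fun s : ℝ => r q + s • b) ?_ hev
      have := hcv.tendsto
      simp only [zero_smul, add_zero] at this
      exact this.mono_left nhdsWithin_le_nhds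
    exact ((hc (r q) hqb).mono Set.inter_subset_left).mem_closure_image hcl

/-- A hyperplane which misses the interior of a chart has the chart on one side. -/
theorem IsConeChart.nonneg_or_nonpos_of_not_isRegularAt (hA : IsConeChart r A p)
    (h : ¬ IsRegularAt r a p) : (∀ x ∈ A, 0 ≤ ⟪a, x⟫) ∨ ∀ x ∈ A, ⟪a, x⟫ ≤ 0 := by
  have hne : ∀ x ∈ interior A, ⟪a, x⟫ ≠ 0 := fun x hx h0 => h ⟨A, hA, x, hx, h0⟩
  have hc : Continuous fun x : E => ⟪a, x⟫ := by fun_prop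
  obtain ⟨z, hz⟩ := hA.cone.nonempty_interior
  have key : ∀ b : E, (∀ x ∈ interior A, ⟪b, x⟫ ≠ 0) → 0 < ⟪b, z⟫ → ∀ x ∈ A, 0 ≤ ⟪b, x⟫ := by
    intro b hb hbz x hx
    have hcb : Continuous fun x : E => ⟪b, x⟫ := by fun_prop
    have h1 : ∀ y ∈ interior A, 0 < ⟪b, y⟫ := by
      intro y hy
      by_contra! hle
      obtain ⟨w, hw, hw0⟩ := hA.cone.convex.interior.isPreconnected.intermediate_value hy hz
        hcb.continuousOn ⟨hle, hbz.le⟩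
      exact hb w hw hw0
    exact closure_minimal (fun y hy => (h1 y hy).le) (isClosed_le continuous_const hcb)
      (hA.cone.subset_closure_interior hx)
  rcases lt_or_gt_of_ne (hne z hz) with h0 | h0
  · right
    intro x hx
    have := key (-a) (fun x hx => by rw [inner_neg_left]; exact neg_ne_zero.2 (hne x hx))
      (by rw [inner_neg_left]; linarith) x hx
    rw [inner_neg_left] at this
    linarith
  · exact Or.inl (key a hne h0)

/-- Where `r` stays in a hyperplane, it covers this hyperplane locally. -/
theorem IsLocallyConeBoundary.eventually_exists_eq_of_flat [T2Space M] [CompactSpace M]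
    (hr : IsLocallyConeBoundary r) (hn : n ≠ 0) (h : ∀ᶠ q in 𝓝 p, ⟪n, r q⟫ = 0) {W : Set M}
    (hW : W ∈ 𝓝 p) : ∀ᶠ y in 𝓝 (r p), ⟪n, y⟫ = 0 → ∃ q ∈ W, ∃ t : ℝ, 0 < t ∧ y = t • r q := by
  obtain ⟨A, hA⟩ := hr.exists_chart p
  -- With `ζ` transversal to the hyperplane, the section has to move a point of the hyperplane by
  -- zero, since both ends lie in the hyperplane.
  obtain ⟨ζ, hζ, hnζ⟩ : ∃ ζ ∈ interior A, ⟪n, ζ⟫ ≠ 0 := by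
    by_contra! hall
    obtain ⟨z, hz⟩ := hA.cone.nonempty_interior
    have hc : ContinuousAt (fun s : ℝ => z + s • n) 0 := by fun_prop
    have h1 : ∀ᶠ s : ℝ in 𝓝[>] 0, z + s • n ∈ interior A :=
      (hc.eventually (p := fun x => x ∈ interior A)
        (by simpa using isOpen_interior.mem_nhds hz)).filter_mono nhdsWithin_le_nhds
    obtain ⟨s, hs, hs0⟩ := (h1.and self_mem_nhdsWithin).exists
    have hs0 : 0 < s := hs0
    have h2 := hall _ hs
    rw [inner_add_right, hall z hz, inner_smul_right, zero_add] at h2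
    have : 0 < ⟪n, n⟫ := real_inner_self_pos.2 hn
    exact (mul_pos hs0 this).ne' h2
  obtain ⟨Z, hZ, -, ε, hε, W', hW', hsec⟩ := hr.exists_local_section hA hζ (Filter.inter_mem hW h)
  obtain ⟨f, hc, hhs, -⟩ := hsec ζ (mem_of_mem_nhds hZ)
  filter_upwards [Metric.ball_mem_nhds _ hε] with y hy hny
  obtain ⟨⟨hyW, hy0⟩, t, s, ht, he⟩ := hhs y hy
  have hy0 : ⟪n, r (f y)⟫ = 0 := hy0
  have h3 := congrArg (fun x => ⟪n, x⟫) he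
  simp only [inner_add_right, inner_smul_right, hny, hy0, zero_add, mul_zero, mul_eq_zero, hnζ,
    or_false] at h3
  rw [h3, zero_smul, add_zero] at he
  exact ⟨f y, hyW, t, ht, he⟩

end LocalSection

/-! ### Connected punctured neighbourhoods. -/

section Punctured

/-- Every point has small punctured neighbourhoods which are connected. -/
def HasConnectedPunctures (M : Type*) [TopologicalSpace M] : Prop :=
  ∀ b : M, ∀ W ∈ 𝓝 b, ∃ W' ∈ 𝓝 b, W' ⊆ W ∧ IsPreconnected (W' \ {b}) ∧ (W' \ {b}).Nonempty

/-- A punctured ball is the image of sphere times interval, and spheres are connected in dimension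
above one. -/
theorem hasConnectedPunctures_of_chartedSpace (H : Type*) [NormedAddCommGroup H] [NormedSpace ℝ H]
    (hH : 1 < Module.rank ℝ H) (M : Type*) [TopologicalSpace M] [ChartedSpace H M] :
    HasConnectedPunctures M := by
  intro b W hW
  have hnt : Nontrivial H := (rank_pos_iff_nontrivial (R := ℝ)).1 (zero_lt_one.trans hH)
  let φ := chartAt H b
  have hb : b ∈ φ.source := mem_chart_source H b
  have h1 : ∀ᶠ y in 𝓝 (φ b), φ.symm y ∈ W ∧ y ∈ φ.target := by
    refine Filter.Eventually.and ?_ (φ.open_target.mem_nhds (φ.map_source hb))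
    have := φ.continuousAt_symm (φ.map_source hb)
    exact this.eventually (p := fun q => q ∈ W) (by rw [φ.left_inv hb]; exact hW)
  obtain ⟨ε, hε, hball⟩ := Metric.eventually_nhds_iff_ball.1 h1
  have hnhds : φ.symm '' Metric.ball (φ b) ε ∈ 𝓝 b := by
    have := φ.symm.image_mem_nhds (x := φ b) (φ.map_source hb) (Metric.ball_mem_nhds _ hε)
    rwa [φ.left_inv hb] at this
  have hsub : φ.symm '' Metric.ball (φ b) ε ⊆ W := by
    rintro _ ⟨y, hy, rfl⟩; exact (hball y hy).1
  refine ⟨_, hnhds, hsub, ?_, ?_⟩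
  · have hpre : IsPreconnected ((fun z : H × ℝ => φ b + z.2 • z.1) ''
        (Metric.sphere 0 1 ×ˢ Set.Ioo 0 ε)) :=
      ((isPreconnected_sphere hH 0 1).prod isPreconnected_Ioo).image _ (by fun_prop)
    have himg : ((fun z : H × ℝ => φ b + z.2 • z.1) '' (Metric.sphere 0 1 ×ˢ Set.Ioo 0 ε)) =
        Metric.ball (φ b) ε \ {φ b} := by
      ext y
      constructor
      · rintro ⟨⟨u, t⟩, ⟨hu, ht⟩, rfl⟩
        have hu : ‖u‖ = 1 := mem_sphere_zero_iff_norm.1 hu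
        have ht : 0 < t ∧ t < ε := ht
        have hn : ‖t • u‖ = t := by rw [norm_smul, hu, mul_one, Real.norm_of_nonneg ht.1.le]
        refine ⟨?_, fun h => ?_⟩
        · rw [mem_ball_iff_norm, add_sub_cancel_left, hn]; exact ht.2
        · have h : φ b + t • u = φ b := h
          rw [add_eq_left] at h
          rw [h, norm_zero] at hn
          exact ht.1.ne hn
      · rintro ⟨hy, hne⟩
        have hne : y ≠ φ b := hne
        have h0 : 0 < ‖y - φ b‖ := norm_pos_iff.2 (sub_ne_zero.2 hne)
        refine ⟨(‖y - φ b‖⁻¹ • (y - φ b), ‖y - φ b‖), ⟨?_, h0, mem_ball_iff_norm.1 hy⟩, ?_⟩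
        · rw [mem_sphere_zero_iff_norm, norm_smul, norm_inv, norm_norm, inv_mul_cancel₀ h0.ne']
        · simp only [smul_smul, mul_inv_cancel₀ h0.ne', one_smul, add_sub_cancel]
    rw [himg] at hpre
    have := hpre.image φ.symm (φ.continuousOn_symm.mono fun y hy => (hball y hy.1).2)
    convert this using 1
    ext q
    constructor
    · rintro ⟨⟨y, hy, rfl⟩, hne⟩
      exact ⟨y, ⟨hy, fun h => hne (by rw [Set.mem_singleton_iff.1 h]; exact φ.left_inv hb)⟩, rfl⟩
    · rintro ⟨y, ⟨hy, hne⟩, rfl⟩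
      refine ⟨⟨y, hy, rfl⟩, fun h => hne ?_⟩
      have h := congrArg φ (Set.mem_singleton_iff.1 h)
      rwa [φ.right_inv (hball y hy).2] at h
  · obtain ⟨q, hq, hne⟩ := exists_mem_ne_of_chartedSpace H b hnhds
    exact ⟨q, hq, hne⟩

end Punctured

/-! ### Generic linear functionals. -/

section Generic

open MeasureTheory

variable {E : Type*} [NormedAddCommGroup E] [InnerProductSpace ℝ E] [FiniteDimensional ℝ E]
  [MeasurableSpace E] [BorelSpace E]

/-- Almost every linear functional has at most one maximum point on a compact set. -/
theorem IsCompact.ae_unique_max (μ : Measure E) [μ.IsAddHaarMeasure] {X : Set E} (hX : IsCompact X) :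
    ∀ᵐ e ∂μ, ∀ x ∈ X, ∀ y ∈ X, (∀ z ∈ X, ⟪e, z⟫ ≤ ⟪e, x⟫) → (∀ z ∈ X, ⟪e, z⟫ ≤ ⟪e, y⟫) → x = y := by
  rcases X.eq_empty_or_nonempty with rfl | hne
  · simp
  obtain ⟨C, hC⟩ := hX.isBounded.exists_norm_le
  have hC0 : 0 ≤ C := by
    obtain ⟨x, hx⟩ := hne
    exact (norm_nonneg x).trans (hC x hx)
  -- The support function is Lipschitz, hence differentiable almost everywhere by Rademacher's
  -- theorem; where it is differentiable, its gradient is the maximum point.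
  set φ : E → ℝ := fun e => sSup ((fun x => ⟪e, x⟫) '' X) with hφ
  have hbdd : ∀ e : E, BddAbove ((fun x => ⟪e, x⟫) '' X) := fun e =>
    (hX.image (by fun_prop)).bddAbove
  have hle : ∀ e, ∀ x ∈ X, ⟪e, x⟫ ≤ φ e := fun e x hx => le_csSup (hbdd e) ⟨x, hx, rfl⟩
  have hlip : LipschitzWith ⟨C, hC0⟩ φ := by
    refine LipschitzWith.of_le_add_mul _ fun e e' => ?_
    refine csSup_le (hne.image _) ?_
    rintro _ ⟨x, hx, rfl⟩
    have h1 : ⟪e, x⟫ = ⟪e', x⟫ + ⟪e - e', x⟫ := by rw [inner_sub_left]; ring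
    have h2 : ⟪e - e', x⟫ ≤ ‖e - e'‖ * ‖x‖ := real_inner_le_norm _ _
    have h3 : ‖e - e'‖ * ‖x‖ ≤ ‖e - e'‖ * C := mul_le_mul_of_nonneg_left (hC x hx) (norm_nonneg _)
    have h4 := hle e' x hx
    show ⟪e, x⟫ ≤ φ e' + C * dist e e'
    rw [dist_eq_norm]
    linarith
  filter_upwards [hlip.ae_differentiableAt (μ := μ)] with e he
  have key : ∀ x ∈ X, (∀ z ∈ X, ⟪e, z⟫ ≤ ⟪e, x⟫) → fderiv ℝ φ e = innerSL ℝ x := by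
    intro x hx hmax
    have hφe : φ e = ⟪e, x⟫ := le_antisymm
      (csSup_le (hne.image _) (by rintro _ ⟨z, hz, rfl⟩; exact hmax z hz)) (hle e x hx)
    have h1 : HasFDerivAt (fun e' => φ e' - innerSL ℝ x e') (fderiv ℝ φ e - innerSL ℝ x) e :=
      he.hasFDerivAt.sub (innerSL ℝ x).hasFDerivAt
    have h2 : IsLocalMin (fun e' => φ e' - innerSL ℝ x e') e := by
      refine Filter.Eventually.of_forall fun e' => ?_
      simp only [innerSL_apply_apply]
      rw [hφe, real_inner_comm, sub_self, real_inner_comm]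
      exact sub_nonneg.2 (hle e' x hx)
    exact sub_eq_zero.1 (h2.hasFDerivAt_eq_zero h1)
  intro x hx y hy hmx hmy
  have h1 := (key x hx hmx).symm.trans (key y hy hmy)
  refine ext_inner_right ℝ fun w => ?_
  have := congrArg (fun f => f w) h1
  simpa using this

theorem IsCompact.ae_unique_min (μ : Measure E) [μ.IsAddHaarMeasure] {X : Set E} (hX : IsCompact X) :
    ∀ᵐ e ∂μ, ∀ x ∈ X, ∀ y ∈ X, (∀ z ∈ X, ⟪e, x⟫ ≤ ⟪e, z⟫) → (∀ z ∈ X, ⟪e, y⟫ ≤ ⟪e, z⟫) → x = y := by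
  filter_upwards [(hX.image continuous_neg).ae_unique_max μ] with e he x hx y hy h1 h2
  refine neg_injective (he (-x) ⟨x, hx, rfl⟩ (-y) ⟨y, hy, rfl⟩ ?_ ?_)
  · rintro _ ⟨z, hz, rfl⟩
    simp only [inner_neg_right]
    exact neg_le_neg (h1 z hz)
  · rintro _ ⟨z, hz, rfl⟩
    simp only [inner_neg_right]
    exact neg_le_neg (h2 z hz)

/-- For almost every `e`, no hyperplane `e + t • v` supports `B` at a point of the axis. -/
theorem ae_not_support_axis (μ : Measure E) [μ.IsAddHaarMeasure] (v : E) (B : Set E) :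
    ∀ᵐ e ∂μ, ∀ x ∈ B, x ≠ 0 → ⟪e, x⟫ = 0 → ⟪v, x⟫ = 0 → ∀ t : ℝ,
      ¬ ∀ y ∈ B, 0 ≤ ⟪e + t • v, y⟫ := by
  -- `D` is convex, so its boundary is a null set. A supported axis point `x` puts `e` on this
  -- boundary, because `e - s • x` leaves `D` for every `s > 0`.
  set D : Set E := {e | ∃ t : ℝ, ∀ y ∈ B, 0 ≤ ⟪e + t • v, y⟫} with hD
  have hconv : Convex ℝ D := by
    rintro e ⟨t, ht⟩ e' ⟨t', ht'⟩ α β hα hβ -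
    refine ⟨α * t + β * t', fun y hy => ?_⟩
    have h1 := mul_nonneg hα (ht y hy)
    have h2 := mul_nonneg hβ (ht' y hy)
    simp only [inner_add_left, inner_smul_left, conj_trivial] at h1 h2 ⊢
    nlinarith
  have hnull := hconv.addHaar_frontier μ
  have hae : ∀ᵐ e ∂μ, e ∉ frontier D := measure_eq_zero_iff_ae_notMem.1 hnull
  filter_upwards [hae] with e he x hx hx0 hex hvx t ht
  have heD : e ∈ D := ⟨t, ht⟩
  apply he
  refine ⟨subset_closure heD, fun hint => ?_⟩
  have hc : ContinuousAt (fun s : ℝ => e - s • x) 0 := by fun_prop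
  have h1 : ∀ᶠ s : ℝ in 𝓝 0, e - s • x ∈ D :=
    hc.preimage_mem_nhds (by simpa using mem_interior_iff_mem_nhds.1 hint)
  obtain ⟨s, ⟨t', hs⟩, hs0⟩ :=
    ((h1.filter_mono nhdsWithin_le_nhds).and (self_mem_nhdsWithin : Set.Ioi (0 : ℝ) ∈ 𝓝[>] 0)).exists
  have hs0 : 0 < s := hs0
  have h2 := hs x hx
  rw [inner_add_left, inner_sub_left, hex, inner_smul_left, inner_smul_left, hvx] at h2
  have h3 : 0 < ⟪x, x⟫ := real_inner_self_pos.2 hx0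
  have h4 := mul_pos hs0 h3
  simp only [conj_trivial, mul_zero, add_zero, zero_sub] at h2
  linarith

end Generic

/-! ### Generic pencils of hyperplanes. -/

section Pencil

variable {E : Type*} [NormedAddCommGroup E] [InnerProductSpace ℝ E]
variable {M : Type*} [TopologicalSpace M] {r : M → E} {v e : E}

/-- The pencil of hyperplanes `e + t • v` is in general position with respect to `r`. -/
structure IsGenericPencil (r : M → E) (v e : E) : Prop where
  axis : ∀ (t : ℝ) (b : M), ⟪e, r b⟫ = 0 → ⟪v, r b⟫ = 0 → IsRegularAt r (e + t • v) b
  isolated : ∀ (t : ℝ) (b : M), 0 < ⟪v, r b⟫ → ⟪e + t • v, r b⟫ = 0 →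
    ¬ IsRegularAt r (e + t • v) b → ∀ᶠ q in 𝓝[≠] b, ⟪e + t • v, r q⟫ ≠ 0

/-- Where a hyperplane of the pencil is not regular, it supports a chart. On the axis this is
excluded by `ae_not_support_axis`. Off the axis, `r b / ⟪v, r b⟫` is an extremum of `⟪e, ·⟫` on a
centrally projected compact piece, and generic extrema are unique. Finitely many charts and
countably many pieces suffice. -/
theorem IsLocallyConeBoundary.dense_isGenericPencil [FiniteDimensional ℝ E] [T2Space M] [CompactSpace M]
    (hr : IsLocallyConeBoundary r) (v : E) : Dense {e | IsGenericPencil r v e} := by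
  let _ : MeasurableSpace E := borel E
  have : BorelSpace E := ⟨rfl⟩
  have hloc : ∀ p : M, ∃ A : Set E, ∃ V ∈ 𝓝 p, IsSolidCone A ∧ IsCompact V ∧ Set.InjOn r V ∧
      Set.MapsTo r V (frontier A) := by
    intro p
    obtain ⟨A, hA⟩ := hr.exists_chart p
    obtain ⟨U, hU, hinj, hmaps⟩ := hA.exists_nhds
    obtain ⟨V, hV, hVU, hVc⟩ := local_compact_nhds hU
    exact ⟨A, V, hV, hA.cone, hVc, hinj.mono hVU, hmaps.mono_left hVU⟩
  choose A V hV hA hVc hinj hmaps using hloc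
  obtain ⟨s, hs⟩ : ∃ s : Finset M, ∀ b, ∃ p ∈ s, b ∈ interior (V p) := by
    obtain ⟨s, -, hs⟩ := isCompact_univ.elim_nhds_subcover (fun p => interior (V p))
      (fun p _ => interior_mem_nhds.2 (hV p))
    refine ⟨s, fun b => ?_⟩
    simpa using hs (Set.mem_univ b)
  set X : M → ℕ → Set E := fun p k =>
    (fun q => ⟪v, r q⟫⁻¹ • r q) '' (V p ∩ {q | 1 / ((k : ℝ) + 1) ≤ ⟪v, r q⟫}) with hX
  have hvc : Continuous fun q => ⟪v, r q⟫ := continuous_const.inner hr.continuous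
  have hXc : ∀ p k, IsCompact (X p k) := fun p k => by
    refine ((hVc p).inter_right (isClosed_le continuous_const hvc)).image_of_continuousOn ?_
    refine (hvc.continuousOn.inv₀ fun q hq => ?_).smul hr.continuous.continuousOn
    have h1 : 1 / ((k : ℝ) + 1) ≤ ⟪v, r q⟫ := hq.2
    have : 0 < 1 / ((k : ℝ) + 1) := by positivity
    exact (this.trans_le h1).ne'
  let μ : MeasureTheory.Measure E := MeasureTheory.volume
  have hμ1 : ∀ᵐ e ∂μ, ∀ p ∈ s, ∀ k, ∀ x ∈ X p k, ∀ y ∈ X p k, (∀ z ∈ X p k, ⟪e, z⟫ ≤ ⟪e, x⟫) →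
      (∀ z ∈ X p k, ⟪e, z⟫ ≤ ⟪e, y⟫) → x = y :=
    (MeasureTheory.ae_ball_iff s.countable_toSet).2 fun p _ =>
      MeasureTheory.ae_all_iff.2 fun k => (hXc p k).ae_unique_max μ
  have hμ2 : ∀ᵐ e ∂μ, ∀ p ∈ s, ∀ k, ∀ x ∈ X p k, ∀ y ∈ X p k, (∀ z ∈ X p k, ⟪e, x⟫ ≤ ⟪e, z⟫) →
      (∀ z ∈ X p k, ⟪e, y⟫ ≤ ⟪e, z⟫) → x = y :=
    (MeasureTheory.ae_ball_iff s.countable_toSet).2 fun p _ =>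
      MeasureTheory.ae_all_iff.2 fun k => (hXc p k).ae_unique_min μ
  have hμ3 := (MeasureTheory.ae_ball_iff s.countable_toSet).2 fun p _ =>
    ae_not_support_axis μ v (A p)
  have hμ4 := (MeasureTheory.ae_ball_iff s.countable_toSet).2 fun p _ =>
    ae_not_support_axis μ v (Neg.neg '' A p)
  refine MeasureTheory.Measure.dense_of_ae (μ := μ) ?_
  filter_upwards [hμ1, hμ2, hμ3, hμ4] with e h1 h2 h3 h4
  have hchart : ∀ p, ∀ b ∈ interior (V p), IsConeChart r (A p) b := fun p b hb =>
    ⟨hA p, V p, mem_interior_iff_mem_nhds.1 hb, hinj p, hmaps p⟩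
  have hne0 : ∀ b, r b ≠ 0 := fun b h => by
    have := hr.norm_eq b; rw [h, norm_zero] at this; exact zero_ne_one this
  refine ⟨fun t b heb hvb => ?_, fun t b hvb hab hreg => ?_⟩
  · obtain ⟨p, hp, hbp⟩ := hs b
    by_contra hreg
    have hb := hchart p b hbp
    rcases hb.nonneg_or_nonpos_of_not_isRegularAt hreg with h | h
    · exact h3 p hp (r b) hb.mem (hne0 b) heb hvb t h
    · refine h4 p hp (-r b) ⟨_, hb.mem, rfl⟩ (neg_ne_zero.2 (hne0 b)) (by rw [inner_neg_right, heb, neg_zero])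
        (by rw [inner_neg_right, hvb, neg_zero]) t ?_
      rintro _ ⟨y, hy, rfl⟩
      rw [inner_neg_right]
      exact neg_nonneg.2 (h y hy)
  · obtain ⟨p, hp, hbp⟩ := hs b
    have hb := hchart p b hbp
    obtain ⟨k, hk⟩ := exists_nat_one_div_lt hvb
    have hVb : ∀ᶠ q in 𝓝 b, q ∈ V p := mem_interior_iff_mem_nhds.1 hbp
    have hev : ∀ᶠ q in 𝓝 b, q ∈ V p ∧ 1 / ((k : ℝ) + 1) < ⟪v, r q⟫ := hVb.and
        (hvc.continuousAt.eventually (lt_mem_nhds hk))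
    have hk0 : 0 < 1 / ((k : ℝ) + 1) := by positivity
    filter_upwards [hev.filter_mono nhdsWithin_le_nhds, self_mem_nhdsWithin] with q hq hqb haq
    have hvq : 0 < ⟪v, r q⟫ := hk0.trans hq.2
    have hval : ∀ q, 0 < ⟪v, r q⟫ → ⟪e, ⟪v, r q⟫⁻¹ • r q⟫ = ⟪v, r q⟫⁻¹ * ⟪e + t • v, r q⟫ - t := by
      intro q hq
      rw [inner_smul_right, inner_add_left, inner_smul_left, conj_trivial]
      field_simp
      ring
    have hxb : ⟪v, r b⟫⁻¹ • r b ∈ X p k := ⟨b, ⟨interior_subset hbp, hk.le⟩, rfl⟩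
    have hxq : ⟪v, r q⟫⁻¹ • r q ∈ X p k := ⟨q, ⟨hq.1, hq.2.le⟩, rfl⟩
    have heq : ⟪v, r b⟫⁻¹ • r b = ⟪v, r q⟫⁻¹ • r q := by
      rcases hb.nonneg_or_nonpos_of_not_isRegularAt hreg with h | h
      · have hz : ∀ z ∈ X p k, -t ≤ ⟪e, z⟫ := by
          rintro _ ⟨z, ⟨hzV, hz⟩, rfl⟩
          have hz : 0 < ⟪v, r z⟫ := hk0.trans_le hz
          rw [hval z hz]
          have := mul_nonneg (inv_pos.2 hz).le (h _ ((hA p).mem_of_frontier (hmaps p hzV)))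
          linarith
        refine h2 p hp k _ hxb _ hxq ?_ ?_
        · rw [hval b hvb, hab, mul_zero, zero_sub]; exact hz
        · rw [hval q hvq, haq, mul_zero, zero_sub]; exact hz
      · have hz : ∀ z ∈ X p k, ⟪e, z⟫ ≤ -t := by
          rintro _ ⟨z, ⟨hzV, hz⟩, rfl⟩
          have hz : 0 < ⟪v, r z⟫ := hk0.trans_le hz
          rw [hval z hz]
          have := mul_nonneg (inv_pos.2 hz).le
            (neg_nonneg.2 (h _ ((hA p).mem_of_frontier (hmaps p hzV))))
          linarith
        refine h1 p hp k _ hxb _ hxq ?_ ?_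
        · rw [hval b hvb, hab, mul_zero, zero_sub]; exact hz
        · rw [hval q hvq, haq, mul_zero, zero_sub]; exact hz
    have hnorm := congrArg norm heq
    rw [norm_smul, norm_smul, hr.norm_eq, hr.norm_eq, mul_one, mul_one,
      Real.norm_of_nonneg (inv_pos.2 hvb).le, Real.norm_of_nonneg (inv_pos.2 hvq).le] at hnorm
    rw [← hnorm] at heq
    exact hqb (hinj p hq.1 (interior_subset hbp)
      (smul_right_injective E (inv_pos.2 hvb).ne' heq).symm)

end Pencil

/-! ### Two facts about connected sets. -/

theorem IsPreconnected.subset_interior_of_disjoint_frontier {X : Type*} [TopologicalSpace X] {S K : Set X}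
    (hS : IsPreconnected S) {x : X} (hx : x ∈ S) (hxK : x ∈ interior K) (h : ∀ y ∈ S, y ∉ frontier K) :
    S ⊆ interior K := by
  refine hS.subset_left_of_subset_union (v := (closure K)ᶜ) isOpen_interior
    isClosed_closure.isOpen_compl
    (disjoint_compl_right.mono_left (interior_subset.trans subset_closure)) (fun y hy => ?_) ⟨x, hx, hxK⟩
  by_contra hz
  rw [Set.mem_union, not_or, Set.mem_compl_iff, not_not] at hz
  exact h y hy ⟨hz.2, hz.1⟩

theorem exists_nhds_isPreconnected {X : Type*} [TopologicalSpace X] [LocallyConnectedSpace X] {x : X}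
    {P : X → Prop} (h : ∀ᶠ y in 𝓝 x, P y) :
    ∃ W ∈ 𝓝 x, IsPreconnected W ∧ ∀ y ∈ W, P y := by
  have hx : x ∈ interior {y | P y} := mem_interior_iff_mem_nhds.2 h
  exact ⟨connectedComponentIn (interior {y | P y}) x,
    isOpen_interior.connectedComponentIn.mem_nhds (mem_connectedComponentIn hx),
    isPreconnected_connectedComponentIn,
    fun y hy => interior_subset (s := {y | P y}) (connectedComponentIn_subset _ _ hy)⟩

/-! ### Turning a pencil: strict local support is global. -/

section Sweep

variable {E : Type*} [NormedAddCommGroup E] [InnerProductSpace ℝ E]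
variable {M : Type*} [TopologicalSpace M] {r : M → E} {v e : E} {p b q : M} {t t' T : ℝ}

/-- The hyperplane orthogonal to `v` supports the hypersurface locally at `p`, and only there. -/
structure IsStrictSupport (r : M → E) (v : E) (p : M) : Prop where
  zero : ⟪v, r p⟫ = 0
  pos : ∀ᶠ q in 𝓝[≠] p, 0 < ⟪v, r q⟫

theorem inner_pencil (e v x : E) (t : ℝ) : ⟪e + t • v, x⟫ = ⟪e, x⟫ + t * ⟪v, x⟫ := by
  rw [inner_add_left, inner_smul_left, conj_trivial]

/-- The component at `p` of the part of the hypersurface on the positive side of `e + t • v`. -/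
def sweepSet (r : M → E) (v e : E) (p : M) (t : ℝ) : Set M :=
  connectedComponentIn {q | 0 < ⟪e + t • v, r q⟫} p

theorem isPreconnected_sweepSet : IsPreconnected (sweepSet r v e p t) :=
  isPreconnected_connectedComponentIn

theorem pos_of_mem_sweepSet (h : q ∈ sweepSet r v e p t) : 0 < ⟪e + t • v, r q⟫ :=
  connectedComponentIn_subset {q | 0 < ⟪e + t • v, r q⟫} p h

theorem subset_sweepSet {D : Set M} (hD : IsPreconnected D) (hsub : ∀ q ∈ D, 0 < ⟪e + t • v, r q⟫)
    (hq : q ∈ D) (hqU : q ∈ sweepSet r v e p t) : D ⊆ sweepSet r v e p t := by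
  have h := connectedComponentIn_eq (show q ∈ connectedComponentIn {q | 0 < ⟪e + t • v, r q⟫} p from hqU)
  rw [sweepSet, h]
  exact hD.subset_connectedComponentIn hq hsub

theorem mem_sweepSet_of_closure (hb : b ∈ closure (sweepSet r v e p t)) (hpos : 0 < ⟪e + t • v, r b⟫)
    (hne : (sweepSet r v e p t).Nonempty) : b ∈ sweepSet r v e p t := by
  obtain ⟨q, hq⟩ := hne
  refine subset_sweepSet (D := insert b (sweepSet r v e p t))
    (isPreconnected_sweepSet.subset_closure (Set.subset_insert _ _)
      (Set.insert_subset hb subset_closure)) ?_ (Set.mem_insert_of_mem _ hq) hq (Set.mem_insert _ _)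
  rintro x (rfl | hx)
  · exact hpos
  · exact pos_of_mem_sweepSet hx

theorem mem_sweepSet_self (hv : IsStrictSupport r v p) (he : 0 < ⟪e, r p⟫) (t : ℝ) :
    p ∈ sweepSet r v e p t :=
  mem_connectedComponentIn (by rw [Set.mem_ofPred_eq, inner_pencil, hv.zero, mul_zero, add_zero]; exact he)

/-- The closure of the sweeping component stays on the positive side of the support hyperplane. -/
def IsSweepGood (r : M → E) (v e : E) (p : M) (t : ℝ) : Prop :=
  ∀ b ∈ closure (sweepSet r v e p t), b = p ∨ 0 < ⟪v, r b⟫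

theorem IsSweepGood.nonneg (hv : IsStrictSupport r v p) (h : IsSweepGood r v e p t)
    (hb : b ∈ closure (sweepSet r v e p t)) : 0 ≤ ⟪v, r b⟫ := by
  rcases h b hb with rfl | h
  · exact hv.zero.ge
  · exact h.le

theorem IsSweepGood.mono (hv : IsStrictSupport r v p) (he : 0 < ⟪e, r p⟫) (h : IsSweepGood r v e p t)
    (htt : t ≤ t') : sweepSet r v e p t ⊆ sweepSet r v e p t' := by
  refine subset_sweepSet isPreconnected_sweepSet (fun q hq => ?_) (mem_sweepSet_self hv he t)
    (mem_sweepSet_self hv he t')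
  have h1 := pos_of_mem_sweepSet hq
  have h2 := h.nonneg hv (subset_closure hq)
  rw [inner_pencil] at h1 ⊢
  have := mul_le_mul_of_nonneg_right htt h2
  linarith

variable [T2Space M] [CompactSpace M]

/-- For very negative `t` the positive side misses the boundary of a compact neighbourhood of `p`,
where `v` is at least `δ`; the component is confined to that neighbourhood. -/
theorem exists_isSweepGood (hr : IsLocallyConeBoundary r) (hv : IsStrictSupport r v p)
    (he : 0 < ⟪e, r p⟫) : ∃ t₀, ∀ t ≤ t₀, IsSweepGood r v e p t := by
  have hW : {q | q ≠ p → 0 < ⟪v, r q⟫} ∈ 𝓝 p := eventually_nhdsWithin_iff.1 hv.pos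
  obtain ⟨K, hK, hKW, hKc⟩ := local_compact_nhds hW
  have hfc : IsCompact (frontier K) := hKc.of_isClosed_subset isClosed_frontier hKc.isClosed.frontier_subset
  have hvc : Continuous fun q => ⟪v, r q⟫ := continuous_const.inner hr.continuous
  have hpK : p ∈ interior K := mem_interior_iff_mem_nhds.2 hK
  obtain ⟨δ, hδ, hδf⟩ : ∃ δ : ℝ, 0 < δ ∧ ∀ q ∈ frontier K, δ ≤ ⟪v, r q⟫ := by
    rcases (frontier K).eq_empty_or_nonempty with h0 | hne
    · exact ⟨1, one_pos, by simp [h0]⟩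
    obtain ⟨m, hm, hmin⟩ := hfc.exists_isMinOn hne hvc.continuousOn
    refine ⟨_, hKW (hKc.isClosed.frontier_subset hm) ?_, fun q hq => hmin hq⟩
    rintro rfl
    exact hm.2 hpK
  refine ⟨-((‖e‖ + 1) / δ), fun t ht => ?_⟩
  have hneg : ∀ q ∈ frontier K, ⟪e + t • v, r q⟫ < 0 := fun q hq => by
    rw [inner_pencil]
    have h1 : ⟪e, r q⟫ ≤ ‖e‖ := by
      have := real_inner_le_norm e (r q)
      rwa [hr.norm_eq, mul_one] at this
    have h2 : t * ⟪v, r q⟫ ≤ t * δ := by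
      have : t ≤ 0 := ht.trans (by rw [neg_nonpos]; positivity)
      exact mul_le_mul_of_nonpos_left (hδf q hq) this
    have h3 : t * δ ≤ -(‖e‖ + 1) := by
      have := mul_le_mul_of_nonneg_right ht hδ.le
      rwa [neg_mul, div_mul_cancel₀ _ hδ.ne'] at this
    linarith
  have hsub := isPreconnected_sweepSet.subset_interior_of_disjoint_frontier
    (mem_sweepSet_self hv he t) hpK fun y hy hyf => (hneg y hyf).not_gt (pos_of_mem_sweepSet hy)
  intro b hb
  have hbK : b ∈ K := hKc.isClosed.closure_subset_iff.2 (hsub.trans interior_subset) hb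
  by_cases hbp : b = p
  · exact Or.inl hbp
  · exact Or.inr (hKW hbK hbp)

variable [LocallyConnectedSpace M]

omit [T2Space M] [CompactSpace M] in
theorem isOpen_sweepSet (hr : Continuous r) : IsOpen (sweepSet r v e p t) :=
  (isOpen_lt continuous_const (continuous_const.inner hr)).connectedComponentIn

/-- Let `b` be a boundary point of the component. If the hyperplane is regular at `b`, its positive
side is locally connected and is filled by the component. If not, genericity isolates the zero at
`b`, and the component fills a connected punctured neighbourhood. So no other component comes near
the closure. -/
theorem IsSweepGood.eventually_mem_closure (hr : IsLocallyConeBoundary r) (hp : HasConnectedPunctures M)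
    (hv : IsStrictSupport r v p) (he : 0 < ⟪e, r p⟫) (hg : IsGenericPencil r v e)
    (h : IsSweepGood r v e p t) (hb : b ∈ closure (sweepSet r v e p t)) :
    ∀ᶠ q in 𝓝 b, (0 ≤ ⟪e + t • v, r q⟫ → q ∈ closure (sweepSet r v e p t)) ∧ (q = p ∨ 0 < ⟪v, r q⟫) := by
  have hac : Continuous fun q => ⟪e + t • v, r q⟫ := continuous_const.inner hr.continuous
  have hvc : Continuous fun q => ⟪v, r q⟫ := continuous_const.inner hr.continuous
  have hpU := mem_sweepSet_self hv he t
  have hab : 0 ≤ ⟪e + t • v, r b⟫ :=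
    closure_minimal (fun q hq => (pos_of_mem_sweepSet hq).le) (isClosed_le continuous_const hac) hb
  rcases hab.lt_or_eq with hab | hab
  · filter_upwards [(isOpen_sweepSet hr.continuous).mem_nhds (mem_sweepSet_of_closure hb hab ⟨p, hpU⟩)]
      with q hq
    exact ⟨fun _ => subset_closure hq, h q (subset_closure hq)⟩
  have hbU : b ∉ sweepSet r v e p t := fun hbU => hab.not_lt (pos_of_mem_sweepSet hbU)
  have hvb : 0 < ⟪v, r b⟫ := (h b hb).resolve_left fun hbp => hbU (hbp ▸ hpU)
  have hev := hvc.continuousAt.eventually (lt_mem_nhds hvb)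
  have ha0 : e + t • v ≠ 0 := fun h0 => by
    have := pos_of_mem_sweepSet hpU
    rw [h0, inner_zero_left] at this
    exact lt_irrefl _ this
  by_cases hreg : IsRegularAt r (e + t • v) b
  · obtain ⟨W', hW', hD⟩ := hr.eventually_exists_isPreconnected hreg ha0 Filter.univ_mem
    obtain ⟨D, hDc, hD1, hD2, hD3⟩ := hD.self_of_nhds
    obtain ⟨x, hxW, hxU⟩ := mem_closure_iff_nhds.1 hb W' hW'
    have hDU := subset_sweepSet hDc (fun q hq => (hD2 hq).2) (hD1 ⟨hxW, pos_of_mem_sweepSet hxU⟩) hxU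
    filter_upwards [hW', hev] with q hq hqv
    exact ⟨fun hqa => closure_mono hDU (hD3 ⟨hq, hqa⟩), Or.inr hqv⟩
  · have hiso : {q | q ≠ b → ⟪e + t • v, r q⟫ ≠ 0} ∈ 𝓝 b :=
      eventually_nhdsWithin_iff.1 (hg.isolated t b hvb hab.symm hreg)
    obtain ⟨W', hW', hsub, hpre, -⟩ := hp b _ hiso
    obtain ⟨x, hxW, hxU⟩ := mem_closure_iff_nhds.1 hb W' hW'
    have hxb : x ≠ b := fun hxb => hbU (hxb ▸ hxU)
    have hDU : W' \ {b} ⊆ sweepSet r v e p t := by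
      refine subset_sweepSet hpre (fun q hq => ?_) ⟨hxW, hxb⟩ hxU
      by_contra! hle
      obtain ⟨y, hy, hy0⟩ := hpre.intermediate_value hq ⟨hxW, hxb⟩ hac.continuousOn
        ⟨hle, (pos_of_mem_sweepSet hxU).le⟩
      exact hsub hy.1 hy.2 hy0
    filter_upwards [hW', hev] with q hq hqv
    refine ⟨fun _ => ?_, Or.inr hqv⟩
    by_cases hqb : q = b
    · exact hqb ▸ hb
    · exact subset_closure (hDU ⟨hq, hqb⟩)

/-- The closure has a neighbourhood on whose boundary `e + t • v` is negative, by compactness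
uniformly so. This persists for slightly larger parameters and confines the component. -/
theorem IsSweepGood.exists_right (hr : IsLocallyConeBoundary r) (hp : HasConnectedPunctures M)
    (hv : IsStrictSupport r v p) (he : 0 < ⟪e, r p⟫) (hg : IsGenericPencil r v e)
    (h : IsSweepGood r v e p t) : ∃ η > 0, ∀ t', t ≤ t' → t' ≤ t + η → IsSweepGood r v e p t' := by
  set O := interior {q | (0 ≤ ⟪e + t • v, r q⟫ → q ∈ closure (sweepSet r v e p t)) ∧
    (q = p ∨ 0 < ⟪v, r q⟫)} with hO
  have hsub : closure (sweepSet r v e p t) ⊆ O := fun b hb =>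
    mem_interior_iff_mem_nhds.2 (h.eventually_mem_closure hr hp hv he hg hb)
  obtain ⟨O', hO'o, hO', hO'O⟩ := normal_exists_closure_subset isClosed_closure isOpen_interior hsub
  have hac : Continuous fun q => ⟪e + t • v, r q⟫ := continuous_const.inner hr.continuous
  have hneg : ∀ q ∈ frontier O', ⟪e + t • v, r q⟫ < 0 := by
    intro q hq
    by_contra! hle
    have h1 := (interior_subset (hO'O hq.1)).1 hle
    rw [hO'o.frontier_eq] at hq
    exact hq.2 (hO' h1)
  obtain ⟨m, hm, hmf⟩ : ∃ m : ℝ, 0 < m ∧ ∀ q ∈ frontier O', ⟪e + t • v, r q⟫ ≤ -m := by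
    rcases (frontier O').eq_empty_or_nonempty with h0 | hne
    · exact ⟨1, one_pos, by simp [h0]⟩
    obtain ⟨x, hx, hmax⟩ := isClosed_frontier.isCompact.exists_isMaxOn hne hac.continuousOn
    exact ⟨_, neg_pos.2 (hneg x hx), fun q hq => by rw [neg_neg]; exact hmax hq⟩
  refine ⟨m / (2 * (‖v‖ + 1)), by positivity, fun t' htt' ht' => ?_⟩
  have hneg' : ∀ q ∈ frontier O', ⟪e + t' • v, r q⟫ < 0 := fun q hq => by
    have h1 := hmf q hq
    have h2 : ⟪v, r q⟫ ≤ ‖v‖ := by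
      have := real_inner_le_norm v (r q)
      rwa [hr.norm_eq, mul_one] at this
    rw [inner_pencil] at h1 ⊢
    have h3 : (t' - t) * ⟪v, r q⟫ ≤ (t' - t) * ‖v‖ := mul_le_mul_of_nonneg_left h2 (by linarith)
    have h4 : (t' - t) * ‖v‖ ≤ m / (2 * (‖v‖ + 1)) * ‖v‖ :=
      mul_le_mul_of_nonneg_right (by linarith) (norm_nonneg _)
    have h5 : m / (2 * (‖v‖ + 1)) * ‖v‖ ≤ m / 2 := by
      rw [div_mul_eq_mul_div, div_le_div_iff₀ (by positivity) two_pos]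
      nlinarith [norm_nonneg v]
    nlinarith
  have hpO : p ∈ interior O' := by
    rw [hO'o.interior_eq]; exact hO' (subset_closure (mem_sweepSet_self hv he t))
  have hU := isPreconnected_sweepSet.subset_interior_of_disjoint_frontier
    (mem_sweepSet_self hv he t') hpO fun y hy hyf => (hneg' y hyf).not_gt (pos_of_mem_sweepSet hy)
  intro b hb
  exact (interior_subset (hO'O (closure_mono (hU.trans interior_subset) hb))).2

omit [T2Space M] [CompactSpace M] in
/-- Points near which the pencil is uniformly positive are reached by the sweep. -/
theorem mem_of_mem_closure_iUnion (hv : IsStrictSupport r v p) (he : 0 < ⟪e, r p⟫)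
    {I : Set ℝ} {l : ℝ} (hI : ∀ s ∈ I, ∃ t ∈ I, s ≤ t ∧ l ≤ t) (h : ∀ t ∈ I, IsSweepGood r v e p t)
    (hb : b ∈ closure (⋃ t ∈ I, sweepSet r v e p t))
    (hev : ∀ᶠ q in 𝓝 b, ∀ t ∈ I, l ≤ t → 0 < ⟪e + t • v, r q⟫) : ∃ t ∈ I, b ∈ sweepSet r v e p t := by
  obtain ⟨W, hW, hWc, hWp⟩ := exists_nhds_isPreconnected hev
  obtain ⟨x, hxW, hx⟩ := mem_closure_iff_nhds.1 hb W hW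
  obtain ⟨s, hs, hxs⟩ := Set.mem_iUnion₂.1 hx
  obtain ⟨t, ht, hst, hlt⟩ := hI s hs
  exact ⟨t, ht, subset_sweepSet hWc (fun q hq => hWp q hq t ht hlt) hxW ((h s hs).mono hv he hst hxs)
    (mem_of_mem_nhds hW)⟩

/-- The only danger in the limit is a new point `b ≠ p` of the axis. There the limit hyperplane is
regular by genericity, so hyperplanes shortly before already have `b` in the closure of their
component, which is impossible. -/
theorem isSweepGood_of_lt (hr : IsLocallyConeBoundary r)
    (hv : IsStrictSupport r v p) (he : 0 < ⟪e, r p⟫) (hg : IsGenericPencil r v e)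
    (h : ∀ t < T, IsSweepGood r v e p t) : IsSweepGood r v e p T := by
  set Un := ⋃ t ∈ Set.Iio T, sweepSet r v e p t with hUn
  have hUno : IsOpen Un := isOpen_biUnion fun t _ => isOpen_sweepSet hr.continuous
  have hpUn : p ∈ Un := Set.mem_iUnion₂.2 ⟨T - 1, by simp, mem_sweepSet_self hv he _⟩
  have hvc : Continuous fun q => ⟪v, r q⟫ := continuous_const.inner hr.continuous
  have hac : Continuous fun z : ℝ × M => ⟪e + z.1 • v, r z.2⟫ :=
    (continuous_const.add (continuous_fst.smul continuous_const)).inner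
      (hr.continuous.comp continuous_snd)
  have hvnn : ∀ b ∈ closure Un, 0 ≤ ⟪v, r b⟫ := fun b hb => by
    refine closure_minimal (s := Un) (fun q hq => ?_) (isClosed_le continuous_const hvc) hb
    obtain ⟨t, ht, hq⟩ := Set.mem_iUnion₂.1 hq
    exact (h t ht).nonneg hv (subset_closure hq)
  have haTc : Continuous fun q => ⟪e + T • v, r q⟫ := continuous_const.inner hr.continuous
  have hann : ∀ b ∈ closure Un, 0 ≤ ⟪e + T • v, r b⟫ := fun b hb => by
    refine closure_minimal (s := Un) (fun q hq => ?_) (isClosed_le continuous_const haTc) hb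
    obtain ⟨t, ht, hq⟩ := Set.mem_iUnion₂.1 hq
    exact (pos_of_mem_sweepSet ((h t ht).mono hv he (le_of_lt ht) hq)).le
  have hIof : ∀ l < T, ∀ s ∈ Set.Iio T, ∃ t ∈ Set.Iio T, s ≤ t ∧ l ≤ t := fun l hl s hs =>
    ⟨max s l, max_lt hs hl, le_max_left _ _, le_max_right _ _⟩
  have hstar : ∀ b ∈ closure Un, 0 < ⟪e + T • v, r b⟫ → ∃ t < T, b ∈ sweepSet r v e p t := by
    intro b hb hpos
    have h1 : ∀ᶠ z : ℝ × M in 𝓝 T ×ˢ 𝓝 b, 0 < ⟪e + z.1 • v, r z.2⟫ := by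
      rw [← nhds_prod_eq]
      exact hac.continuousAt.eventually (lt_mem_nhds hpos)
    obtain ⟨P, hP, Q, hQ, hPQ⟩ := Filter.eventually_prod_iff.1 h1
    obtain ⟨l, hl, hlP⟩ := mem_nhdsLE_iff_exists_Icc_subset.1 (mem_nhdsWithin_of_mem_nhds hP : {t | P t} ∈ 𝓝[≤] T)
    exact mem_of_mem_closure_iUnion hv he (hIof l hl) (fun t ht => h t ht) hb
      (hQ.mono fun q hq t ht hlt => hPQ (hlP ⟨hlt, le_of_lt ht⟩) hq)
  have hgood : ∀ b ∈ closure Un, b = p ∨ 0 < ⟪v, r b⟫ := by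
    intro b hb
    by_contra! hcon
    have hvb : ⟪v, r b⟫ = 0 := le_antisymm hcon.2 (hvnn b hb)
    have hcontra : ∀ t < T, b ∉ closure (sweepSet r v e p t) := fun t ht hbt =>
      (h t ht b hbt).elim hcon.1 hcon.2.not_gt
    rcases (hann b hb).lt_or_eq with hab | hab
    · obtain ⟨t, ht, hbt⟩ := hstar b hb hab
      exact hcontra t ht (subset_closure hbt)
    have heb : ⟪e, r b⟫ = 0 := by
      rw [inner_pencil, hvb, mul_zero, add_zero] at hab; exact hab.symm
    have ha0 : e + T • v ≠ 0 := fun h0 => by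
      have := pos_of_mem_sweepSet (mem_sweepSet_self hv he T)
      rw [h0, inner_zero_left] at this
      exact lt_irrefl _ this
    obtain ⟨W', hW', hD⟩ := hr.eventually_exists_isPreconnected (hg.axis T b heb hvb) ha0 Filter.univ_mem
    have htc : ContinuousAt (fun t : ℝ => e + t • v) T := by fun_prop
    have hD' := htc.eventually hD
    obtain ⟨l, hl, hlP⟩ := mem_nhdsLE_iff_exists_Icc_subset.1 (mem_nhdsWithin_of_mem_nhds hD')
    obtain ⟨x, hxW, hx⟩ := mem_closure_iff_nhds.1 hb W' hW'
    obtain ⟨s, hs, hxs⟩ := Set.mem_iUnion₂.1 hx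
    obtain ⟨t, ht, hst, hlt⟩ := hIof l hl s hs
    have hxt := (h s hs).mono hv he hst hxs
    obtain ⟨D, hDc, hD1, hD2, hD3⟩ := hlP ⟨hlt, le_of_lt ht⟩
    have hDU := subset_sweepSet hDc (fun q hq => (hD2 hq).2) (hD1 ⟨hxW, pos_of_mem_sweepSet hxt⟩) hxt
    refine hcontra t ht (closure_mono hDU (hD3 ⟨mem_of_mem_nhds hW', ?_⟩))
    rw [Set.mem_ofPred_eq, inner_pencil, heb, hvb, mul_zero, add_zero]
  have hsub : sweepSet r v e p T ⊆ Un := by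
    refine isPreconnected_sweepSet.subset_left_of_subset_union (v := (closure Un)ᶜ) hUno
      isClosed_closure.isOpen_compl (disjoint_compl_right.mono_left subset_closure) (fun x hx => ?_)
      ⟨p, mem_sweepSet_self hv he T, hpUn⟩
    by_cases hxc : x ∈ closure Un
    · obtain ⟨t, ht, hxt⟩ := hstar x hxc (pos_of_mem_sweepSet hx)
      exact Or.inl (Set.mem_iUnion₂.2 ⟨t, ht, hxt⟩)
    · exact Or.inr hxc
  exact fun b hb => hgood b (closure_mono hsub hb)

theorem isSweepGood (hr : IsLocallyConeBoundary r) (hp : HasConnectedPunctures M)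
    (hv : IsStrictSupport r v p) (he : 0 < ⟪e, r p⟫) (hg : IsGenericPencil r v e) (t : ℝ) :
    IsSweepGood r v e p t := by
  obtain ⟨t₀, ht₀⟩ := exists_isSweepGood hr hv he
  set S : Set ℝ := {t | ∀ s ≤ t, IsSweepGood r v e p s} with hS
  have hSne : S.Nonempty := ⟨t₀, ht₀⟩
  by_cases hb : BddAbove S
  · exfalso
    have hT : ∀ t < sSup S, IsSweepGood r v e p t := fun t ht => by
      obtain ⟨s, hs, hts⟩ := exists_lt_of_lt_csSup hSne ht
      exact hs t hts.le
    have hTg := isSweepGood_of_lt hr hv he hg hT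
    obtain ⟨η, hη, hright⟩ := hTg.exists_right hr hp hv he hg
    have hmem : sSup S + η ∈ S := fun s hs => by
      rcases lt_or_ge s (sSup S) with h | h
      · exact hT s h
      · exact hright s h hs
    have := le_csSup hb hmem
    linarith
  · obtain ⟨s, hs, hts⟩ := not_bddAbove_iff.1 hb t
    exact hs t hts.le

/-- The union of the sweeping components of a generic pencil. -/
theorem IsStrictSupport.exists_sweep (hr : IsLocallyConeBoundary r) (hp : HasConnectedPunctures M)
    (hv : IsStrictSupport r v p) (he : 0 < ⟪e, r p⟫) (hg : IsGenericPencil r v e) :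
    ∃ U, IsOpen U ∧ IsPreconnected U ∧ p ∈ U ∧ (∀ q ∈ U, q = p ∨ 0 < ⟪v, r q⟫) ∧
      ∀ b ∈ closure U, b ∉ U → ⟪v, r b⟫ = 0 ∧ ⟪e, r b⟫ ≤ 0 := by
  have hgood := isSweepGood hr hp hv he hg
  set U := ⋃ t ∈ (Set.univ : Set ℝ), sweepSet r v e p t with hU
  have hmem : ∀ {q}, q ∈ U ↔ ∃ t, q ∈ sweepSet r v e p t := fun {q} => by simp [hU]
  have hUpos : ∀ q ∈ U, q = p ∨ 0 < ⟪v, r q⟫ := fun q hq => by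
    obtain ⟨t, ht⟩ := hmem.1 hq
    exact hgood t q (subset_closure ht)
  have hvc : Continuous fun q => ⟪v, r q⟫ := continuous_const.inner hr.continuous
  have hec : Continuous fun q => ⟪e, r q⟫ := continuous_const.inner hr.continuous
  have hpU : p ∈ U := hmem.2 ⟨0, mem_sweepSet_self hv he 0⟩
  refine ⟨U, isOpen_biUnion fun t _ => isOpen_sweepSet hr.continuous, ?_, hpU, hUpos, fun b hb hbU => ?_⟩
  · rw [hU, Set.biUnion_univ]
    exact isPreconnected_iUnion ⟨p, Set.mem_iInter.2 fun t => mem_sweepSet_self hv he t⟩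
      fun t => isPreconnected_sweepSet
  have hbp : b ≠ p := fun h => hbU (h ▸ hpU)
  have hvb : 0 ≤ ⟪v, r b⟫ := closure_minimal (s := U) (fun q hq => by
    rcases hUpos q hq with rfl | h
    · exact hv.zero.ge
    · exact h.le) (isClosed_le continuous_const hvc) hb
  -- If the pencil were positive near `b` for all large `t`, the sweep would have reached `b`.
  have hcl : ∀ l : ℝ, ¬ ∀ᶠ q in 𝓝 b, ∀ t, l ≤ t → 0 < ⟪e + t • v, r q⟫ := fun l hev => by
    obtain ⟨t, -, hbt⟩ := mem_of_mem_closure_iUnion hv he (I := Set.univ) (l := l)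
      (fun s _ => ⟨max s l, Set.mem_univ _, le_max_left _ _, le_max_right _ _⟩) (fun t _ => hgood t) hb
      (hev.mono fun q hq t _ hlt => hq t hlt)
    exact hbU (hmem.2 ⟨t, hbt⟩)
  have hvb0 : ⟪v, r b⟫ = 0 := by
    by_contra hne
    have hpos : 0 < ⟪v, r b⟫ := lt_of_le_of_ne hvb (Ne.symm hne)
    refine hcl (2 * (‖e‖ + 1) / ⟪v, r b⟫) ?_
    filter_upwards [hvc.continuousAt.eventually (lt_mem_nhds (half_lt_self hpos))] with q hq t ht
    have hq : ⟪v, r b⟫ / 2 < ⟪v, r q⟫ := hq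
    have h1 : -‖e‖ ≤ ⟪e, r q⟫ := by
      have := neg_le_of_abs_le (abs_real_inner_le_norm e (r q))
      rwa [hr.norm_eq, mul_one] at this
    rw [div_le_iff₀ hpos] at ht
    have ht0 : 0 < t := by
      by_contra! hle
      have := mul_nonpos_of_nonpos_of_nonneg hle hpos.le
      linarith [norm_nonneg e]
    rw [inner_pencil]
    have := mul_lt_mul_of_pos_left hq ht0
    linarith
  refine ⟨hvb0, ?_⟩
  by_contra! heb
  have heev : ∀ᶠ q in 𝓝 b, 0 < ⟪e, r q⟫ := hec.continuousAt.eventually (lt_mem_nhds heb)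
  have hnear : ∀ W ∈ 𝓝 b, ∃ x ∈ W, x ∈ U ∧ 0 < ⟪v, r x⟫ := fun W hW => by
    obtain ⟨x, ⟨hxW, hxp⟩, hxU⟩ := mem_closure_iff_nhds.1 hb (W ∩ {p}ᶜ)
      (Filter.inter_mem hW (isOpen_compl_singleton.mem_nhds hbp))
    exact ⟨x, hxW, hxU, (hUpos x hxU).resolve_left hxp⟩
  -- A boundary point with `⟪v, r b⟫ = 0` and `⟪e, r b⟫ > 0` is excluded. If `v` is regular there,
  -- its positive side near `b` lies in a single component, which then has `b` in its closure.
  -- Otherwise the chart is on one side of `v`, and either sign is contradictory.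
  by_cases hreg : IsRegularAt r v b
  · have hv0 : v ≠ 0 := by
      rintro rfl
      obtain ⟨x, -, -, hx⟩ := hnear _ Filter.univ_mem
      rw [inner_zero_left] at hx
      exact lt_irrefl _ hx
    obtain ⟨W', hW', hD⟩ := hr.eventually_exists_isPreconnected hreg hv0 heev
    obtain ⟨D, hDc, hD1, hD2, hD3⟩ := hD.self_of_nhds
    obtain ⟨x, hxW, hxU, hxv⟩ := hnear W' hW'
    obtain ⟨s, hs⟩ := hmem.1 hxU
    have hDU := subset_sweepSet hDc (t := max s 0) (fun q hq => by
      obtain ⟨h1, h2⟩ := hD2 hq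
      have h1 : 0 < ⟪e, r q⟫ := h1
      have h2 : 0 < ⟪v, r q⟫ := h2
      rw [inner_pencil]
      have := mul_nonneg (le_max_right s 0) h2.le
      linarith) (hD1 ⟨hxW, hxv⟩) ((hgood s).mono hv he (le_max_left s 0) hs)
    have hbD : b ∈ closure D := hD3 ⟨mem_of_mem_nhds hW', hvb⟩
    rcases hgood _ b (closure_mono hDU hbD) with h | h
    · exact hbp h
    · exact h.ne' hvb0
  · obtain ⟨A, hA⟩ := hr.exists_chart b
    rcases hA.nonneg_or_nonpos_of_not_isRegularAt hreg with h | h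
    · refine hcl 0 ?_
      filter_upwards [hA.eventually, heev] with q hq hqe t ht
      rw [inner_pencil]
      have := mul_nonneg ht (h _ hq.mem)
      linarith
    · obtain ⟨x, hx, -, hxv⟩ := hnear _ hA.eventually
      exact (h _ (IsConeChart.mem hx)).not_gt hxv

/-- A strict local support hyperplane supports globally. -/
theorem IsStrictSupport.global [FiniteDimensional ℝ E] [ConnectedSpace M] (hr : IsLocallyConeBoundary r)
    (hp : HasConnectedPunctures M) (hv : IsStrictSupport r v p) (q : M) :
    q = p ∨ 0 < ⟪v, r q⟫ ∨ (⟪v, r q⟫ = 0 ∧ r q = -r p) := by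
  have hpp : 0 < ⟪r p, r p⟫ := by rw [real_inner_self_eq_norm_sq, hr.norm_eq]; norm_num
  have hopen : ∀ x : E, IsOpen {e : E | 0 < ⟪e, x⟫} := fun x =>
    isOpen_lt continuous_const (by fun_prop)
  obtain ⟨e, he, hg⟩ := (hr.dense_isGenericPencil v).inter_open_nonempty _ (hopen (r p)) ⟨r p, hpp⟩
  obtain ⟨U, hUo, hUc, hpU, hU1, hU2⟩ := hv.exists_sweep hr hp he hg
  -- Unless `r b = -r p`, some generic `e'` is positive at both `r p` and `r b`. Its sweep contains
  -- `U` but not `b`, so `b` is a boundary point of it where `e'` is positive.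
  have hbd : ∀ b ∈ closure U, b ∉ U → r b = -r p := by
    intro b hb hbU
    by_contra hne
    have hsum : 0 < ‖r p + r b‖ ^ 2 := by
      have : r p + r b ≠ 0 := fun h => hne (eq_neg_of_add_eq_zero_right h)
      positivity
    rw [norm_add_sq_real, hr.norm_eq, hr.norm_eq] at hsum
    obtain ⟨e', ⟨he'p, he'b⟩, hg'⟩ := (hr.dense_isGenericPencil v).inter_open_nonempty _
      ((hopen (r p)).inter (hopen (r b))) ⟨r p + r b, by
        show 0 < ⟪r p + r b, r p⟫
        rw [inner_add_left, real_inner_self_eq_norm_sq, hr.norm_eq, real_inner_comm]; linarith, by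
        show 0 < ⟪r p + r b, r b⟫
        rw [inner_add_left, real_inner_self_eq_norm_sq, hr.norm_eq]; linarith⟩
    obtain ⟨U', hU'o, -, hpU', hU'1, hU'2⟩ := hv.exists_sweep hr hp he'p hg'
    have hsub : U ⊆ U' := by
      refine hUc.subset_left_of_subset_union (v := (closure U')ᶜ) hU'o
        isClosed_closure.isOpen_compl (disjoint_compl_right.mono_left subset_closure) (fun x hx => ?_)
        ⟨p, hpU, hpU'⟩
      by_contra hxc
      rw [Set.mem_union, not_or, Set.mem_compl_iff, not_not] at hxc
      rcases hU1 x hx with rfl | h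
      · exact hxc.1 hpU'
      · exact h.ne' (hU'2 x hxc.2 hxc.1).1
    have hbU' : b ∉ U' := fun h => by
      rcases hU'1 b h with rfl | h
      · exact hbU hpU
      · exact h.ne' (hU2 b hb hbU).1
    exact (hU'2 b (closure_mono hsub hb) hbU').2.not_gt he'b
  -- All boundary points of `U` map to `-r p`, so they are isolated by local injectivity, and a
  -- connected punctured neighbourhood of such a point lies in `U`.
  have hclopen : IsClopen (closure U) := by
    refine ⟨isClosed_closure, isOpen_iff_mem_nhds.2 fun b hb => ?_⟩
    by_cases hbU : b ∈ U
    · exact Filter.mem_of_superset (hUo.mem_nhds hbU) subset_closure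
    obtain ⟨W, hWo, hbW, hWi⟩ := hr.isLocallyInjective b
    obtain ⟨W', hW', hW'W, hpre, -⟩ := hp b W (hWo.mem_nhds hbW)
    obtain ⟨x, hxW, hxU⟩ := mem_closure_iff_nhds.1 hb W' hW'
    have hsub : W' \ {b} ⊆ U := by
      refine hpre.subset_left_of_subset_union (v := (closure U)ᶜ) hUo
        isClosed_closure.isOpen_compl (disjoint_compl_right.mono_left subset_closure) (fun y hy => ?_)
        ⟨x, ⟨hxW, fun h => hbU (Set.mem_singleton_iff.1 h ▸ hxU)⟩, hxU⟩
      by_contra hyc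
      rw [Set.mem_union, not_or, Set.mem_compl_iff, not_not] at hyc
      exact hy.2 (hWi (hW'W hy.1) hbW ((hbd y hyc.2 hyc.1).trans (hbd b hb hbU).symm))
    filter_upwards [hW'] with y hy
    by_cases hyb : y = b
    · exact hyb ▸ hb
    · exact subset_closure (hsub ⟨hy, hyb⟩)
  have huniv := hclopen.eq_univ ⟨p, subset_closure hpU⟩
  have hq : q ∈ closure U := huniv ▸ Set.mem_univ q
  by_cases hqU : q ∈ U
  · exact (hU1 q hqU).imp_right Or.inl
  · exact Or.inr (Or.inr ⟨(hU2 q hq hqU).1, hbd q hq hqU⟩)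

end Sweep

theorem nonneg_of_forall_pos_add_mul {a b : ℝ} (h : ∀ s > 0, 0 ≤ a + s * b) : 0 ≤ a := by
  have h1 : Filter.Tendsto (fun s : ℝ => a + s * b) (𝓝[>] 0) (𝓝 a) := by
    have : ContinuousAt (fun s : ℝ => a + s * b) 0 := by fun_prop
    have h2 := this.tendsto
    simp only [zero_mul, add_zero] at h2
    exact h2.mono_left nhdsWithin_le_nhds
  exact ge_of_tendsto h1 (eventually_nhdsWithin_of_forall h)

/-! ### Nearest points of a solid cone. -/

section NearestPoint

variable {E : Type*} [NormedAddCommGroup E] [InnerProductSpace ℝ E] {A : Set E}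

/-- The nearest point projection to a solid cone. -/
theorem IsSolidCone.exists_nearest [CompleteSpace E] (hA : IsSolidCone A) :
    ∃ π : E → E, Continuous π ∧ ∀ z, π z ∈ A ∧ ⟪π z - z, π z⟫ = 0 ∧ (∀ y ∈ A, 0 ≤ ⟪π z - z, y⟫) ∧
      ∀ y ∈ A, ‖π z - z‖ ≤ ‖y - z‖ := by
  have hex : ∀ z : E, ∃ x ∈ A, ‖z - x‖ = ⨅ w : A, ‖z - w‖ := fun z =>
    exists_norm_eq_iInf_of_complete_convex ⟨0, hA.zero_mem⟩ hA.closed.isComplete hA.convex z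
  choose π hπA hπ using hex
  have hle : ∀ z, ∀ y ∈ A, ⟪z - π z, y - π z⟫ ≤ 0 := fun z =>
    (norm_eq_iInf_iff_real_inner_le_zero hA.convex (hπA z)).1 (hπ z)
  have hlip : LipschitzWith 1 π := by
    refine LipschitzWith.of_dist_le_mul fun z w => ?_
    rw [NNReal.coe_one, one_mul, dist_eq_norm, dist_eq_norm]
    have h1 := hle z _ (hπA w)
    have h2 := hle w _ (hπA z)
    have h3 : ‖π z - π w‖ ^ 2 ≤ ⟪z - w, π z - π w⟫ := by
      rw [← real_inner_self_eq_norm_sq]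
      have e1 : ⟪z - π z, π w - π z⟫ = -⟪z - π z, π z - π w⟫ := by rw [← inner_neg_right, neg_sub]
      have e2 : ⟪z - w, π z - π w⟫ = ⟪z - π z, π z - π w⟫ + ⟪π z - π w, π z - π w⟫ -
          ⟪w - π w, π z - π w⟫ := by
        rw [← inner_add_left, ← inner_sub_left]
        congr 1; abel
      rw [e2]; linarith
    have h4 := real_inner_le_norm (z - w) (π z - π w)
    rcases (norm_nonneg (π z - π w)).eq_or_lt with h | h
    · rw [← h]; exact norm_nonneg _
    · rw [sq] at h3
      exact le_of_mul_le_mul_right (h3.trans h4) h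
  have hzero : ∀ z, ⟪π z - z, π z⟫ = 0 := fun z => by
    have h1 := hle z 0 hA.zero_mem
    have h2 := hle z ((2 : ℝ) • π z) (hA.smul_mem zero_le_two (hπA z))
    rw [zero_sub, inner_neg_right] at h1
    have e : (2 : ℝ) • π z - π z = π z := by module
    rw [e] at h2
    have h3 : ⟪π z - z, π z⟫ = -⟪z - π z, π z⟫ := by rw [← inner_neg_left, neg_sub]
    rw [h3]; linarith
  refine ⟨π, hlip.continuous, fun z => ⟨hπA z, hzero z, fun y hy => ?_, fun y hy => ?_⟩⟩
  · have h1 := hle z y hy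
    have h2 : ⟪z - π z, y - π z⟫ = -⟪π z - z, y⟫ + ⟪π z - z, π z⟫ := by
      rw [← neg_sub (π z) z, inner_neg_left, inner_sub_right]; ring
    rw [h2, hzero] at h1
    linarith
  · rw [← norm_neg, neg_sub, hπ z, ← norm_neg (y - z), neg_sub]
    exact ciInf_le (f := fun w : A => ‖z - w‖) ⟨0, by rintro _ ⟨w, rfl⟩; exact norm_nonneg _⟩ ⟨y, hy⟩

end NearestPoint

/-! ### Local supports that contain no piece of the hypersurface. -/

section WeakSupport

variable {E : Type*} [NormedAddCommGroup E] [InnerProductSpace ℝ E]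
variable {M : Type*} [TopologicalSpace M] {r : M → E} {v n m : E} {p q : M}

/-- The points at which some hyperplane supports the whole hypersurface. -/
def globalSupportSet (r : M → E) : Set M :=
  {q | ∃ n : E, n ≠ 0 ∧ ⟪n, r q⟫ = 0 ∧ ∀ x, 0 ≤ ⟪n, r x⟫}

theorem isClosed_globalSupportSet [FiniteDimensional ℝ E] [T2Space M] [CompactSpace M]
    (hr : Continuous r) : IsClosed (globalSupportSet r) := by
  set S : Set (E × M) := (Metric.sphere 0 1 ×ˢ Set.univ) ∩
    ({z | ⟪z.1, r z.2⟫ = 0} ∩ ⋂ x, {z | 0 ≤ ⟪z.1, r x⟫}) with hS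
  have hSc : IsCompact S := by
    refine ((isCompact_sphere 0 1).prod isCompact_univ).inter_right (IsClosed.inter ?_ ?_)
    · exact isClosed_eq (continuous_fst.inner (hr.comp continuous_snd)) continuous_const
    · exact isClosed_iInter fun x => isClosed_le continuous_const (continuous_fst.inner continuous_const)
  have hG : globalSupportSet r = Prod.snd '' S := by
    ext q
    constructor
    · rintro ⟨n, hn, hnq, hnx⟩
      have h0 : 0 < ‖n‖⁻¹ := inv_pos.2 (norm_pos_iff.2 hn)
      refine ⟨(‖n‖⁻¹ • n, q), ⟨⟨?_, trivial⟩, ?_, Set.mem_iInter.2 fun x => ?_⟩, rfl⟩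
      · rw [mem_sphere_zero_iff_norm, norm_smul, norm_inv, norm_norm,
          inv_mul_cancel₀ (norm_ne_zero_iff.2 hn)]
      · show ⟪‖n‖⁻¹ • n, r q⟫ = 0
        rw [inner_smul_left, hnq, mul_zero]
      · show 0 ≤ ⟪‖n‖⁻¹ • n, r x⟫
        rw [inner_smul_left, conj_trivial]
        exact mul_nonneg h0.le (hnx x)
    · rintro ⟨⟨n, q⟩, ⟨⟨hn, -⟩, hnq, hnx⟩, rfl⟩
      refine ⟨n, fun h => ?_, hnq, fun x => Set.mem_iInter.1 hnx x⟩
      have : ‖n‖ = 1 := mem_sphere_zero_iff_norm.1 hn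
      rw [h, norm_zero] at this
      exact zero_ne_one this
  rw [hG]
  exact (hSc.image continuous_snd).isClosed

variable [T2Space M] [CompactSpace M]

/-- At a regular point the positive side accumulates at every nearby zero, so no open set of zeros
is near. -/
theorem IsLocallyConeBoundary.not_isRegularAt_of_flat (hr : IsLocallyConeBoundary r) (hn : n ≠ 0)
    (h : q ∈ closure (interior {x | ⟪n, r x⟫ = 0})) : ¬ IsRegularAt r n q := by
  intro hreg
  obtain ⟨W', hW', hD⟩ := hr.eventually_exists_isPreconnected hreg hn Filter.univ_mem
  obtain ⟨D, -, -, hD2, hD3⟩ := hD.self_of_nhds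
  obtain ⟨x, hxW, hx⟩ := mem_closure_iff_nhds.1 h W' hW'
  have hxD : x ∈ closure D := hD3 ⟨hxW, (interior_subset (s := {x | ⟪n, r x⟫ = 0}) hx).ge⟩
  obtain ⟨y, hyI, hyD⟩ := mem_closure_iff.1 hxD _ isOpen_interior hx
  exact (hD2 hyD).2.ne' (interior_subset (s := {x | ⟪n, r x⟫ = 0}) hyI)

/-- Two hyperplanes which contain the same piece of the hypersurface coincide. -/
theorem IsLocallyConeBoundary.exists_eq_smul_of_flat (hr : IsLocallyConeBoundary r) (hn : n ≠ 0)
    (h : ∀ᶠ x in 𝓝 q, ⟪n, r x⟫ = 0) (h' : ∀ᶠ x in 𝓝 q, ⟪m, r x⟫ = 0) : ∃ c : ℝ, m = c • n := by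
  have hnn : ⟪n, n⟫ ≠ 0 := inner_self_ne_zero.2 hn
  refine ⟨⟪n, m⟫ / ⟪n, n⟫, ?_⟩
  set u := m - (⟪n, m⟫ / ⟪n, n⟫) • n with hu
  have hnu : ⟪n, u⟫ = 0 := by
    rw [hu, inner_sub_right, inner_smul_right, div_mul_cancel₀ _ hnn, sub_self]
  have hc : ContinuousAt (fun s : ℝ => r q + s • u) 0 := by fun_prop
  have h1 : ∀ᶠ y in 𝓝 (r q + (0 : ℝ) • u), ⟪n, y⟫ = 0 → ∃ x ∈ {x | ⟪m, r x⟫ = 0}, ∃ t : ℝ, 0 < t ∧ y = t • r x := by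
    rw [zero_smul, add_zero]
    exact hr.eventually_exists_eq_of_flat hn h h'
  obtain ⟨s, hs, hs0⟩ := (((hc.eventually h1).filter_mono nhdsWithin_le_nhds).and
    (self_mem_nhdsWithin : Set.Ioi (0 : ℝ) ∈ 𝓝[>] 0)).exists
  obtain ⟨x, hx, t, -, he⟩ := hs (by
    rw [inner_add_right, inner_smul_right, hnu, mul_zero, add_zero]; exact h.self_of_nhds)
  have hx : ⟪m, r x⟫ = 0 := hx
  have hs0 : 0 < s := hs0
  have h2 := congrArg (fun y => ⟪m, y⟫) he
  simp only [inner_add_right, inner_smul_right, hx, mul_zero,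
    (show ⟪m, r q⟫ = 0 from h'.self_of_nhds), zero_add, mul_eq_zero, hs0.ne', false_or] at h2
  have h3 : ⟪u, u⟫ = 0 := by
    conv_lhs => rw [hu]
    rw [inner_sub_left, ← hu, inner_smul_left, hnu, h2, mul_zero, sub_zero]
  exact sub_eq_zero.1 (inner_self_eq_zero.1 h3)

/-- The unit normals of hyperplanes which contain a piece of the hypersurface. -/
def flatNormals (r : M → E) : Set E :=
  {n | ‖n‖ = 1 ∧ (interior {x | ⟪n, r x⟫ = 0}).Nonempty}

/-- A nonempty basic open set is contained in at most one hyperplane, which has two unit normals. -/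
theorem IsLocallyConeBoundary.countable_flatNormals [SecondCountableTopology M]
    (hr : IsLocallyConeBoundary r) : (flatNormals r).Countable := by
  have hB := TopologicalSpace.isBasis_countableBasis M
  have hsub : flatNormals r ⊆ ⋃ W ∈ TopologicalSpace.countableBasis M,
      {n | W.Nonempty ∧ ‖n‖ = 1 ∧ ∀ x ∈ W, ⟪n, r x⟫ = 0} := by
    rintro n ⟨hn, x, hx⟩
    obtain ⟨W, hW, hxW, hWs⟩ := hB.exists_subset_of_mem_open hx isOpen_interior
    exact Set.mem_iUnion₂.2 ⟨W, hW, ⟨x, hxW⟩, hn, fun y hy => interior_subset (s := {x | ⟪n, r x⟫ = 0}) (hWs hy)⟩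
  refine ((TopologicalSpace.countable_countableBasis M).biUnion fun W hW => ?_).mono hsub
  rcases Set.eq_empty_or_nonempty {n : E | W.Nonempty ∧ ‖n‖ = 1 ∧ ∀ x ∈ W, ⟪n, r x⟫ = 0} with h0 | h0
  · rw [h0]; exact Set.countable_empty
  obtain ⟨n₀, ⟨x, hx⟩, hn₀, hn₀W⟩ := h0
  refine (Set.toFinite {n₀, -n₀}).countable.mono ?_
  rintro n ⟨-, hn, hnW⟩
  have hWx : W ∈ 𝓝 x := (hB.isOpen hW).mem_nhds hx
  obtain ⟨c, hc⟩ := hr.exists_eq_smul_of_flat (q := x) (n := n₀) (m := n)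
    (fun h => by rw [h, norm_zero] at hn₀; exact zero_ne_one hn₀)
    (Filter.mem_of_superset hWx hn₀W) (Filter.mem_of_superset hWx hnW)
  rw [hc, norm_smul, hn₀, mul_one, Real.norm_eq_abs] at hn
  rcases eq_or_eq_neg_of_abs_eq hn with h | h
  · left; rw [hc, h, one_smul]
  · right; rw [hc, h, neg_one_smul]; rfl

variable [LocallyConnectedSpace M] [FiniteDimensional ℝ E] [ConnectedSpace M]

theorem IsStrictSupport.nonneg (hr : IsLocallyConeBoundary r) (hp : HasConnectedPunctures M)
    (hv : IsStrictSupport r v p) (q : M) : 0 ≤ ⟪v, r q⟫ := by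
  rcases hv.global hr hp q with rfl | h | h
  · exact hv.zero.ge
  · exact h.le
  · exact h.1.ge

/-- All zeros of `v` map to `± r p`, so local injectivity isolates them. -/
theorem IsStrictSupport.of_eq_zero (hr : IsLocallyConeBoundary r) (hp : HasConnectedPunctures M)
    (hv : IsStrictSupport r v p) (hq : ⟪v, r q⟫ = 0) : IsStrictSupport r v q := by
  refine ⟨hq, ?_⟩
  have hpm : ∀ x, ⟪v, r x⟫ = 0 → r x = r p ∨ r x = -r p := fun x hx => by
    rcases hv.global hr hp x with rfl | h | h
    · exact Or.inl rfl
    · exact absurd hx h.ne'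
    · exact Or.inr h.2
  obtain ⟨W, hWo, hqW, hWi⟩ := hr.isLocallyInjective q
  have hnear := hr.continuous.continuousAt.eventually (Metric.ball_mem_nhds (r q) one_pos)
  filter_upwards [(hWo.eventually_mem hqW).filter_mono nhdsWithin_le_nhds,
    hnear.filter_mono nhdsWithin_le_nhds, self_mem_nhdsWithin] with x hxW hx hxq
  refine lt_of_le_of_ne (hv.nonneg hr hp x) fun h0 => ?_
  have hcase : r x = r q ∨ r x = -r q := by
    rcases hpm x h0.symm with h1 | h1 <;> rcases hpm q hq with h2 | h2 <;> rw [h1, h2] <;> simp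
  rcases hcase with h | h
  · exact hxq (hWi hxW hqW h)
  · have hx : dist (r x) (r q) < 1 := hx
    rw [h, dist_eq_norm, ← neg_add', norm_neg, ← two_smul ℝ, norm_smul, hr.norm_eq] at hx
    norm_num at hx

/-- A local support hyperplane which contains no piece of the hypersurface supports globally. -/
theorem IsStrictSupport.nonneg_of_local_support (hr : IsLocallyConeBoundary r)
    (hp : HasConnectedPunctures M) (hv : IsStrictSupport r v p) (hn : ∀ᶠ x in 𝓝 q, 0 ≤ ⟪n, r x⟫)
    (hnq : ⟪n, r q⟫ = 0) (hflat : interior {x | ⟪n, r x⟫ = 0} = ∅) (x : M) : 0 ≤ ⟪n, r x⟫ := by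
  have hnc : ∀ n : E, Continuous fun x => ⟪n, r x⟫ := fun n => continuous_const.inner hr.continuous
  have hn0 : n ≠ 0 := by
    rintro rfl
    have : q ∈ interior {x | ⟪(0 : E), r x⟫ = 0} := by simp
    rw [hflat] at this
    exact this
  set N₀ := interior {x | 0 ≤ ⟪n, r x⟫} with hN₀
  -- `L` consists of the points where the hyperplane supports locally. It is closed: at a limit
  -- point the hyperplane is not regular, and a chart on its negative side would produce a flat
  -- piece.
  set L := N₀ ∩ {x | ⟪n, r x⟫ = 0} with hL
  have hqL : q ∈ L := ⟨mem_interior_iff_mem_nhds.2 hn, hnq⟩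
  have hLcl : IsClosed L := by
    refine isClosed_of_closure_subset fun b hb => ?_
    have hnb : ⟪n, r b⟫ = 0 :=
      closure_minimal (s := L) (fun y hy => hy.2) (isClosed_eq (hnc n) continuous_const) hb
    refine ⟨?_, hnb⟩
    by_cases hreg : IsRegularAt r n b
    · obtain ⟨A, hA, ζ, hζ, hnζ⟩ := hreg
      have hreg' : IsRegularAt r (-n) b := ⟨A, hA, ζ, hζ, by rw [inner_neg_left, hnζ, neg_zero]⟩
      obtain ⟨W', hW', hD⟩ := hr.eventually_exists_isPreconnected hreg' (neg_ne_zero.2 hn0)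
        Filter.univ_mem
      obtain ⟨D, -, -, hD2, hD3⟩ := hD.self_of_nhds
      obtain ⟨y, hyW, hyL⟩ := mem_closure_iff_nhds.1 hb W' hW'
      have hyD : y ∈ closure D := hD3 ⟨hyW, by
        show 0 ≤ ⟪-n, r y⟫
        rw [inner_neg_left, show ⟪n, r y⟫ = 0 from hyL.2, neg_zero]⟩
      obtain ⟨w, hwN, hwD⟩ := mem_closure_iff.1 hyD N₀ isOpen_interior hyL.1
      have h1 : 0 < ⟪-n, r w⟫ := (hD2 hwD).2
      have h2 : 0 ≤ ⟪n, r w⟫ := interior_subset (s := {x | 0 ≤ ⟪n, r x⟫}) hwN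
      rw [inner_neg_left] at h1
      linarith
    · obtain ⟨A, hA⟩ := hr.exists_chart b
      rcases hA.nonneg_or_nonpos_of_not_isRegularAt hreg with h | h
      · exact mem_interior_iff_mem_nhds.2 (hA.eventually.mono fun y hy => h _ hy.mem)
      · exfalso
        have hle : {y | ⟪n, r y⟫ ≤ 0} ∈ 𝓝 b := hA.eventually.mono fun y hy => h _ hy.mem
        obtain ⟨y, hyI, hyL⟩ := mem_closure_iff.1 hb _ isOpen_interior (mem_interior_iff_mem_nhds.2 hle)
        have : y ∈ interior {x | ⟪n, r x⟫ = 0} :=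
          interior_maximal (t := interior {y | ⟪n, r y⟫ ≤ 0} ∩ N₀) (fun z hz => le_antisymm
            (interior_subset (s := {y | ⟪n, r y⟫ ≤ 0}) hz.1)
            (interior_subset (s := {x | 0 ≤ ⟪n, r x⟫}) hz.2))
            (isOpen_interior.inter isOpen_interior) ⟨hyI, hyL.1⟩
        rw [hflat] at this
        exact this
  -- If `v` vanishes somewhere on `L`, then `n + s • v` is a strict support there for all `s > 0`,
  -- and `s` tends to 0. Otherwise `v` is positive near `L`, and `n` is perturbed to a generic `f`.
  by_cases hzero : ∃ p' ∈ L, ⟪v, r p'⟫ = 0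
  · obtain ⟨p', hp'L, hvp'⟩ := hzero
    have hvp := hv.of_eq_zero hr hp hvp'
    have hstrict : ∀ s > (0 : ℝ), IsStrictSupport r (n + s • v) p' := fun s hs => by
      refine ⟨by rw [inner_pencil, hvp', hp'L.2, mul_zero, add_zero], ?_⟩
      have h1 : ∀ᶠ y in 𝓝 p', 0 ≤ ⟪n, r y⟫ := mem_interior_iff_mem_nhds.1 hp'L.1
      filter_upwards [h1.filter_mono nhdsWithin_le_nhds, hvp.pos] with y hy1 hy2
      rw [inner_pencil]
      have := mul_pos hs hy2
      linarith
    refine nonneg_of_forall_pos_add_mul (b := ⟪v, r x⟫) fun s hs => ?_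
    rw [← inner_pencil]
    exact (hstrict s hs).nonneg hr hp x
  push Not at hzero
  have hLsub : L ⊆ N₀ ∩ {y | 0 < ⟪v, r y⟫} := fun y hy =>
    ⟨hy.1, lt_of_le_of_ne (hv.nonneg hr hp y) (hzero y hy).symm⟩
  obtain ⟨N₁, hN₁o, hLN₁, hN₁⟩ := normal_exists_closure_subset hLcl
    (isOpen_interior.inter (isOpen_lt continuous_const (hnc v))) hLsub
  have hCc : IsCompact (closure N₁) := isClosed_closure.isCompact
  have hqC : q ∈ closure N₁ := subset_closure (hLN₁ hqL)
  obtain ⟨δ, hδ, hδC⟩ : ∃ δ : ℝ, 0 < δ ∧ ∀ y ∈ closure N₁, δ ≤ ⟪v, r y⟫ := by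
    obtain ⟨y, hy, hmin⟩ := hCc.exists_isMinOn ⟨q, hqC⟩ (hnc v).continuousOn
    exact ⟨_, (hN₁ hy).2, fun z hz => hmin hz⟩
  have hnC : ∀ y ∈ closure N₁, 0 ≤ ⟪n, r y⟫ := fun y hy =>
    interior_subset (s := {x | 0 ≤ ⟪n, r x⟫}) (hN₁ hy).1
  obtain ⟨μ, hμ, hμf⟩ : ∃ μ : ℝ, 0 < μ ∧ ∀ y ∈ frontier N₁, μ ≤ ⟪n, r y⟫ := by
    rcases (frontier N₁).eq_empty_or_nonempty with h0 | hne
    · exact ⟨1, one_pos, by simp [h0]⟩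
    obtain ⟨y, hy, hmin⟩ := isClosed_frontier.isCompact.exists_isMinOn hne (hnc n).continuousOn
    refine ⟨_, lt_of_le_of_ne (hnC y hy.1) fun h0 => ?_, fun z hz => hmin hz⟩
    rw [hN₁o.frontier_eq] at hy
    exact hy.2 (hLN₁ ⟨(hN₁ hy.1).1, h0.symm⟩)
  by_contra! hx
  -- The first bound keeps the minimum of `⟪f, ·⟫ / ⟪v, ·⟫` off the boundary of `N₁`; the second
  -- keeps the perturbed functional negative at `x`.
  obtain ⟨ε, ⟨hε1, hε2⟩, hε⟩ : ∃ ε : ℝ, (ε / δ * (‖v‖ + 1) + ε < μ ∧ ε / δ * ‖v‖ + ε < -⟪n, r x⟫) ∧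
      0 < ε := by
    have h1 : ContinuousAt (fun ε : ℝ => ε / δ * (‖v‖ + 1) + ε) 0 := by fun_prop
    have h2 : ContinuousAt (fun ε : ℝ => ε / δ * ‖v‖ + ε) 0 := by fun_prop
    have h3 := (h1.eventually (gt_mem_nhds
      (show (0 : ℝ) / δ * (‖v‖ + 1) + 0 < μ by simpa using hμ))).and
      (h2.eventually (gt_mem_nhds
      (show (0 : ℝ) / δ * ‖v‖ + 0 < -⟪n, r x⟫ by simpa using hx)))
    exact ((h3.filter_mono nhdsWithin_le_nhds).and
      (self_mem_nhdsWithin : Set.Ioi (0 : ℝ) ∈ 𝓝[>] 0)).exists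
  set g : M → E := fun y => ⟪v, r y⟫⁻¹ • r y with hg
  have hgc : ContinuousOn g (closure N₁) :=
    ((hnc v).continuousOn.inv₀ fun y hy => (hδ.trans_le (hδC y hy)).ne').smul hr.continuous.continuousOn
  have hXc : IsCompact (g '' closure N₁) := hCc.image_of_continuousOn hgc
  let _ : MeasurableSpace E := borel E
  have : BorelSpace E := ⟨rfl⟩
  obtain ⟨f, hfn, hf⟩ := (MeasureTheory.Measure.dense_of_ae
    (hXc.ae_unique_min (MeasureTheory.volume : MeasureTheory.Measure E))).inter_open_nonempty _
    (Metric.isOpen_ball (x := n) (ε := ε)) ⟨n, Metric.mem_ball_self hε⟩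
  have hfn : ‖f - n‖ < ε := by rw [← mem_ball_iff_norm]; exact hfn
  have hfny : ∀ y, |⟪f, r y⟫ - ⟪n, r y⟫| < ε := fun y => by
    rw [← inner_sub_left]
    refine (abs_real_inner_le_norm _ _).trans_lt ?_
    rwa [hr.norm_eq, mul_one]
  obtain ⟨y₀, hy₀, hmin⟩ := hCc.exists_isMinOn ⟨q, hqC⟩ (f := fun y => ⟪f, g y⟫)
    (continuousOn_const.inner hgc)
  set τ := ⟪f, g y₀⟫ with hτ
  have hgy : ∀ y, ⟪f, g y⟫ = ⟪f, r y⟫ / ⟪v, r y⟫ := fun y => by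
    rw [hg, inner_smul_right, inv_mul_eq_div]
  have hvn : ∀ y, ⟪v, r y⟫ ≤ ‖v‖ := fun y => by
    have := real_inner_le_norm v (r y)
    rwa [hr.norm_eq, mul_one] at this
  have hτ1 : τ ≤ ε / δ := by
    have h1 : τ ≤ ⟪f, g q⟫ := hmin hqC
    rw [hgy] at h1
    have h2 := (abs_lt.1 (hfny q)).2
    rw [hnq, sub_zero] at h2
    exact h1.trans (div_le_div₀ hε.le h2.le hδ (hδC q hqC))
  have hτ2 : -(ε / δ) ≤ τ := by
    rw [hτ, hgy]
    have h2 := (abs_lt.1 (hfny y₀)).1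
    have h3 := hnC y₀ hy₀
    have h4 := hδC y₀ hy₀
    rw [le_div_iff₀ (hδ.trans_le h4), neg_mul, div_mul_eq_mul_div]
    have h5 : ε ≤ ε * ⟪v, r y₀⟫ / δ := by
      rw [le_div_iff₀ hδ]
      exact mul_le_mul_of_nonneg_left h4 hε.le
    linarith
  have hy₀N : y₀ ∈ N₁ := by
    by_contra hnot
    have hfr : y₀ ∈ frontier N₁ := by rw [hN₁o.frontier_eq]; exact ⟨hy₀, hnot⟩
    have h1 := hμf y₀ hfr
    have h2 := (abs_lt.1 (hfny y₀)).1
    have h4 := hδ.trans_le (hδC y₀ hy₀)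
    have h5 : τ * ⟪v, r y₀⟫ = ⟪f, r y₀⟫ := by rw [hτ, hgy, div_mul_cancel₀ _ h4.ne']
    have h6 : τ * ⟪v, r y₀⟫ ≤ ε / δ * (‖v‖ + 1) := by
      refine (mul_le_mul_of_nonneg_right hτ1 h4.le).trans ?_
      refine mul_le_mul_of_nonneg_left ?_ (by positivity)
      linarith [hvn y₀]
    linarith
  have hval : ∀ y ∈ closure N₁, ⟪f + (-τ) • v, r y⟫ = ⟪v, r y⟫ * (⟪f, g y⟫ - τ) := fun y hy => by
    have h4 := hδ.trans_le (hδC y hy)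
    rw [inner_pencil, hgy]
    field_simp
    ring
  -- Subtracting `τ • v` moves the minimum value to zero, and uniqueness of the minimum makes the
  -- support strict.
  have hstrict : IsStrictSupport r (f + (-τ) • v) y₀ := by
    refine ⟨by rw [hval y₀ hy₀, ← hτ, sub_self, mul_zero], ?_⟩
    obtain ⟨W, hWo, hyW, hWi⟩ := hr.isLocallyInjective y₀
    filter_upwards [((hWo.inter hN₁o).eventually_mem ⟨hyW, hy₀N⟩).filter_mono nhdsWithin_le_nhds,
      self_mem_nhdsWithin] with y hy hyne
    have hyC : y ∈ closure N₁ := subset_closure hy.2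
    have h4 := hδ.trans_le (hδC y hyC)
    have h40 := hδ.trans_le (hδC y₀ hy₀)
    have hle : τ ≤ ⟪f, g y⟫ := hmin hyC
    rw [hval y hyC]
    refine mul_pos h4 (sub_pos.2 (lt_of_le_of_ne hle fun heq => hyne ?_))
    have hgeq : g y = g y₀ := by
      refine hf _ ⟨y, hyC, rfl⟩ _ ⟨y₀, hy₀, rfl⟩ ?_ ?_
      · rintro _ ⟨z, hz, rfl⟩
        rw [← heq]; exact hmin hz
      · rintro _ ⟨z, hz, rfl⟩
        exact hmin hz
    have hnorm := congrArg norm hgeq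
    simp only [hg, norm_smul, hr.norm_eq, mul_one] at hnorm
    rw [Real.norm_of_nonneg (inv_pos.2 h4).le, Real.norm_of_nonneg (inv_pos.2 h40).le] at hnorm
    simp only [hg] at hgeq
    rw [← hnorm] at hgeq
    exact hWi hy.1 hyW (smul_right_injective E (inv_pos.2 h4).ne' hgeq)
  have hfin := hstrict.nonneg hr hp x
  rw [inner_pencil] at hfin
  have h1 := (abs_lt.1 (hfny x)).2
  have h2 : -τ * ⟪v, r x⟫ ≤ ε / δ * ‖v‖ :=
    (mul_le_mul_of_nonneg_right (by linarith : -τ ≤ ε / δ) (hv.nonneg hr hp x)).trans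
      (mul_le_mul_of_nonneg_left (hvn x) (by positivity))
  linarith

end WeakSupport

/-! ### Every point has a global support hyperplane. -/

section GlobalSupport

variable {E : Type*} [NormedAddCommGroup E] [InnerProductSpace ℝ E] [FiniteDimensional ℝ E]
variable {M : Type*} [TopologicalSpace M] [T2Space M] [CompactSpace M] [LocallyConnectedSpace M]
  [ConnectedSpace M] [SecondCountableTopology M] {r : M → E} {v n : E} {p q : M}

/-- Points without global support are flat. -/
theorem IsStrictSupport.exists_flat (hr : IsLocallyConeBoundary r) (hp : HasConnectedPunctures M)
    (hv : IsStrictSupport r v p) (hq : q ∉ globalSupportSet r) :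
    ∃ n : E, n ≠ 0 ∧ ∀ᶠ x in 𝓝 q, ⟪n, r x⟫ = 0 := by
  obtain ⟨A, hA⟩ := hr.exists_chart q
  obtain ⟨π, hπc, hπ⟩ := hA.cone.exists_nearest
  have hW : {x | x ∉ globalSupportSet r ∧ IsConeChart r A x} ∈ 𝓝 q :=
    Filter.inter_mem ((isClosed_globalSupportSet hr.continuous).isOpen_compl.mem_nhds hq) hA.eventually
  obtain ⟨δ, hδ, hsurj⟩ := hr.exists_smul_mem hA hW
  -- `u z` is the unit normal, pointing towards `A`, of the support hyperplane at the point of `A`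
  -- nearest to `z`. Near `q` such hyperplanes do not support globally, so they contain pieces of
  -- the hypersurface.
  set u : E → E := fun z => ‖π z - z‖⁻¹ • (π z - z) with hu
  have hne : ∀ z, z ∉ A → π z - z ≠ 0 := fun z hz h => hz (sub_eq_zero.1 h ▸ (hπ z).1)
  have key : ∀ z, z ∉ A → ‖z - r q‖ < δ / 2 → u z ∈ flatNormals r := by
    intro z hz hzq
    obtain ⟨h1, h2, h3, h4⟩ := hπ z
    have hm := hne z hz
    have hdist : ‖π z - r q‖ < δ := by
      have e1 : π z - r q = (π z - z) + (z - r q) := by abel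
      have e2 := h4 _ hA.mem
      rw [← norm_neg, neg_sub] at e2
      rw [e1]
      refine (norm_add_le _ _).trans_lt ?_
      rw [← norm_neg (r q - z), neg_sub] at e2
      rw [← norm_neg (π z - z), neg_sub]
      linarith
    have hfr : π z ∈ frontier A := hA.cone.mem_frontier.2 ⟨h1, fun hi =>
      (IsSolidCone.inner_pos_of_mem_interior hm h3 hi).ne' h2⟩
    obtain ⟨x, ⟨hxG, hxA⟩, hpos, he⟩ := hsurj _ hfr hdist
    have hpos' : 0 < ‖π z - z‖⁻¹ := inv_pos.2 (norm_pos_iff.2 hm)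
    refine ⟨by rw [hu, norm_smul, norm_inv, norm_norm, inv_mul_cancel₀ (norm_ne_zero_iff.2 hm)], ?_⟩
    by_contra hint
    rw [Set.not_nonempty_iff_eq_empty] at hint
    have hux : ⟪u z, r x⟫ = 0 := by
      have h5 : ‖π z‖ * ⟪π z - z, r x⟫ = 0 := by rw [← inner_smul_right, ← he]; exact h2
      rw [hu, inner_smul_left, (mul_eq_zero.1 h5).resolve_left hpos.ne', mul_zero]
    refine hxG ⟨u z, smul_ne_zero hpos'.ne' hm, hux, hv.nonneg_of_local_support hr hp (q := x) ?_ hux hint⟩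
    filter_upwards [hxA.eventually] with y hy
    rw [hu, inner_smul_left, conj_trivial]
    exact mul_nonneg hpos'.le (h3 _ hy.mem)
  obtain ⟨ζ, hζ⟩ := hA.cone.nonempty_interior
  have hHc := hA.cone.continuous_height hζ hA.mem_frontier
  -- `F (y, t)` lies at depth `t` below the boundary point over `y`; a connected set of parameters
  -- describes the outside of `A` near `r q`.
  set F : E × ℝ → E := fun z => z.1 + (coneHeight A ζ z.1 - z.2) • ζ with hF
  have hFc : Continuous F := continuous_fst.add
    (((hHc.comp continuous_fst).sub continuous_snd).smul continuous_const)
  have hF0 : F (r q, 0) = r q := by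
    simp only [hF, hA.cone.height_eq_zero hζ hA.mem_frontier hA.mem_frontier, sub_zero, zero_smul, add_zero]
  have hFev : ∀ᶠ z in 𝓝 (r q, (0 : ℝ)), ‖F z - r q‖ < δ / 2 := by
    have h1 := (hFc.continuousAt (x := (r q, (0 : ℝ)))).eventually
      (p := fun y => ‖y - r q‖ < δ / 2) (by
        rw [hF0]
        filter_upwards [Metric.ball_mem_nhds (r q) (half_pos hδ)] with y hy
        exact mem_ball_iff_norm.1 hy)
    exact h1
  obtain ⟨ρ, hρ, hball⟩ := Metric.eventually_nhds_iff_ball.1 hFev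
  set S : Set (E × ℝ) := Metric.ball (r q) ρ ×ˢ Set.Ioo 0 ρ with hS
  have hSball : ∀ z ∈ S, ‖F z - r q‖ < δ / 2 := fun z hz => hball z (by
    rw [← ball_prod_same]
    refine ⟨hz.1, ?_⟩
    rw [mem_ball_zero_iff, Real.norm_of_nonneg hz.2.1.le]
    exact hz.2.2)
  have hSA : ∀ z ∈ S, F z ∉ A := fun z hz hzA => by
    have := (hA.cone.height_le_iff hζ hA.mem_frontier).2 hzA
    have h0 : 0 < z.2 := hz.2.1
    linarith
  have hSpre : IsPreconnected S := (convex_ball _ _).isPreconnected.prod isPreconnected_Ioo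
  have hcont : ContinuousOn (fun z => u (F z)) S := by
    have h1 : Continuous fun z => π (F z) - F z := (hπc.comp hFc).sub hFc
    exact (h1.norm.continuousOn.inv₀ fun z hz => norm_ne_zero_iff.2 (hne _ (hSA z hz))).smul h1.continuousOn
  -- A continuous map from a connected set to the countable set of flat normals is constant, so
  -- there is one normal `n` for all outside points near `r q`.
  have hsub := hr.countable_flatNormals.isTotallyDisconnected _
    (by rintro _ ⟨z, hz, rfl⟩; exact key _ (hSA z hz) (hSball z hz)) (hSpre.image _ hcont)
  have hz₀ : (r q, ρ / 2) ∈ S := ⟨Metric.mem_ball_self hρ, by constructor <;> simp only <;> linarith⟩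
  set n := u (F (r q, ρ / 2)) with hn
  have hn1 : ‖n‖ = 1 := (key _ (hSA _ hz₀) (hSball _ hz₀)).1
  refine ⟨n, fun h => by rw [h, norm_zero] at hn1; exact zero_ne_one hn1, ?_⟩
  filter_upwards [hr.continuous.continuousAt.eventually (Metric.ball_mem_nhds (r q) hρ), hA.eventually]
    with x hx hxA
  have hbound : ∀ t ∈ Set.Ioo 0 ρ, |⟪n, r x⟫| ≤ 2 * t * ‖ζ‖ := by
    intro t ht
    have hzS : (r x, t) ∈ S := ⟨hx, ht⟩
    have hun : u (F (r x, t)) = n := hsub ⟨_, hzS, rfl⟩ ⟨_, hz₀, rfl⟩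
    set z := F (r x, t) with hz
    have hzx : z = r x - t • ζ := by
      simp only [hz, hF, hA.cone.height_eq_zero hζ hA.mem_frontier hxA.mem_frontier]
      module
    have h0 : ⟪n, π z⟫ = 0 := by
      rw [← hun, hu, inner_smul_left, (hπ z).2.1, mul_zero]
    have h1 : ‖r x - z‖ = t * ‖ζ‖ := by
      rw [hzx, sub_sub_cancel, norm_smul, Real.norm_of_nonneg ht.1.le]
    have h2 := (hπ z).2.2.2 _ hxA.mem
    calc |⟪n, r x⟫| = |⟪n, r x - π z⟫| := by rw [inner_sub_right, h0, sub_zero]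
      _ ≤ ‖n‖ * ‖r x - π z‖ := abs_real_inner_le_norm _ _
      _ = ‖(r x - z) - (π z - z)‖ := by rw [hn1, one_mul, sub_sub_sub_cancel_right]
      _ ≤ ‖r x - z‖ + ‖π z - z‖ := norm_sub_le _ _
      _ ≤ 2 * t * ‖ζ‖ := by rw [h1] at h2 ⊢; linarith
  have hlim : Filter.Tendsto (fun t : ℝ => 2 * t * ‖ζ‖) (𝓝[>] 0) (𝓝 0) := by
    have : ContinuousAt (fun t : ℝ => 2 * t * ‖ζ‖) 0 := by fun_prop
    have h2 := this.tendsto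
    simp only [mul_zero, zero_mul] at h2
    exact h2.mono_left nhdsWithin_le_nhds
  have := ge_of_tendsto hlim (by
    filter_upwards [Ioo_mem_nhdsGT hρ] with t ht using hbound t ht)
  exact abs_nonpos_iff.1 this

/-- Every point of the hypersurface has a global support hyperplane. -/
theorem IsStrictSupport.mem_globalSupportSet (hr : IsLocallyConeBoundary r)
    (hp : HasConnectedPunctures M) (hv : IsStrictSupport r v p) (q : M) : q ∈ globalSupportSet r := by
  by_contra hq
  have hGcl := isClosed_globalSupportSet (r := r) hr.continuous
  have hv0 : v ≠ 0 := by
    rintro rfl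
    obtain ⟨W', hW', hsub, -, x, hx⟩ := hp p _ (eventually_nhdsWithin_iff.1 hv.pos)
    have := hsub hx.1 hx.2
    rw [inner_zero_left] at this
    exact lt_irrefl _ this
  have hpG : p ∈ globalSupportSet r := ⟨v, hv0, hv.zero, hv.nonneg hr hp⟩
  obtain ⟨n, hn0, hnq⟩ := hv.exists_flat hr hp hq
  set X := interior {x | ⟪n, r x⟫ = 0} with hX
  have hXn : ∀ x ∈ X, ⟪n, r x⟫ = 0 := fun x hx => interior_subset (s := {x | ⟪n, r x⟫ = 0}) hx
  have hqX : q ∈ X := mem_interior_iff_mem_nhds.2 hnq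
  set Y := X ∩ (globalSupportSet r)ᶜ with hY
  have hYo : IsOpen Y := isOpen_interior.inter hGcl.isOpen_compl
  -- At the rim of the unsupported flat piece there is a point `b` with two support hyperplanes:
  -- that of the piece, locally, and another one `m`, globally.
  obtain ⟨b, hbY, hbG⟩ : ∃ b ∈ closure Y, b ∈ globalSupportSet r := by
    by_contra! hcon
    have hYc : IsClosed Y := by
      refine isClosed_of_closure_subset fun b hb => ⟨?_, hcon b hb⟩
      obtain ⟨n', hn'0, hn'⟩ := hv.exists_flat hr hp (hcon b hb)
      obtain ⟨W, hWsub, hWo, hbW⟩ := mem_nhds_iff.1 hn'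
      obtain ⟨y, hyW, hyY⟩ := mem_closure_iff.1 hb W hWo hbW
      obtain ⟨c, hc⟩ := hr.exists_eq_smul_of_flat (q := y) (m := n) hn'0
        (Filter.mem_of_superset (hWo.mem_nhds hyW) hWsub)
        (mem_interior_iff_mem_nhds.1 hyY.1)
      refine mem_interior_iff_mem_nhds.2 (hn'.mono fun x hx => ?_)
      show ⟪n, r x⟫ = 0
      rw [hc, inner_smul_left, hx, mul_zero]
    have := IsClopen.eq_univ ⟨hYc, hYo⟩ ⟨q, hqX, hq⟩
    exact ((this ▸ Set.mem_univ p : p ∈ Y)).2 hpG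
  obtain ⟨m, hm0, hmb, hm⟩ := hbG
  have hbX : b ∈ closure X := closure_mono Set.inter_subset_left hbY
  have hnb : ⟪n, r b⟫ = 0 := closure_minimal (s := X) hXn
    (isClosed_eq (continuous_const.inner hr.continuous) continuous_const) hbX
  obtain ⟨A, hA⟩ := hr.exists_chart b
  obtain ⟨k, hk0, hkX, hkb, hkA⟩ : ∃ k : E, k ≠ 0 ∧ (∀ x ∈ X, ⟪k, r x⟫ = 0) ∧ ⟪k, r b⟫ = 0 ∧
      ∀ x ∈ A, 0 ≤ ⟪k, x⟫ := by
    rcases hA.nonneg_or_nonpos_of_not_isRegularAt (hr.not_isRegularAt_of_flat hn0 hbX) with h | h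
    · exact ⟨n, hn0, hXn, hnb, h⟩
    · refine ⟨-n, neg_ne_zero.2 hn0, fun x hx => ?_, ?_, fun x hx => ?_⟩
      · rw [inner_neg_left, hXn x hx, neg_zero]
      · rw [inner_neg_left, hnb, neg_zero]
      · rw [inner_neg_left]; exact neg_nonneg.2 (h x hx)
  have hindep : ∀ y, ¬ ((∀ᶠ x in 𝓝 y, ⟪k, r x⟫ = 0) ∧ ∀ᶠ x in 𝓝 y, ⟪m, r x⟫ = 0) := by
    rintro y ⟨h1, h2⟩
    obtain ⟨c, hc⟩ := hr.exists_eq_smul_of_flat (m := m) hk0 h1 h2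
    exact hq ⟨m, hm0, by rw [hc, inner_smul_left, hkX q hqX, mul_zero], hm⟩
  -- Only countably many of the hyperplanes `k + s • m` contain a piece, since no piece lies in two
  -- of them. The others with `s > 0` support globally, and as `s` tends to 0 so does `k`, which
  -- contains `r q`.
  have hcount : {s : ℝ | (interior {x | ⟪k + s • m, r x⟫ = 0}).Nonempty}.Countable := by
    have hB := TopologicalSpace.isBasis_countableBasis M
    refine ((TopologicalSpace.countable_countableBasis M).biUnion (t := fun W _ =>
      {s : ℝ | W.Nonempty ∧ ∀ x ∈ W, ⟪k + s • m, r x⟫ = 0}) fun W hW => ?_).mono ?_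
    · refine Set.Subsingleton.countable ?_
      rintro s ⟨⟨x, hx⟩, hs⟩ s' ⟨-, hs'⟩
      by_contra hne
      have hWx : W ∈ 𝓝 x := (hB.isOpen hW).mem_nhds hx
      have h2 : ∀ y ∈ W, ⟪m, r y⟫ = 0 := fun y hy => by
        have e1 := hs y hy
        have e2 := hs' y hy
        rw [inner_pencil] at e1 e2
        have : (s - s') * ⟪m, r y⟫ = 0 := by linarith
        exact (mul_eq_zero.1 this).resolve_left (sub_ne_zero.2 hne)
      refine hindep x ⟨Filter.mem_of_superset hWx fun y hy => ?_, Filter.mem_of_superset hWx h2⟩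
      have e1 := hs y hy
      rw [inner_pencil, h2 y hy, mul_zero, add_zero] at e1
      exact e1
    · rintro s ⟨x, hx⟩
      obtain ⟨W, hW, hxW, hWs⟩ := hB.exists_subset_of_mem_open hx isOpen_interior
      exact Set.mem_iUnion₂.2 ⟨W, hW, ⟨x, hxW⟩, fun y hy =>
        interior_subset (s := {x | ⟪k + s • m, r x⟫ = 0}) (hWs hy)⟩
  refine hq ⟨k, hk0, hkX q hqX, fun x => ?_⟩
  by_contra! hlt
  obtain ⟨s, hs, hs0, hsε⟩ := (hcount.dense_compl ℝ).exists_between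
    (show (0 : ℝ) < -⟪k, r x⟫ / (⟪m, r x⟫ + 1) from div_pos (by linarith) (by linarith [hm x]))
  have hflat : interior {x | ⟪k + s • m, r x⟫ = 0} = ∅ := Set.not_nonempty_iff_eq_empty.1 hs
  have hfin := hv.nonneg_of_local_support hr hp (n := k + s • m) (q := b) (by
    filter_upwards [hA.eventually] with y hy
    rw [inner_pencil]
    exact add_nonneg (hkA _ hy.mem) (mul_nonneg hs0.le (hm y)))
    (by rw [inner_pencil, hkb, hmb, mul_zero, add_zero]) hflat x
  rw [inner_pencil] at hfin
  rw [lt_div_iff₀ (by linarith [hm x])] at hsε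
  linarith

end GlobalSupport

/-! ### From global supports to the boundary of a cone. -/

section GlobalConvexity

variable {E : Type*} [NormedAddCommGroup E] [InnerProductSpace ℝ E] [FiniteDimensional ℝ E]
variable {M : Type*} [TopologicalSpace M] {r : M → E} {v n : E} {p q : M} {K : Set E}

theorem exists_ne_zero_orthogonal {s : Set E} (hs : s.Finite) (hcard : s.ncard < Module.finrank ℝ E) :
    ∃ u : E, u ≠ 0 ∧ ∀ x ∈ s, ⟪x, u⟫ = 0 := by
  have hlt : Submodule.span ℝ s ≠ ⊤ := fun h => by
    have := finrank_span_finset_le_card (R := ℝ) hs.toFinset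
    rw [Set.finrank, hs.coe_toFinset, h, finrank_top, ← Set.ncard_eq_toFinset_card s hs] at this
    omega
  have hne : (Submodule.span ℝ s)ᗮ ≠ ⊥ := fun h => hlt (Submodule.orthogonal_eq_bot_iff.1 h)
  obtain ⟨u, hu, hu0⟩ := Submodule.exists_mem_ne_zero_of_ne_bot hne
  exact ⟨u, hu0, fun x hx => hu x (Submodule.subset_span hx)⟩

variable [T2Space M] [CompactSpace M]

/-- In dimension at least four some `u ≠ 0` is orthogonal to `n`, `v` and `r p`. A flat hypersurface
would cover the directions `r p + s • u`, on which `v` vanishes, against strictness. -/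
theorem IsStrictSupport.not_flat (hr : IsLocallyConeBoundary r) (hv : IsStrictSupport r v p)
    (hdim : 4 ≤ Module.finrank ℝ E) (hn : n ≠ 0) : ¬ ∀ᶠ x in 𝓝 p, ⟪n, r x⟫ = 0 := by
  intro h
  obtain ⟨u, hu0, hu⟩ := exists_ne_zero_orthogonal (Set.toFinite {n, v, r p}) (by
    have h1 := Set.ncard_insert_le n {v, r p}
    have h2 := Set.ncard_insert_le v {r p}
    rw [Set.ncard_singleton] at h2
    omega)
  have hnu : ⟪n, u⟫ = 0 := hu n (by simp)
  have hvu : ⟪v, u⟫ = 0 := hu v (by simp)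
  have hpu : ⟪r p, u⟫ = 0 := hu (r p) (by simp)
  have hW : {x | x ≠ p → 0 < ⟪v, r x⟫} ∈ 𝓝 p := eventually_nhdsWithin_iff.1 hv.pos
  have hc : ContinuousAt (fun s : ℝ => r p + s • u) 0 := by fun_prop
  have h1 : ∀ᶠ y in 𝓝 (r p + (0 : ℝ) • u), ⟪n, y⟫ = 0 → ∃ x ∈ {x | x ≠ p → 0 < ⟪v, r x⟫}, ∃ t : ℝ,
      0 < t ∧ y = t • r x := by
    rw [zero_smul, add_zero]
    exact hr.eventually_exists_eq_of_flat hn h hW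
  obtain ⟨s, hs, hs0⟩ := (((hc.eventually h1).filter_mono nhdsWithin_le_nhds).and
    (self_mem_nhdsWithin : Set.Ioi (0 : ℝ) ∈ 𝓝[>] 0)).exists
  have hs0 : 0 < s := hs0
  obtain ⟨x, hx, t, ht, he⟩ := hs (by
    rw [inner_add_right, inner_smul_right, hnu, mul_zero, add_zero]; exact h.self_of_nhds)
  have hvx : ⟪v, r x⟫ = 0 := by
    have h2 := congrArg (fun y => ⟪v, y⟫) he
    simp only [inner_add_right, inner_smul_right, hvu, hv.zero, mul_zero, add_zero] at h2
    exact (mul_eq_zero.1 h2.symm).resolve_left ht.ne'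
  have hxp : x = p := by
    by_contra hne
    exact (hx hne).ne' hvx
  rw [hxp] at he
  have h3 := congrArg (fun y => ⟪u, y⟫) he
  simp only [inner_add_right, inner_smul_right, real_inner_comm (r p) u, hpu, mul_zero, zero_add,
    mul_eq_zero, hs0.ne', false_or] at h3
  exact hu0 (inner_self_eq_zero.1 h3)

/-- The closed convex cone spanned by the hypersurface. -/
def supportCone (r : M → E) : Set E := {x | ∀ n : E, (∀ q, 0 ≤ ⟪n, r q⟫) → 0 ≤ ⟪n, x⟫}

-- Interior points exist because, by assumption, the image of `r` spans the whole space.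
omit [TopologicalSpace M] [T2Space M] [CompactSpace M] in
theorem isSolidCone_supportCone (h : ∀ n : E, (∀ q, ⟪n, r q⟫ = 0) → n = 0) :
    IsSolidCone (supportCone r) := by
  have hcl : IsClosed (supportCone r) := by
    simp only [supportCone, Set.ofPred_forall]
    exact isClosed_iInter fun n => isClosed_iInter fun _ => isClosed_le continuous_const (by fun_prop)
  have hadd : ∀ {x y}, x ∈ supportCone r → y ∈ supportCone r → x + y ∈ supportCone r :=
    fun {x y} hx hy n hn => by rw [inner_add_right]; exact add_nonneg (hx n hn) (hy n hn)
  have hsmul : ∀ {t : ℝ} {x}, 0 ≤ t → x ∈ supportCone r → t • x ∈ supportCone r :=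
    fun {t x} ht hx n hn => by rw [inner_smul_right]; exact mul_nonneg ht (hx n hn)
  refine ⟨hcl, hadd, hsmul, ?_⟩
  have hconv : Convex ℝ (supportCone r) := fun x hx y hy s t hs ht _ => hadd (hsmul hs hx) (hsmul ht hy)
  have h0 : (0 : E) ∈ supportCone r := fun n _ => by rw [inner_zero_right]
  rw [hconv.interior_nonempty_iff_affineSpan_eq_top,
    AffineSubspace.affineSpan_eq_top_iff_vectorSpan_eq_top_of_nonempty ℝ E E ⟨0, h0⟩]
  have hspan : Submodule.span ℝ (Set.range r) = ⊤ := by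
    rw [← Submodule.orthogonal_eq_bot_iff, Submodule.eq_bot_iff]
    intro n hn
    refine h n fun q => ?_
    rw [real_inner_comm]
    exact hn _ (Submodule.subset_span ⟨q, rfl⟩)
  refine top_unique (hspan ▸ Submodule.span_le.2 ?_)
  rintro _ ⟨q, rfl⟩
  have hq : r q ∈ supportCone r := fun n hn => hn q
  simpa using vsub_mem_vectorSpan ℝ hq h0

omit [FiniteDimensional ℝ E] in
/-- If all points have a chart with the same cone, a hypersurface which is injective at one point is
injective. -/
theorem IsLocallyConeBoundary.injective_of_chart [ConnectedSpace M] (hr : IsLocallyConeBoundary r)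
    (hK : ∀ q, IsConeChart r K q) (hp : ∀ q, r q = r p → q = p) : Function.Injective r := by
  -- The double points. They form a closed set by local injectivity, and their projection is open
  -- because `r` covers the boundary near both preimages; it misses `p`.
  set Q : Set (M × M) := {z | r z.1 = r z.2 ∧ z.1 ≠ z.2} with hQ
  have hQc : IsClosed Q := by
    rw [← isOpen_compl_iff, isOpen_iff_mem_nhds]
    rintro ⟨x, y⟩ hxy
    by_cases h : r x = r y
    · have hxy : x = y := by
        by_contra hne; exact hxy ⟨h, hne⟩
      subst hxy
      obtain ⟨W, hWo, hxW, hWi⟩ := hr.isLocallyInjective x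
      filter_upwards [prod_mem_nhds (hWo.mem_nhds hxW) (hWo.mem_nhds hxW)] with z hz hzQ
      exact hzQ.2 (hWi hz.1 hz.2 hzQ.1)
    · have : {z : M × M | r z.1 ≠ r z.2} ∈ 𝓝 (x, y) :=
        (isOpen_ne_fun (hr.continuous.comp continuous_fst) (hr.continuous.comp continuous_snd)).mem_nhds h
      filter_upwards [this] with z hz hzQ
      exact hz hzQ.1
  set D := Prod.fst '' Q with hD
  have hDc : IsClosed D := (hQc.isCompact.image continuous_fst).isClosed
  have hDo : IsOpen D := by
    rw [isOpen_iff_mem_nhds]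
    rintro _ ⟨⟨x, y⟩, ⟨hxy, hne⟩, rfl⟩
    have hxy : r x = r y := hxy
    obtain ⟨N, N', hN, hN', hxN, hyN, hdisj⟩ := t2_separation hne
    obtain ⟨δ, hδ, hδ'⟩ := hr.exists_mem (hK y) N' (hN'.mem_nhds hyN)
    filter_upwards [hN.mem_nhds hxN, hr.continuous.continuousAt.eventually
      (Metric.ball_mem_nhds (r x) hδ)] with z hzN hz
    obtain ⟨w, hwN, hw⟩ := hδ' (r z) (hK z).mem_frontier (hr.norm_eq z)
      (by rw [← hxy, ← mem_ball_iff_norm]; exact hz)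
    exact ⟨(z, w), ⟨hw.symm, fun h => Set.disjoint_left.1 hdisj hzN ((show z = w from h) ▸ hwN)⟩, rfl⟩
  have hpD : p ∉ D := by
    rintro ⟨⟨x, y⟩, ⟨hxy, hne⟩, rfl⟩
    exact hne (hp y hxy.symm).symm
  rcases isClopen_iff.1 ⟨hDc, hDo⟩ with h | h
  · intro x y hxy
    by_contra hne
    have : x ∈ D := ⟨(x, y), ⟨hxy, hne⟩, rfl⟩
    rw [h] at this
    exact this
  · exact absurd (h ▸ Set.mem_univ p) hpD

omit [T2Space M] in
/-- If all points have a chart with the same cone, the hypersurface is the boundary of this cone. -/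
theorem IsLocallyConeBoundary.range_eq_of_chart (hr : IsLocallyConeBoundary r)
    (hdim : 3 ≤ Module.finrank ℝ E) (hK : ∀ q, IsConeChart r K q) (hKc : IsSolidCone K)
    (hex : ∀ w : E, ∃ q, r q ≠ w) : Set.range r = {w | w ∈ frontier K ∧ ‖w‖ = 1} := by
  refine Set.Subset.antisymm ?_ fun w hw => ?_
  · rintro _ ⟨q, rfl⟩
    exact ⟨(hK q).mem_frontier, hr.norm_eq q⟩
  obtain ⟨hwK, hw1⟩ := hw
  obtain ⟨q, hq⟩ := hex (-w)
  set P := Submodule.span ℝ {w, r q} with hP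
  obtain ⟨c, hc, hcP⟩ : ∃ c ∈ interior K, c ∉ P := by
    by_contra! hsub
    have htop : P = ⊤ := P.eq_top_of_nonempty_interior'
      (hKc.nonempty_interior.mono (interior_maximal hsub isOpen_interior))
    obtain ⟨u, hu0, hu⟩ := exists_ne_zero_orthogonal (Set.toFinite {w, r q}) (by
      have := Set.ncard_insert_le w {r q}
      rw [Set.ncard_singleton] at this
      omega)
    have h1 : u ∈ Pᗮ := by
      rw [Submodule.mem_orthogonal]
      intro y hy
      refine Submodule.span_induction (p := fun y _ => ⟪y, u⟫ = 0) hu (by simp) ?_ ?_ hy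
      · intro x y _ _ hx hy; rw [inner_add_left, hx, hy, add_zero]
      · intro a x _ hx; rw [inner_smul_left, hx, mul_zero]
    rw [htop, Submodule.top_orthogonal_eq_bot, Submodule.mem_bot] at h1
    exact hu0 h1
  -- The segment from `w` to `r q` is raised to the boundary in an interior direction `c` outside
  -- its plane. As `r q ≠ -w`, the raised curve avoids 0, and its normalization joins `w` to `r q`
  -- in the connected set `C` on which the range of `r` is open and closed.
  set y : ℝ → E := fun s => (1 - s) • w + s • r q with hy
  have hyc : Continuous y := by fun_prop
  have hyP : ∀ s, y s ∈ P := fun s => P.add_mem (P.smul_mem _ (Submodule.subset_span (by simp)))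
    (P.smul_mem _ (Submodule.subset_span (by simp)))
  set x : ℝ → E := fun s => y s + coneHeight K c (y s) • c with hx
  have hxc : Continuous x := hyc.add (((hKc.continuous_height hc hwK).comp hyc).smul continuous_const)
  have hxK : ∀ s, x s ∈ frontier K := fun s => hKc.add_height_mem_frontier hc hwK _
  have hx0 : ∀ s ∈ Set.Icc (0 : ℝ) 1, x s ≠ 0 := by
    intro s hs h0
    have hH : coneHeight K c (y s) = 0 := by
      by_contra hne
      refine hcP ?_
      have h1 : coneHeight K c (y s) • c ∈ P := by
        have : coneHeight K c (y s) • c = -y s := eq_neg_of_add_eq_zero_right h0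
        rw [this]; exact P.neg_mem (hyP s)
      exact (P.smul_mem_iff hne).1 h1
    have hy0 : (1 - s) • w + s • r q = 0 := by
      simpa only [hx, hH, zero_smul, add_zero] using h0
    have h2 : s • r q = -((1 - s) • w) := eq_neg_of_add_eq_zero_right hy0
    have h3 := congrArg norm h2
    rw [norm_neg, norm_smul, norm_smul, hr.norm_eq, hw1, mul_one, mul_one, Real.norm_of_nonneg hs.1,
      Real.norm_of_nonneg (sub_nonneg.2 hs.2)] at h3
    rw [← h3, ← smul_neg] at h2
    exact hq (smul_right_injective E (by intro h; rw [h] at h3; norm_num at h3 : s ≠ 0) h2)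
  set C := (fun s => ‖x s‖⁻¹ • x s) '' Set.Icc (0 : ℝ) 1 with hC
  have hCpre : IsPreconnected C := isPreconnected_Icc.image _
    ((hxc.norm.continuousOn.inv₀ fun s hs => norm_ne_zero_iff.2 (hx0 s hs)).smul hxc.continuousOn)
  have hCK : ∀ z ∈ C, z ∈ frontier K ∧ ‖z‖ = 1 := by
    rintro _ ⟨s, hs, rfl⟩
    have := norm_pos_iff.2 (hx0 s hs)
    refine ⟨hKc.smul_mem_frontier (inv_pos.2 this) (hxK s), ?_⟩
    simp only [norm_smul, norm_inv, norm_norm, inv_mul_cancel₀ this.ne']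
  have hend : ∀ s z, y s = z → z ∈ frontier K → ‖z‖ = 1 → ‖x s‖⁻¹ • x s = z := by
    intro s z h1 h2 h3
    simp only [hx, h1, hKc.height_eq_zero hc hwK h2, zero_smul, add_zero, h3, inv_one, one_smul]
  have hwC : w ∈ C := ⟨0, by simp, hend 0 w (by simp [hy]) hwK hw1⟩
  have hqC : r q ∈ C := ⟨1, by simp, hend 1 _ (by simp [hy]) (hK q).mem_frontier (hr.norm_eq q)⟩
  choose δ hδ hδ' using fun x => hr.exists_mem (hK x) Set.univ Filter.univ_mem
  have hU : IsOpen (⋃ x, Metric.ball (r x) (δ x)) := isOpen_iUnion fun x => Metric.isOpen_ball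
  have hR : IsOpen (Set.range r)ᶜ := (isCompact_range hr.continuous).isClosed.isOpen_compl
  have hUC : ∀ z ∈ C, z ∈ ⋃ x, Metric.ball (r x) (δ x) → z ∈ Set.range r := by
    intro z hz hzU
    obtain ⟨a, ha⟩ := Set.mem_iUnion.1 hzU
    obtain ⟨b, -, hb⟩ := hδ' a z (hCK z hz).1 (hCK z hz).2 (mem_ball_iff_norm.1 ha)
    exact ⟨b, hb⟩
  rcases isPreconnected_iff_subset_of_disjoint.1 hCpre _ _ hU hR (fun z _ => by
    by_cases hz : z ∈ Set.range r
    · obtain ⟨a, rfl⟩ := hz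
      exact Or.inl (Set.mem_iUnion.2 ⟨a, Metric.mem_ball_self (hδ a)⟩)
    · exact Or.inr hz) (by
    rw [Set.eq_empty_iff_forall_notMem]
    rintro z ⟨hz, hzU, hzR⟩
    exact hzR (hUC z hz hzU)) with h | h
  · exact hUC w hwC (h hwC)
  · exact absurd ⟨q, rfl⟩ (h hqC)

variable [LocallyConnectedSpace M] [ConnectedSpace M] [SecondCountableTopology M]

/-- A closed locally convex hypersurface of the sphere with a strict support hyperplane is the
boundary of a convex cone. -/
theorem IsStrictSupport.exists_solidCone (hr : IsLocallyConeBoundary r) (hp : HasConnectedPunctures M)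
    (hv : IsStrictSupport r v p) (hdim : 4 ≤ Module.finrank ℝ E) :
    ∃ C, IsSolidCone C ∧ Function.Injective r ∧ Set.range r = {w | w ∈ frontier C ∧ ‖w‖ = 1} := by
  have hK : IsSolidCone (supportCone r) := isSolidCone_supportCone fun n hn => by
    by_contra hn0
    exact hv.not_flat hr hdim hn0 (Filter.Eventually.of_forall hn)
  have hfr : ∀ q, r q ∈ frontier (supportCone r) := fun q => by
    refine hK.mem_frontier.2 ⟨fun n hn => hn q, fun hi => ?_⟩
    obtain ⟨n, hn0, hnq, hn⟩ := hv.mem_globalSupportSet hr hp q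
    exact (IsSolidCone.inner_pos_of_mem_interior (A := supportCone r) hn0 (fun y hy => hy n hn) hi).ne' hnq
  have hchart : ∀ q, IsConeChart r (supportCone r) q := fun q => by
    obtain ⟨A, hA⟩ := hr.exists_chart q
    exact hA.of_eventually hK (Filter.Eventually.of_forall hfr)
  have hinj : Function.Injective r := hr.injective_of_chart (p := p) hchart fun q hq => by
    rcases hv.global hr hp q with h | h | h
    · exact h
    · rw [hq, hv.zero] at h
      exact absurd h (lt_irrefl _)
    · have h2 := h.2
      rw [hq, eq_neg_iff_add_eq_zero, ← two_smul ℝ, smul_eq_zero] at h2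
      have h3 := hr.norm_eq p
      rw [h2.resolve_left two_ne_zero, norm_zero] at h3
      exact absurd h3 zero_ne_one
  refine ⟨_, hK, hinj, hr.range_eq_of_chart (by omega) hchart hK fun w => ?_⟩
  by_contra! hall
  obtain ⟨W, hW, -, -, x, hx⟩ := hp p _ Filter.univ_mem
  exact hx.2 (hinj ((hall x).trans (hall p).symm))

end GlobalConvexity

/-! ### The spherical case. -/

section Spherical

variable {n : ℕ} {M : Type*} [TopologicalSpace M] {r : M → Sph n}

theorem isSphericalConeBoundary_of_range [CompactSpace M] (hr : Continuous r)
    {C : Set (Euc (n + 1))} (hC : IsSolidCone C)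
    (hinj : Function.Injective fun q => (r q : Euc (n + 1)))
    (hrange : Set.range (fun q => (r q : Euc (n + 1))) = {w | w ∈ frontier C ∧ ‖w‖ = 1}) :
    IsSphericalConeBoundary r := by
  refine ⟨⟨C, fun c hc x hx => hC.smul_mem hc.le hx, fun x hx y hy => hC.add_mem hx hy⟩,
    hC.closed, hC.zero_mem, ?_, ?_, ?_⟩
  · rintro F hF ⟨x, hx⟩
    -- `x` is the midpoint of 0 and `2 x`, so an extreme set containing `x` contains 0.
    refine hF.left_mem_of_mem_openSegment hC.zero_mem
      (hC.smul_mem (t := 2) zero_le_two (hF.subset hx)) hx ?_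
    exact ⟨1 / 2, 1 / 2, by norm_num, by norm_num, by norm_num, by module⟩
  · exact (hr.isClosedEmbedding fun q q' h => hinj (congrArg Subtype.val h)).isEmbedding
  · ext k
    constructor
    · rintro ⟨q, rfl⟩
      have : (r q : Euc (n + 1)) ∈ Set.range fun q => (r q : Euc (n + 1)) := ⟨q, rfl⟩
      rw [hrange] at this
      exact this.1
    · intro hk
      have : (k : Euc (n + 1)) ∈ Set.range fun q => (r q : Euc (n + 1)) := by
        rw [hrange]; exact ⟨hk, Sph.norm_eq k⟩
      obtain ⟨q, hq⟩ := this
      exact ⟨q, Subtype.ext hq⟩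

/-- Near a local maximum of a height function which is negative there, the hypersurface is strictly
supported. -/
theorem IsLocallyConeBoundary.isStrictSupport_of_isLocalMax {E : Type*} [NormedAddCommGroup E]
    [InnerProductSpace ℝ E] {r : M → E} {z : E} {p : M}
    (hr : IsLocallyConeBoundary r) (hz : ⟪z, r p⟫ < 0)
    (hmax : IsLocalMax (fun q => ⟪z, r q⟫) p) :
    IsStrictSupport r (⟪z, r p⟫ • r p - z) p := by
  refine ⟨?_, ?_⟩
  · rw [inner_sub_left, inner_smul_left, real_inner_self_eq_norm_sq, hr.norm_eq, conj_trivial]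
    ring
  · obtain ⟨W, hWo, hpW, hinj⟩ := hr.isLocallyInjective p
    filter_upwards [nhdsWithin_le_nhds hmax, nhdsWithin_le_nhds (hWo.mem_nhds hpW), self_mem_nhdsWithin]
      with q hq hqW hqp
    have hne : r p ≠ r q := fun h => hqp (hinj hpW hqW h).symm
    have h1 := inner_lt_one_iff_real_of_norm_eq_one (hr.norm_eq p) (hr.norm_eq q) |>.2 hne
    -- The value is at least `⟪z, r p⟫ (⟪r p, r q⟫ - 1)`, a product of two negative numbers; this is
    -- where negativity of the maximum enters.
    rw [inner_sub_left, inner_smul_left, conj_trivial]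
    have hq : ⟪z, r q⟫ ≤ ⟪z, r p⟫ := hq
    nlinarith

/-- A closed locally convex hypersurface of the sphere is the boundary of a convex cone. -/
theorem isSphericalConeBoundary_of_locallyConvexAt (hn : 2 < n) [T2Space M] [CompactSpace M]
    [ConnectedSpace M] [ChartedSpace (EuclideanSpace ℝ (Fin (n - 1))) M] (hr : Continuous r)
    (hloc : ∀ p, (sphericalGeometry n).LocallyConvexAt r p) : IsSphericalConeBoundary r := by
  have : Nonempty (Fin (n - 1)) := ⟨⟨0, by omega⟩⟩
  have hdim : Module.finrank ℝ (Euc (n + 1)) =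
      Module.finrank ℝ (EuclideanSpace ℝ (Fin (n - 1))) + 2 := by
    simp only [finrank_euclideanSpace, Fintype.card_fin]; omega
  have hdim' : 4 ≤ Module.finrank ℝ (Euc (n + 1)) := by
    simp only [finrank_euclideanSpace, Fintype.card_fin]; omega
  set ρ : M → Euc (n + 1) := fun q => (r q : Euc (n + 1))
  have hρc : Continuous ρ := continuous_subtype_val.comp hr
  have hbd : IsLocallyConeBoundary ρ :=
    ⟨hρc, fun p => Sph.norm_eq _, fun p => by
      obtain ⟨K, hK⟩ := hloc p
      exact ⟨_, isConeChart_of_witness hK⟩, fun h W hW =>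
      h.exists_mem_of_manifold hdim hρc (fun p => Sph.norm_eq _) hW⟩
  -- Either all faces have dimension at least two and the leaf argument applies, or some face is a
  -- ray and there is a strict support hyperplane.
  by_cases htwo : ∀ q A, ∀ h : IsConeChart ρ A q, 2 ≤ Module.finrank ℝ (h.cone.faceSpan (ρ q))
  · obtain ⟨C, hC, hinj, hrange⟩ := hbd.exists_solidCone (by omega) htwo
    exact isSphericalConeBoundary_of_range hr hC hinj hrange
  · push Not at htwo
    obtain ⟨q, A, hA, hlt⟩ := htwo
    have hface : hA.cone.faceSpan (ρ q) ≤ ℝ ∙ ρ q := by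
      have hne : ρ q ≠ 0 := by
        intro h; have := hbd.norm_eq q; rw [h, norm_zero] at this; exact zero_ne_one this
      have hle : ℝ ∙ ρ q ≤ hA.cone.faceSpan (ρ q) :=
        (Submodule.span_singleton_le_iff_mem _ _).2 (hA.cone.self_mem_faceSpan hA.mem)
      refine (Submodule.eq_of_le_of_finrank_le hle ?_).ge
      rw [finrank_span_singleton hne]
      omega
    obtain ⟨z, p, hz, hmax⟩ := hA.exists_isLocalMax hρc hbd.norm_eq hface
    have := ChartedSpace.locallyConnectedSpace (EuclideanSpace ℝ (Fin (n - 1))) M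
    have := ChartedSpace.secondCountable_of_sigmaCompact (EuclideanSpace ℝ (Fin (n - 1))) M
    obtain ⟨C, hC, hinj, hrange⟩ :=
      (hbd.isStrictSupport_of_isLocalMax hz hmax).exists_solidCone hbd
        (hasConnectedPunctures_of_chartedSpace (EuclideanSpace ℝ (Fin (n - 1))) (by
          rw [← Module.finrank_eq_rank, finrank_euclideanSpace, Fintype.card_fin]
          exact_mod_cast (by omega : 1 < n - 1)) M) hdim'
    exact isSphericalConeBoundary_of_range hr hC hinj hrange

end Spherical

theorem mainTheorem3 (n : ℕ) (hn : 2 < n) (M : Type*) [TopologicalSpace M] [T2Space M]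
    [CompactSpace M] [ConnectedSpace M] [ChartedSpace (EuclideanSpace ℝ (Fin (n - 1))) M] :
    (∀ r : M → Euc n, Continuous r →
      (euclideanGeometry n).IsCompleteRealization r →
      (∀ p, (euclideanGeometry n).LocallyConvexAt r p) →
      ∃ p, (euclideanGeometry n).StrictlyLocallyConvexAt r p) ∧
    (∀ r : M → Sph n, Continuous r →
      (sphericalGeometry n).IsCompleteRealization r →
      (∀ p, (sphericalGeometry n).LocallyConvexAt r p) →
      (∃ p, (sphericalGeometry n).StrictlyLocallyConvexAt r p) ∨ IsSphericalConeBoundary r) ∧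
    (∀ r : M → Hyp n, Continuous r →
      (hyperbolicGeometry n).IsCompleteRealization r →
      (∀ p, (hyperbolicGeometry n).LocallyConvexAt r p) →
      ∃ p, (hyperbolicGeometry n).StrictlyLocallyConvexAt r p) := by
  exact ⟨fun r hr _ hloc => exists_strictlyLocallyConvexAt_euclidean hn hr hloc,
    fun r hr _ hloc => Or.inr (isSphericalConeBoundary_of_locallyConvexAt hn hr hloc),
    fun r hr _ hloc => exists_strictlyLocallyConvexAt_hyperbolic hn hr hloc⟩
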